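/- **Setting.** Let $\Theta^\star=[\theta_1^\star,\dots,\theta_T^\star]\in\mathbb R^{d\times T}$ have rank $r\ge1$ with reduced SVD $\Theta^\star=U^\star\Sigma^\star V^{\star\top}$, let $\sigma_{\max}^\star,\sigma_{\min}^\star$ be its largest and smallest nonzero singular values, $\kappa=\sigma_{\max}^\star/\sigma_{\min}^\star$, and $b_t^\star$ the columns of $\Sigma^\star V^{\star\top}$. Assume incoherence, $\|b_t^\star\|^2\le\mu^2\frac rT\sigma_{\max}^{\star2}$ for all $t$, with $\mu>1$. For each task $t$ one observes $X_t\in\mathbb R^{n\times d}$ and $y_t=X_t\theta_t^\star$; all entries of $X_1,\dots,X_T$ are i.i.d. $N(0,1)$. The tasks are distributed over $L$ nodes (node $g$ holds the tasks in $\mathcal S_g$, the sets $\mathcal S_1,\dots,\mathcal S_L$ partition $[T]$) of an undirected connected graph $\mathcal G$. Let $W\in\mathbb R^{L\times L}$ be symmetric, doubly stochastic, with $W_{gj}=0$ for distinct non-adjacent $g,j$, let $\lambda_1\ge\dots\ge\lambda_L$ be its eigenvalues, $\gamma(W)=\max(|\lambda_2|,|\lambda_L|)$ ($0$ if $L=1$),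 and assume $\gamma(W)<1$ (and $\frac1{\log(1/\gamma(W))}:=0$ if $\gamma(W)=0$). $\textsc{Agree}^{k}$ denotes $k$ rounds of $Z_g\leftarrow Z_g+\sum_{j\sim g}W_{gj}(Z_j-Z_g)$; QR decompositions $A=QR$ have a triangular factor with positive diagonal; $M^\dagger=(M^\top M)^{-1}M^\top$; $\|\cdot\|$ is the Euclidean or induced norm; and $\mathrm{SD}(U_1,U_2)=\|(I-U_1U_1^\top)U_2\|$. **Algorithm (Dif-AltGDmin).** The $n$ samples of each task are partitioned into sets $00,0,1,\dots,2T_{GD}$; below $X_t^{(\ell)},y_t^{(\ell)}$ are the rows in set $\ell$ and $n_\ell$ is its size. The sets $1,\dots,2T_{GD}$ have a common size $n_1$. *Initialization:* (i) $\alpha_g=\textsc{Agree}_g^{T_{con,init}}(\alpha^{in})$ with $\alpha_g^{in}=9\kappa^2\mu^2\frac{L}{n_{00}T}\sum_{t\in\mathcal S_g}\|y^{(00)}_t\|^2$; (ii) $\Theta_g^{(0)}=[\frac1{n_0}X_t^{(0)\top}(y_{ti}^{(0)}\mathbf 1\{(y_{ti}^{(0)})^2\le\alpha_g\})_i,\ t\in\mathcal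 S_g]$; (iii) all $U_g$ start from the $Q$-factor of one common $d\times r$ matrix with i.i.d. $N(0,1)$ entries, independent of the data; (iv) $T_{pm}$ times: node $g$ forms the $Q$-factor of $\textsc{Agree}_g^{T_{con,init}}(\Theta_{g'}^{(0)}\Theta_{g'}^{(0)\top}U_{g'},\,g'\in[L])$, and then the matrix of node $1$ is broadcast to all nodes: the others are set to $0$, and for $\mathrm{ecc}(1)$ rounds (the eccentricity of node 1) every node with a nonzero matrix sends it to its neighbours, which adopt it. The result is $U_g^{(0)}$. *Descent:* for $\tau=1,\dots,T_{GD}$ and every node $g$: $b_t^{(\tau)}=(X_t^{(\tau)}U_g^{(\tau-1)})^\dagger y_t^{(\tau)}$ and $\hat\theta_t^{(\tau)}=U_g^{(\tau-1)}b_t^{(\tau)}$ for $t\in\mathcal S_g$; $D_g=\sum_{t\in\mathcal S_g}X_t^\top(X_tU_g^{(\tau-1)}b_t^{(\tau)}-y_t)b_t^{(\tau)\top}$ with the data of set $\tau+T_{GD}$; $U_g^{(\tau)}$ is the $Q$-factor of $\textsc{Agree}_g^{T_{con,GD}}(U_{g'}^{(\tau-1)}-\eta LD_{g'},\,g'\in[L])$.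 **Theorem.** There is an absolute constant $C_0>1$ such that for every $C_{GD}\ge C_0$ and every $\rho>0$ there is a constant $C_1>1$, depending only on $C_{GD}$ and $\rho$, with the following property in the setting above. Let $0<\varepsilon<1$ and $\eta=\frac{0.4}{n_1\sigma_{\max}^{\star2}}$, and assume a) $T_{pm}\ge C_0\kappa^2(\log d+\log\kappa)$, $T_{con,init}\ge1$ and $T_{con,init}\ge\frac{C_0}{\log(1/\gamma(W))}(\log L+\log d+\log r+\log\kappa)$; b) $T_{GD}=\lceil C_{GD}\kappa^2\log(1/\varepsilon)\rceil$, $T_{con,GD}\ge1$ and $T_{con,GD}\ge\frac{C_0}{\log(1/\gamma(W))}(\log L+\log r+\log\kappa)$; c) $nT\ge C_1\kappa^6\mu^2(d+T)r(\kappa^2r+\log(1/\varepsilon))$, where the sample split satisfies $n_{00},n_0\ge\rho n$ and $T_{GD}\,n_1\ge\rho n$, and $n_1\ge C_1\max(\log T,\log d)$. Then with probability at least $1-1/d$: 1. for every node $g$ and every $t\in\mathcal S_g$, $\|\hat\theta_t-\theta_t^\star\|\le1.4\,\varepsilon\,\|\theta_t^\star\|$, both for $\hat\theta_t=\hat\theta_t^{(T_{GD})}=U_g^{(T_{GD}-1)}b_t^{(T_{GD})}$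 and for the output column $\hat\theta_t=U_g^{(T_{GD})}b_t^{(T_{GD})}$; 2. for every node $g$, $\mathrm{SD}(U_g^{(T_{GD})},U^\star)\le\varepsilon$. In particular, the required number $T_{con,GD}$ of agreement rounds per descent iteration does not depend on $\varepsilon$. -/

import Mathlib

open MeasureTheory ProbabilityTheory

namespace DifAltGDmin

/- Linear algebra. -/

/-- Euclidean norm of a coordinate vector. -/
noncomputable def vecNorm {m : ℕ} (v : Fin m → ℝ) : ℝ := ‖(WithLp.toLp 2 v : EuclideanSpace ℝ (Fin m))‖

open scoped Matrix.Norms.L2Operator in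
/-- Subspace distance `‖(I - U₁ U₁ᵀ) U₂‖`, in the norm induced by the Euclidean norms. -/
noncomputable def subspaceDist {d r : ℕ} (U₁ U₂ : Matrix (Fin d) (Fin r) ℝ) : ℝ :=
  ‖(1 - U₁ * U₁.transpose) * U₂‖

/-- The pseudo-inverse `(MᵀM)⁻¹Mᵀ` of a tall matrix. -/
noncomputable def pinv {ι : Type} [Fintype ι] {r : ℕ} (M : Matrix ι (Fin r) ℝ) : Matrix (Fin r) ι ℝ :=
  (M.transpose * M)⁻¹ * M.transpose

/-- The orthonormal factor of the QR decomposition whose triangular factor has a positive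
diagonal: the columns are obtained from those of `A` by the Gram-Schmidt process. -/
noncomputable def qrQ {d r : ℕ} (A : Matrix (Fin d) (Fin r) ℝ) : Matrix (Fin d) (Fin r) ℝ :=
  Matrix.of fun i k =>
    InnerProductSpace.gramSchmidtNormed ℝ
      (fun l : Fin r => (WithLp.toLp 2 fun j => A j l : EuclideanSpace ℝ (Fin d))) k i

/-- `Θ = U diag(s) Vᵀ` is a reduced singular value decomposition (of rank `r`). -/
def IsReducedSVD {d T r : ℕ} (Θ : Matrix (Fin d) (Fin T) ℝ) (U : Matrix (Fin d) (Fin r) ℝ)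
    (s : Fin r → ℝ) (V : Matrix (Fin T) (Fin r) ℝ) : Prop :=
  U.transpose * U = 1 ∧ V.transpose * V = 1 ∧ (∀ k, 0 < s k) ∧
    Θ = U * Matrix.diagonal s * V.transpose

/-- Largest of the singular values `s`. -/
noncomputable def sigmaMax {r : ℕ} (s : Fin r → ℝ) : ℝ := ⨆ k, s k

/-- Smallest of the singular values `s`. -/
noncomputable def sigmaMin {r : ℕ} (s : Fin r → ℝ) : ℝ := ⨅ k, s k

/-- Condition number. -/
noncomputable def condNumber {r : ℕ} (s : Fin r → ℝ) : ℝ := sigmaMax s / sigmaMin s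

/-- Incoherence: every column `b_t = diag(s) Vᵀ e_t` satisfies `‖b_t‖² ≤ μ² (r/T) σ_max²`. -/
def Incoherent {T r : ℕ} (μ : ℝ) (s : Fin r → ℝ) (V : Matrix (Fin T) (Fin r) ℝ) : Prop :=
  ∀ t, vecNorm (fun k => s k * V t k) ^ 2 ≤ μ ^ 2 * ((r : ℝ) / T) * sigmaMax s ^ 2

/- The network. -/

/-- `W` is a symmetric doubly stochastic weight matrix which lets only neighbours communicate. -/
def IsWeightMatrix {L : ℕ} (G : SimpleGraph (Fin L)) (W : Matrix (Fin L) (Fin L) ℝ) : Prop :=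
  W ∈ doublyStochastic ℝ (Fin L) ∧ W.IsHermitian ∧ ∀ g j, g ≠ j → ¬ G.Adj g j → W g j = 0

open Classical in
/-- `max(|λ₂(W)|, |λ_L(W)|)`, where `λ₁ ≥ … ≥ λ_L` are the eigenvalues of the symmetric matrix `W`;
it is `0` when there is a single node. -/
noncomputable def connectivity {L : ℕ} (W : Matrix (Fin L) (Fin L) ℝ) : ℝ :=
  if h : W.IsHermitian ∧ 1 < Fintype.card (Fin L) then
    max |h.1.eigenvalues₀ ⟨1, h.2⟩|
      |h.1.eigenvalues₀ ⟨Fintype.card (Fin L) - 1, Nat.sub_lt (by omega) one_pos⟩|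
  else 0

open Classical in
/-- One round of the agreement protocol. -/
noncomputable def agreeStep {L : ℕ} {M : Type} [AddCommGroup M] [Module ℝ M]
    (G : SimpleGraph (Fin L)) (W : Matrix (Fin L) (Fin L) ℝ) (Z : Fin L → M) : Fin L → M :=
  fun g => Z g + ∑ j ∈ Finset.univ.filter (fun j => G.Adj g j), W g j • (Z j - Z g)

/-- `k` rounds of the agreement protocol. -/
noncomputable def agree {L : ℕ} {M : Type} [AddCommGroup M] [Module ℝ M]
    (G : SimpleGraph (Fin L)) (W : Matrix (Fin L) (Fin L) ℝ) (k : ℕ) (Z : Fin L → M) : Fin L → M :=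
  (agreeStep G W)^[k] Z

open Classical in
/-- One round of the broadcast: every node with a nonzero matrix sends it to its neighbours,
and a node that receives a nonzero matrix adopts it. -/
noncomputable def broadcastStep {L d r : ℕ} (G : SimpleGraph (Fin L))
    (U : Fin L → Matrix (Fin d) (Fin r) ℝ) : Fin L → Matrix (Fin d) (Fin r) ℝ :=
  fun g => if h : ∃ j, G.Adj g j ∧ U j ≠ 0 then U h.choose else U g

/-- All matrices except that of the first node are set to zero, and the matrix of
the first node is then broadcast for as many rounds as its eccentricity (finite in a connected graph). -/
noncomputable def broadcast {L d r : ℕ} [NeZero L] (G : SimpleGraph (Fin L))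
    (U : Fin L → Matrix (Fin d) (Fin r) ℝ) : Fin L → Matrix (Fin d) (Fin r) ℝ :=
  (broadcastStep G)^[(G.eccent 0).toNat] (fun g => if g = 0 then U g else 0)

/- The algorithm. -/

/-- Inputs and parameters of the algorithm other than the data: `d` features, `T` tasks with `n`
samples each, `L` nodes, `K` gradient steps. -/
structure Config (T n L K : ℕ) where
  /-- communication graph -/
  graph : SimpleGraph (Fin L)
  /-- weights of the agreement protocol -/
  W : Matrix (Fin L) (Fin L) ℝ
  /-- the node that holds a task -/
  node : Fin T → Fin L
  /-- sample splitting of the `n` samples into `2K + 2` disjoint sets: the sets `0` and `1` are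
  for the initialization, the sets `2, …, K + 1` for the minimization steps `1, …, K`, and the
  sets `K + 2, …, 2K + 1` for the gradient steps `1, …, K` -/
  part : Fin n → Fin (2 * K + 2)
  /-- condition number used in the truncation threshold -/
  κ : ℝ
  /-- incoherence parameter used in the truncation threshold -/
  μ : ℝ
  /-- step size -/
  η : ℝ
  /-- number of power iterations -/
  Tpm : ℕ
  /-- agreement rounds in the initialization (per call) -/
  TconInit : ℕ
  /-- agreement rounds per gradient step -/
  TconGD : ℕ

/-- The sample indices in the `l`-th set of the split. -/
abbrev Config.Idx {T n L K : ℕ} (c : Config T n L K) (l : ℕ) : Type :=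
  {i : Fin n // (c.part i : ℕ) = l}

/-- The number of samples (per task) in the `l`-th set of the split. -/
def Config.size {T n L K : ℕ} (c : Config T n L K) (l : ℕ) : ℕ := Fintype.card (c.Idx l)

/-- The data: for each task the design matrix and the response vector, and the common random
matrix from which all the nodes start the power iteration. -/
structure Data (d T n r : ℕ) where
  X : Fin T → Matrix (Fin n) (Fin d) ℝ
  y : Fin T → Fin n → ℝ
  Z : Matrix (Fin d) (Fin r) ℝ

section Algorithm

variable {d T n r L K : ℕ} (c : Config T n L K) (D : Data d T n r)

/-- The rows of the design matrix of task `t` in the `l`-th set. -/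
def splitX (l : ℕ) (t : Fin T) : Matrix (c.Idx l) (Fin d) ℝ := (D.X t).submatrix Subtype.val id

/-- The responses of task `t` in the `l`-th set. -/
def splitY (l : ℕ) (t : Fin T) : c.Idx l → ℝ := fun i => D.y t i.1

/-- Truncation threshold of node `g` before agreement. -/
noncomputable def alphaIn (g : Fin L) : ℝ :=
  9 * c.κ ^ 2 * c.μ ^ 2 * ((L : ℝ) / (c.size 0 * T)) *
    ∑ t ∈ Finset.univ.filter (fun t => c.node t = g), ∑ i, splitY c D 0 t i ^ 2

/-- Truncation thresholds after agreement. -/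
noncomputable def alpha : Fin L → ℝ := agree c.graph c.W c.TconInit (alphaIn c D)

open Classical in
/-- The responses of task `t` truncated at the threshold of the node that holds `t`. -/
noncomputable def yTrunc (t : Fin T) : c.Idx 1 → ℝ := fun i =>
  if splitY c D 1 t i ^ 2 ≤ alpha c D (c.node t) then splitY c D 1 t i else 0

/-- The matrix of node `g` whose columns are `(1/n) Xₜᵀ y_{t,trunc}`, `t` held by `g`. -/
noncomputable def theta0 (g : Fin L) : Matrix (Fin d) {t : Fin T // c.node t = g} ℝ :=
  Matrix.of fun j t =>
    (1 / (c.size 1 : ℝ)) * ((splitX c D 1 t.1).transpose.mulVec (yTrunc c D t.1)) j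

/-- One round of the decentralized power iteration, with broadcast of node 1's estimate. -/
noncomputable def pmStep [NeZero L] (U : Fin L → Matrix (Fin d) (Fin r) ℝ) :
    Fin L → Matrix (Fin d) (Fin r) ℝ :=
  broadcast c.graph fun g =>
    qrQ (agree c.graph c.W c.TconInit
      (fun g' => theta0 c D g' * (theta0 c D g').transpose * U g') g)

/-- Modified decentralized spectral initialization. -/
noncomputable def spectralInit [NeZero L] : Fin L → Matrix (Fin d) (Fin r) ℝ :=
  (pmStep c D)^[c.Tpm] (fun _ => qrQ D.Z)

/-- The minimization step `τ`: `b_t = (Xₜ U_g)† yₜ`, where `g` is the node that holds `t`. -/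
noncomputable def bStep (τ : ℕ) (U : Fin L → Matrix (Fin d) (Fin r) ℝ) (t : Fin T) : Fin r → ℝ :=
  (pinv (splitX c D (τ + 1) t * U (c.node t))).mulVec (splitY c D (τ + 1) t)

/-- The local gradient `∑_{t ∈ S_g} Xₜᵀ (Xₜ U_g b_t - yₜ) b_tᵀ` of step `τ`. -/
noncomputable def localGrad (τ : ℕ) (U : Fin L → Matrix (Fin d) (Fin r) ℝ) (g : Fin L) :
    Matrix (Fin d) (Fin r) ℝ :=
  ∑ t ∈ Finset.univ.filter (fun t => c.node t = g),
    Matrix.vecMulVec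
      ((splitX c D (τ + K + 1) t).transpose.mulVec
        ((splitX c D (τ + K + 1) t).mulVec ((U g).mulVec (bStep c D τ U t)) -
          splitY c D (τ + K + 1) t))
      (bStep c D τ U t)

/-- Step `τ`: local update, diffusion, projection. -/
noncomputable def gdStep (τ : ℕ) (U : Fin L → Matrix (Fin d) (Fin r) ℝ) :
    Fin L → Matrix (Fin d) (Fin r) ℝ :=
  fun g => qrQ (agree c.graph c.W c.TconGD
    (fun g' => U g' - (c.η * (L : ℝ)) • localGrad c D τ U g') g)

/-- The representation estimates of the nodes after `τ` steps. -/
noncomputable def iterU [NeZero L] : ℕ → Fin L → Matrix (Fin d) (Fin r) ℝ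
  | 0 => spectralInit c D
  | τ + 1 => gdStep c D (τ + 1) (iterU τ)

/-- The coefficients of task `t` computed in the last step. -/
noncomputable def finalB [NeZero L] (t : Fin T) : Fin r → ℝ := bStep c D K (iterU c D (K - 1)) t

/-- The estimate of the parameter of task `t` formed in the last step, `U_g^{(K-1)} b_t^{(K)}`. -/
noncomputable def thetaHat [NeZero L] (t : Fin T) : Fin d → ℝ :=
  (iterU c D (K - 1) (c.node t)).mulVec (finalB c D t)

/-- The column for task `t` of the output matrix of the node that holds it,
`U_g^{(K)} b_t^{(K)}`. -/
noncomputable def thetaOut [NeZero L] (t : Fin T) : Fin d → ℝ :=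
  (iterU c D K (c.node t)).mulVec (finalB c D t)

end Algorithm

/-- Noiseless linear data `yₜ = Xₜ θₜ`. -/
def linearData {d T n r : ℕ} (Θ : Matrix (Fin d) (Fin T) ℝ) (X : Fin T → Matrix (Fin n) (Fin d) ℝ)
    (Z : Matrix (Fin d) (Fin r) ℝ) : Data d T n r where
  X := X
  y := fun t => (X t).mulVec (Θ.col t)
  Z := Z

/-- The entries of the design matrices and of the starting matrix, taken together, are
independent standard Gaussian random variables. -/
def IsIIDGaussian {Ω : Type*} [MeasurableSpace Ω] (P : Measure Ω) {d T n r : ℕ}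
    (X : Ω → Fin T → Matrix (Fin n) (Fin d) ℝ) (Z : Ω → Matrix (Fin d) (Fin r) ℝ) : Prop :=
  (∀ t i j, HasLaw (fun ω => X ω t i j) (gaussianReal 0 1) P) ∧
  (∀ j k, HasLaw (fun ω => Z ω j k) (gaussianReal 0 1) P) ∧
  iIndepFun (fun (p : (Fin T × Fin n × Fin d) ⊕ (Fin d × Fin r)) ω =>
    Sum.elim (fun q : Fin T × Fin n × Fin d => X ω q.1 q.2.1 q.2.2)
      (fun q : Fin d × Fin r => Z ω q.1 q.2) p) P

end DifAltGDmin

namespace DifAltGDmin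
set_option linter.unusedSectionVars false
open scoped Matrix Matrix.Norms.L2Operator
open Matrix
open ENNReal (ofReal)
open Real (exp sqrt log)

section Nrm
variable {ι κ ι' : Type*} [Fintype ι] [Fintype κ] [Fintype ι']

/-- Euclidean norm of a vector indexed by a finite type. -/
noncomputable def nrm (v : ι → ℝ) : ℝ := ‖(WithLp.toLp 2 v : EuclideanSpace ℝ ι)‖

lemma vecNorm_eq {m : ℕ} (v : Fin m → ℝ) : vecNorm v = nrm v := rfl

lemma nrm_nonneg (v : ι → ℝ) : 0 ≤ nrm v := norm_nonneg _

@[simp] lemma nrm_zero : nrm (0 : ι → ℝ) = 0 := by simp [nrm]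

lemma nrm_eq_zero {v : ι → ℝ} : nrm v = 0 ↔ v = 0 := by
  simp [nrm]

lemma nrm_add_le (v w : ι → ℝ) : nrm (v + w) ≤ nrm v + nrm w := by
  simpa [nrm, WithLp.toLp_add] using
    norm_add_le (WithLp.toLp 2 v : EuclideanSpace ℝ ι) (WithLp.toLp 2 w)

lemma nrm_smul (c : ℝ) (v : ι → ℝ) : nrm (c • v) = |c| * nrm v := by
  simp [nrm, WithLp.toLp_smul, norm_smul]

lemma nrm_neg (v : ι → ℝ) : nrm (-v) = nrm v := by
  simp [nrm, WithLp.toLp_neg]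

lemma nrm_sub_le (v w : ι → ℝ) : nrm (v - w) ≤ nrm v + nrm w := by
  rw [sub_eq_add_neg, ← nrm_neg w]; exact nrm_add_le _ _

lemma le_nrm_add (v w : ι → ℝ) : nrm v - nrm w ≤ nrm (v + w) := by
  have := nrm_sub_le (v + w) w
  rw [add_sub_cancel_right] at this; linarith

lemma inner_toLp (v w : ι → ℝ) :
    inner ℝ (WithLp.toLp 2 v : EuclideanSpace ℝ ι) (WithLp.toLp 2 w) = v ⬝ᵥ w := by
  simp [PiLp.inner_apply, dotProduct, mul_comm]

lemma nrm_sq (v : ι → ℝ) : nrm v ^ 2 = v ⬝ᵥ v := by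
  rw [← inner_toLp, real_inner_self_eq_norm_sq]; rfl

lemma nrm_sq_eq_sum (v : ι → ℝ) : nrm v ^ 2 = ∑ i, v i ^ 2 := by
  rw [nrm_sq]; simp [dotProduct, sq]

lemma abs_dotProduct_le (v w : ι → ℝ) : |v ⬝ᵥ w| ≤ nrm v * nrm w := by
  rw [← inner_toLp]; exact abs_real_inner_le_norm _ _

lemma dotProduct_le (v w : ι → ℝ) : v ⬝ᵥ w ≤ nrm v * nrm w :=
  (le_abs_self _).trans (abs_dotProduct_le v w)

lemma abs_apply_le_nrm (v : ι → ℝ) (i : ι) : |v i| ≤ nrm v := by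
  refine abs_le_of_sq_le_sq ?_ (nrm_nonneg v)
  rw [nrm_sq_eq_sum]
  exact Finset.single_le_sum (f := fun i => v i ^ 2) (fun i _ => sq_nonneg _) (Finset.mem_univ i)

lemma nrm_single [DecidableEq ι] (i : ι) (c : ℝ) : nrm (Pi.single i c) = |c| := by
  simp [nrm]

lemma nrm_le_of_sq_le {v : ι → ℝ} {c : ℝ} (hc : 0 ≤ c) (h : v ⬝ᵥ v ≤ c ^ 2) : nrm v ≤ c := by
  rw [← nrm_sq] at h
  exact abs_le_of_sq_le_sq' h hc |>.2

/-- Frobenius norm. -/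
noncomputable def fro (A : Matrix ι κ ℝ) : ℝ := nrm fun p : ι × κ => A p.1 p.2

lemma fro_nonneg (A : Matrix ι κ ℝ) : 0 ≤ fro A := nrm_nonneg _

lemma fro_sq (A : Matrix ι κ ℝ) : fro A ^ 2 = ∑ i, ∑ j, A i j ^ 2 := by
  rw [fro, nrm_sq_eq_sum, Fintype.sum_prod_type]

lemma fro_add_le (A B : Matrix ι κ ℝ) : fro (A + B) ≤ fro A + fro B :=
  nrm_add_le (fun p : ι × κ => A p.1 p.2) fun p => B p.1 p.2

lemma fro_smul (c : ℝ) (A : Matrix ι κ ℝ) : fro (c • A) = |c| * fro A :=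
  nrm_smul c fun p : ι × κ => A p.1 p.2

lemma fro_neg (A : Matrix ι κ ℝ) : fro (-A) = fro A :=
  nrm_neg fun p : ι × κ => A p.1 p.2

lemma fro_sub_le (A B : Matrix ι κ ℝ) : fro (A - B) ≤ fro A + fro B :=
  nrm_sub_le (fun p : ι × κ => A p.1 p.2) fun p => B p.1 p.2

lemma fro_sub_comm (A B : Matrix ι κ ℝ) : fro (A - B) = fro (B - A) := by
  rw [← fro_neg, neg_sub]

lemma fro_transpose (A : Matrix ι κ ℝ) : fro Aᵀ = fro A := by
  refine (sq_eq_sq₀ (fro_nonneg _) (fro_nonneg _)).1 ?_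
  rw [fro_sq, fro_sq, Finset.sum_comm]; rfl

lemma fro_le_of_entry_le {A B : Matrix ι κ ℝ} (h : ∀ i j, |A i j| ≤ |B i j|) : fro A ≤ fro B := by
  refine abs_le_of_sq_le_sq' ?_ (fro_nonneg _) |>.2
  rw [fro_sq, fro_sq]
  exact Finset.sum_le_sum fun i _ => Finset.sum_le_sum fun j _ => sq_le_sq.2 (h i j)

lemma fro_sq_eq_sum_col (A : Matrix ι κ ℝ) : fro A ^ 2 = ∑ j, nrm (A.col j) ^ 2 := by
  rw [fro_sq, Finset.sum_comm]
  exact Finset.sum_congr rfl fun j _ => by rw [nrm_sq_eq_sum]; rfl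

section op
variable [DecidableEq κ]

lemma nrm_mulVec_le (A : Matrix ι κ ℝ) (v : κ → ℝ) : nrm (A *ᵥ v) ≤ ‖A‖ * nrm v := by
  have := Matrix.l2_opNorm_mulVec A (WithLp.toLp 2 v)
  simpa [nrm] using this

lemma opNorm_le {A : Matrix ι κ ℝ} {c : ℝ} (hc : 0 ≤ c)
    (h : ∀ v, nrm (A *ᵥ v) ≤ c * nrm v) : ‖A‖ ≤ c := by
  rw [Matrix.l2_opNorm_def]
  refine ContinuousLinearMap.opNorm_le_bound _ hc fun v => ?_
  exact h v.ofLp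

lemma norm_transpose [DecidableEq ι] (A : Matrix ι κ ℝ) : ‖Aᵀ‖ = ‖A‖ := by
  rw [← Matrix.l2_opNorm_conjTranspose A, Matrix.conjTranspose_eq_transpose_of_trivial]


lemma dot_mulVec_comm (A : Matrix ι κ ℝ) (w : ι → ℝ) (v : κ → ℝ) :
    w ⬝ᵥ A *ᵥ v = (Aᵀ *ᵥ w) ⬝ᵥ v := by
  rw [Matrix.dotProduct_mulVec, ← Matrix.mulVec_transpose]

lemma nrm_mulVec_sq (A : Matrix ι κ ℝ) (v : κ → ℝ) :
    nrm (A *ᵥ v) ^ 2 = v ⬝ᵥ (Aᵀ * A) *ᵥ v := by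
  rw [nrm_sq, dot_mulVec_comm, dotProduct_comm, Matrix.mulVec_mulVec]

lemma nrm_mulVec_orthonormal {A : Matrix ι κ ℝ} (h : Aᵀ * A = 1) (v : κ → ℝ) :
    nrm (A *ᵥ v) = nrm v := by
  have := nrm_mulVec_sq A v
  rw [h, Matrix.one_mulVec, ← nrm_sq] at this
  exact (sq_eq_sq₀ (nrm_nonneg _) (nrm_nonneg _)).1 this

lemma norm_orthonormal_le {A : Matrix ι κ ℝ} (h : Aᵀ * A = 1) : ‖A‖ ≤ 1 :=
  opNorm_le zero_le_one fun v => by rw [nrm_mulVec_orthonormal h, one_mul]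

lemma norm_le_fro (A : Matrix ι κ ℝ) : ‖A‖ ≤ fro A := by
  refine opNorm_le (fro_nonneg _) fun v => ?_
  refine nrm_le_of_sq_le (mul_nonneg (fro_nonneg _) (nrm_nonneg _)) ?_
  rw [← nrm_sq, nrm_sq_eq_sum, mul_pow, fro_sq, Finset.sum_mul]
  refine Finset.sum_le_sum fun i _ => ?_
  have := abs_dotProduct_le (A i) v
  calc (A *ᵥ v) i ^ 2 = |A i ⬝ᵥ v| ^ 2 := by rw [sq_abs]; rfl
    _ ≤ (nrm (A i) * nrm v) ^ 2 := by gcongr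
    _ = _ := by rw [mul_pow, nrm_sq_eq_sum]

lemma fro_le_norm (A : Matrix ι κ ℝ) : fro A ≤ sqrt (Fintype.card κ) * ‖A‖ := by
  refine abs_le_of_sq_le_sq' ?_ (by positivity) |>.2
  rw [mul_pow, Real.sq_sqrt (by positivity), fro_sq_eq_sum_col, ← nsmul_eq_mul]
  refine Finset.sum_le_card_nsmul _ _ _ fun j _ => ?_
  have := nrm_mulVec_le A (Pi.single j 1)
  rw [nrm_single, abs_one, mul_one, mulVec_single_one] at this
  exact pow_le_pow_left₀ (nrm_nonneg _) this 2

lemma fro_mul_le (A : Matrix ι κ ℝ) (B : Matrix κ ι' ℝ) : fro (A * B) ≤ ‖A‖ * fro B := by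
  refine abs_le_of_sq_le_sq' ?_ (mul_nonneg (norm_nonneg _) (fro_nonneg _)) |>.2
  rw [mul_pow, fro_sq_eq_sum_col, fro_sq_eq_sum_col, Finset.mul_sum]
  refine Finset.sum_le_sum fun j _ => ?_
  have : (A * B).col j = A *ᵥ B.col j := by ext i; simp [mul_apply, mulVec, dotProduct]
  rw [this, ← mul_pow]
  exact pow_le_pow_left₀ (nrm_nonneg _) (nrm_mulVec_le _ _) 2

lemma fro_mul_le' [DecidableEq ι] [DecidableEq ι'] (A : Matrix ι κ ℝ) (B : Matrix κ ι' ℝ) :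
    fro (A * B) ≤ fro A * ‖B‖ := by
  rw [← fro_transpose, transpose_mul, ← fro_transpose A, ← norm_transpose B, mul_comm]
  exact fro_mul_le _ _

lemma norm_mul_le' [DecidableEq ι'] (A : Matrix ι κ ℝ) (B : Matrix κ ι' ℝ) : ‖A * B‖ ≤ ‖A‖ * ‖B‖ :=
  Matrix.l2_opNorm_mul A B

/-- A complementary orthogonal projection applied to a vector. -/
lemma nrm_proj_compl_sq {U : Matrix ι κ ℝ} [DecidableEq ι] (h : Uᵀ * U = 1) (v : ι → ℝ) :
    nrm ((1 - U * Uᵀ) *ᵥ v) ^ 2 = nrm v ^ 2 - nrm (Uᵀ *ᵥ v) ^ 2 := by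
  have e : (1 - U * Uᵀ)ᵀ * (1 - U * Uᵀ) = 1 - U * Uᵀ := by
    simp only [transpose_sub, transpose_one, transpose_mul, transpose_transpose]
    have : U * Uᵀ * (U * Uᵀ) = U * Uᵀ := by
      rw [Matrix.mul_assoc, ← Matrix.mul_assoc Uᵀ, h, Matrix.one_mul]
    rw [Matrix.sub_mul, Matrix.mul_sub, Matrix.mul_sub, this]
    simp
  rw [nrm_mulVec_sq, e, sub_mulVec, dotProduct_sub, one_mulVec, ← nrm_sq, nrm_mulVec_sq,
    transpose_transpose]

lemma norm_proj_compl_le {U : Matrix ι κ ℝ} [DecidableEq ι] (h : Uᵀ * U = 1) :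
    ‖1 - U * Uᵀ‖ ≤ 1 := by
  refine opNorm_le zero_le_one fun v => ?_
  have := nrm_proj_compl_sq h v
  rw [one_mul]
  exact abs_le_of_sq_le_sq' (by nlinarith [sq_nonneg (nrm (Uᵀ *ᵥ v))]) (nrm_nonneg _) |>.2

lemma proj_compl_mul {U : Matrix ι κ ℝ} [DecidableEq ι] (h : Uᵀ * U = 1) :
    (1 - U * Uᵀ) * U = 0 := by
  rw [Matrix.sub_mul, Matrix.mul_assoc, h]; simp

lemma isUnit_det_of_lower {M : Matrix κ κ ℝ} {c : ℝ} (hc : 0 < c)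
    (h : ∀ v, c * nrm v ≤ nrm (M *ᵥ v)) : IsUnit M := by
  rw [← Matrix.mulVec_injective_iff_isUnit]
  intro v w hvw
  have h1 := h (v - w)
  have : M *ᵥ (v - w) = 0 := by rw [mulVec_sub]; exact sub_eq_zero.2 hvw
  rw [this, nrm_zero] at h1
  have h2 : nrm (v - w) = 0 := le_antisymm (by nlinarith [nrm_nonneg (v - w)]) (nrm_nonneg _)
  exact sub_eq_zero.1 (nrm_eq_zero.1 h2)

lemma norm_inv_le {M : Matrix κ κ ℝ} {c : ℝ} (hc : 0 < c)
    (h : ∀ v, c * nrm v ≤ nrm (M *ᵥ v)) : ‖M⁻¹‖ ≤ 1 / c := by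
  have hu := (Matrix.isUnit_iff_isUnit_det _).1 (isUnit_det_of_lower hc h)
  refine opNorm_le (by positivity) fun v => ?_
  have := h (M⁻¹ *ᵥ v)
  rw [mulVec_mulVec, Matrix.mul_nonsing_inv _ hu, one_mulVec] at this
  rw [one_div, inv_mul_eq_div, le_div_iff₀ hc]; linarith

/-- A lower bound of a square matrix passes to its transpose. -/
lemma lower_transpose {M : Matrix κ κ ℝ} {c : ℝ}
    (h : ∀ v, c * nrm v ≤ nrm (M *ᵥ v)) (v : κ → ℝ) : c * nrm v ≤ nrm (Mᵀ *ᵥ v) := by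
  rcases le_or_gt c 0 with hc | hc
  · exact (mul_nonpos_of_nonpos_of_nonneg hc (nrm_nonneg v)).trans (nrm_nonneg _)
  have hu := (Matrix.isUnit_iff_isUnit_det _).1 (isUnit_det_of_lower hc h)
  have h1 := h (M⁻¹ *ᵥ v)
  rw [mulVec_mulVec, Matrix.mul_nonsing_inv _ hu, one_mulVec] at h1
  have h2 : nrm v ^ 2 = (Mᵀ *ᵥ v) ⬝ᵥ (M⁻¹ *ᵥ v) := by
    rw [← dot_mulVec_comm, mulVec_mulVec, Matrix.mul_nonsing_inv _ hu, one_mulVec, nrm_sq]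
  have h3 := dotProduct_le (Mᵀ *ᵥ v) (M⁻¹ *ᵥ v)
  rcases (nrm_nonneg v).eq_or_lt with h0 | h0
  · rw [← h0]; simpa using nrm_nonneg _
  · have := mul_le_mul_of_nonneg_left h1 (nrm_nonneg (Mᵀ *ᵥ v))
    nlinarith [nrm_nonneg (Mᵀ *ᵥ v)]

end op
end Nrm

/-- The subspace distance of two subspaces of equal dimension is symmetric. -/
lemma subspaceDist_le_comm {d r : ℕ} {U₁ U₂ : Matrix (Fin d) (Fin r) ℝ}
    (h₁ : U₁ᵀ * U₁ = 1) (h₂ : U₂ᵀ * U₂ = 1) : subspaceDist U₁ U₂ ≤ subspaceDist U₂ U₁ := by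
  unfold subspaceDist
  set s := ‖(1 - U₂ * U₂ᵀ) * U₁‖ with hs
  have hs0 : 0 ≤ s := norm_nonneg _
  by_cases hs1 : 1 ≤ s
  · refine le_trans ?_ hs1
    refine (norm_mul_le' _ _).trans ?_
    exact mul_le_one₀ (norm_proj_compl_le h₁) (norm_nonneg _) (norm_orthonormal_le h₂)
  push Not at hs1
  have key : ∀ v, sqrt (1 - s ^ 2) * nrm v ≤ nrm ((U₂ᵀ * U₁) *ᵥ v) := fun v => by
    have h3 := nrm_proj_compl_sq h₂ (U₁ *ᵥ v)
    have h4 := nrm_mulVec_le ((1 - U₂ * U₂ᵀ) * U₁) v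
    rw [← mulVec_mulVec] at h4
    rw [nrm_mulVec_orthonormal h₁] at h3
    refine abs_le_of_sq_le_sq' ?_ (nrm_nonneg _) |>.2
    rw [mul_pow, Real.sq_sqrt (by nlinarith), ← mulVec_mulVec]
    have := mul_self_le_mul_self (nrm_nonneg _) h4
    nlinarith
  refine opNorm_le hs0 fun v => ?_
  have h5 := lower_transpose key v
  rw [transpose_mul, transpose_transpose, ← mulVec_mulVec] at h5
  have h3 := nrm_proj_compl_sq h₁ (U₂ *ᵥ v)
  rw [nrm_mulVec_orthonormal h₂] at h3
  rw [← mulVec_mulVec]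
  refine abs_le_of_sq_le_sq' ?_ (mul_nonneg hs0 (nrm_nonneg _)) |>.2
  have h6 := mul_self_le_mul_self (by positivity [nrm_nonneg v]) h5
  have h7 := Real.sq_sqrt (show 0 ≤ 1 - s ^ 2 by nlinarith)
  have h8 : sqrt (1 - s ^ 2) * nrm v * (sqrt (1 - s ^ 2) * nrm v) = (1 - s ^ 2) * nrm v ^ 2 := by
    linear_combination nrm v ^ 2 * h7
  nlinarith

section QR
variable {d r : ℕ}

lemma diag_mul_upper {A B : Matrix (Fin r) (Fin r) ℝ} (hA : ∀ i j, j < i → A i j = 0)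
    (hB : ∀ i j, j < i → B i j = 0) (i : Fin r) : (A * B) i i = A i i * B i i := by
  rw [Matrix.mul_apply]
  refine Finset.sum_eq_single i (fun k _ hk => ?_) (by simp)
  rcases hk.lt_or_gt with h | h
  · rw [hA i k h, zero_mul]
  · rw [hB k i h, mul_zero]

lemma mul_upper {A B : Matrix (Fin r) (Fin r) ℝ} (hA : ∀ i j, j < i → A i j = 0)
    (hB : ∀ i j, j < i → B i j = 0) (i j : Fin r) (hij : j < i) : (A * B) i j = 0 := by
  rw [Matrix.mul_apply]
  refine Finset.sum_eq_zero fun k _ => ?_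
  rcases lt_or_ge k i with h | h
  · rw [hA i k h, zero_mul]
  · rw [hB k j (hij.trans_le h), mul_zero]

lemma inv_upper {A : Matrix (Fin r) (Fin r) ℝ} (hu : IsUnit A.det)
    (hA : ∀ i j, j < i → A i j = 0) (i j : Fin r) (hij : j < i) : A⁻¹ i j = 0 := by
  let _ := Matrix.invertibleOfIsUnitDet A hu
  have : BlockTriangular A id := fun i j h => hA i j h
  exact blockTriangular_inv_of_blockTriangular this hij

/-- Existence of the QR decomposition of a matrix of full column rank. -/
lemma qrQ_spec {A : Matrix (Fin d) (Fin r) ℝ} {c : ℝ} (hc : 0 < c)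
    (h : ∀ v, c * nrm v ≤ nrm (A *ᵥ v)) :
    (qrQ A)ᵀ * qrQ A = 1 ∧ A = qrQ A * ((qrQ A)ᵀ * A) ∧
      (∀ i j, j < i → ((qrQ A)ᵀ * A) i j = 0) ∧ ∀ i, 0 < ((qrQ A)ᵀ * A) i i := by
  set f : Fin r → EuclideanSpace ℝ (Fin d) := fun l => WithLp.toLp 2 fun j => A j l with hf
  have hli : LinearIndependent ℝ f := by
    rw [Fintype.linearIndependent_iff]
    intro g hg
    have h1 : A *ᵥ g = 0 := by
      ext i
      have := congrArg (fun x : EuclideanSpace ℝ (Fin d) => x i) hg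
      simpa [hf, mulVec, dotProduct, mul_comm] using this
    have h2 := h g
    rw [h1, nrm_zero] at h2
    have h3 : nrm g = 0 := le_antisymm (by nlinarith [nrm_nonneg g]) (nrm_nonneg _)
    intro i
    exact congrFun (nrm_eq_zero.1 h3) i
  set q := InnerProductSpace.gramSchmidtNormed ℝ f with hq
  have ho : Orthonormal ℝ q := InnerProductSpace.gramSchmidtNormed_orthonormal hli
  have hQ : ∀ i k, qrQ A i k = q k i := fun i k => rfl
  have hR : ∀ i j, ((qrQ A)ᵀ * A) i j = inner ℝ (q i) (f j) := fun i j => by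
    rw [PiLp.inner_apply, Matrix.mul_apply]
    simp [hQ, hf, mul_comm]
  have hQQ : (qrQ A)ᵀ * qrQ A = 1 := by
    ext i j
    rw [Matrix.mul_apply, Matrix.one_apply, ← orthonormal_iff_ite.1 ho i j, PiLp.inner_apply]
    simp [hQ, mul_comm]
  have hqs : ∀ i, q i = ((‖InnerProductSpace.gramSchmidt ℝ f i‖ : ℝ)⁻¹) •
      InnerProductSpace.gramSchmidt ℝ f i := fun i => rfl
  refine ⟨hQQ, ?_, ?_, ?_⟩
  · ext i j
    rw [Matrix.mul_apply]
    have hspan : f j ∈ Submodule.span ℝ (Set.range q) := by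
      rw [InnerProductSpace.span_gramSchmidtNormed_range, InnerProductSpace.span_gramSchmidt]
      exact Submodule.subset_span ⟨j, rfl⟩
    rw [Submodule.mem_span_range_iff_exists_fun] at hspan
    obtain ⟨a, ha⟩ := hspan
    have hco : ∀ k, inner ℝ (q k) (f j) = a k := fun k => by
      rw [← ha]; exact ho.inner_right_fintype a k
    have := congrArg (fun x : EuclideanSpace ℝ (Fin d) => x i) ha
    simp only [hR, hco, hQ]
    rw [show A i j = f j i from rfl, ← this]
    simp [mul_comm]
  · intro i j hij
    rw [hR, hqs, inner_smul_left, InnerProductSpace.gramSchmidt_inv_triangular ℝ f hij, mul_zero]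
  · intro i
    have hne : InnerProductSpace.gramSchmidt ℝ f i ≠ 0 :=
      InnerProductSpace.gramSchmidt_ne_zero i hli
    have hpos := norm_pos_iff.2 hne
    have e : inner ℝ (InnerProductSpace.gramSchmidt ℝ f i) (f i) =
        ‖InnerProductSpace.gramSchmidt ℝ f i‖ ^ 2 := by
      conv_lhs => rw [InnerProductSpace.gramSchmidt_def'' ℝ f i]
      rw [inner_add_right, inner_sum, Finset.sum_eq_zero, add_zero, real_inner_self_eq_norm_sq]
      intro k hk
      rw [inner_smul_right,
        InnerProductSpace.gramSchmidt_orthogonal ℝ f (Finset.mem_Iio.1 hk).ne', mul_zero]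
    rw [hR, hqs, inner_smul_left, e]
    simp only [map_inv₀, conj_trivial]
    positivity

/-- If `RᵀR = 1 + S` with `R` upper triangular with positive diagonal, then `R - 1` is
controlled by `S`. -/
lemma upper_sub_one_le {R S : Matrix (Fin r) (Fin r) ℝ} (hu : IsUnit R.det)
    (hR : ∀ i j, j < i → R i j = 0) (hd : ∀ i, 0 < R i i) (hS : Rᵀ * R = 1 + S) :
    fro (R - 1) ≤ ‖R⁻¹‖ * fro S := by
  have e : (R⁻¹)ᵀ * S = R - (R⁻¹)ᵀ := by
    have : S = Rᵀ * R - 1 := by rw [hS]; simp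
    rw [this, Matrix.mul_sub, ← Matrix.mul_assoc, ← transpose_mul, Matrix.mul_nonsing_inv _ hu]
    simp
  have hi := inv_upper hu hR
  have hdi : ∀ i, R i i * R⁻¹ i i = 1 := fun i => by
    rw [← diag_mul_upper hR hi, Matrix.mul_nonsing_inv _ hu, Matrix.one_apply_eq]
  have h1 : fro (R - 1) ≤ fro ((R⁻¹)ᵀ * S) := by
    refine fro_le_of_entry_le fun i j => ?_
    rw [e, Matrix.sub_apply, Matrix.sub_apply, transpose_apply]
    rcases lt_trichotomy i j with h | h | h
    · rw [Matrix.one_apply_ne h.ne, hi j i h]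
    · subst h
      rw [Matrix.one_apply_eq]
      have hp := hd i
      have h3 : R⁻¹ i i = 1 / R i i := by rw [eq_div_iff hp.ne', mul_comm]; exact hdi i
      have h4 : R i i - 1 / R i i = (R i i - 1) * (1 + 1 / R i i) := by field_simp; ring
      rw [h3, h4, abs_mul]
      have h5 : 1 ≤ |1 + 1 / R i i| := by
        rw [abs_of_pos (by positivity)]
        have : 0 < 1 / R i i := by positivity
        linarith
      exact le_mul_of_one_le_right (abs_nonneg _) h5
    · rw [Matrix.one_apply_ne h.ne', hR i j h]; simp
  refine h1.trans ((fro_mul_le _ _).trans ?_)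
  rw [norm_transpose]

/-- Perturbation of the orthonormal factor of well-conditioned matrices. -/
lemma qrQ_perturb {A A' : Matrix (Fin d) (Fin r) ℝ} (h : ∀ v, 1 / 2 * nrm v ≤ nrm (A *ᵥ v)) (h' : ∀ v, 1 / 2 * nrm v ≤ nrm (A' *ᵥ v))
    (hA : ‖A‖ ≤ 2)
    (hA' : ‖A'‖ ≤ 2) : fro (qrQ A' - qrQ A) ≤ 330 * fro (A - A') := by
  obtain ⟨hQ, hQR, hup, hdg⟩ := qrQ_spec (by norm_num) h
  obtain ⟨hQ', hQR', hup', hdg'⟩ := qrQ_spec (by norm_num) h'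
  set Q := qrQ A
  set Q' := qrQ A'
  set R := Qᵀ * A with hR
  set R' := Q'ᵀ * A'
  set ε := fro (A - A') with hε
  have hε0 : 0 ≤ ε := fro_nonneg _
  have hQn := norm_orthonormal_le hQ
  have hQn' := norm_orthonormal_le hQ'
  have hRl : ∀ v, 1 / 2 * nrm v ≤ nrm (R *ᵥ v) := fun v => by
    have := h v
    rwa [hQR, ← mulVec_mulVec, nrm_mulVec_orthonormal hQ] at this
  have hRl' : ∀ v, 1 / 2 * nrm v ≤ nrm (R' *ᵥ v) := fun v => by
    have := h' v
    rwa [hQR', ← mulVec_mulVec, nrm_mulVec_orthonormal hQ'] at this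
  have hu := (Matrix.isUnit_iff_isUnit_det _).1 (isUnit_det_of_lower (by norm_num) hRl)
  have hu' := (Matrix.isUnit_iff_isUnit_det _).1 (isUnit_det_of_lower (by norm_num) hRl')
  have hRi : ‖R⁻¹‖ ≤ 2 := by simpa using norm_inv_le (by norm_num) hRl
  have hRi' : ‖R'⁻¹‖ ≤ 2 := by simpa using norm_inv_le (by norm_num) hRl'
  have hRn : ‖R‖ ≤ 2 := by
    refine (norm_mul_le' _ _).trans ?_
    rw [norm_transpose]
    nlinarith [norm_nonneg Q, norm_nonneg A]
  set R2 := R' * R⁻¹ with hR2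
  have hu2 : IsUnit R2.det := by
    rw [hR2, det_mul]
    exact hu'.mul (by rw [Matrix.det_nonsing_inv]; exact hu.ringInverse)
  have hR2i : R2⁻¹ = R * R'⁻¹ := by
    rw [hR2, Matrix.mul_inv_rev, Matrix.nonsing_inv_nonsing_inv _ hu]
  have hR2n : ‖R2⁻¹‖ ≤ 4 := by
    rw [hR2i]; refine (norm_mul_le' _ _).trans ?_
    nlinarith [norm_nonneg R, norm_nonneg R'⁻¹]
  have hR2up := mul_upper hup' (inv_upper hu hup)
  have hR2d : ∀ i, 0 < R2 i i := fun i => by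
    rw [hR2, diag_mul_upper hup' (inv_upper hu hup)]
    have : R i i * R⁻¹ i i = 1 := by
      rw [← diag_mul_upper hup (inv_upper hu hup), Matrix.mul_nonsing_inv _ hu, Matrix.one_apply_eq]
    have hp := hdg i
    have : 0 < R⁻¹ i i := by
      by_contra hn
      push Not at hn
      nlinarith
    exact mul_pos (hdg' i) this
  set D := (A' - A) * R⁻¹ with hD
  have hDn : fro D ≤ 2 * ε := by
    refine (fro_mul_le' _ _).trans ?_
    rw [fro_sub_comm, ← hε]
    nlinarith
  have hQR2 : Q' * R2 = Q + D := by
    have e1 : A * R⁻¹ = Q := by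
      conv_lhs => rw [hQR]
      rw [Matrix.mul_assoc, Matrix.mul_nonsing_inv _ hu, Matrix.mul_one]
    rw [hR2, ← Matrix.mul_assoc, ← hQR', hD, Matrix.sub_mul, e1]; abel
  have hS : R2ᵀ * R2 = 1 + (Qᵀ * D + Dᵀ * Q + Dᵀ * D) := by
    have : R2ᵀ * R2 = (Q' * R2)ᵀ * (Q' * R2) := by
      rw [transpose_mul Q' R2, Matrix.mul_assoc R2ᵀ, ← Matrix.mul_assoc Q'ᵀ, hQ', Matrix.one_mul]
    rw [this, hQR2, transpose_add, Matrix.add_mul, Matrix.mul_add, Matrix.mul_add, hQ]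
    abel
  have hDo : ‖D‖ ≤ 8 := by
    refine (norm_mul_le' _ _).trans ?_
    have := (norm_sub_le A' A).trans (add_le_add hA' hA)
    nlinarith [norm_nonneg (A' - A), norm_nonneg R⁻¹]
  have hSn : fro (Qᵀ * D + Dᵀ * Q + Dᵀ * D) ≤ 20 * ε := by
    have h1 : fro (Qᵀ * D) ≤ 2 * ε := (fro_mul_le _ _).trans (by
      rw [norm_transpose]; nlinarith [fro_nonneg D])
    have h2 : fro (Dᵀ * Q) ≤ 2 * ε := (fro_mul_le' _ _).trans (by
      rw [fro_transpose]; nlinarith [fro_nonneg D])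
    have h3 : fro (Dᵀ * D) ≤ 16 * ε := (fro_mul_le _ _).trans (by
      rw [norm_transpose]; nlinarith [fro_nonneg D])
    calc _ ≤ fro (Qᵀ * D + Dᵀ * Q) + fro (Dᵀ * D) := fro_add_le _ _
      _ ≤ fro (Qᵀ * D) + fro (Dᵀ * Q) + fro (Dᵀ * D) := by gcongr; exact fro_add_le _ _
      _ ≤ _ := by linarith
  have hN : fro (R2 - 1) ≤ 80 * ε := by
    refine (upper_sub_one_le hu2 hR2up hR2d hS).trans ?_
    calc _ ≤ 4 * (20 * ε) := by gcongr; exact fro_nonneg _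
      _ = _ := by ring
  have e : Q' - Q = (D - Q * (R2 - 1)) * R2⁻¹ := by
    have e1 : D - Q * (R2 - 1) = (Q' - Q) * R2 := by
      rw [Matrix.sub_mul, hQR2, Matrix.mul_sub]; simp; abel
    rw [e1, Matrix.mul_assoc, Matrix.mul_nonsing_inv _ hu2, Matrix.mul_one]
  rw [e]
  have h5 : fro (D - Q * (R2 - 1)) ≤ 82 * ε := by
    refine (fro_sub_le _ _).trans ?_
    have := (fro_mul_le Q (R2 - 1)).trans (mul_le_of_le_one_left (fro_nonneg _) hQn)
    linarith
  calc _ ≤ fro (D - Q * (R2 - 1)) * ‖R2⁻¹‖ := fro_mul_le' _ _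
    _ ≤ 82 * ε * 4 := by gcongr
    _ ≤ 330 * ε := by linarith

end QR

section Net
variable {ι κ : Type*} [Fintype ι] [Fintype κ]

lemma nrm_normalize_le (v : ι → ℝ) : nrm ((nrm v)⁻¹ • v) ≤ 1 := by
  rw [nrm_smul, abs_of_nonneg (inv_nonneg.2 (nrm_nonneg v))]
  exact inv_mul_le_one

/-- A `1/2`-net of the unit ball with at most `5 ^ dim` points. -/
lemma exists_net (ι : Type*) [Fintype ι] : ∃ N : Finset (ι → ℝ), N.card ≤ 5 ^ Fintype.card ι ∧
    (∀ u ∈ N, nrm u ≤ 1) ∧ ∀ v, nrm v ≤ 1 → ∃ u ∈ N, nrm (v - u) ≤ 1 / 2 := by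
  classical
  let good : Finset (EuclideanSpace ℝ ι) → Prop := fun s =>
    (∀ c ∈ s, ‖c‖ ≤ 2) ∧ ∀ c ∈ s, ∀ e ∈ s, c ≠ e → 1 ≤ ‖c - e‖
  have hb : ∀ s, good s → s.card ≤ 5 ^ Fintype.card ι := fun s hs => by
    have := Besicovitch.card_le_of_separated s hs.1 hs.2
    rwa [finrank_euclideanSpace] at this
  obtain ⟨s, hs, hmax⟩ : ∃ s, good s ∧ ∀ t, good t → t.card ≤ s.card := by
    let p : ℕ → Prop := fun n => ∃ s, good s ∧ s.card = n
    have h0 : p 0 := ⟨∅, ⟨by simp, by simp⟩, rfl⟩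
    obtain ⟨s, hs, hc⟩ := Nat.findGreatest_spec (P := p) (Nat.zero_le (5 ^ Fintype.card ι)) h0
    refine ⟨s, hs, fun t ht => ?_⟩
    rw [hc]
    exact Nat.le_findGreatest (hb t ht) ⟨t, ht, rfl⟩
  refine ⟨s.image fun c => ((2 : ℝ)⁻¹ • c).ofLp, Finset.card_image_le.trans (hb s hs), ?_, ?_⟩
  · intro u hu
    obtain ⟨c, hc, rfl⟩ := Finset.mem_image.1 hu
    have := hs.1 c hc
    change ‖(2 : ℝ)⁻¹ • c‖ ≤ 1
    rw [norm_smul]; norm_num; linarith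
  · intro v hv
    set w : EuclideanSpace ℝ ι := (2 : ℝ) • WithLp.toLp 2 v with hw
    have hwn : ‖w‖ ≤ 2 := by
      rw [hw, norm_smul]
      have : ‖(WithLp.toLp 2 v : EuclideanSpace ℝ ι)‖ ≤ 1 := hv
      norm_num; linarith
    have : ∃ c ∈ s, ‖w - c‖ ≤ 1 := by
      by_contra hcon
      push Not at hcon
      have hns : w ∉ s := fun h => by have := hcon w h; simp at this; linarith
      have hg : good (insert w s) := by
        refine ⟨?_, ?_⟩
        · intro c hc
          rcases Finset.mem_insert.1 hc with rfl | hc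
          · exact hwn
          · exact hs.1 c hc
        · intro c hc e he hne
          rcases Finset.mem_insert.1 hc with rfl | hc <;> rcases Finset.mem_insert.1 he with rfl | he
          · exact (hne rfl).elim
          · exact (hcon e he).le
          · rw [norm_sub_rev]; exact (hcon c hc).le
          · exact hs.2 c hc e he hne
      have := hmax _ hg
      rw [Finset.card_insert_of_notMem hns] at this
      omega
    obtain ⟨c, hc, hcw⟩ := this
    refine ⟨_, Finset.mem_image_of_mem _ hc, ?_⟩
    have e : (WithLp.toLp 2 (v - ((2 : ℝ)⁻¹ • c).ofLp) : EuclideanSpace ℝ ι) = (2 : ℝ)⁻¹ • (w - c) := by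
      rw [hw, smul_sub, smul_smul]; norm_num
    unfold nrm
    rw [e, norm_smul]; norm_num; linarith

/-- The operator norm is controlled by the bilinear form on nets. -/
lemma exists_net_opNorm_le [DecidableEq κ] {N : Finset (ι → ℝ)} {N' : Finset (κ → ℝ)}
    (h2 : ∀ v, nrm v ≤ 1 → ∃ u ∈ N, nrm (v - u) ≤ 1 / 2)
    (h2' : ∀ v, nrm v ≤ 1 → ∃ u ∈ N', nrm (v - u) ≤ 1 / 2) (A : Matrix ι κ ℝ) :
    ∃ w ∈ N, ∃ z ∈ N', ‖A‖ ≤ 4 * (w ⬝ᵥ A *ᵥ z) := by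
  have hne : N.Nonempty := by
    obtain ⟨u, hu, -⟩ := h2 0 (by simp); exact ⟨u, hu⟩
  have hne' : N'.Nonempty := by
    obtain ⟨u, hu, -⟩ := h2' 0 (by simp); exact ⟨u, hu⟩
  obtain ⟨⟨w, z⟩, hwz, hmax⟩ := (N ×ˢ N').exists_max_image (fun p => p.1 ⬝ᵥ A *ᵥ p.2)
    (hne.product hne')
  rw [Finset.mem_product] at hwz
  refine ⟨w, hwz.1, z, hwz.2, ?_⟩
  set m := w ⬝ᵥ A *ᵥ z with hm
  have hmm : ∀ u ∈ N, ∀ y ∈ N', u ⬝ᵥ A *ᵥ y ≤ m := fun u hu y hy =>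
    hmax (u, y) (Finset.mk_mem_product hu hy)
  have hN' : ∀ y ∈ N', nrm (A *ᵥ y) ≤ 2 * m := fun y hy => by
    rcases (nrm_nonneg (A *ᵥ y)).eq_or_lt with h0 | h0
    · obtain ⟨u, hu, -⟩ := h2 0 (by simp)
      have := hmm u hu y hy
      rw [nrm_eq_zero.1 h0.symm, dotProduct_zero] at this
      rw [← h0]; linarith
    obtain ⟨u, hu, huv⟩ := h2 _ (nrm_normalize_le (A *ᵥ y))
    have h3 := hmm u hu y hy
    have h4 := dotProduct_le ((nrm (A *ᵥ y))⁻¹ • (A *ᵥ y) - u) (A *ᵥ y)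
    rw [sub_dotProduct, smul_dotProduct, ← nrm_sq, smul_eq_mul, sq, inv_mul_cancel_left₀ h0.ne'] at h4
    nlinarith
  have hm0 : 0 ≤ m := by
    obtain ⟨y, hy⟩ := hne'
    linarith [hN' y hy, nrm_nonneg (A *ᵥ y)]
  have hall : ∀ v, nrm v ≤ 1 → nrm (A *ᵥ v) ≤ 2 * m + ‖A‖ / 2 := fun v hv => by
    obtain ⟨y, hy, hyv⟩ := h2' v hv
    have h5 : A *ᵥ v = A *ᵥ y + A *ᵥ (v - y) := by rw [mulVec_sub]; abel
    rw [h5]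
    refine (nrm_add_le _ _).trans (add_le_add (hN' y hy) ((nrm_mulVec_le _ _).trans ?_))
    nlinarith [norm_nonneg A]
  have : ‖A‖ ≤ 2 * m + ‖A‖ / 2 := by
    refine opNorm_le (by positivity) fun v => ?_
    rcases (nrm_nonneg v).eq_or_lt with h0 | h0
    · rw [nrm_eq_zero.1 h0.symm]; simp
    have h6 := hall _ (nrm_normalize_le v)
    rw [mulVec_smul, nrm_smul, abs_of_pos (inv_pos.2 h0), inv_mul_le_iff₀ h0] at h6
    linarith
  linarith

end Net

section Network
variable {L : ℕ} {G : SimpleGraph (Fin L)} {W : Matrix (Fin L) (Fin L) ℝ}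

lemma agreeStep_eq {M : Type} [AddCommGroup M] [Module ℝ M] (hW : IsWeightMatrix G W)
    (Z : Fin L → M) (g : Fin L) : agreeStep G W Z g = ∑ j, W g j • Z j := by
  classical
  have hrow : ∑ j, W g j = 1 := by
    have := (mem_doublyStochastic_iff_sum.1 hW.1).2.1 g
    exact this
  unfold agreeStep
  have h1 : ∑ j ∈ Finset.univ.filter (fun j => G.Adj g j), W g j • (Z j - Z g) =
      ∑ j, W g j • (Z j - Z g) := by
    refine Finset.sum_subset (Finset.filter_subset _ _) fun j _ hj => ?_
    have hj : ¬ G.Adj g j := by simpa using hj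
    by_cases hgj : g = j
    · subst hgj; simp
    · rw [hW.2.2 g j hgj hj, zero_smul]
  rw [h1]
  simp only [smul_sub, Finset.sum_sub_distrib]
  rw [← Finset.sum_smul, hrow, one_smul]; abel

lemma agree_eq {M : Type} [AddCommGroup M] [Module ℝ M] (hW : IsWeightMatrix G W) (k : ℕ)
    (Z : Fin L → M) (g : Fin L) : agree G W k Z g = ∑ j, (W ^ k) g j • Z j := by
  induction k generalizing g with
  | zero => simp [agree, Matrix.one_apply, ite_smul]
  | succ k ih =>
    have : agree G W (k + 1) Z = agreeStep G W (agree G W k Z) := by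
      unfold agree; rw [Function.iterate_succ_apply']
    rw [this, agreeStep_eq hW, pow_succ']
    simp only [ih, Matrix.mul_apply, Finset.smul_sum, Finset.sum_smul, smul_smul]
    rw [Finset.sum_comm]

lemma connectivity_nonneg (W : Matrix (Fin L) (Fin L) ℝ) : 0 ≤ connectivity W := by
  unfold connectivity
  split_ifs
  · exact le_max_of_le_left (abs_nonneg _)
  · exact le_rfl

lemma nrm_weight_mulVec_le (hW : IsWeightMatrix G W) (hγ : connectivity W < 1) (hL : 1 < L)
    {x : Fin L → ℝ} (hx : ∑ i, x i = 0) : nrm (W *ᵥ x) ≤ connectivity W * nrm x := by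
  classical
  have hH : W.IsHermitian := hW.2.1
  have hcard : 1 < Fintype.card (Fin L) := by simpa using hL
  have hcon : connectivity W = max |hH.eigenvalues₀ ⟨1, hcard⟩|
      |hH.eigenvalues₀ ⟨Fintype.card (Fin L) - 1, Nat.sub_lt (by omega) one_pos⟩| := by
    unfold connectivity
    rw [dif_pos ⟨hH, hcard⟩]
  set γ := connectivity W with hγd
  let e : Fin (Fintype.card (Fin L)) ≃ Fin L := Fintype.equivOfCardEq (Fintype.card_fin _)
  have hev : ∀ k, hH.eigenvalues (e k) = hH.eigenvalues₀ k := fun k => by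
    unfold Matrix.IsHermitian.eigenvalues
    congr 1
    exact e.symm_apply_apply k
  let i0 : Fin L := e ⟨0, by omega⟩
  have hle : ∀ i, i ≠ i0 → |hH.eigenvalues i| ≤ γ := fun i hi => by
    obtain ⟨k, rfl⟩ := e.surjective i
    have hk : (⟨1, hcard⟩ : Fin (Fintype.card (Fin L))) ≤ k := by
      rw [Fin.le_def]
      by_contra hc
      apply hi
      have : k = ⟨0, by omega⟩ := Fin.ext (by simp at hc ⊢; omega)
      rw [this]
    have hk2 : k ≤ ⟨Fintype.card (Fin L) - 1, Nat.sub_lt (by omega) one_pos⟩ := by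
      have := k.2
      rw [Fin.le_def]
      change (k : ℕ) ≤ Fintype.card (Fin L) - 1
      omega
    have h1 := hH.eigenvalues₀_antitone hk
    have h2 := hH.eigenvalues₀_antitone hk2
    rw [hev, hcon, abs_le]
    refine ⟨?_, h1.trans ((le_abs_self _).trans (le_max_left _ _))⟩
    have := (neg_abs_le _).trans h2
    exact (neg_le_neg (le_max_right _ _)).trans this
  set b := hH.eigenvectorBasis with hb
  have hmul : ∀ i, W *ᵥ (b i).ofLp = hH.eigenvalues i • (b i).ofLp := fun i =>
    hH.mulVec_eigenvectorBasis i
  have hsymm : Wᵀ = W := by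
    have := hH.eq; rwa [conjTranspose_eq_transpose_of_trivial] at this
  have hcoef : ∀ (y : Fin L → ℝ) i, (b i).ofLp ⬝ᵥ (W *ᵥ y) = hH.eigenvalues i * ((b i).ofLp ⬝ᵥ y) :=
    fun y i => by
      rw [dot_mulVec_comm, hsymm, hmul, smul_dotProduct, smul_eq_mul]
  have hone : W *ᵥ (fun _ => (1 : ℝ)) = fun _ => 1 := by
    ext g
    have := (mem_doublyStochastic_iff_sum.1 hW.1).2.1 g
    simpa [mulVec, dotProduct] using this
  have hone0 : ∀ i, i ≠ i0 → (b i).ofLp ⬝ᵥ (fun _ => (1 : ℝ)) = 0 := fun i hi => by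
    have h1 := hcoef (fun _ => 1) i
    rw [hone] at h1
    have h2 := hle i hi
    have h3 : hH.eigenvalues i ≠ 1 := fun h => by
      rw [h, abs_one] at h2; linarith
    have : (1 - hH.eigenvalues i) * ((b i).ofLp ⬝ᵥ (fun _ => (1 : ℝ))) = 0 := by linarith
    rcases mul_eq_zero.1 this with h | h
    · exact (h3 (by linarith)).elim
    · exact h
  have pars : ∀ y z : Fin L → ℝ, ∑ i, ((b i).ofLp ⬝ᵥ y) * ((b i).ofLp ⬝ᵥ z) = y ⬝ᵥ z := fun y z => by
    rw [← inner_toLp, ← b.sum_inner_mul_inner]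
    refine Finset.sum_congr rfl fun i _ => ?_
    rw [real_inner_comm, ← inner_toLp, ← inner_toLp]
  have hx0 : (b i0).ofLp ⬝ᵥ x = 0 := by
    have h1 := pars (fun _ => 1) x
    have h2 := pars (fun _ => 1) (fun _ => 1)
    rw [Finset.sum_eq_single i0 (fun i _ hi => by rw [hone0 i hi, zero_mul]) (by simp)] at h1 h2
    have h3 : (fun _ => (1 : ℝ)) ⬝ᵥ x = 0 := by simpa [dotProduct] using hx
    have h4 : (fun _ : Fin L => (1 : ℝ)) ⬝ᵥ (fun _ => 1) = L := by simp [dotProduct]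
    rw [h3] at h1
    rw [h4] at h2
    have h5 : (0 : ℝ) < L := by exact_mod_cast (by omega : 0 < L)
    rcases mul_eq_zero.1 h1 with h | h
    · rw [h] at h2; linarith
    · exact h
  have hγ0 : 0 ≤ γ := connectivity_nonneg W
  refine nrm_le_of_sq_le (mul_nonneg hγ0 (nrm_nonneg _)) ?_
  rw [← pars, mul_pow, nrm_sq x, ← pars x x, Finset.mul_sum]
  refine Finset.sum_le_sum fun i _ => ?_
  rw [hcoef]
  by_cases hi : i = i0
  · rw [hi, hx0]; simp
  · have h1 := hle i hi
    have h2 : hH.eigenvalues i ^ 2 ≤ γ ^ 2 := sq_le_sq' (by linarith [neg_abs_le (hH.eigenvalues i)]) (by linarith [le_abs_self (hH.eigenvalues i)])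
    nlinarith [mul_self_nonneg ((b i).ofLp ⬝ᵥ x)]

lemma weight_pow_sum_col (hW : IsWeightMatrix G W) (k : ℕ) (x : Fin L → ℝ) :
    ∑ i, (W ^ k *ᵥ x) i = ∑ i, x i := by
  have h := (mem_doublyStochastic_iff_sum.1 ((doublyStochastic ℝ (Fin L)).pow_mem hW.1 k)).2.2
  simp only [mulVec, dotProduct]
  rw [Finset.sum_comm]
  refine Finset.sum_congr rfl fun j _ => ?_
  rw [← Finset.sum_mul, h j, one_mul]

/-- The powers of the weight matrix approach the averaging matrix at the rate `connectivity W`. -/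
lemma abs_weight_pow_sub_le (hW : IsWeightMatrix G W) (hγ : connectivity W < 1) (k : ℕ)
    (g j : Fin L) : |(W ^ k) g j - 1 / L| ≤ if L = 1 then 0 else connectivity W ^ k := by
  classical
  have hL0 : 0 < L := g.pos
  split_ifs with hL
  · subst hL
    have h := (mem_doublyStochastic_iff_sum.1 ((doublyStochastic ℝ (Fin 1)).pow_mem hW.1 k)).2.1 g
    have hj : j = 0 := Subsingleton.elim _ _
    have hg : g = 0 := Subsingleton.elim _ _
    subst hj hg
    simp at h
    simp [h]
  have hL1 : 1 < L := by omega
  have hLr : (0 : ℝ) < L := by exact_mod_cast hL0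
  set x : Fin L → ℝ := Pi.single j 1 - fun _ => 1 / (L : ℝ) with hx
  have hx0 : ∑ i, x i = 0 := by
    simp [hx, Finset.sum_sub_distrib, Finset.sum_pi_single']
    field_simp
    simp
  have hk : nrm (W ^ k *ᵥ x) ≤ connectivity W ^ k * nrm x := by
    induction k with
    | zero => simp
    | succ k ih =>
      rw [pow_succ', ← mulVec_mulVec]
      refine (nrm_weight_mulVec_le hW hγ hL1 (by rw [weight_pow_sum_col hW, hx0])).trans ?_
      rw [pow_succ', mul_assoc]
      exact mul_le_mul_of_nonneg_left ih (connectivity_nonneg W)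
  have hxn : nrm x ≤ 1 := by
    refine nrm_le_of_sq_le zero_le_one ?_
    have h1 : x ⬝ᵥ x = x ⬝ᵥ (Pi.single j 1) := by
      conv_lhs => rw [hx, dotProduct_sub]
      rw [← hx]
      have : x ⬝ᵥ (fun _ => 1 / (L : ℝ)) = 0 := by
        simp only [dotProduct]; rw [← Finset.sum_mul, hx0, zero_mul]
      rw [this, sub_zero]
    rw [h1, dotProduct_single]
    simp [hx]
  have hone : W ^ k *ᵥ (fun _ => 1 / (L : ℝ)) = fun _ => 1 / (L : ℝ) := by
    ext g
    have := (mem_doublyStochastic_iff_sum.1 ((doublyStochastic ℝ (Fin L)).pow_mem hW.1 k)).2.1 g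
    simp only [mulVec, dotProduct]
    rw [← Finset.sum_mul, this, one_mul]
  have h2 : (W ^ k *ᵥ x) g = (W ^ k) g j - 1 / L := by
    rw [hx, mulVec_sub, hone]; simp
  rw [← h2]
  refine (abs_apply_le_nrm _ g).trans (hk.trans ?_)
  exact mul_le_of_le_one_right (pow_nonneg (connectivity_nonneg W) _) hxn

lemma connectivity_pow_le {C Λ : ℝ} {k : ℕ} (hγ : connectivity W < 1) (hk : 1 ≤ k)
    (h : C * (1 / log (1 / connectivity W)) * Λ ≤ k) :
    connectivity W ^ k ≤ exp (-(C * Λ)) := by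
  rcases (connectivity_nonneg W).eq_or_lt with h0 | h0
  · rw [← h0, zero_pow (by omega)]; positivity
  have hl : 0 < log (1 / connectivity W) := Real.log_pos (by rw [lt_div_iff₀ h0]; linarith)
  have h1 : C * Λ ≤ k * log (1 / connectivity W) := by
    have : C * (1 / log (1 / connectivity W)) * Λ = C * Λ / log (1 / connectivity W) := by ring
    rwa [this, div_le_iff₀ hl] at h
  rw [one_div, Real.log_inv] at h1
  rw [← Real.exp_log (pow_pos h0 k), Real.log_pow]
  exact Real.exp_le_exp.2 (by linarith)

lemma broadcastStep_spec {d r : ℕ} {A : Matrix (Fin d) (Fin r) ℝ} {U : Fin L → Matrix (Fin d) (Fin r) ℝ}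
    (hU : ∀ g, U g = 0 ∨ U g = A) (g : Fin L) :
    (broadcastStep G U g = 0 ∨ broadcastStep G U g = A) ∧
      ((U g = A ∨ ∃ j, G.Adj g j ∧ U j = A ∧ A ≠ 0) → broadcastStep G U g = A) := by
  unfold broadcastStep
  split_ifs with h
  · have h1 : U h.choose = A := (hU _).resolve_left h.choose_spec.2
    exact ⟨Or.inr h1, fun _ => h1⟩
  · refine ⟨hU g, fun h2 => ?_⟩
    rcases h2 with h2 | ⟨j, hj, hjA, hA⟩
    · exact h2
    · exact (h ⟨j, hj, by rw [hjA]; exact hA⟩).elim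

lemma broadcast_eq [NeZero L] {d r : ℕ} (hG : G.Connected) {U : Fin L → Matrix (Fin d) (Fin r) ℝ}
    (hU : U 0 ≠ 0) (g : Fin L) : broadcast G U g = U 0 := by
  classical
  have key : ∀ k : ℕ, (∀ g, (broadcastStep G)^[k] (fun g => if g = 0 then U g else 0) g = 0 ∨
      (broadcastStep G)^[k] (fun g => if g = 0 then U g else 0) g = U 0) ∧
      ∀ g, G.dist 0 g ≤ k →
        (broadcastStep G)^[k] (fun g => if g = 0 then U g else 0) g = U 0 := by
    intro k
    induction k with
    | zero =>
      refine ⟨fun g => ?_, fun g hg => ?_⟩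
      · by_cases h : g = 0 <;> simp [h]
      · have : g = 0 := (hG.dist_eq_zero_iff.1 (Nat.le_zero.1 hg)).symm
        simp [this]
    | succ k ih =>
      simp only [Function.iterate_succ_apply']
      refine ⟨fun g => (broadcastStep_spec ih.1 g).1, fun g hg => ?_⟩
      refine (broadcastStep_spec ih.1 g).2 ?_
      rcases Nat.lt_or_ge k (G.dist 0 g) with hlt | hle
      · right
        have hd : G.dist 0 g = k + 1 := by omega
        obtain ⟨w, hw⟩ := hG.exists_walk_length_eq_dist g 0
        rw [SimpleGraph.dist_comm, hd] at hw
        cases w with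
        | nil => simp at hw
        | cons hadj p =>
          rename_i v
          refine ⟨v, hadj, ih.2 v ?_, hU⟩
          rw [SimpleGraph.dist_comm]
          refine (SimpleGraph.dist_le p).trans ?_
          simp at hw; omega
      · exact Or.inl (ih.2 g hle)
  refine (key _).2 g ?_
  have h1 : G.edist 0 g ≤ G.eccent 0 := SimpleGraph.edist_le_eccent
  have h2 : G.eccent 0 ≠ ⊤ := by
    obtain ⟨v, hv⟩ := G.exists_edist_eq_eccent_of_finite 0
    rw [← hv]
    exact SimpleGraph.edist_ne_top_iff_reachable.2 (hG 0 v)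
  have : (G.dist 0 g : ℕ∞) ≤ ((G.eccent 0).toNat : ℕ∞) := by
    rw [ENat.natCast_toNat h2, SimpleGraph.dist, ENat.natCast_toNat]
    · exact h1
    · exact fun h => h2 (top_le_iff.1 (h ▸ h1))
  exact_mod_cast this

end Network

section Measurability
variable {m n l : Type*}

instance : MeasurableSpace (Matrix m n ℝ) := inferInstanceAs (MeasurableSpace (m → n → ℝ))

instance [Finite m] [Finite n] : BorelSpace (Matrix m n ℝ) :=
  inferInstanceAs (BorelSpace (m → n → ℝ))

variable {α : Type*} [MeasurableSpace α]

lemma measurable_matrix_iff {A : α → Matrix m n ℝ} :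
    Measurable A ↔ ∀ i j, Measurable fun x => A x i j := by
  constructor
  · intro h i j
    have h' : Measurable (fun x => (A x : m → n → ℝ)) := h
    exact (measurable_pi_apply j).comp ((measurable_pi_apply i).comp h')
  · intro h
    exact measurable_pi_lambda _ fun i => measurable_pi_lambda _ fun j => h i j

lemma _root_.Measurable.matrix_entry {A : α → Matrix m n ℝ} (h : Measurable A) (i : m) (j : n) :
    Measurable fun x => A x i j := measurable_matrix_iff.1 h i j

lemma measurable_matrix_norm [Fintype m] [Fintype n] [DecidableEq n] :
    Measurable (fun A : Matrix m n ℝ => ‖A‖) := continuous_norm.measurable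

lemma _root_.Measurable.matrix_norm [Fintype m] [Fintype n] [DecidableEq n] {A : α → Matrix m n ℝ}
    (h : Measurable A) : Measurable fun x => ‖A x‖ := measurable_matrix_norm.comp h

lemma _root_.Measurable.matrix_mul [Fintype m] {A : α → Matrix l m ℝ} {B : α → Matrix m n ℝ}
    (hA : Measurable A) (hB : Measurable B) : Measurable fun x => A x * B x := by
  rw [measurable_matrix_iff] at *
  intro i j
  simp only [Matrix.mul_apply]
  exact Finset.measurable_sum _ fun k _ => (hA i k).mul (hB k j)

lemma _root_.Measurable.matrix_transpose {A : α → Matrix m n ℝ} (hA : Measurable A) :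
    Measurable fun x => (A x)ᵀ := by
  rw [measurable_matrix_iff] at *
  exact fun i j => hA j i

lemma _root_.Measurable.matrix_sub {A B : α → Matrix m n ℝ} (hA : Measurable A) (hB : Measurable B) :
    Measurable fun x => A x - B x := by
  rw [measurable_matrix_iff] at *
  exact fun i j => (hA i j).sub (hB i j)

lemma _root_.Measurable.matrix_smul {A : α → Matrix m n ℝ} {c : α → ℝ} (hc : Measurable c)
    (hA : Measurable A) : Measurable fun x => c x • A x := by
  rw [measurable_matrix_iff] at *
  exact fun i j => hc.mul (hA i j)

lemma _root_.Measurable.matrix_sum {ι : Type*} {s : Finset ι} {A : ι → α → Matrix m n ℝ}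
    (hA : ∀ i ∈ s, Measurable (A i)) : Measurable fun x => ∑ i ∈ s, A i x := by
  rw [measurable_matrix_iff]
  intro i j
  simp only [Matrix.sum_apply]
  exact Finset.measurable_sum _ fun k hk => (hA k hk).matrix_entry i j

lemma _root_.Measurable.mulVec [Fintype n] {A : α → Matrix m n ℝ} {v : α → n → ℝ}
    (hA : Measurable A) (hv : Measurable v) : Measurable fun x => A x *ᵥ v x := by
  rw [measurable_matrix_iff] at hA
  refine measurable_pi_lambda _ fun i => ?_
  simp only [Matrix.mulVec, dotProduct]
  exact Finset.measurable_sum _ fun k _ => (hA i k).mul ((measurable_pi_apply k).comp hv)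

lemma _root_.Measurable.dotProduct [Fintype n] {v w : α → n → ℝ} (hv : Measurable v) (hw : Measurable w) :
    Measurable fun x => v x ⬝ᵥ w x :=
  Finset.measurable_sum _ fun k _ =>
    ((measurable_pi_apply k).comp hv).mul ((measurable_pi_apply k).comp hw)

lemma _root_.Measurable.nrm [Fintype n] {v : α → n → ℝ} (hv : Measurable v) :
    Measurable fun x => nrm (v x) := by
  have : ∀ x, DifAltGDmin.nrm (v x) = sqrt (v x ⬝ᵥ v x) := fun x => by
    rw [← nrm_sq, Real.sqrt_sq (nrm_nonneg _)]
  simp only [this]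
  exact (hv.dotProduct hv).sqrt

end Measurability

section Decouple
variable {J S : Type*} [Fintype J] [MeasurableSpace S]

/-- Functions of disjoint sets of coordinates can be integrated one after the other. -/
lemma lintegral_decouple (μ : J → Measure ℝ) [∀ j, IsProbabilityMeasure (μ j)] (p : J → Prop)
    {f : (J → ℝ) → S} (hf : Measurable f) {h : S → (J → ℝ) → ENNReal}
    (hh : Measurable (Function.uncurry h))
    (hfp : ∀ x y, (∀ j, ¬ p j → x j = y j) → f x = f y)
    (hhp : ∀ s x y, (∀ j, p j → x j = y j) → h s x = h s y) :
    ∫⁻ x, h (f x) x ∂Measure.pi μ = ∫⁻ x, ∫⁻ y, h (f x) y ∂Measure.pi μ ∂Measure.pi μ := by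
  classical
  let φ := MeasurableEquiv.piEquivPiSubtypeProd (fun _ : J => ℝ) p
  have hφ := measurePreserving_piEquivPiSubtypeProd μ p
  have hφs := hφ.symm
  have hz : ∀ a b j, φ.symm (a, b) j = if h : p j then a ⟨j, h⟩ else b ⟨j, h⟩ := fun a b j => rfl
  set ν₁ := Measure.pi fun i : {j // p j} => μ i
  set ν₂ := Measure.pi fun i : {j // ¬ p j} => μ i
  let F : ({j // ¬ p j} → ℝ) → S := fun b => f (φ.symm (0, b))
  let H : S → ({j // p j} → ℝ) → ENNReal := fun s a => h s (φ.symm (a, 0))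
  have e1 : ∀ a b, f (φ.symm (a, b)) = F b := fun a b =>
    hfp _ _ fun j hj => by rw [hz, hz, dif_neg hj, dif_neg hj]
  have e2 : ∀ s a b, h s (φ.symm (a, b)) = H s a := fun s a b =>
    hhp s _ _ fun j hj => by rw [hz, hz, dif_pos hj, dif_pos hj]
  have hF : Measurable F := hf.comp (φ.symm.measurable.comp measurable_prodMk_left)
  have hH : Measurable (Function.uncurry H) :=
    hh.comp (measurable_fst.prodMk (φ.symm.measurable.comp (measurable_snd.prodMk measurable_const)))
  have hint : ∀ g : (J → ℝ) → ENNReal,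
      ∫⁻ x, g x ∂Measure.pi μ = ∫⁻ z, g (φ.symm z) ∂ν₁.prod ν₂ := fun g => by
    rw [← hφs.map_eq]
    exact lintegral_map_equiv g φ.symm
  have hHm : Measurable fun z : ({j // p j} → ℝ) × ({j // ¬ p j} → ℝ) => H (F z.2) z.1 :=
    hH.comp ((hF.comp measurable_snd).prodMk measurable_fst)
  rw [hint, hint]
  calc ∫⁻ z, h (f (φ.symm z)) (φ.symm z) ∂ν₁.prod ν₂
      = ∫⁻ z, H (F z.2) z.1 ∂ν₁.prod ν₂ := lintegral_congr fun z => by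
        obtain ⟨a, b⟩ := z; rw [e1, e2]
    _ = ∫⁻ b, ∫⁻ a, H (F b) a ∂ν₁ ∂ν₂ := lintegral_prod_symm _ hHm.aemeasurable
    _ = ∫⁻ z, ∫⁻ a, H (F z.2) a ∂ν₁ ∂ν₁.prod ν₂ := by
        rw [lintegral_prod_symm]
        · simp
        · have : Measurable fun b => ∫⁻ a, H (F b) a ∂ν₁ :=
            Measurable.lintegral_prod_right (hH.comp ((hF.comp measurable_fst).prodMk measurable_snd))
          exact (this.comp measurable_snd).aemeasurable
    _ = _ := lintegral_congr fun z => by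
        obtain ⟨a, b⟩ := z
        rw [e1, hint]
        rw [lintegral_prod]
        · simp only [e2]; simp
        · have : Measurable fun z : ({j // p j} → ℝ) × ({j // ¬ p j} → ℝ) => h (F b) (φ.symm z) :=
            hh.comp (measurable_const.prodMk φ.symm.measurable)
          exact this.aemeasurable

end Decouple

section Gaussian

/-- The standard Gaussian measure on `J → ℝ`. -/
noncomputable abbrev gaussM (J : Type*) [Fintype J] : Measure (J → ℝ) :=
  Measure.pi fun _ => gaussianReal 0 1

variable {J K : Type*} [Fintype J] [Fintype K]

lemma gaussM_map_comp {e : K → J} (he : Function.Injective e) :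
    (gaussM J).map (fun x k => x (e k)) = gaussM K := by
  have h : iIndepFun (fun (j : J) (x : J → ℝ) => x j) (gaussM J) :=
    iIndepFun_pi (μ := fun _ : J => gaussianReal 0 1) (X := fun _ => id) fun _ => aemeasurable_id
  have h2 := (h.precomp he).map_fun_eq_pi_map (fun k => (measurable_pi_apply (e k)).aemeasurable)
  rw [h2]
  congr 1
  ext k : 1
  exact (measurePreserving_eval (fun _ : J => gaussianReal 0 1) (e k)).map_eq

lemma lintegral_gaussM_comp {e : K → J} (he : Function.Injective e) {F : (K → ℝ) → ENNReal}
    (hF : Measurable F) : ∫⁻ x, F (fun k => x (e k)) ∂gaussM J = ∫⁻ y, F y ∂gaussM K := by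
  rw [← gaussM_map_comp he, lintegral_map hF (by fun_prop)]

/-- A linear functional of a standard Gaussian vector is a centred Gaussian variable. -/
lemma gaussM_map_dotProduct (a : J → ℝ) :
    (gaussM J).map (fun x => a ⬝ᵥ x) = (gaussianReal 0 1).map (fun g => nrm a * g) := by
  have hv : (gaussM J).map (fun x => a ⬝ᵥ x) = gaussianReal 0 ⟨nrm a ^ 2, sq_nonneg _⟩ := by
    have : (fun x : J → ℝ => a ⬝ᵥ x) = (fun y : EuclideanSpace ℝ J => inner ℝ (WithLp.toLp 2 a) y) ∘
        (WithLp.toLp 2) := by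
      ext x; simp [inner_toLp]
    rw [this, ← Measure.map_map (by fun_prop) (by fun_prop), map_pi_eq_stdGaussian]
    set Lf : StrongDual ℝ (EuclideanSpace ℝ J) := innerSL ℝ (WithLp.toLp 2 a) with hLf
    have hL : (fun y : EuclideanSpace ℝ J => inner ℝ (WithLp.toLp 2 a) y) = Lf := by
      ext y; simp [hLf]
    rw [hL, IsGaussian.map_eq_gaussianReal, integral_strongDual_stdGaussian,
      variance_dual_stdGaussian]
    congr 1
    have : ‖Lf‖ = nrm a := by rw [hLf, innerSL_apply_norm]; rfl
    ext
    rw [this]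
    rw [Real.coe_toNNReal _ (sq_nonneg _)]
    rfl
  rw [hv, gaussianReal_map_const_mul]
  rw [mul_zero]
  congr 1
  ext
  simp
  rfl

lemma lintegral_gaussM_dotProduct (a : J → ℝ) {F : ℝ → ENNReal} (hF : Measurable F) :
    ∫⁻ x, F (a ⬝ᵥ x) ∂gaussM J = ∫⁻ g, F (nrm a * g) ∂gaussianReal 0 1 := by
  have hm : Measurable fun x : J → ℝ => a ⬝ᵥ x := measurable_const.dotProduct measurable_id
  rw [← lintegral_map hF hm, gaussM_map_dotProduct, lintegral_map hF (by fun_prop)]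

lemma lintegral_exp_sq_gaussianReal_eq {s : ℝ} (hs : s < 1 / 2) :
    ∫⁻ g, ofReal (exp (s * g ^ 2)) ∂gaussianReal 0 1 =
      ofReal (sqrt (1 / (1 - 2 * s))) := by
  have hb : 0 < 1 / 2 - s := by linarith
  have hpi := Real.pi_pos
  rw [gaussianReal_of_var_ne_zero _ one_ne_zero,
    lintegral_withDensity_eq_lintegral_mul _ (measurable_gaussianPDF 0 1) (by fun_prop)]
  have e : ∀ x : ℝ, (gaussianPDF 0 1 * fun g : ℝ => ofReal (exp (s * g ^ 2))) x =
      ofReal ((sqrt (2 * Real.pi))⁻¹ * exp (-(1 / 2 - s) * x ^ 2)) := fun x => by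
    simp only [Pi.mul_apply, gaussianPDF, gaussianPDFReal]
    rw [← ENNReal.ofReal_mul (by positivity), mul_assoc, ← Real.exp_add]
    congr 3
    · simp
    · simp; ring
  simp only [e]
  rw [← ofReal_integral_eq_lintegral_ofReal ((integrable_exp_neg_mul_sq hb).const_mul _)
    (Filter.Eventually.of_forall fun x => by positivity), integral_const_mul, integral_gaussian]
  congr 1
  rw [← Real.sqrt_inv, ← Real.sqrt_mul (by positivity)]
  congr 1
  have : 1 - 2 * s ≠ 0 := by linarith
  field_simp

lemma lintegral_exp_sq_gaussianReal {s : ℝ} (hs : |s| ≤ 1 / 4) :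
    ∫⁻ g, ofReal (exp (s * g ^ 2)) ∂gaussianReal 0 1 ≤
      ofReal (exp (s + 4 * s ^ 2)) := by
  rw [abs_le] at hs
  rw [lintegral_exp_sq_gaussianReal_eq (by linarith)]
  refine ENNReal.ofReal_le_ofReal ?_
  rw [Real.sqrt_le_left (Real.exp_nonneg _), ← Real.exp_nat_mul, one_div]
  have h2 : 0 < 1 - 2 * s := by linarith
  have h3 := Real.one_sub_inv_le_log_of_pos h2
  have h4 : -(2 * (s + 4 * s ^ 2)) ≤ 1 - (1 - 2 * s)⁻¹ := by
    rw [← sub_nonneg]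
    have : 1 - (1 - 2 * s)⁻¹ - -(2 * (s + 4 * s ^ 2)) = (4 * s ^ 2 * (1 - 4 * s)) / (1 - 2 * s) := by
      field_simp
      ring
    rw [this]
    apply div_nonneg _ h2.le
    nlinarith [sq_nonneg s]
  rw [inv_le_iff_one_le_mul₀ h2]
  have h5 : exp (-(2 * (s + 4 * s ^ 2))) ≤ 1 - 2 * s := by
    rw [← Real.exp_log h2]; exact Real.exp_le_exp.2 (h4.trans h3)
  push_cast
  calc (1 : ℝ) = exp (2 * (s + 4 * s ^ 2)) * exp (-(2 * (s + 4 * s ^ 2))) := by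
        rw [← Real.exp_add]; simp
    _ ≤ _ := by gcongr

/-- Exponential moments of a product of two linear functionals of a Gaussian vector. -/
lemma lintegral_exp_bilin (a c : J → ℝ) (h : nrm a * nrm c ≤ 1 / 8) :
    ∫⁻ x, ofReal (exp ((a ⬝ᵥ x) * (c ⬝ᵥ x) - a ⬝ᵥ c)) ∂gaussM J ≤
      ofReal (exp (16 * (nrm a ^ 2 * nrm c ^ 2))) := by
  have one_case : ∀ (u : J → ℝ) (s : ℝ), |s * nrm u ^ 2| ≤ 1 / 4 →
      ∫⁻ x, ofReal (exp (s * (u ⬝ᵥ x) ^ 2 - s * nrm u ^ 2)) ∂gaussM J ≤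
        ofReal (exp (4 * (s * nrm u ^ 2) ^ 2)) := fun u s hs => by
    rw [lintegral_gaussM_dotProduct u (F := fun t => ofReal (exp (s * t ^ 2 - s * nrm u ^ 2)))
      (by fun_prop)]
    have e : ∀ g : ℝ, ofReal (exp (s * (nrm u * g) ^ 2 - s * nrm u ^ 2)) =
        ofReal (exp (-(s * nrm u ^ 2))) *
          ofReal (exp (s * nrm u ^ 2 * g ^ 2)) := fun g => by
      rw [← ENNReal.ofReal_mul (Real.exp_nonneg _), ← Real.exp_add]; congr 2; ring
    simp only [e]
    rw [lintegral_const_mul _ (by fun_prop)]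
    refine (mul_le_mul_right (lintegral_exp_sq_gaussianReal hs) _).trans ?_
    rw [← ENNReal.ofReal_mul (Real.exp_nonneg _), ← Real.exp_add]
    refine ENNReal.ofReal_le_ofReal (Real.exp_le_exp.2 ?_)
    linarith
  by_cases ha : nrm a = 0
  · have := nrm_eq_zero.1 ha; subst this; simp
  by_cases hc : nrm c = 0
  · have := nrm_eq_zero.1 hc; subst this; simp
  have ha0 : 0 < nrm a := lt_of_le_of_ne (nrm_nonneg _) (Ne.symm ha)
  have hc0 : 0 < nrm c := lt_of_le_of_ne (nrm_nonneg _) (Ne.symm hc)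
  set t := sqrt (nrm c / nrm a) with ht
  have ht0 : 0 < t := Real.sqrt_pos.2 (by positivity)
  have ht2 : t ^ 2 = nrm c / nrm a := Real.sq_sqrt (by positivity)
  set u := t • a + t⁻¹ • c with hu
  set v := t • a - t⁻¹ • c with hv
  have hta : nrm (t • a) ^ 2 = nrm a * nrm c := by
    rw [nrm_smul, mul_pow, sq_abs, ht2]; field_simp
  have htc : nrm (t⁻¹ • c) ^ 2 = nrm a * nrm c := by
    rw [nrm_smul, mul_pow, sq_abs, inv_pow, ht2]; field_simp
  have hun : nrm u ^ 2 ≤ 4 * (nrm a * nrm c) := by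
    have := nrm_add_le (t • a) (t⁻¹ • c)
    nlinarith [nrm_nonneg u, nrm_nonneg (t • a), nrm_nonneg (t⁻¹ • c), sq_nonneg (nrm (t • a) - nrm (t⁻¹ • c))]
  have hvn : nrm v ^ 2 ≤ 4 * (nrm a * nrm c) := by
    have := nrm_sub_le (t • a) (t⁻¹ • c)
    nlinarith [nrm_nonneg v, nrm_nonneg (t • a), nrm_nonneg (t⁻¹ • c), sq_nonneg (nrm (t • a) - nrm (t⁻¹ • c))]
  have huv : nrm u ^ 2 - nrm v ^ 2 = 4 * (a ⬝ᵥ c) := by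
    rw [nrm_sq, nrm_sq, hu, hv]
    simp only [add_dotProduct, dotProduct_add, sub_dotProduct, dotProduct_sub, smul_dotProduct,
      dotProduct_smul, smul_eq_mul]
    rw [dotProduct_comm c a]; field_simp; ring
  have key : ∀ x : J → ℝ, exp ((a ⬝ᵥ x) * (c ⬝ᵥ x) - a ⬝ᵥ c) ≤
      (1 / 2) * exp (1 / 2 * (u ⬝ᵥ x) ^ 2 - 1 / 2 * nrm u ^ 2) +
        (1 / 2) * exp (-(1 / 2) * (v ⬝ᵥ x) ^ 2 - -(1 / 2) * nrm v ^ 2) := fun x => by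
    have e1 : (a ⬝ᵥ x) * (c ⬝ᵥ x) - a ⬝ᵥ c = (1 / 4 * (u ⬝ᵥ x) ^ 2 - 1 / 4 * nrm u ^ 2) +
        (-(1 / 4) * (v ⬝ᵥ x) ^ 2 - -(1 / 4) * nrm v ^ 2) := by
      have : (u ⬝ᵥ x) ^ 2 - (v ⬝ᵥ x) ^ 2 = 4 * ((a ⬝ᵥ x) * (c ⬝ᵥ x)) := by
        rw [hu, hv]
        simp only [add_dotProduct, sub_dotProduct, smul_dotProduct, smul_eq_mul]
        field_simp; ring
      linarith
    rw [e1, Real.exp_add]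
    set A := exp (1 / 4 * (u ⬝ᵥ x) ^ 2 - 1 / 4 * nrm u ^ 2) with hA
    set B := exp (-(1 / 4) * (v ⬝ᵥ x) ^ 2 - -(1 / 4) * nrm v ^ 2) with hB
    have hA2 : exp (1 / 2 * (u ⬝ᵥ x) ^ 2 - 1 / 2 * nrm u ^ 2) = A ^ 2 := by
      rw [hA, ← Real.exp_nat_mul]; congr 1; push_cast; ring
    have hB2 : exp (-(1 / 2) * (v ⬝ᵥ x) ^ 2 - -(1 / 2) * nrm v ^ 2) = B ^ 2 := by
      rw [hB, ← Real.exp_nat_mul]; congr 1; push_cast; ring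
    rw [hA2, hB2]
    nlinarith [sq_nonneg (A - B)]
  have hρ : 0 ≤ nrm a * nrm c := by positivity
  calc _ ≤ ∫⁻ x, (ofReal (1 / 2) * ofReal (exp (1 / 2 * (u ⬝ᵥ x) ^ 2 - 1 / 2 * nrm u ^ 2)) +
        ofReal (1 / 2) * ofReal (exp (-(1 / 2) * (v ⬝ᵥ x) ^ 2 - -(1 / 2) * nrm v ^ 2)))
          ∂gaussM J := by
        refine lintegral_mono fun x => ?_
        rw [← ENNReal.ofReal_mul (by norm_num), ← ENNReal.ofReal_mul (by norm_num),
          ← ENNReal.ofReal_add (by positivity) (by positivity)]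
        exact ENNReal.ofReal_le_ofReal (key x)
    _ ≤ ofReal (1 / 2) * ofReal (exp (16 * (nrm a ^ 2 * nrm c ^ 2))) +
        ofReal (1 / 2) * ofReal (exp (16 * (nrm a ^ 2 * nrm c ^ 2))) := by
        have hmu : Measurable fun x : J → ℝ => u ⬝ᵥ x := measurable_const.dotProduct measurable_id
        have hmv : Measurable fun x : J → ℝ => v ⬝ᵥ x := measurable_const.dotProduct measurable_id
        rw [lintegral_add_left (by fun_prop), lintegral_const_mul _ (by fun_prop),
          lintegral_const_mul _ (by fun_prop)]
        refine add_le_add (mul_le_mul_right ((one_case u (1 / 2) ?_).trans ?_) _)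
          (mul_le_mul_right ((one_case v (-(1 / 2)) ?_).trans ?_) _)
        · rw [abs_le]; constructor <;> nlinarith [sq_nonneg (nrm u)]
        · refine ENNReal.ofReal_le_ofReal (Real.exp_le_exp.2 ?_)
          nlinarith [sq_nonneg (nrm u)]
        · rw [abs_le]; constructor <;> nlinarith [sq_nonneg (nrm v)]
        · refine ENNReal.ofReal_le_ofReal (Real.exp_le_exp.2 ?_)
          nlinarith [sq_nonneg (nrm v)]
    _ = _ := by
        rw [← add_mul, ← ENNReal.ofReal_add (by norm_num) (by norm_num)]; norm_num

end Gaussian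

section Rows
variable {J K : Type*} [Fintype J] {d : ℕ}

lemma gaussM_map_row {e : K → Fin d → J} (he : Function.Injective (Function.uncurry e)) (k : K) :
    Function.Injective (e k) := fun i j hij => by
  have := @he (k, i) (k, j) hij
  exact (Prod.ext_iff.1 this).2

lemma measurable_row (e : K → Fin d → J) (k : K) :
    Measurable fun (x : J → ℝ) (j : Fin d) => x (e k j) := by fun_prop

/-- Functions of different rows integrate to the product of the integrals. -/
lemma lintegral_prod_rows {e : K → Fin d → J} (he : Function.Injective (Function.uncurry e))
    (s : Finset K) {F : K → (Fin d → ℝ) → ENNReal} (hF : ∀ k, Measurable (F k)) :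
    ∫⁻ x, ∏ k ∈ s, F k (fun j => x (e k j)) ∂gaussM J = ∏ k ∈ s, ∫⁻ y, F k y ∂gaussM (Fin d) := by
  classical
  induction s using Finset.induction_on with
  | empty => simp
  | insert a s ha ih =>
    simp only [Finset.prod_insert ha]
    have hm : ∀ k, Measurable fun x : J → ℝ => F k (fun j => x (e k j)) := fun k =>
      (hF k).comp (measurable_row e k)
    have hP : Measurable fun x : J → ℝ => ∏ k ∈ s, F k (fun j => x (e k j)) :=
      Finset.measurable_fun_prod s fun k _ => hm k
    have := lintegral_decouple (fun _ : J => gaussianReal 0 1) (fun j => ∃ i, e a i = j)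
      (f := fun x => ∏ k ∈ s, F k (fun j => x (e k j))) hP
      (h := fun t x => F a (fun j => x (e a j)) * t)
      (((hm a).comp measurable_snd).mul measurable_fst) ?_ ?_
    · rw [this, ← ih, ← lintegral_gaussM_comp (gaussM_map_row he a) (hF a),
        ← lintegral_const_mul _ hP]
      refine lintegral_congr fun x => ?_
      rw [lintegral_mul_const _ (hm a)]
    · intro x y hxy
      refine Finset.prod_congr rfl fun k hk => ?_
      congr 1
      ext j
      refine hxy _ ?_
      rintro ⟨i, hi⟩
      have := @he (a, i) (k, j) hi
      have h1 : a = k := (Prod.ext_iff.1 this).1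
      exact ha (h1 ▸ hk)
    · intro s x y hxy
      congr 2
      ext j
      exact hxy _ ⟨j, rfl⟩

/-- Exponential moments of a sum over independent rows. -/
lemma lintegral_exp_sum_rows {e : K → Fin d → J} (he : Function.Injective (Function.uncurry e))
    (s : Finset K) {F : K → (Fin d → ℝ) → ℝ} (hF : ∀ k, Measurable (F k)) {B : K → ℝ}
    (hB : ∀ k ∈ s, ∫⁻ y, ofReal (exp (F k y)) ∂gaussM (Fin d) ≤
      ofReal (exp (B k))) :
    ∫⁻ x, ofReal (exp (∑ k ∈ s, F k (fun j => x (e k j)))) ∂gaussM J ≤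
      ofReal (exp (∑ k ∈ s, B k)) := by
  have h1 : ∀ (G : K → ℝ), ofReal (exp (∑ k ∈ s, G k)) =
      ∏ k ∈ s, ofReal (exp (G k)) := fun G => by
    rw [Real.exp_sum, ENNReal.ofReal_prod_of_nonneg fun _ _ => Real.exp_nonneg _]
  simp only [h1]
  rw [lintegral_prod_rows he s (F := fun k y => ofReal (exp (F k y)))
    (fun k => ((hF k).exp).ennreal_ofReal)]
  exact Finset.prod_le_prod' hB

lemma lintegral_exp_sum_bilin {e : K → Fin d → J} (he : Function.Injective (Function.uncurry e))
    (s : Finset K) (a c : K → Fin d → ℝ) (h : ∀ k ∈ s, nrm (a k) * nrm (c k) ≤ 1 / 8) :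
    ∫⁻ x, ofReal (exp (∑ k ∈ s, ((a k ⬝ᵥ fun j => x (e k j)) *
      (c k ⬝ᵥ fun j => x (e k j)) - a k ⬝ᵥ c k))) ∂gaussM J ≤
      ofReal (exp (∑ k ∈ s, 16 * (nrm (a k) ^ 2 * nrm (c k) ^ 2))) :=
  lintegral_exp_sum_rows he s (F := fun k y => (a k ⬝ᵥ y) * (c k ⬝ᵥ y) - a k ⬝ᵥ c k)
    (fun _ => (((measurable_const.dotProduct measurable_id).mul
      (measurable_const.dotProduct measurable_id)).sub_const _))
    fun _ hk => lintegral_exp_bilin _ _ (h _ hk)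

end Rows

section OpNorm
variable {Ω : Type*} [MeasurableSpace Ω] {P : Measure Ω}
variable {ι κ : Type*} [Fintype ι] [Fintype κ] [DecidableEq κ]

/-- Exponential moments of the operator norm of a random matrix. -/
lemma lintegral_exp_norm_le {A : Ω → Matrix ι κ ℝ} (hA : Measurable A) {s : ℝ} (hs : 0 ≤ s)
    {B : ENNReal} (h : ∀ w z, nrm w ≤ 1 → nrm z ≤ 1 →
      ∫⁻ x, ofReal (exp (4 * s * (w ⬝ᵥ A x *ᵥ z))) ∂P ≤ B) :
    ∫⁻ x, ofReal (exp (s * ‖A x‖)) ∂P ≤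
      5 ^ (Fintype.card ι + Fintype.card κ) * B := by
  obtain ⟨N, hNc, hN1, hN2⟩ := exists_net ι
  obtain ⟨N', hNc', hN1', hN2'⟩ := exists_net κ
  have hm : ∀ w z, Measurable fun x => ofReal (exp (4 * s * (w ⬝ᵥ A x *ᵥ z))) :=
    fun w z => ((measurable_const.dotProduct (hA.mulVec measurable_const)).const_mul _).exp.ennreal_ofReal
  calc _ ≤ ∫⁻ x, ∑ w ∈ N, ∑ z ∈ N', ofReal (exp (4 * s * (w ⬝ᵥ A x *ᵥ z))) ∂P := by
        refine lintegral_mono fun x => ?_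
        obtain ⟨w, hw, z, hz, hwz⟩ := exists_net_opNorm_le hN2 hN2' (A x)
        refine le_trans ?_ (Finset.single_le_sum (f := fun w => ∑ z ∈ N',
          ofReal (exp (4 * s * (w ⬝ᵥ A x *ᵥ z)))) (fun _ _ => zero_le) hw)
        refine le_trans ?_ (Finset.single_le_sum (f := fun z =>
          ofReal (exp (4 * s * (w ⬝ᵥ A x *ᵥ z)))) (fun _ _ => zero_le) hz)
        refine ENNReal.ofReal_le_ofReal (Real.exp_le_exp.2 ?_)
        calc s * ‖A x‖ ≤ s * (4 * (w ⬝ᵥ A x *ᵥ z)) := by gcongr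
          _ = _ := by ring
    _ = ∑ w ∈ N, ∑ z ∈ N', ∫⁻ x, ofReal (exp (4 * s * (w ⬝ᵥ A x *ᵥ z))) ∂P := by
        rw [lintegral_finsetSum _ fun w _ => Finset.measurable_sum _ fun z _ => hm w z]
        exact Finset.sum_congr rfl fun w _ => lintegral_finsetSum _ fun z _ => hm w z
    _ ≤ ∑ w ∈ N, ∑ z ∈ N', B := Finset.sum_le_sum fun w hw => Finset.sum_le_sum fun z hz =>
        h w z (hN1 w hw) (hN1' z hz)
    _ = (N.card * N'.card : ℕ) * B := by
        simp only [Finset.sum_const, nsmul_eq_mul, Nat.cast_mul]; ring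
    _ ≤ _ := by
        gcongr
        rw [pow_add]
        exact_mod_cast Nat.mul_le_mul hNc hNc'

/-- Markov's inequality for exponential moments. -/
lemma measure_ge_le_exp {f : Ω → ℝ} (hf : Measurable f) {s t B : ℝ} (hs : 0 ≤ s)
    (h : ∫⁻ x, ofReal (exp (s * f x)) ∂P ≤ ofReal (exp B)) :
    P {x | t ≤ f x} ≤ ofReal (exp (B - s * t)) := by
  have h1 := meas_ge_le_lintegral_div (μ := P) (f := fun x => ofReal (exp (s * f x)))
    ((hf.const_mul s).exp.ennreal_ofReal.aemeasurable) (ε := ofReal (exp (s * t)))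
    (by simp [Real.exp_pos]) ENNReal.ofReal_ne_top
  calc P {x | t ≤ f x} ≤ P {x | ofReal (exp (s * t)) ≤ ofReal (exp (s * f x))} :=
        measure_mono fun x (hx : t ≤ f x) => ENNReal.ofReal_le_ofReal (Real.exp_le_exp.2 (by gcongr))
    _ ≤ _ := h1
    _ ≤ ofReal (exp B) / ofReal (exp (s * t)) := by gcongr
    _ = _ := by rw [← ENNReal.ofReal_div_of_pos (Real.exp_pos _), ← Real.exp_sub]

end OpNorm

section SmallBall

lemma gaussianReal_Icc_le {s : ℝ} :
    gaussianReal 0 1 {g | |g| ≤ s} ≤ ofReal s := by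
  have e : {g : ℝ | |g| ≤ s} = Set.Icc (-s) s := by ext; simp [abs_le]
  rw [e, gaussianReal_apply _ one_ne_zero]
  have hpdf : ∀ x, gaussianPDF 0 1 x ≤ ofReal (1 / 2) := fun x => by
    unfold gaussianPDF gaussianPDFReal
    refine ENNReal.ofReal_le_ofReal ?_
    have h2 : 2 ≤ sqrt (2 * Real.pi * (1 : NNReal)) := by
      rw [Real.le_sqrt' (by norm_num)]
      have := Real.pi_gt_three
      push_cast; linarith
    have h3 : exp (-(x - 0) ^ 2 / (2 * (1 : NNReal))) ≤ 1 := by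
      rw [Real.exp_le_one_iff]
      push_cast
      have := sq_nonneg (x - 0)
      linarith
    calc _ ≤ (2 : ℝ)⁻¹ * 1 := by gcongr
      _ = _ := by norm_num
  calc _ ≤ ∫⁻ x in Set.Icc (-s) s, ofReal (1 / 2) := lintegral_mono fun x => hpdf x
    _ = ofReal s := by
      rw [setLIntegral_const, Real.volume_Icc, ← ENNReal.ofReal_mul (by norm_num)]
      congr 1; ring

lemma gaussM_abs_dotProduct_le {J : Type*} [Fintype J] {a : J → ℝ} (ha : nrm a = 1) {s : ℝ} :
    gaussM J {x | |a ⬝ᵥ x| ≤ s} ≤ ofReal s := by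
  have hm : MeasurableSet {t : ℝ | |t| ≤ s} := measurableSet_le (by fun_prop) measurable_const
  have h := congrArg (fun ν => ν {t : ℝ | |t| ≤ s}) (gaussM_map_dotProduct a)
  simp only [ha, one_mul] at h
  rw [Measure.map_apply (measurable_const.dotProduct measurable_id : Measurable fun x : J → ℝ => a ⬝ᵥ x) hm, Measure.map_id'] at h
  exact h.le.trans gaussianReal_Icc_le

variable {J : Type*} [Fintype J] {d r : ℕ}

/-- The matrix with the entries of `x` prescribed by `e`. -/
def entryMatrix (e : Fin d → Fin r → J) (x : J → ℝ) : Matrix (Fin d) (Fin r) ℝ :=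
  Matrix.of fun i k => x (e i k)

lemma isClosed_exists_compact {X Y : Type*} [TopologicalSpace X] [TopologicalSpace Y]
    {C : Set Y} (hC : IsCompact C) {S : Set (X × Y)} (hS : IsClosed S) :
    IsClosed {x | ∃ y ∈ C, (x, y) ∈ S} := by
  have : CompactSpace C := isCompact_iff_compactSpace.1 hC
  have h1 : IsClosed ((fun p : X × C => (p.1, (p.2 : Y))) ⁻¹' S) := hS.preimage (by fun_prop)
  have h2 := isClosedMap_fst_of_compactSpace _ h1
  convert h2 using 1
  ext x
  constructor
  · rintro ⟨y, hy, h⟩; exact ⟨(x, ⟨y, hy⟩), h, rfl⟩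
  · rintro ⟨⟨x', y⟩, h, rfl⟩; exact ⟨y, y.2, h⟩

lemma continuous_nrm {ι : Type*} [Fintype ι] : Continuous (nrm : (ι → ℝ) → ℝ) := by
  unfold nrm; fun_prop

/-- The smallest singular value of a square Gaussian matrix is not too small. -/
lemma gaussM_small_ball {e : Fin d → Fin r → J} (he : Function.Injective (Function.uncurry e))
    {U : Matrix (Fin d) (Fin r) ℝ} (hU : Uᵀ * U = 1) {s : ℝ} (hs : 0 ≤ s) :
    gaussM J {x | ∃ w, nrm w = 1 ∧ nrm ((Uᵀ * entryMatrix e x) *ᵥ w) ≤ s} ≤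
      ofReal (r ^ 2 * s) := by
  classical
  let C : Fin r → Set (Fin r → ℝ) := fun k => {w | w k = 1 ∧ ∀ j, |w j| ≤ 1}
  have hC : ∀ k, IsCompact (C k) := fun k => by
    have h1 : IsClosed (C k) := by
      have : C k = {w | w k = 1} ∩ ⋂ j, {w | |w j| ≤ 1} := by ext; simp [C]
      rw [this]
      exact (isClosed_eq (by fun_prop) continuous_const).inter
        (isClosed_iInter fun j => isClosed_le (by fun_prop) continuous_const)
    refine (isCompact_univ_pi fun _ : Fin r => isCompact_Icc (a := (-1 : ℝ)) (b := 1)).of_isClosed_subset h1 ?_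
    intro w hw j _
    exact abs_le.1 (hw.2 j)
  let B : Fin r → Set (J → ℝ) := fun k => {x | ∃ w ∈ C k, nrm ((Uᵀ * entryMatrix e x) *ᵥ w) ≤ r * s}
  have hcontE : Continuous (entryMatrix e : (J → ℝ) → _) := by
    unfold entryMatrix
    exact continuous_matrix fun i j => by simp; fun_prop
  have hBc : ∀ k, IsClosed (B k) := fun k => by
    refine isClosed_exists_compact (hC k) (S := {p : (J → ℝ) × (Fin r → ℝ) |
      nrm ((Uᵀ * entryMatrix e p.1) *ᵥ p.2) ≤ r * s}) (isClosed_le ?_ continuous_const)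
    refine continuous_nrm.comp ?_
    exact ((continuous_const.matrix_mul (hcontE.comp continuous_fst))).matrix_mulVec continuous_snd
  have hsub : {x | ∃ w, nrm w = 1 ∧ nrm ((Uᵀ * entryMatrix e x) *ᵥ w) ≤ s} ⊆ ⋃ k, B k := by
    rintro x ⟨w, hw, hwx⟩
    have hne : Nonempty (Fin r) := by
      by_contra hcon
      have : w = 0 := by ext i; exact (hcon ⟨i⟩).elim
      rw [this, nrm_zero] at hw; norm_num at hw
    obtain ⟨k, -, hk⟩ := Finset.exists_max_image Finset.univ (fun k => |w k|) Finset.univ_nonempty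
    have hk : ∀ j, |w j| ≤ |w k| := fun j => hk j (Finset.mem_univ j)
    have hr1 : (1 : ℝ) ≤ r := by exact_mod_cast k.pos
    have h1 : (1 : ℝ) ≤ r * |w k| := by
      have h2 : (1 : ℝ) ≤ r * |w k| ^ 2 := by
        calc (1 : ℝ) = ∑ j, w j ^ 2 := by rw [← nrm_sq_eq_sum, hw]; norm_num
          _ ≤ ∑ j : Fin r, |w k| ^ 2 := Finset.sum_le_sum fun j _ => by
              rw [← sq_abs]; exact pow_le_pow_left₀ (abs_nonneg _) (hk j) 2
          _ = _ := by simp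
      have h3 : |w k| ≤ 1 := hw ▸ abs_apply_le_nrm w k
      nlinarith [abs_nonneg (w k)]
    have hk0 : 0 < |w k| := by
      by_contra hcon
      have : |w k| = 0 := le_antisymm (not_lt.1 hcon) (abs_nonneg _)
      rw [this] at h1; norm_num at h1
    have hk0' : w k ≠ 0 := abs_pos.1 hk0
    refine Set.mem_iUnion.2 ⟨k, (w k)⁻¹ • w, ⟨?_, fun j => ?_⟩, ?_⟩
    · simp [hk0']
    · rw [Pi.smul_apply, smul_eq_mul, abs_mul, abs_inv, inv_mul_le_iff₀ hk0, mul_one]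
      exact hk j
    · rw [mulVec_smul, nrm_smul, abs_inv, inv_mul_le_iff₀ hk0]
      nlinarith
  have hBk : ∀ k, gaussM J (B k) ≤ ofReal (r * s) := fun k => by
    let p : J → Prop := fun j => ∃ i, e i k = j
    let glue : (J → ℝ) → (J → ℝ) → (J → ℝ) := fun s x j => if p j then x j else s j
    have hglue : Measurable (Function.uncurry glue) := by
      refine measurable_pi_lambda _ fun j => ?_
      by_cases hj : p j
      · simp only [Function.uncurry_def, glue, if_pos hj]; fun_prop
      · simp only [Function.uncurry_def, glue, if_neg hj]; fun_prop
    have hBm := (hBc k).measurableSet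
    have := lintegral_decouple (fun _ : J => gaussianReal 0 1) p
      (f := fun x => glue x 0) (hglue.comp (measurable_id.prodMk measurable_const))
      (h := fun t x => (B k).indicator 1 (glue t x))
      ((measurable_one.indicator hBm).comp hglue) ?_ ?_
    · have e0 : ∀ x, glue (glue x 0) x = x := fun x => by
        ext j; simp only [glue]; split_ifs <;> rfl
      simp only [e0] at this
      rw [lintegral_indicator_one hBm] at this
      rw [this]
      calc _ ≤ ∫⁻ x, ofReal (r * s) ∂gaussM J := lintegral_mono fun x => ?_
        _ = _ := by simp
      set t := glue x 0
      have hgt : Measurable (glue t) := hglue.comp (measurable_const.prodMk measurable_id)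
      have e1 : (fun y => (B k).indicator (1 : (J → ℝ) → ENNReal) (glue t y)) =
          (glue t ⁻¹' B k).indicator 1 := rfl
      rw [e1, lintegral_indicator_one (hgt hBm)]
      obtain ⟨v, hv0, hv⟩ := (Matrix.exists_mulVec_eq_zero_iff
        (M := ((Uᵀ * entryMatrix e t)ᵀ.updateRow k 0))).2
        (Matrix.det_eq_zero_of_row_eq_zero k (by simp))
      set v' := (nrm v)⁻¹ • v with hv'
      have hvn : 0 < nrm v := lt_of_le_of_ne (nrm_nonneg _) fun h => hv0 (nrm_eq_zero.1 h.symm)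
      have hv'n : nrm v' = 1 := by
        rw [hv', nrm_smul, abs_of_pos (inv_pos.2 hvn), inv_mul_cancel₀ hvn.ne']
      have hort : ∀ j, j ≠ k → v' ⬝ᵥ (Uᵀ * entryMatrix e t) *ᵥ (Pi.single j 1) = 0 := fun j hj => by
        have h1 := congrFun hv j
        rw [mulVec, Matrix.updateRow_ne hj] at h1
        rw [hv', smul_dotProduct]
        have : v ⬝ᵥ (Uᵀ * entryMatrix e t) *ᵥ (Pi.single j 1) = 0 := by
          rw [dotProduct_comm, mulVec_single_one]
          exact h1
        rw [this, smul_zero]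
      have hinj : Function.Injective (fun i => e i k) := fun i i' h => by
        have := @he (i, k) (i', k) h; exact (Prod.ext_iff.1 this).1
      have hsub2 : glue t ⁻¹' B k ⊆ {y | |(U *ᵥ v') ⬝ᵥ (fun i => y (e i k))| ≤ r * s} := by
        rintro y ⟨w, hw, hwy⟩
        have hcol : ∀ j, j ≠ k → entryMatrix e (glue t y) *ᵥ Pi.single j 1 =
            entryMatrix e t *ᵥ Pi.single j 1 := fun j hj => by
          ext i
          simp only [mulVec_single_one, Matrix.col_apply, entryMatrix, of_apply]
          have : ¬ p (e i j) := by
            rintro ⟨i', hi'⟩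
            have := @he (i', k) (i, j) hi'
            exact hj (Prod.ext_iff.1 this).2.symm
          simp only [glue, if_neg this]
        have hcolk : entryMatrix e (glue t y) *ᵥ Pi.single k 1 = fun i => y (e i k) := by
          ext i
          simp only [mulVec_single_one, Matrix.col_apply, entryMatrix, of_apply]
          have : p (e i k) := ⟨i, rfl⟩
          simp only [glue, if_pos this]
        have hw2 : w = ∑ j, w j • Pi.single j (1 : ℝ) := by
          ext i; simp [Finset.sum_apply, Pi.single_apply]
        have h3 : v' ⬝ᵥ (Uᵀ * entryMatrix e (glue t y)) *ᵥ w = (U *ᵥ v') ⬝ᵥ (fun i => y (e i k)) := by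
          conv_lhs => rw [hw2]
          rw [mulVec_sum, dotProduct_sum, Finset.sum_eq_single k]
          · rw [hw.1, one_smul, ← mulVec_mulVec, hcolk, dot_mulVec_comm, transpose_transpose]
          · intro j _ hj
            have := hort j hj
            rw [← mulVec_mulVec] at this
            rw [mulVec_smul, dotProduct_smul, ← mulVec_mulVec, hcol j hj, this, smul_zero]
          · simp
        have h4 := abs_dotProduct_le v' ((Uᵀ * entryMatrix e (glue t y)) *ᵥ w)
        rw [h3, hv'n, one_mul] at h4
        exact h4.trans hwy
      refine (measure_mono hsub2).trans ?_
      have hUv : nrm (U *ᵥ v') = 1 := by rw [nrm_mulVec_orthonormal hU, hv'n]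
      have h5 := gaussM_abs_dotProduct_le hUv (s := r * s)
      refine le_trans (le_of_eq ?_) h5
      rw [← gaussM_map_comp hinj, Measure.map_apply (by fun_prop)]
      · rfl
      · exact measurableSet_le ((measurable_const.dotProduct measurable_id).abs) measurable_const
    · intro x y hxy
      ext j
      simp only [glue]
      split_ifs with hj
      · rfl
      · exact hxy j hj
    · intro t x y hxy
      congr 1
      ext j
      simp only [glue]
      split_ifs with hj
      · exact hxy j hj
      · rfl
  calc _ ≤ gaussM J (⋃ k, B k) := measure_mono hsub
    _ ≤ ∑ k, gaussM J (B k) := measure_iUnion_fintype_le _ _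
    _ ≤ ∑ k : Fin r, ofReal (r * s) := Finset.sum_le_sum fun k _ => hBk k
    _ = _ := by
      rw [Finset.sum_const, Finset.card_fin, nsmul_eq_mul, ← ENNReal.ofReal_natCast,
        ← ENNReal.ofReal_mul (by positivity)]
      congr 1; ring

end SmallBall

section Descent
variable {d T r L : ℕ}

/-- The orthonormal factor of a matrix with orthonormal columns is the matrix itself. -/
lemma qrQ_of_orthonormal {V : Matrix (Fin d) (Fin r) ℝ} (h : Vᵀ * V = 1) : qrQ V = V := by
  obtain ⟨hQ, hQR, hup, hdg⟩ := qrQ_spec (c := 1) one_pos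
    (fun v => by rw [one_mul, nrm_mulVec_orthonormal h])
  set Q := qrQ V
  set R := Qᵀ * V
  have hRR : Rᵀ * R = 1 + 0 := by
    have : Rᵀ * R = (Q * R)ᵀ * (Q * R) := by
      rw [transpose_mul Q R, Matrix.mul_assoc Rᵀ, ← Matrix.mul_assoc Qᵀ, hQ, Matrix.one_mul]
    rw [this, ← hQR, h, add_zero]
  have hu : IsUnit R.det := by
    refine (Matrix.isUnit_iff_isUnit_det _).1 (isUnit_det_of_lower one_pos fun v => ?_)
    rw [one_mul, nrm_mulVec_orthonormal (by simpa using hRR)]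
  have := upper_sub_one_le hu hup hdg hRR
  have h0 : fro (0 : Matrix (Fin r) (Fin r) ℝ) = 0 := by
    have := fro_smul 0 (0 : Matrix (Fin r) (Fin r) ℝ); simpa using this
  rw [h0, mul_zero] at this
  have h1 : ‖R - 1‖ = 0 := le_antisymm ((norm_le_fro _).trans this) (norm_nonneg _)
  have h2 : R = 1 := sub_eq_zero.1 (norm_eq_zero.1 h1)
  rw [h2, Matrix.mul_one] at hQR
  exact hQR.symm

lemma fro_sum_vecMulVec_le (S : Finset (Fin T)) (e : Fin T → Fin d → ℝ) (bs : Matrix (Fin r) (Fin T) ℝ)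
    (B : Matrix (Fin r) (Fin T) ℝ) {c : ℝ} (hc : 0 ≤ c) (he : ∀ t, nrm (e t) ≤ c * nrm (bs.col t)) :
    fro (∑ t ∈ S, vecMulVec (e t) (B.col t)) ≤ c * fro bs * ‖B‖ := by
  classical
  set E : Matrix (Fin d) (Fin T) ℝ := Matrix.of fun i t => if t ∈ S then e t i else 0 with hE
  have h1 : ∑ t ∈ S, vecMulVec (e t) (B.col t) = E * Bᵀ := by
    ext i k
    rw [Matrix.sum_apply, Matrix.mul_apply, ← Finset.sum_subset (Finset.subset_univ S)]
    · refine Finset.sum_congr rfl fun t ht => ?_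
      simp [hE, ht, vecMulVec_apply]
    · intro t _ ht
      simp [hE, ht]
  rw [h1]
  refine (fro_mul_le' _ _).trans ?_
  rw [norm_transpose]
  refine mul_le_mul_of_nonneg_right ?_ (norm_nonneg _)
  refine abs_le_of_sq_le_sq' ?_ (mul_nonneg hc (fro_nonneg _)) |>.2
  rw [mul_pow, fro_sq_eq_sum_col, fro_sq_eq_sum_col, Finset.mul_sum]
  refine Finset.sum_le_sum fun t _ => ?_
  rw [← mul_pow]
  refine pow_le_pow_left₀ (nrm_nonneg _) ?_ 2
  by_cases ht : t ∈ S
  · have : E.col t = e t := by ext i; simp [hE, ht]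
    rw [this]; exact he t
  · have : E.col t = 0 := by ext i; simp [hE, ht]
    rw [this, nrm_zero]; exact mul_nonneg hc (nrm_nonneg _)

lemma nrm_transpose_mulVec_le {U : Matrix (Fin d) (Fin r) ℝ} (h : Uᵀ * U = 1) (v : Fin d → ℝ) :
    nrm (Uᵀ *ᵥ v) ≤ nrm v := by
  refine (nrm_mulVec_le _ _).trans ?_
  rw [norm_transpose]
  exact mul_le_of_le_one_left (nrm_nonneg _) (norm_orthonormal_le h)

/-- The columns of `Us * bs` are the parameters of the tasks; the singular values of `bs` lie
between `σ / κ` and `σ`. -/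
structure GroundTruth (Us : Matrix (Fin d) (Fin r) ℝ) (bs : Matrix (Fin r) (Fin T) ℝ) (σ κ : ℝ) :
    Prop where
  orth : Usᵀ * Us = 1
  sigma_pos : 0 < σ
  one_le : 1 ≤ κ
  rank_pos : 1 ≤ r
  upper : ‖bs‖ ≤ σ
  lower : ∀ z, σ / κ * nrm z ≤ nrm (bsᵀ *ᵥ z)

/-- All the estimates are orthonormal, close to the column space of `Us` and to one another. -/
structure GoodState [NeZero L] (Us : Matrix (Fin d) (Fin r) ℝ) (A ψ : ℝ)
    (U : Fin L → Matrix (Fin d) (Fin r) ℝ) : Prop where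
  orth : ∀ g, (U g)ᵀ * U g = 1
  dist : ∀ g, ‖(1 - Us * Usᵀ) * U g‖ ≤ ψ
  spread : ∀ g, A * ‖U g - U 0‖ ≤ ψ

lemma GroundTruth.fro_le {Us : Matrix (Fin d) (Fin r) ℝ} {bs : Matrix (Fin r) (Fin T) ℝ} {σ κ : ℝ}
    (h : GroundTruth Us bs σ κ) : fro bs ≤ sqrt r * σ := by
  rw [← fro_transpose]
  refine (fro_le_norm _).trans ?_
  rw [norm_transpose, Fintype.card_fin]
  exact mul_le_mul_of_nonneg_left h.upper (Real.sqrt_nonneg _)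

variable [NeZero L] {Us : Matrix (Fin d) (Fin r) ℝ} {bs : Matrix (Fin r) (Fin T) ℝ} {σ κ : ℝ}

lemma GoodState.residual_le {A ψ : ℝ} {U : Fin L → Matrix (Fin d) (Fin r) ℝ}
    (hs : GoodState Us A ψ U) (hU : Usᵀ * Us = 1) (g : Fin L) (b : Fin r → ℝ) :
    nrm ((1 - U g * (U g)ᵀ) *ᵥ (Us *ᵥ b)) ≤ ψ * nrm b := by
  rw [mulVec_mulVec]
  refine (nrm_mulVec_le _ _).trans (mul_le_mul_of_nonneg_right ?_ (nrm_nonneg _))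
  exact (subspaceDist_le_comm (hs.orth g) hU).trans (hs.dist g)

lemma GoodState.coeff_error {A ψ q : ℝ} {U : Fin L → Matrix (Fin d) (Fin r) ℝ}
    (hs : GoodState Us A ψ U) (hU : Usᵀ * Us = 1) (hψ : ψ ≤ 1) (hq : 0 ≤ q) (g : Fin L) (β b : Fin r → ℝ)
    (hb : nrm (b - (U g)ᵀ *ᵥ (Us *ᵥ β)) ≤ q * nrm ((1 - U g * (U g)ᵀ) *ᵥ (Us *ᵥ β))) :
    nrm (U g *ᵥ b - Us *ᵥ β) ≤ (1 + q) * ψ * nrm β ∧ nrm b ≤ (1 + q) * nrm β := by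
  have h1 := hs.residual_le hU g β
  have h2 : nrm (b - (U g)ᵀ *ᵥ (Us *ᵥ β)) ≤ q * (ψ * nrm β) := hb.trans (by gcongr)
  constructor
  · have e : U g *ᵥ b - Us *ᵥ β =
        U g *ᵥ (b - (U g)ᵀ *ᵥ (Us *ᵥ β)) - (1 - U g * (U g)ᵀ) *ᵥ (Us *ᵥ β) := by
      rw [mulVec_sub, sub_mulVec, one_mulVec, ← mulVec_mulVec (Us *ᵥ β) (U g) (U g)ᵀ]; abel
    rw [e]
    refine (nrm_sub_le _ _).trans ?_
    rw [nrm_mulVec_orthonormal (hs.orth g)]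
    linarith
  · have e : b = (b - (U g)ᵀ *ᵥ (Us *ᵥ β)) + (U g)ᵀ *ᵥ (Us *ᵥ β) := by abel
    rw [e]
    refine (nrm_add_le _ _).trans ?_
    have h3 := nrm_transpose_mulVec_le (hs.orth g) (Us *ᵥ β)
    rw [nrm_mulVec_orthonormal hU] at h3
    have : q * (ψ * nrm β) ≤ q * nrm β :=
      mul_le_mul_of_nonneg_left (mul_le_of_le_one_left (nrm_nonneg _) hψ) hq
    linarith

/-- The coefficient matrix inherits the conditioning of the true one. -/
lemma coeff_conditioning (hG : GroundTruth Us bs σ κ) {A ψ : ℝ} {U : Fin L → Matrix (Fin d) (Fin r) ℝ}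
    (hs : GoodState Us A ψ U) (hA : 200 ≤ A) (hψ : sqrt r * ψ ≤ 1 / 100 / κ ^ 2) (hψ0 : 0 ≤ ψ)
    {node : Fin T → Fin L} {B : Matrix (Fin r) (Fin T) ℝ}
    (hB : ∀ t, nrm (B.col t - (U (node t))ᵀ *ᵥ (Us *ᵥ bs.col t)) ≤
      0.1 * nrm ((1 - U (node t) * (U (node t))ᵀ) *ᵥ (Us *ᵥ bs.col t))) :
    ‖B‖ ≤ 1.01 * σ ∧ ∀ z, 0.99 * (σ / κ) * nrm z ≤ nrm (Bᵀ *ᵥ z) := by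
  have hκ := hG.one_le
  have hσ := hG.sigma_pos
  have hr1 : 1 ≤ sqrt r := Real.one_le_sqrt.2 (by exact_mod_cast hG.rank_pos)
  have hκ2 : 1 / 100 / κ ^ 2 ≤ 1 / 100 / κ := by
    gcongr; nlinarith
  have hκ1 : 1 / 100 / κ ≤ 1 / 100 := div_le_self (by norm_num) hκ
  have hψ1 : ψ ≤ 1 / 100 := by nlinarith
  set C : Matrix (Fin r) (Fin T) ℝ := (U 0)ᵀ * (Us * bs) with hC
  set E := B - C with hE
  have hcol : ∀ t, nrm (E.col t) ≤ 0.11 * ψ * nrm (bs.col t) := fun t => by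
    have e : E.col t = (B.col t - (U (node t))ᵀ *ᵥ (Us *ᵥ bs.col t)) +
        (U (node t) - U 0)ᵀ *ᵥ (Us *ᵥ bs.col t) := by
      have : C.col t = (U 0)ᵀ *ᵥ (Us *ᵥ bs.col t) := by
        rw [hC, mulVec_mulVec, ← Matrix.mul_assoc]; ext i; simp [mul_apply, mulVec, dotProduct]
      have e2 : E.col t = B.col t - C.col t := rfl
      rw [e2, this, transpose_sub, sub_mulVec]; abel
    rw [e]
    refine (nrm_add_le _ _).trans ?_
    have h1 := hs.residual_le hG.orth (node t) (bs.col t)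
    have h2 := nrm_mulVec_le (U (node t) - U 0)ᵀ (Us *ᵥ bs.col t)
    rw [norm_transpose, nrm_mulVec_orthonormal hG.orth] at h2
    have h3 := hs.spread (node t)
    have h4 : ‖U (node t) - U 0‖ ≤ 0.01 * ψ := by
      have : 200 * ‖U (node t) - U 0‖ ≤ A * ‖U (node t) - U 0‖ := by gcongr
      linarith
    have h5 := mul_le_mul_of_nonneg_right h4 (nrm_nonneg (bs.col t))
    have := hB t
    linarith
  have hEn : ‖E‖ ≤ 0.0011 * (σ / κ) := by
    have h0 : fro E ≤ 0.11 * ψ * fro bs := by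
      refine abs_le_of_sq_le_sq' ?_ (mul_nonneg (by positivity) (fro_nonneg _)) |>.2
      rw [mul_pow, fro_sq_eq_sum_col, fro_sq_eq_sum_col, Finset.mul_sum]
      refine Finset.sum_le_sum fun t _ => ?_
      rw [← mul_pow]
      exact pow_le_pow_left₀ (nrm_nonneg _) (hcol t) 2
    have h1 := hG.fro_le
    calc ‖E‖ ≤ fro E := norm_le_fro E
      _ ≤ 0.11 * ψ * (sqrt r * σ) := h0.trans (by gcongr)
      _ = 0.11 * σ * (sqrt r * ψ) := by ring
      _ ≤ 0.11 * σ * (1 / 100 / κ) := by gcongr; exact hψ.trans hκ2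
      _ = _ := by ring
  have hBE : B = C + E := by rw [hE]; abel
  have hσκ : σ / κ ≤ σ := div_le_self hσ.le hκ
  constructor
  · have hCn : ‖C‖ ≤ σ := by
      refine (norm_mul_le' _ _).trans ?_
      rw [norm_transpose]
      refine (mul_le_of_le_one_left (norm_nonneg _) (norm_orthonormal_le (hs.orth 0))).trans ?_
      exact (norm_mul_le' _ _).trans
        ((mul_le_of_le_one_left (norm_nonneg _) (norm_orthonormal_le hG.orth)).trans hG.upper)
    rw [hBE]
    refine (norm_add_le _ _).trans ?_
    linarith
  · intro z
    have h1 : 0.999 * nrm z ≤ nrm (Usᵀ *ᵥ (U 0 *ᵥ z)) := by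
      have h2 := nrm_proj_compl_sq hG.orth (U 0 *ᵥ z)
      rw [nrm_mulVec_orthonormal (hs.orth 0)] at h2
      have h3 := nrm_mulVec_le ((1 - Us * Usᵀ) * U 0) z
      rw [← mulVec_mulVec] at h3
      have h4 : nrm ((1 - Us * Usᵀ) *ᵥ (U 0 *ᵥ z)) ≤ 1 / 100 * nrm z :=
        h3.trans (mul_le_mul_of_nonneg_right ((hs.dist 0).trans hψ1) (nrm_nonneg _))
      refine abs_le_of_sq_le_sq' ?_ (nrm_nonneg _) |>.2
      have h5 := pow_le_pow_left₀ (nrm_nonneg _) h4 2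
      nlinarith [sq_nonneg (nrm z)]
    have h2 := hG.lower (Usᵀ *ᵥ (U 0 *ᵥ z))
    have e : Bᵀ *ᵥ z = bsᵀ *ᵥ (Usᵀ *ᵥ (U 0 *ᵥ z)) + Eᵀ *ᵥ z := by
      conv_lhs => rw [hBE, transpose_add, add_mulVec, hC]
      simp [transpose_mul, mulVec_mulVec, Matrix.mul_assoc]
    have h3 := nrm_mulVec_le Eᵀ z
    rw [norm_transpose] at h3
    have h4 := mul_le_mul_of_nonneg_right hEn (nrm_nonneg z)
    have h5 := le_nrm_add (bsᵀ *ᵥ (Usᵀ *ᵥ (U 0 *ᵥ z))) (Eᵀ *ᵥ z)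
    rw [e]
    have h6 : σ / κ * (0.999 * nrm z) ≤ σ / κ * nrm (Usᵀ *ᵥ (U 0 *ᵥ z)) :=
      mul_le_mul_of_nonneg_left h1 (by positivity)
    have h7 : 0 ≤ σ / κ * nrm z := mul_nonneg (by positivity) (nrm_nonneg _)
    linarith

/-- Gradient descent contraction in the coefficient space. -/
lemma norm_one_sub_gram_le {B : Matrix (Fin r) (Fin T) ℝ} (hσ : 0 < σ) (hκ : 1 ≤ κ)
    (h1 : ‖B‖ ≤ 1.01 * σ) (h2 : ∀ z, 0.99 * (σ / κ) * nrm z ≤ nrm (Bᵀ *ᵥ z)) :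
    ‖(1 : Matrix (Fin r) (Fin r) ℝ) - (0.4 / σ ^ 2) • (B * Bᵀ)‖ ≤ 1 - 0.31 / κ ^ 2 := by
  have hκ2 : 1 / κ ^ 2 ≤ 1 := by
    rw [div_le_one (by positivity)]; nlinarith
  have hp : 0 < 1 / κ ^ 2 := by positivity
  have e1 : 0.31 / κ ^ 2 = 0.31 * (1 / κ ^ 2) := by ring
  refine opNorm_le (by rw [e1]; linarith) fun v => ?_
  refine abs_le_of_sq_le_sq' ?_ (mul_nonneg (by rw [e1]; linarith) (nrm_nonneg _)) |>.2
  set s := 0.4 / σ ^ 2 with hs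
  have hs0 : 0 < s := by positivity
  have hsσ : s * σ ^ 2 = 0.4 := by rw [hs]; field_simp
  set x := nrm (Bᵀ *ᵥ v) with hx
  have ex : v ⬝ᵥ (B * Bᵀ) *ᵥ v = x ^ 2 := by
    rw [hx, nrm_mulVec_sq, transpose_transpose]
  have ex2 : nrm ((B * Bᵀ) *ᵥ v) ≤ 1.01 * σ * x := by
    rw [← mulVec_mulVec]
    exact (nrm_mulVec_le _ _).trans (mul_le_mul_of_nonneg_right h1 (nrm_nonneg _))
  have e : nrm ((1 - s • (B * Bᵀ)) *ᵥ v) ^ 2 =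
      nrm v ^ 2 - 2 * s * x ^ 2 + s ^ 2 * nrm ((B * Bᵀ) *ᵥ v) ^ 2 := by
    rw [sub_mulVec, one_mulVec, smul_mulVec, ← ex, nrm_sq (v - _), nrm_sq v, nrm_sq (_ *ᵥ v)]
    simp only [sub_dotProduct, dotProduct_sub, smul_dotProduct, dotProduct_smul, smul_eq_mul]
    rw [dotProduct_comm ((B * Bᵀ) *ᵥ v) v]; ring
  have h3 := pow_le_pow_left₀ (nrm_nonneg _) ex2 2
  have h4 : (0.99 * (σ / κ) * nrm v) ^ 2 ≤ x ^ 2 :=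
    pow_le_pow_left₀ (mul_nonneg (by positivity) (nrm_nonneg _)) (h2 v) 2
  have h5 : s * (0.99 * (σ / κ) * nrm v) ^ 2 = 0.4 * 0.99 ^ 2 * (1 / κ ^ 2) * nrm v ^ 2 := by
    rw [← hsσ]; field_simp
  have h6 : s ^ 2 * nrm ((B * Bᵀ) *ᵥ v) ^ 2 ≤ 0.41 * s * x ^ 2 := by
    calc s ^ 2 * nrm ((B * Bᵀ) *ᵥ v) ^ 2 ≤ s ^ 2 * (1.01 * σ * x) ^ 2 := by gcongr
      _ = (s * σ ^ 2) * 1.01 ^ 2 * s * x ^ 2 := by ring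
      _ ≤ _ := by rw [hsσ]; nlinarith [mul_nonneg hs0.le (sq_nonneg x)]
  have h7 := mul_le_mul_of_nonneg_left h4 hs0.le
  rw [h5] at h7
  rw [e, e1, mul_pow]
  set y := 1 / κ ^ 2
  nlinarith [sq_nonneg (nrm v), mul_nonneg hp.le (sq_nonneg (nrm v)), mul_nonneg (mul_nonneg hp.le hp.le) (sq_nonneg (nrm v))]

end Descent

section Mixing
variable {L : ℕ} [NeZero L] {M : Type*} [AddCommGroup M] [Module ℝ M] (p : Seminorm ℝ M)

lemma seminorm_sum_le (S : Finset (Fin L)) (c : Fin L → ℝ) (x : Fin L → M) {a : ℝ}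
    (h : ∀ j, |c j| ≤ a) : p (∑ j ∈ S, c j • x j) ≤ a * ∑ j ∈ S, p (x j) := by
  refine (map_sum_le_sum (p := p) S _).trans ?_
  rw [Finset.mul_sum]
  refine Finset.sum_le_sum fun j _ => ?_
  rw [map_smul_eq_mul, Real.norm_eq_abs]
  exact mul_le_mul_of_nonneg_right (h j) (apply_nonneg _ _)
where
  map_sum_le_sum {p : Seminorm ℝ M} (S : Finset (Fin L)) (f : Fin L → M) :
      p (∑ j ∈ S, f j) ≤ ∑ j ∈ S, p (f j) := by
    classical
    induction S using Finset.induction_on with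
    | empty => simp
    | insert a s ha ih =>
      rw [Finset.sum_insert ha, Finset.sum_insert ha]
      exact (map_add_le_add p _ _).trans (by gcongr)

variable {w w' : Fin L → ℝ} {ω sp : ℝ} {U P : Fin L → M}

/-- A nearly uniform average of local updates is close to the centralized update. -/
lemma mix_sub_le (hw1 : ∑ j, w j = 1) (hw : ∀ j, |w j - 1 / L| ≤ ω / L ^ 2)
    (hω : 0 ≤ ω) (hsp : ∀ j, p (U j - U 0) ≤ sp) :
    p (∑ j, w j • (U j - (L : ℝ) • P j) - U 0 + ∑ j, P j) ≤
      (1 + ω) * sp + ω * (1 / L * ∑ j, p (P j)) := by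
  have hL : (1 : ℝ) ≤ L := by exact_mod_cast NeZero.one_le
  have e : ∑ j, w j • (U j - (L : ℝ) • P j) - U 0 + ∑ j, P j =
      ∑ j, w j • (U j - U 0) - ∑ j, (L * (w j - 1 / L)) • P j := by
    have e1 : U 0 = ∑ j, w j • U 0 := by rw [← Finset.sum_smul, hw1, one_smul]
    conv_lhs => rw [e1]
    rw [← Finset.sum_sub_distrib, ← Finset.sum_add_distrib, ← Finset.sum_sub_distrib]
    refine Finset.sum_congr rfl fun j _ => ?_
    have e2 : (L : ℝ) * (w j - 1 / L) = L * w j - 1 := by field_simp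
    rw [e2, smul_sub, smul_sub, smul_smul, sub_smul, one_smul, mul_comm (w j)]
    abel
  have hsp0 : 0 ≤ sp := (apply_nonneg _ _).trans (hsp 0)
  rw [e]
  refine (map_sub_le_add p _ _).trans (add_le_add ?_ ?_)
  · have hb : ∀ j, |w j| ≤ (1 + ω) / L := fun j => by
      have h1 := abs_add_le (w j - 1 / L) (1 / L)
      rw [sub_add_cancel, abs_of_nonneg (show (0 : ℝ) ≤ 1 / L by positivity)] at h1
      have h2 := hw j
      have h3 : ω / L ^ 2 ≤ ω / L := by
        gcongr; nlinarith
      rw [add_div]; linarith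
    refine (seminorm_sum_le p _ _ _ hb).trans ?_
    have : ∑ j, p (U j - U 0) ≤ L * sp := by
      refine (Finset.sum_le_sum fun j _ => hsp j).trans ?_
      simp
    calc (1 + ω) / L * ∑ j, p (U j - U 0) ≤ (1 + ω) / L * (L * sp) := by gcongr
      _ = _ := by field_simp
  · have hb : ∀ j, |(L : ℝ) * (w j - 1 / L)| ≤ ω * (1 / L) := fun j => by
      rw [abs_mul, abs_of_pos (by linarith)]
      calc (L : ℝ) * |w j - 1 / L| ≤ L * (ω / L ^ 2) := by gcongr; exact hw j
        _ = _ := by field_simp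
    refine (seminorm_sum_le p _ _ _ hb).trans (le_of_eq (by ring))

/-- Two nearly uniform averages of local updates are close to each other. -/
lemma mix_diff_le (hw1 : ∑ j, w j = 1) (hw1' : ∑ j, w' j = 1) (hw : ∀ j, |w j - 1 / L| ≤ ω / L ^ 2)
    (hw' : ∀ j, |w' j - 1 / L| ≤ ω / L ^ 2) (hω : 0 ≤ ω) (hsp : ∀ j, p (U j - U 0) ≤ sp) :
    p (∑ j, w j • (U j - (L : ℝ) • P j) - ∑ j, w' j • (U j - (L : ℝ) • P j)) ≤
      2 * ω * (sp + 1 / L * ∑ j, p (P j)) := by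
  have hL : (1 : ℝ) ≤ L := by exact_mod_cast NeZero.one_le
  have e : ∑ j, w j • (U j - (L : ℝ) • P j) - ∑ j, w' j • (U j - (L : ℝ) • P j) =
      ∑ j, (w j - w' j) • (U j - U 0) - ∑ j, (L * (w j - w' j)) • P j := by
    have e1 : ∑ j, (w j - w' j) • U 0 = 0 := by
      rw [← Finset.sum_smul, Finset.sum_sub_distrib, hw1, hw1', sub_self, zero_smul]
    have e2 : ∑ j, (w j - w' j) • (U j - U 0) = ∑ j, (w j - w' j) • U j := by
      simp only [smul_sub, Finset.sum_sub_distrib]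
      rw [e1, sub_zero]
    rw [e2, ← Finset.sum_sub_distrib, ← Finset.sum_sub_distrib]
    refine Finset.sum_congr rfl fun j _ => ?_
    rw [← sub_smul, smul_sub, smul_smul, mul_comm (L : ℝ)]
  have hd : ∀ j, |w j - w' j| ≤ 2 * ω / L ^ 2 := fun j => by
    have h1 := abs_sub_le (w j) (1 / L) (w' j)
    rw [abs_sub_comm (1 / (L : ℝ))] at h1
    have h2 := hw j
    have h3 := hw' j
    have : 2 * ω / (L : ℝ) ^ 2 = ω / L ^ 2 + ω / L ^ 2 := by ring
    linarith
  have hsp0 : 0 ≤ sp := (apply_nonneg _ _).trans (hsp 0)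
  rw [e, mul_add]
  refine (map_sub_le_add p _ _).trans (add_le_add ?_ ?_)
  · refine (seminorm_sum_le p _ _ _ hd).trans ?_
    have : ∑ j, p (U j - U 0) ≤ L * sp := by
      refine (Finset.sum_le_sum fun j _ => hsp j).trans ?_
      simp
    calc 2 * ω / L ^ 2 * ∑ j, p (U j - U 0) ≤ 2 * ω / L ^ 2 * (L * sp) := by gcongr
      _ = 2 * ω * sp / L := by field_simp
      _ ≤ _ := div_le_self (by positivity) hL
  · have hb : ∀ j, |(L : ℝ) * (w j - w' j)| ≤ 2 * ω * (1 / L) := fun j => by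
      rw [abs_mul, abs_of_pos (by linarith)]
      calc (L : ℝ) * |w j - w' j| ≤ L * (2 * ω / L ^ 2) := by gcongr; exact hd j
        _ = _ := by field_simp
    refine (seminorm_sum_le p _ _ _ hb).trans (le_of_eq (by ring))

end Mixing

section Descent
variable {d T r L : ℕ} [NeZero L]

/-- The Frobenius norm as a seminorm. -/
noncomputable def froSeminorm (d r : ℕ) : Seminorm ℝ (Matrix (Fin d) (Fin r) ℝ) :=
  Seminorm.of fro fro_add_le fun c A => by rw [fro_smul, Real.norm_eq_abs]

lemma froSeminorm_apply (A : Matrix (Fin d) (Fin r) ℝ) : froSeminorm d r A = fro A := rfl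

/-- Orthonormalization of a matrix close to one with orthonormal columns. -/
lemma qrQ_near {U₀ Y : Matrix (Fin d) (Fin r) ℝ} (h : U₀ᵀ * U₀ = 1) {β : ℝ} (hβ : β ≤ 1 / 2)
    (hY : ‖Y - U₀‖ ≤ β) : (qrQ Y)ᵀ * qrQ Y = 1 ∧
      (∀ R : Matrix (Fin d) (Fin d) ℝ, ‖R * qrQ Y‖ ≤ ‖R * Y‖ / (1 - β)) ∧
      (∀ v, 1 / 2 * nrm v ≤ nrm (Y *ᵥ v)) ∧ ‖Y‖ ≤ 2 := by
  have h1 : ∀ v, (1 - β) * nrm v ≤ nrm (Y *ᵥ v) := fun v => by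
    have e : Y *ᵥ v = U₀ *ᵥ v + (Y - U₀) *ᵥ v := by rw [sub_mulVec]; abel
    have h2 := le_nrm_add (U₀ *ᵥ v) ((Y - U₀) *ᵥ v)
    have h3 := (nrm_mulVec_le (Y - U₀) v).trans (mul_le_mul_of_nonneg_right hY (nrm_nonneg _))
    rw [nrm_mulVec_orthonormal h] at h2
    rw [e]; linarith
  have hβ' : 0 < 1 - β := by linarith
  obtain ⟨hQ, hQR, -, -⟩ := qrQ_spec hβ' h1
  refine ⟨hQ, fun R => ?_, fun v => ?_, ?_⟩
  · set S := (qrQ Y)ᵀ * Y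
    have hS : ∀ v, (1 - β) * nrm v ≤ nrm (S *ᵥ v) := fun v => by
      have := h1 v
      rwa [hQR, ← mulVec_mulVec, nrm_mulVec_orthonormal hQ] at this
    have hu := (Matrix.isUnit_iff_isUnit_det _).1 (isUnit_det_of_lower hβ' hS)
    have e : R * qrQ Y = R * Y * S⁻¹ := by
      conv_rhs => rw [hQR]
      rw [Matrix.mul_assoc, Matrix.mul_assoc, Matrix.mul_nonsing_inv _ hu, Matrix.mul_one]
    rw [e, div_eq_mul_one_div]
    exact (norm_mul_le' _ _).trans
      (mul_le_mul_of_nonneg_left (norm_inv_le hβ' hS) (norm_nonneg _))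
  · refine le_trans ?_ (h1 v)
    have := nrm_nonneg v
    nlinarith
  · have e : Y = U₀ + (Y - U₀) := by abel
    rw [e]
    refine (norm_add_le _ _).trans ?_
    have := norm_orthonormal_le h
    linarith

variable {Us : Matrix (Fin d) (Fin r) ℝ} {bs : Matrix (Fin r) (Fin T) ℝ} {σ κ : ℝ}

/-- The state after orthonormalization. -/
lemma goodState_qrQ {U₀ : Matrix (Fin d) (Fin r) ℝ} {Y : Fin L → Matrix (Fin d) (Fin r) ℝ}
    (h : U₀ᵀ * U₀ = 1) {β α ς A ψ : ℝ} (hβ : β ≤ 1 / 2) (hY : ∀ g, ‖Y g - U₀‖ ≤ β)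
    (hα : ∀ g, ‖(1 - Us * Usᵀ) * Y g‖ ≤ α) (hς : ∀ g, fro (Y g - Y 0) ≤ ς) (hA : 0 ≤ A)
    (h1 : α / (1 - β) ≤ ψ) (h2 : A * (330 * ς) ≤ ψ) : GoodState Us A ψ fun g => qrQ (Y g) where
  orth g := (qrQ_near h hβ (hY g)).1
  dist g := ((qrQ_near h hβ (hY g)).2.1 _).trans
    ((div_le_div_of_nonneg_right (hα g) (by linarith)).trans h1)
  spread g := by
    refine le_trans (mul_le_mul_of_nonneg_left ?_ hA) h2
    have h3 := qrQ_near h hβ (hY g)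
    have h4 := qrQ_near h hβ (hY 0)
    refine (norm_le_fro _).trans ((qrQ_perturb h4.2.2.1 h3.2.2.1 h4.2.2.2 h3.2.2.2).trans ?_)
    rw [fro_sub_comm]
    gcongr; exact hς g

lemma proj_compl_mul_sum (hU : Usᵀ * Us = 1) (V : Matrix (Fin d) (Fin r) ℝ)
    (U : Fin T → Matrix (Fin d) (Fin r) ℝ) (bs B : Matrix (Fin r) (Fin T) ℝ) :
    (1 - Us * Usᵀ) * ∑ t, vecMulVec (U t *ᵥ B.col t - Us *ᵥ bs.col t) (B.col t) =
      (1 - Us * Usᵀ) * V * (B * Bᵀ) +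
      (1 - Us * Usᵀ) * ∑ t, vecMulVec ((U t - V) *ᵥ B.col t) (B.col t) := by
  have hBsum : B * Bᵀ = ∑ t, vecMulVec (B.col t) (B.col t) := by
    ext i k; simp [Matrix.sum_apply, Matrix.mul_apply, vecMulVec_apply]
  rw [hBsum, Matrix.mul_sum, Matrix.mul_sum, Matrix.mul_sum, ← Finset.sum_add_distrib]
  refine Finset.sum_congr rfl fun t _ => ?_
  rw [mul_vecMulVec, mul_vecMulVec, mul_vecMulVec, ← add_vecMulVec]
  congr 1
  rw [mulVec_sub, mulVec_mulVec (bs.col t), proj_compl_mul hU, zero_mulVec, sub_zero,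
    sub_mulVec (U t), mulVec_sub, mulVec_mulVec (B.col t) (1 - Us * Usᵀ) V]
  abel

set_option maxHeartbeats 800000 in
/-- The matrices before orthonormalization in one step of the descent. -/
lemma GoodState.descent_bounds (hG : GroundTruth Us bs σ κ) {ψ : ℝ} {U : Fin L → Matrix (Fin d) (Fin r) ℝ}
    (hs : GoodState Us (200 * r * κ ^ 2) ψ U) (hψ : sqrt r * ψ ≤ 1 / 10000 / κ ^ 2) (hψ0 : 0 < ψ)
    {node : Fin T → Fin L} {B : Matrix (Fin r) (Fin T) ℝ}
    (hB : ∀ t, nrm (B.col t - (U (node t))ᵀ *ᵥ (Us *ᵥ bs.col t)) ≤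
      0.1 * nrm ((1 - U (node t) * (U (node t))ᵀ) *ᵥ (Us *ᵥ bs.col t)))
    {w : Fin L → Fin L → ℝ} {ω η dev : ℝ} (hw1 : ∀ g, ∑ j, w g j = 1)
    (hw : ∀ g j, |w g j - 1 / L| ≤ ω / L ^ 2) (hω0 : 0 ≤ ω) (hω : ω * (r ^ 2 * κ ^ 2) ≤ 1e-6)
    (hη : 0 ≤ η) (Dv : Fin L → Matrix (Fin d) (Fin r) ℝ)
    (hdev : η * ‖∑ j, Dv j‖ + 1 / L * ∑ j, η * ‖Dv j‖ ≤ dev)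
    {Y : Fin L → Matrix (Fin d) (Fin r) ℝ}
    (hY : ∀ g, Y g = ∑ j, w g j • (U j - (L : ℝ) • ((0.4 / σ ^ 2) •
      (∑ t ∈ Finset.univ.filter (fun t => node t = j),
        vecMulVec (U (node t) *ᵥ B.col t - Us *ᵥ bs.col t) (B.col t)) + η • Dv j))) :
    (∀ g, ‖(1 - Us * Usᵀ) * Y g‖ ≤ ψ * (1 - 0.3 / κ ^ 2) + dev) ∧
      (∀ g, fro (Y g - U 0) ≤ sqrt r * (0.5 * ψ + dev)) ∧
      ∀ g, fro (Y g - Y 0) ≤ 2 * ω * (sqrt r * (0.5 * ψ + dev)) := by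
  have hκ := hG.one_le
  have hσ := hG.sigma_pos
  have hrN : (1 : ℝ) ≤ r := by exact_mod_cast hG.rank_pos
  have hr1 : 1 ≤ sqrt r := Real.one_le_sqrt.2 hrN
  have hrr : sqrt r * sqrt r = r := Real.mul_self_sqrt (by positivity)
  have hκκ : 1 ≤ κ ^ 2 := one_le_pow₀ hκ
  set sr := sqrt r with hsr
  have hk1 : 1 / κ ^ 2 ≤ 1 := by rw [div_le_one (by positivity)]; exact hκκ
  have hk0 : 0 < 1 / κ ^ 2 := by positivity
  have hψk : sr * ψ ≤ 1e-4 * (1 / κ ^ 2) := hψ.trans (le_of_eq (by ring))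
  have hψ1 : ψ ≤ 1e-4 := by nlinarith
  set A : ℝ := 200 * r * κ ^ 2 with hA
  have hA200 : 200 ≤ A := by rw [hA]; nlinarith
  have hA0 : 0 < A := by linarith
  obtain ⟨hBn, hBl⟩ := coeff_conditioning hG hs hA200 (hψ.trans (by gcongr; norm_num)) hψ0.le hB
  set E : Fin T → Fin d → ℝ := fun t => U (node t) *ᵥ B.col t - Us *ᵥ bs.col t with hE
  have hce : ∀ t, nrm (E t) ≤ (1 + 0.1) * ψ * nrm (bs.col t) ∧ nrm (B.col t) ≤ (1 + 0.1) * nrm (bs.col t) :=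
    fun t => hs.coeff_error hG.orth (by linarith) (by norm_num) (node t) _ _ (hB t)
  set Mj : Fin L → Matrix (Fin d) (Fin r) ℝ := fun j =>
    ∑ t ∈ Finset.univ.filter (fun t => node t = j), vecMulVec (E t) (B.col t) with hMj
  set P : Fin L → Matrix (Fin d) (Fin r) ℝ := fun j => (0.4 / σ ^ 2) • Mj j + η • Dv j with hP
  have hYP : ∀ g, Y g = ∑ j, w g j • (U j - (L : ℝ) • P j) := hY
  have hfbs := hG.fro_le
  have hσ4 : 0.4 / σ ^ 2 * σ ^ 2 = 0.4 := by field_simp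
  have hMfro : ∀ S : Finset (Fin T), (0.4 / σ ^ 2) * fro (∑ t ∈ S, vecMulVec (E t) (B.col t)) ≤
      0.45 * (sr * ψ) := fun S => by
    have h1 := fro_sum_vecMulVec_le S E bs B (by positivity) fun t => (hce t).1
    calc 0.4 / σ ^ 2 * fro (∑ t ∈ S, vecMulVec (E t) (B.col t))
        ≤ 0.4 / σ ^ 2 * ((1 + 0.1) * ψ * (sr * σ) * (1.01 * σ)) := by
          gcongr
          refine h1.trans ?_
          gcongr
      _ = (0.4 / σ ^ 2 * σ ^ 2) * (1.1 * 1.01 * (sr * ψ)) := by ring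
      _ ≤ _ := by rw [hσ4]; nlinarith
  have hfd : ∀ X : Matrix (Fin d) (Fin r) ℝ, fro (η • X) ≤ sr * (η * ‖X‖) := fun X => by
    rw [fro_smul, abs_of_nonneg hη]
    have := fro_le_norm X
    rw [Fintype.card_fin] at this
    nlinarith
  have hPj : ∀ j, fro (P j) ≤ 0.45 * (sr * ψ) + sr * (η * ‖Dv j‖) := fun j => by
    refine (fro_add_le _ _).trans (add_le_add ?_ (hfd _))
    rw [fro_smul, abs_of_nonneg (by positivity)]
    exact hMfro _
  have hL : (1 : ℝ) ≤ L := by exact_mod_cast NeZero.one_le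
  set davg := 1 / (L : ℝ) * ∑ j, η * ‖Dv j‖ with hdavg
  have hdavg0 : 0 ≤ davg := by positivity
  have hdtot0 : 0 ≤ η * ‖∑ j, Dv j‖ := by positivity
  have hdev0 : 0 ≤ dev := by linarith
  have hPavg : 1 / (L : ℝ) * ∑ j, fro (P j) ≤ 0.45 * (sr * ψ) + sr * davg := by
    calc 1 / (L : ℝ) * ∑ j, fro (P j) ≤ 1 / L * ∑ j, (0.45 * (sr * ψ) + sr * (η * ‖Dv j‖)) := by
          gcongr; exact hPj _
      _ = _ := by
        rw [Finset.sum_add_distrib, ← Finset.mul_sum, hdavg]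
        simp only [Finset.sum_const, Finset.card_univ, Fintype.card_fin, nsmul_eq_mul, mul_add]
        rw [← Finset.mul_sum]
        field_simp
  have hsumM : ∑ j, Mj j = ∑ t, vecMulVec (E t) (B.col t) := by
    rw [hMj]
    exact Finset.sum_fiberwise _ _ _
  have hsumP : ∑ j, P j = (0.4 / σ ^ 2) • (∑ t, vecMulVec (E t) (B.col t)) + η • ∑ j, Dv j := by
    rw [← hsumM, Finset.smul_sum, Finset.smul_sum, ← Finset.sum_add_distrib]
  clear_value davg
  have hPtot : fro (∑ j, P j) ≤ 0.45 * (sr * ψ) + sr * (η * ‖∑ j, Dv j‖) := by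
    rw [hsumP]
    refine (fro_add_le _ _).trans (add_le_add ?_ (hfd _))
    rw [fro_smul, abs_of_nonneg (by positivity)]
    exact hMfro _
  have hAk : A * (1 / κ ^ 2) = 200 * r := by rw [hA]; field_simp
  have hspA : ∀ j, ‖U j - U 0‖ ≤ ψ / A := fun j => by
    rw [le_div_iff₀ hA0, mul_comm]; exact hs.spread j
  have hψA : sr * (ψ / A) ≤ 0.005 * ψ * (1 / κ ^ 2) := by
    have : sr * (ψ / A) * A = sr * ψ := by field_simp
    refine le_of_mul_le_mul_right ?_ hA0
    rw [this, mul_assoc (0.005 * ψ), mul_comm (1 / κ ^ 2) A, hAk]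
    nlinarith [mul_nonneg hψ0.le (mul_nonneg (by linarith : (0 : ℝ) ≤ sr) (sub_nonneg.2 hr1))]
  have hspF : ∀ j, froSeminorm d r (U j - U 0) ≤ sr * (ψ / A) := fun j => by
    rw [froSeminorm_apply]
    have := fro_le_norm (U j - U 0)
    rw [Fintype.card_fin] at this
    exact this.trans (mul_le_mul_of_nonneg_left (hspA j) (by positivity))
  have hω1 : ω ≤ 1e-6 := by
    have : 1 ≤ (r : ℝ) ^ 2 * κ ^ 2 := one_le_mul_of_one_le_of_one_le (one_le_pow₀ hrN) hκκ
    nlinarith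
  have hωk : ω * sr ≤ 1e-6 * (1 / κ ^ 2) := by
    have h1 : ω * (r ^ 2 * κ ^ 2) * (1 / κ ^ 2) = ω * r ^ 2 := by field_simp
    have h2 := mul_le_mul_of_nonneg_right hω hk0.le
    rw [h1] at h2
    refine le_trans ?_ h2
    gcongr; nlinarith
  have hmix := fun g => mix_sub_le (froSeminorm d r) (U := U) (P := P) (hw1 g) (hw g) hω0 hspF
  simp only [froSeminorm_apply] at hmix
  have hωs : ω * sr ≤ 1e-6 := hωk.trans (by linarith)
  have hmix' : ∀ g, fro (Y g - U 0 + ∑ j, P j) ≤ 0.0051 * (ψ * (1 / κ ^ 2)) + 1e-6 * davg := fun g => by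
    have h1 := hmix g
    rw [← hYP g] at h1
    refine h1.trans ?_
    have h2 : (1 + ω) * (sr * (ψ / A)) ≤ 1.000001 * (0.005 * ψ * (1 / κ ^ 2)) := by
      gcongr; linarith
    have h3 : ω * (1 / L * ∑ j, fro (P j)) ≤ 0.45 * (ω * sr * ψ) + ω * sr * davg :=
      (mul_le_mul_of_nonneg_left hPavg hω0).trans (le_of_eq (by ring))
    have h4 : ω * sr * davg ≤ 1e-6 * davg := mul_le_mul_of_nonneg_right hωs hdavg0
    have h5 : ω * sr * ψ ≤ 1e-6 * (ψ * (1 / κ ^ 2)) :=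
      (mul_le_mul_of_nonneg_right hωk hψ0.le).trans (le_of_eq (by ring))
    have : 0 < ψ * (1 / κ ^ 2) := by positivity
    have h6 : 1.000001 * (0.005 * ψ * (1 / κ ^ 2)) = 1.000001 * 0.005 * (ψ * (1 / κ ^ 2)) := by ring
    linarith
  have hψk1 : ψ * (1 / κ ^ 2) ≤ sr * ψ := by
    rw [mul_comm sr]; exact mul_le_mul_of_nonneg_left (hk1.trans hr1) hψ0.le
  have hb : ∀ g, fro (Y g - U 0) ≤ sr * (0.5 * ψ + dev) := fun g => by
    have e : Y g - U 0 = (Y g - U 0 + ∑ j, P j) - ∑ j, P j := by abel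
    rw [e]
    refine (fro_sub_le _ _).trans ((add_le_add (hmix' g) hPtot).trans ?_)
    have h2 : davg ≤ sr * davg := le_mul_of_one_le_left hdavg0 hr1
    have h3 : sr * (η * ‖∑ j, Dv j‖) + sr * davg ≤ sr * dev := by
      rw [← mul_add]; gcongr
    have h4 : 0 ≤ sr * ψ := by positivity
    linarith
  have hc : ∀ g, fro (Y g - Y 0) ≤ 2 * ω * (sr * (0.5 * ψ + dev)) := fun g => by
    have h1 := mix_diff_le (froSeminorm d r) (U := U) (P := P) (hw1 g) (hw1 0) (hw g) (hw 0) hω0 hspF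
    simp only [froSeminorm_apply] at h1
    rw [← hYP g, ← hYP 0] at h1
    refine h1.trans ?_
    have h3 : sr * davg ≤ sr * dev := by gcongr; linarith
    have h4 : 0 ≤ sr * ψ := by positivity
    gcongr
    linarith
  have hPcE := proj_compl_mul_sum hG.orth (U 0) (fun t => U (node t)) bs B
  have hPc1 : ‖1 - Us * Usᵀ‖ ≤ 1 := norm_proj_compl_le hG.orth
  have ha : ∀ g, ‖(1 - Us * Usᵀ) * Y g‖ ≤ ψ * (1 - 0.3 / κ ^ 2) + dev := fun g => by
    have e : (1 - Us * Usᵀ) * Y g = (1 - Us * Usᵀ) * (Y g - U 0 + ∑ j, P j) +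
        (1 - Us * Usᵀ) * U 0 * (1 - (0.4 / σ ^ 2) • (B * Bᵀ)) -
        (0.4 / σ ^ 2) • ((1 - Us * Usᵀ) * ∑ t, vecMulVec ((U (node t) - U 0) *ᵥ B.col t) (B.col t)) -
        η • ((1 - Us * Usᵀ) * ∑ j, Dv j) := by
      have e1 : (1 - Us * Usᵀ) * ∑ j, P j = (0.4 / σ ^ 2) • ((1 - Us * Usᵀ) * U 0 * (B * Bᵀ) +
          (1 - Us * Usᵀ) * ∑ t, vecMulVec ((U (node t) - U 0) *ᵥ B.col t) (B.col t)) +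
          η • ((1 - Us * Usᵀ) * ∑ j, Dv j) := by
        rw [hsumP, Matrix.mul_add, Matrix.mul_smul, Matrix.mul_smul, hPcE]
      rw [Matrix.mul_add _ (Y g - U 0), e1, Matrix.mul_sub _ (Y g), Matrix.mul_sub _ 1, Matrix.mul_one,
        Matrix.mul_smul, smul_add]
      abel
    have t1 : ‖(1 - Us * Usᵀ) * (Y g - U 0 + ∑ j, P j)‖ ≤ 0.0051 * (ψ * (1 / κ ^ 2)) + 1e-6 * davg := by
      refine (norm_mul_le' _ _).trans ((mul_le_of_le_one_left (norm_nonneg _) hPc1).trans ?_)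
      exact (norm_le_fro _).trans (hmix' g)
    have t2 : ‖(1 - Us * Usᵀ) * U 0 * (1 - (0.4 / σ ^ 2) • (B * Bᵀ))‖ ≤ ψ * (1 - 0.31 / κ ^ 2) := by
      refine (norm_mul_le' _ _).trans ?_
      exact mul_le_mul (hs.dist 0) (norm_one_sub_gram_le hσ hκ hBn hBl) (norm_nonneg _) hψ0.le
    have t3 : ‖(0.4 / σ ^ 2) • ((1 - Us * Usᵀ) *
        ∑ t, vecMulVec ((U (node t) - U 0) *ᵥ B.col t) (B.col t))‖ ≤ 0.0025 * (ψ * (1 / κ ^ 2)) := by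
      rw [norm_smul, Real.norm_eq_abs, abs_of_nonneg (by positivity)]
      have h1 := fro_sum_vecMulVec_le Finset.univ (fun t => (U (node t) - U 0) *ᵥ B.col t) bs B
        (c := 1.1 * (ψ / A)) (by positivity) fun t => by
          refine (nrm_mulVec_le _ _).trans ?_
          refine (mul_le_mul (hspA _) (hce t).2 (nrm_nonneg _) (by positivity)).trans (le_of_eq ?_)
          ring
      have h2 : ‖(1 - Us * Usᵀ) * ∑ t, vecMulVec ((U (node t) - U 0) *ᵥ B.col t) (B.col t)‖ ≤
          1.1 * (ψ / A) * (sr * σ) * (1.01 * σ) := by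
        refine (norm_mul_le' _ _).trans ((mul_le_of_le_one_left (norm_nonneg _) hPc1).trans ?_)
        refine (norm_le_fro _).trans (h1.trans ?_)
        gcongr
      calc _ ≤ 0.4 / σ ^ 2 * (1.1 * (ψ / A) * (sr * σ) * (1.01 * σ)) := by gcongr
        _ = (0.4 / σ ^ 2 * σ ^ 2) * (1.1 * 1.01 * (sr * (ψ / A))) := by ring
        _ ≤ 0.4 * (1.1 * 1.01 * (0.005 * ψ * (1 / κ ^ 2))) := by rw [hσ4]; gcongr
        _ = 0.002222 * (ψ * (1 / κ ^ 2)) := by ring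
        _ ≤ _ := mul_le_mul_of_nonneg_right (by norm_num) (by positivity)
    have t4 : ‖η • ((1 - Us * Usᵀ) * ∑ j, Dv j)‖ ≤ η * ‖∑ j, Dv j‖ := by
      rw [norm_smul, Real.norm_eq_abs, abs_of_nonneg hη]
      gcongr
      exact (norm_mul_le' _ _).trans (mul_le_of_le_one_left (norm_nonneg _) hPc1)
    rw [e]
    refine (norm_sub_le _ _).trans ?_
    refine (add_le_add ((norm_sub_le _ _).trans (add_le_add ((norm_add_le _ _).trans
      (add_le_add t1 t2)) t3)) t4).trans ?_
    have e3 : ψ * (1 - 0.31 / κ ^ 2) = ψ - 0.31 * (ψ * (1 / κ ^ 2)) := by ring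
    have e4 : ψ * (1 - 0.3 / κ ^ 2) = ψ - 0.3 * (ψ * (1 / κ ^ 2)) := by ring
    have : 0 < ψ * (1 / κ ^ 2) := by positivity
    linarith
  exact ⟨ha, hb, hc⟩

/-- One step of the descent with a small deviation of the gradients. -/
lemma goodState_descent {ψ κ ω dev : ℝ} {U Y : Fin L → Matrix (Fin d) (Fin r) ℝ} (hκ : 1 ≤ κ) (hr : 1 ≤ r)
    (hs : GoodState Us (200 * r * κ ^ 2) ψ U) (hψ : sqrt r * ψ ≤ 1 / 10000 / κ ^ 2) (hψ0 : 0 < ψ)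
    (hω0 : 0 ≤ ω) (hω : ω * (r ^ 2 * κ ^ 2) ≤ 1e-6) (hdev0 : 0 ≤ dev) (hdr : sqrt r * dev ≤ 0.49)
    (ha : ∀ g, ‖(1 - Us * Usᵀ) * Y g‖ ≤ ψ * (1 - 0.3 / κ ^ 2) + dev)
    (hb : ∀ g, fro (Y g - U 0) ≤ sqrt r * (0.5 * ψ + dev))
    (hc : ∀ g, fro (Y g - Y 0) ≤ 2 * ω * (sqrt r * (0.5 * ψ + dev))) :
    GoodState Us (200 * r * κ ^ 2) (ψ * exp (-0.28 / κ ^ 2 + 3 * (dev / ψ))) (fun g => qrQ (Y g)) ∧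
      ∀ g, fro (qrQ (Y g) - U g) ≤ 330 * (sqrt r * (0.51 * ψ + dev)) := by
  have hrN : (1 : ℝ) ≤ r := by exact_mod_cast hr
  have hr1 : 1 ≤ sqrt r := Real.one_le_sqrt.2 hrN
  have hrr : sqrt r * sqrt r = r := Real.mul_self_sqrt (by positivity)
  have hκκ : 1 ≤ κ ^ 2 := one_le_pow₀ hκ
  set sr := sqrt r with hsr
  have hk1 : 1 / κ ^ 2 ≤ 1 := by rw [div_le_one (by positivity)]; exact hκκ
  have hk0 : 0 < 1 / κ ^ 2 := by positivity
  set k := 1 / κ ^ 2 with hk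
  have hψk : sr * ψ ≤ 1e-4 * k := hψ.trans (le_of_eq (by rw [hk]; ring))
  have hψ1 : ψ ≤ 1e-4 := by nlinarith
  set ξ := dev / ψ with hξ
  have hξ0 : 0 ≤ ξ := by positivity
  have hdξ : dev = ψ * ξ := by rw [hξ]; field_simp
  set β := sr * (0.5 * ψ + dev) with hβ
  have hβ1 : β ≤ 1 / 2 := by rw [hβ]; linarith
  have hβ0 : 0 ≤ β := by positivity
  have hβ2 : 2 * β ≤ 1e-4 * k + 2 * (1e-4 * ξ) := by
    have : sr * ψ * ξ ≤ 1e-4 * ξ := by gcongr; linarith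
    have : β = 0.5 * (sr * ψ) + sr * ψ * ξ := by rw [hβ, hdξ]; ring
    linarith
  have hexp : 1 / (1 - β) ≤ exp (2 * β) := by
    rw [div_le_iff₀ (by linarith)]
    have h1 : 1 + 2 * β ≤ exp (2 * β) := by linarith [Real.add_one_le_exp (2 * β)]
    have : (1 + 2 * β) * (1 - β) ≤ exp (2 * β) * (1 - β) := by
      gcongr; linarith
    nlinarith
  have e28 : -0.28 / κ ^ 2 = -0.28 * k := by rw [hk]; ring
  have e3 : 0.3 / κ ^ 2 = 0.3 * k := by rw [hk]; ring
  have h0 := hs.orth 0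
  refine ⟨goodState_qrQ h0 hβ1 (fun g => (norm_le_fro _).trans (hb g)) ha hc (by positivity) ?_ ?_, ?_⟩
  · have h1 : 1 - 0.3 * k + ξ ≤ exp (-0.3 * k + ξ) := by
      have := Real.add_one_le_exp (-0.3 * k + ξ); linarith
    calc (ψ * (1 - 0.3 / κ ^ 2) + dev) / (1 - β) = ψ * (1 - 0.3 * k + ξ) * (1 / (1 - β)) := by
          rw [e3, hdξ]; ring
      _ ≤ ψ * exp (-0.3 * k + ξ) * exp (2 * β) := by
          have : 0 < 1 - β := by linarith
          gcongr
      _ = ψ * exp (-0.3 * k + ξ + 2 * β) := by rw [mul_assoc, ← Real.exp_add]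
      _ ≤ _ := by
        rw [e28]
        exact mul_le_mul_of_nonneg_left (Real.exp_le_exp.2 (by linarith)) hψ0.le
  · have h1 : 0.7 + ξ ≤ exp (-0.28 * k + 3 * ξ) := by
      have := Real.add_one_le_exp (-0.28 * k + 3 * ξ); linarith
    have h2 : r * κ ^ 2 * (ω * sr) ≤ 1e-6 := by
      refine le_trans ?_ hω
      have : ω * κ ^ 2 * (r * sr) ≤ ω * κ ^ 2 * r ^ 2 := by
        gcongr; nlinarith
      linarith
    calc 200 * r * κ ^ 2 * (330 * (2 * ω * (sr * (0.5 * ψ + dev))))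
        = 132000 * (r * κ ^ 2 * (ω * sr)) * (0.5 * ψ + dev) := by ring
      _ ≤ 132000 * 1e-6 * (0.5 * ψ + dev) := by gcongr
      _ ≤ ψ * (0.7 + ξ) := by rw [hdξ]; nlinarith [mul_nonneg hψ0.le hξ0]
      _ ≤ _ := by rw [e28]; gcongr
  · intro g
    have hY := qrQ_near h0 hβ1 ((norm_le_fro _).trans (hb g))
    have hUl : ∀ v, 1 / 2 * nrm v ≤ nrm (U g *ᵥ v) := fun v => by
      rw [nrm_mulVec_orthonormal (hs.orth g)]; linarith [nrm_nonneg v]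
    have h1 := qrQ_perturb hUl hY.2.2.1 ((norm_orthonormal_le (hs.orth g)).trans one_le_two) hY.2.2.2
    rw [qrQ_of_orthonormal (hs.orth g)] at h1
    refine h1.trans (mul_le_mul_of_nonneg_left ?_ (by norm_num))
    have h2 : fro (U g - U 0) ≤ sr * (0.01 * ψ) := by
      have h3 := fro_le_norm (U g - U 0)
      rw [Fintype.card_fin] at h3
      refine h3.trans (mul_le_mul_of_nonneg_left ?_ (by positivity))
      have h4 := hs.spread g
      have h5 : 200 * ‖U g - U 0‖ ≤ 200 * r * κ ^ 2 * ‖U g - U 0‖ := by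
        gcongr
        nlinarith
      linarith
    have e : U g - Y g = (U g - U 0) - (Y g - U 0) := by abel
    rw [e]
    refine (fro_sub_le _ _).trans ((add_le_add h2 (hb g)).trans (le_of_eq ?_))
    rw [hβ]; ring

end Descent

section Potential
variable {d T r L : ℕ} [NeZero L]
variable {Us : Matrix (Fin d) (Fin r) ℝ} {bs : Matrix (Fin r) (Fin T) ℝ} {σ κ : ℝ}

open Classical in
/-- The distance of a state from the set of perfect states. -/
noncomputable def pot (Us : Matrix (Fin d) (Fin r) ℝ) (A : ℝ) (U : Fin L → Matrix (Fin d) (Fin r) ℝ) : ℝ :=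
  if ∀ g, (U g)ᵀ * U g = 1 then
    max ‖fun g => (1 - Us * Usᵀ) * U g‖ (A * ‖fun g => U g - U 0‖)
  else 1

lemma pot_nonneg (A : ℝ) (U : Fin L → Matrix (Fin d) (Fin r) ℝ) : 0 ≤ pot Us A U := by
  unfold pot
  split_ifs
  · exact (norm_nonneg _).trans (le_max_left _ _)
  · exact zero_le_one

lemma GoodState.pot_le {A ψ : ℝ} {U : Fin L → Matrix (Fin d) (Fin r) ℝ} (hA : 0 < A)
    (h : GoodState Us A ψ U) : pot Us A U ≤ ψ := by
  have hψ : 0 ≤ ψ := (norm_nonneg _).trans (h.dist 0)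
  rw [pot, if_pos h.orth]
  refine max_le ((pi_norm_le_iff_of_nonneg hψ).2 h.dist) ?_
  rw [← le_div_iff₀' hA, pi_norm_le_iff_of_nonneg (by positivity)]
  intro g
  rw [le_div_iff₀' hA]
  exact h.spread g

lemma goodState_of_pot_le {A ψ : ℝ} {U : Fin L → Matrix (Fin d) (Fin r) ℝ} (hA : 0 < A)
    (hψ : ψ < 1) (h : pot Us A U ≤ ψ) : GoodState Us A ψ U := by
  unfold pot at h
  split_ifs at h with ho
  · refine ⟨ho, fun g => ?_, fun g => ?_⟩
    · exact (norm_le_pi_norm (fun g => (1 - Us * Usᵀ) * U g) g).trans ((le_max_left _ _).trans h)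
    · refine le_trans ?_ ((le_max_right _ _).trans h)
      exact mul_le_mul_of_nonneg_left (norm_le_pi_norm (fun g => U g - U 0) g) hA.le
  · linarith

lemma GoodState.mono {A ψ ψ' : ℝ} {U : Fin L → Matrix (Fin d) (Fin r) ℝ}
    (h : GoodState Us A ψ U) (hψ : ψ ≤ ψ') : GoodState Us A ψ' U :=
  ⟨h.orth, fun g => (h.dist g).trans hψ, fun g => (h.spread g).trans hψ⟩

/-- The radius of the region of linear convergence. -/
noncomputable def basin (r : ℕ) (κ : ℝ) : ℝ := 1 / 10000 / κ ^ 2 / sqrt r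

lemma basin_pos (hr : 1 ≤ r) (hκ : 1 ≤ κ) : 0 < basin r κ := by
  have : 0 < sqrt r := Real.sqrt_pos.2 (by exact_mod_cast hr)
  unfold basin; positivity

lemma sqrt_mul_basin (hr : 1 ≤ r) : sqrt r * basin r κ = 1 / 10000 / κ ^ 2 := by
  have : 0 < sqrt r := Real.sqrt_pos.2 (by exact_mod_cast hr)
  unfold basin; field_simp

lemma basin_le (hr : 1 ≤ r) (hκ : 1 ≤ κ) : basin r κ ≤ 1 / 10000 := by
  have h1 : 1 ≤ sqrt r := Real.one_le_sqrt.2 (by exact_mod_cast hr)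
  unfold basin
  refine (div_le_self (by positivity) h1).trans (div_le_self (by norm_num) (one_le_pow₀ hκ))

/-- Contraction of the potential. -/
lemma pot_descent_le (hκ : 1 ≤ κ) (hr : 1 ≤ r) {ψ ω dev : ℝ} {U Y : Fin L → Matrix (Fin d) (Fin r) ℝ}
    (hs : GoodState Us (200 * r * κ ^ 2) ψ U) (hψ : ψ ≤ basin r κ) (hψ0 : 0 < ψ)
    (hω0 : 0 ≤ ω) (hω : ω * (r ^ 2 * κ ^ 2) ≤ 1e-6) (hdev0 : 0 ≤ dev)
    (ha : ∀ g, ‖(1 - Us * Usᵀ) * Y g‖ ≤ ψ * (1 - 0.3 / κ ^ 2) + dev)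
    (hb : ∀ g, fro (Y g - U 0) ≤ sqrt r * (0.5 * ψ + dev))
    (hc : ∀ g, fro (Y g - Y 0) ≤ 2 * ω * (sqrt r * (0.5 * ψ + dev))) :
    min (pot Us (200 * r * κ ^ 2) fun g => qrQ (Y g)) (basin r κ) ≤
      ψ * exp (-0.28 / κ ^ 2 + 3 * (dev / ψ)) := by
  have hrN : (1 : ℝ) ≤ r := by exact_mod_cast hr
  have hA : 0 < 200 * r * κ ^ 2 := by positivity
  have hsr : 0 < sqrt r := Real.sqrt_pos.2 (by linarith)
  have hκκ : 1 ≤ κ ^ 2 := one_le_pow₀ hκ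
  rcases le_or_gt (sqrt r * dev) 0.49 with h | h
  · refine (min_le_left _ _).trans ((goodState_descent hκ hr hs ?_ hψ0 hω0 hω hdev0 h ha hb hc).1.pot_le hA)
    rw [← sqrt_mul_basin hr]; gcongr
  · refine (min_le_right _ _).trans ?_
    have h1 : -0.28 / κ ^ 2 + 3 * (dev / ψ) + 1 ≤ exp (-0.28 / κ ^ 2 + 3 * (dev / ψ)) :=
      Real.add_one_le_exp _
    have h2 : -0.28 ≤ -0.28 / κ ^ 2 := by
      rw [neg_div, neg_le_neg_iff]; exact div_le_self (by norm_num) hκκ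
    have h3 : ψ * (3 * (dev / ψ)) = 3 * dev := by field_simp
    have h4 : 3 * dev ≤ ψ * exp (-0.28 / κ ^ 2 + 3 * (dev / ψ)) := by
      rw [← h3]; gcongr; linarith
    refine le_trans ?_ h4
    have h5 := sqrt_mul_basin (κ := κ) hr
    have h6 : 1 / 10000 / κ ^ 2 ≤ 1 / 10000 := div_le_self (by norm_num) hκκ
    refine le_of_mul_le_mul_left ?_ hsr
    linarith

/-- A crude bound of the growth of the potential. -/
lemma pot_crude_le (hκ : 1 ≤ κ) (hr : 1 ≤ r) {ψ ω S : ℝ} {U P Y : Fin L → Matrix (Fin d) (Fin r) ℝ}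
    (hs : GoodState Us (200 * r * κ ^ 2) ψ U) (hU : Usᵀ * Us = 1) (hψ0 : 0 ≤ ψ)
    {w : Fin L → Fin L → ℝ} (hw1 : ∀ g, ∑ j, w g j = 1)
    (hw : ∀ g j, |w g j - 1 / L| ≤ ω / L ^ 2) (hω0 : 0 ≤ ω) (hω : ω * (r ^ 2 * κ ^ 2) ≤ 1e-6)
    (hS : 1 ≤ S) (hP : ∑ j, fro (P j) ≤ S * ψ)
    (hY : ∀ g, Y g = ∑ j, w g j • (U j - (L : ℝ) • P j)) :
    min (pot Us (200 * r * κ ^ 2) fun g => qrQ (Y g)) (basin r κ) ≤ 528000 * r * κ ^ 2 * S * ψ := by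
  have hrN : (1 : ℝ) ≤ r := by exact_mod_cast hr
  have hκκ : 1 ≤ κ ^ 2 := one_le_pow₀ hκ
  have hrk : 1 ≤ r * κ ^ 2 := one_le_mul_of_one_le_of_one_le hrN hκκ
  have hA : 0 < 200 * r * κ ^ 2 := by positivity
  have hL : (1 : ℝ) ≤ L := by exact_mod_cast NeZero.one_le
  have hω1 : ω ≤ 1 := by
    have : 1 ≤ (r : ℝ) ^ 2 * κ ^ 2 := one_le_mul_of_one_le_of_one_le (one_le_pow₀ hrN) hκκ
    nlinarith
  have hspF : ∀ j, froSeminorm d r (U j - U 0) ≤ ψ := fun j => by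
    rw [froSeminorm_apply]
    have h1 := fro_le_norm (U j - U 0)
    rw [Fintype.card_fin] at h1
    have h2 : sqrt r ≤ 200 * r * κ ^ 2 := by
      have h3 : sqrt r ≤ r := by
        rw [Real.sqrt_le_left (by linarith)]; nlinarith
      nlinarith
    exact h1.trans ((mul_le_mul_of_nonneg_right h2 (norm_nonneg _)).trans (hs.spread j))
  have hPa : 1 / (L : ℝ) * ∑ j, fro (P j) ≤ S * ψ := by
    refine le_trans ?_ hP
    refine mul_le_of_le_one_left (Finset.sum_nonneg fun j _ => fro_nonneg _) ?_
    rw [div_le_one (by linarith)]; exact hL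
  have hψS : ψ ≤ S * ψ := le_mul_of_one_le_left hψ0 hS
  have hb : ∀ g, fro (Y g - U 0) ≤ 4 * (S * ψ) := fun g => by
    have h1 := mix_sub_le (froSeminorm d r) (U := U) (P := P) (hw1 g) (hw g) hω0 hspF
    simp only [froSeminorm_apply] at h1
    rw [← hY g] at h1
    have h2 : fro (∑ j, P j) ≤ S * ψ :=
      (seminorm_sum_le.map_sum_le_sum (p := froSeminorm d r) Finset.univ P).trans hP
    have e : Y g - U 0 = (Y g - U 0 + ∑ j, P j) - ∑ j, P j := by abel
    rw [e]
    refine (fro_sub_le _ _).trans ?_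
    have h3 : (1 + ω) * ψ ≤ 2 * ψ := by gcongr; linarith
    have h4 : ω * (1 / L * ∑ j, fro (P j)) ≤ S * ψ :=
      (mul_le_of_le_one_left (mul_nonneg (by positivity)
        (Finset.sum_nonneg fun j _ => fro_nonneg _)) hω1).trans hPa
    linarith
  have hc : ∀ g, fro (Y g - Y 0) ≤ 8 * (S * ψ) := fun g => by
    have e : Y g - Y 0 = (Y g - U 0) - (Y 0 - U 0) := by abel
    rw [e]
    refine (fro_sub_le _ _).trans ?_
    linarith [hb g, hb 0]
  have ha : ∀ g, ‖(1 - Us * Usᵀ) * Y g‖ ≤ 5 * (S * ψ) := fun g => by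
    have e : (1 - Us * Usᵀ) * Y g = (1 - Us * Usᵀ) * U 0 + (1 - Us * Usᵀ) * (Y g - U 0) := by
      rw [← Matrix.mul_add]; congr 1; abel
    rw [e]
    refine (norm_add_le _ _).trans ?_
    have h1 : ‖(1 - Us * Usᵀ) * (Y g - U 0)‖ ≤ fro (Y g - U 0) :=
      (norm_mul_le' _ _).trans ((mul_le_of_le_one_left (norm_nonneg _)
        (norm_proj_compl_le hU)).trans (norm_le_fro _))
    linarith [hs.dist 0, hb g]
  have hfin : 528000 * r * κ ^ 2 * S * ψ = 528000 * ((r * κ ^ 2) * (S * ψ)) := by ring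
  have hSψ : 0 ≤ S * ψ := by positivity
  have hle : S * ψ ≤ (r * κ ^ 2) * (S * ψ) := le_mul_of_one_le_left hSψ hrk
  rw [hfin]
  rcases le_or_gt (4 * (S * ψ)) (1 / 2) with h | h
  · refine (min_le_left _ _).trans (GoodState.pot_le hA ?_)
    refine goodState_qrQ (hs.orth 0) h (fun g => (norm_le_fro _).trans (hb g)) ha hc hA.le ?_ ?_
    · rw [div_le_iff₀ (by linarith)]
      nlinarith
    · linarith
  · refine (min_le_right _ _).trans ((basin_le hr hκ).trans ?_)
    linarith

end Potential

lemma fro_sum_le {ι : Type*} {d r : ℕ} (S : Finset ι) (f : ι → Matrix (Fin d) (Fin r) ℝ) :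
    fro (∑ j ∈ S, f j) ≤ ∑ j ∈ S, fro (f j) := by
  classical
  induction S using Finset.induction_on with
  | empty =>
    have := fro_smul 0 (0 : Matrix (Fin d) (Fin r) ℝ)
    simp only [zero_smul, abs_zero, zero_mul] at this
    simp [this]
  | insert a s ha ih =>
    rw [Finset.sum_insert ha, Finset.sum_insert ha]
    exact (fro_add_le _ _).trans (by gcongr)

section Algorithm
variable {d T r L n K : ℕ}

lemma fro_vecMulVec_le (a : Fin d → ℝ) (b : Fin r → ℝ) : fro (vecMulVec a b) ≤ nrm a * nrm b := by
  refine abs_le_of_sq_le_sq' (le_of_eq ?_) (mul_nonneg (nrm_nonneg _) (nrm_nonneg _)) |>.2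
  rw [fro_sq, mul_pow, nrm_sq_eq_sum, nrm_sq_eq_sum, Finset.sum_mul]
  refine Finset.sum_congr rfl fun i _ => ?_
  rw [Finset.mul_sum]
  exact Finset.sum_congr rfl fun j _ => by rw [vecMulVec_apply]; ring

/-- Error of the least squares estimate of the coefficients. -/
lemma pinv_mulVec_error {ι : Type} [Fintype ι] {X : Matrix ι (Fin d) ℝ} {V : Matrix (Fin d) (Fin r) ℝ}
    {θ : Fin d → ℝ} {c q : ℝ} (hc : 0 < c)
    (h1 : ∀ z, c * nrm z ≤ nrm (((X * V)ᵀ * (X * V)) *ᵥ z))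
    (h2 : nrm ((X * V)ᵀ *ᵥ (X *ᵥ ((1 - V * Vᵀ) *ᵥ θ))) ≤ q * c * nrm ((1 - V * Vᵀ) *ᵥ θ)) :
    nrm (pinv (X * V) *ᵥ (X *ᵥ θ) - Vᵀ *ᵥ θ) ≤ q * nrm ((1 - V * Vᵀ) *ᵥ θ) := by
  have hu := (Matrix.isUnit_iff_isUnit_det _).1 (isUnit_det_of_lower hc h1)
  set M := X * V with hM
  set h := (1 - V * Vᵀ) *ᵥ θ with hh
  have e : pinv M *ᵥ (X *ᵥ θ) - Vᵀ *ᵥ θ = (Mᵀ * M)⁻¹ *ᵥ (Mᵀ *ᵥ (X *ᵥ h)) := by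
    have e1 : X *ᵥ θ = M *ᵥ (Vᵀ *ᵥ θ) + X *ᵥ h := by
      rw [hh, hM, sub_mulVec, one_mulVec, mulVec_sub]
      simp only [mulVec_mulVec, Matrix.mul_assoc]
      abel
    rw [e1, pinv, mulVec_add, mulVec_mulVec, Matrix.mul_assoc, Matrix.nonsing_inv_mul _ hu, one_mulVec,
      mulVec_mulVec (X *ᵥ h)]
    abel
  rw [e]
  refine (nrm_mulVec_le _ _).trans ?_
  calc ‖(Mᵀ * M)⁻¹‖ * nrm (Mᵀ *ᵥ (X *ᵥ h)) ≤ 1 / c * (q * c * nrm h) :=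
        mul_le_mul (norm_inv_le hc h1) h2 (nrm_nonneg _) (by positivity)
    _ = _ := by field_simp

lemma gdStep_eq (c : Config T n L K) (D : Data d T n r) (hW : IsWeightMatrix c.graph c.W) (τ : ℕ)
    (U : Fin L → Matrix (Fin d) (Fin r) ℝ) (g : Fin L) :
    gdStep c D τ U g = qrQ (∑ j, (c.W ^ c.TconGD) g j •
      (U j - (L : ℝ) • (c.η • localGrad c D τ U j))) := by
  rw [gdStep, agree_eq hW]
  simp only [smul_smul, mul_comm c.η]

lemma localGrad_linearData (c : Config T n L K) (Θ : Matrix (Fin d) (Fin T) ℝ)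
    (X : Fin T → Matrix (Fin n) (Fin d) ℝ) (Z : Matrix (Fin d) (Fin r) ℝ) (τ : ℕ)
    (U : Fin L → Matrix (Fin d) (Fin r) ℝ) (j : Fin L) :
    localGrad c (linearData Θ X Z) τ U j = ∑ t ∈ Finset.univ.filter (fun t => c.node t = j),
      vecMulVec (((splitX c (linearData Θ X Z) (τ + K + 1) t)ᵀ * splitX c (linearData Θ X Z) (τ + K + 1) t) *ᵥ
        (U (c.node t) *ᵥ bStep c (linearData Θ X Z) τ U t - Θ.col t)) (bStep c (linearData Θ X Z) τ U t) := by
  rw [localGrad]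
  refine Finset.sum_congr (by congr) fun t ht => ?_
  rw [(Finset.mem_filter.1 ht).2]
  have : splitY c (linearData Θ X Z) (τ + K + 1) t =
      splitX c (linearData Θ X Z) (τ + K + 1) t *ᵥ Θ.col t := rfl
  rw [this, ← mulVec_sub, mulVec_mulVec]

lemma bStep_linearData (c : Config T n L K) (Θ : Matrix (Fin d) (Fin T) ℝ)
    (X : Fin T → Matrix (Fin n) (Fin d) ℝ) (Z : Matrix (Fin d) (Fin r) ℝ) (τ : ℕ)
    (U : Fin L → Matrix (Fin d) (Fin r) ℝ) (t : Fin T) :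
    bStep c (linearData Θ X Z) τ U t = pinv (splitX c (linearData Θ X Z) (τ + 1) t * U (c.node t)) *ᵥ
      (splitX c (linearData Θ X Z) (τ + 1) t *ᵥ Θ.col t) := rfl

/-- Deviation of the local gradient of a step from its conditional mean. -/
noncomputable def gradDev (c : Config T n L K) (Θ : Matrix (Fin d) (Fin T) ℝ) (D : Data d T n r)
    (τ : ℕ) (U : Fin L → Matrix (Fin d) (Fin r) ℝ) (j : Fin L) : Matrix (Fin d) (Fin r) ℝ :=
  ∑ t ∈ Finset.univ.filter (fun t => c.node t = j),
    vecMulVec (((splitX c D (τ + K + 1) t)ᵀ * splitX c D (τ + K + 1) t - (c.size (τ + K + 1) : ℝ) • 1) *ᵥ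
      (U (c.node t) *ᵥ bStep c D τ U t - Θ.col t)) (bStep c D τ U t)

/-- Total size of the deviations of the gradients of a step. -/
noncomputable def totalDev (c : Config T n L K) (Θ : Matrix (Fin d) (Fin T) ℝ) (D : Data d T n r)
    (τ : ℕ) (U : Fin L → Matrix (Fin d) (Fin r) ℝ) : ℝ :=
  c.η * ‖∑ j, gradDev c Θ D τ U j‖ + 1 / L * ∑ j, c.η * ‖gradDev c Θ D τ U j‖

/-- The coefficients of a step are accurate relative to the subspace error. -/
def CoeffAccurate (c : Config T n L K) (Θ : Matrix (Fin d) (Fin T) ℝ) (D : Data d T n r)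
    (τ : ℕ) (q : ℝ) (U : Fin L → Matrix (Fin d) (Fin r) ℝ) : Prop :=
  ∀ t, nrm (bStep c D τ U t - (U (c.node t))ᵀ *ᵥ Θ.col t) ≤
    q * nrm ((1 - U (c.node t) * (U (c.node t))ᵀ) *ᵥ Θ.col t)

variable [NeZero L] {Us : Matrix (Fin d) (Fin r) ℝ} {bs : Matrix (Fin r) (Fin T) ℝ} {σ κ : ℝ}
  {c : Config T n L K} {X : Fin T → Matrix (Fin n) (Fin d) ℝ} {Z : Matrix (Fin d) (Fin r) ℝ}

lemma mul_col_eq (t : Fin T) : (Us * bs).col t = Us *ᵥ bs.col t := by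
  ext i; simp [mul_apply, mulVec, dotProduct]

lemma gdStep_bounds (hG : GroundTruth Us bs σ κ) (hW : IsWeightMatrix c.graph c.W) {ω : ℝ}
    (hw1 : ∀ g, ∑ j, (c.W ^ c.TconGD) g j = 1)
    (hw : ∀ g j, |(c.W ^ c.TconGD) g j - 1 / L| ≤ ω / L ^ 2) (hω0 : 0 ≤ ω)
    (hω : ω * (r ^ 2 * κ ^ 2) ≤ 1e-6) {τ : ℕ} (hn : 0 < c.size (τ + K + 1))
    (hη : c.η = 0.4 / (c.size (τ + K + 1) * σ ^ 2)) {ψ : ℝ} (hψ0 : 0 < ψ) (hψ : ψ ≤ basin r κ)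
    {U : Fin L → Matrix (Fin d) (Fin r) ℝ} (hs : GoodState Us (200 * r * κ ^ 2) ψ U)
    (hB : CoeffAccurate c (Us * bs) (linearData (Us * bs) X Z) τ 0.1 U) :
    ∃ Y : Fin L → Matrix (Fin d) (Fin r) ℝ,
      gdStep c (linearData (Us * bs) X Z) τ U = (fun g => qrQ (Y g)) ∧
      (∀ g, ‖(1 - Us * Usᵀ) * Y g‖ ≤
        ψ * (1 - 0.3 / κ ^ 2) + totalDev c (Us * bs) (linearData (Us * bs) X Z) τ U) ∧
      (∀ g, fro (Y g - U 0) ≤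
        sqrt r * (0.5 * ψ + totalDev c (Us * bs) (linearData (Us * bs) X Z) τ U)) ∧
      ∀ g, fro (Y g - Y 0) ≤ 2 * ω *
        (sqrt r * (0.5 * ψ + totalDev c (Us * bs) (linearData (Us * bs) X Z) τ U)) := by
  set D := linearData (Us * bs) X Z with hD
  have hσ := hG.sigma_pos
  have hn' : (0 : ℝ) < c.size (τ + K + 1) := by exact_mod_cast hn
  have hη0 : 0 ≤ c.η := by rw [hη]; positivity
  refine ⟨fun g => ∑ j, (c.W ^ c.TconGD) g j • (U j - (L : ℝ) • (c.η • localGrad c D τ U j)),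
    funext fun g => gdStep_eq c D hW τ U g, ?_⟩
  refine hs.descent_bounds hG ((mul_le_mul_of_nonneg_left hψ (Real.sqrt_nonneg _)).trans
    (sqrt_mul_basin hG.rank_pos).le) hψ0 (node := c.node)
    (B := Matrix.of fun k t => bStep c D τ U t k) ?_ hw1 hw hω0 hω hη0 (gradDev c (Us * bs) D τ U) le_rfl ?_
  · intro t
    have := hB t
    rw [mul_col_eq] at this
    exact this
  · intro g
    refine Finset.sum_congr rfl fun j _ => ?_
    congr 3
    rw [hD, localGrad_linearData, ← hD, gradDev, Finset.smul_sum, Finset.smul_sum, Finset.smul_sum,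
      ← Finset.sum_add_distrib]
    refine Finset.sum_congr rfl fun t _ => ?_
    have e : (0.4 / σ ^ 2) = c.η * c.size (τ + K + 1) := by rw [hη]; field_simp
    rw [e, mul_smul, ← smul_add, ← mul_col_eq (Us := Us) (bs := bs)]
    congr 1
    have e2 : (Matrix.of fun k t => bStep c D τ U t k).col t = bStep c D τ U t := rfl
    rw [e2, ← smul_vecMulVec, ← add_vecMulVec, sub_mulVec, smul_mulVec, one_mulVec]
    congr 1
    abel

/-- One step of the algorithm contracts the potential. -/
lemma gdStep_pot_le (hG : GroundTruth Us bs σ κ) (hW : IsWeightMatrix c.graph c.W) {ω : ℝ}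
    (hw1 : ∀ g, ∑ j, (c.W ^ c.TconGD) g j = 1)
    (hw : ∀ g j, |(c.W ^ c.TconGD) g j - 1 / L| ≤ ω / L ^ 2) (hω0 : 0 ≤ ω)
    (hω : ω * (r ^ 2 * κ ^ 2) ≤ 1e-6) {τ : ℕ} (hn : 0 < c.size (τ + K + 1))
    (hη : c.η = 0.4 / (c.size (τ + K + 1) * σ ^ 2)) {ψ : ℝ} (hψ0 : 0 < ψ) (hψ : ψ ≤ basin r κ)
    {U : Fin L → Matrix (Fin d) (Fin r) ℝ} (hs : GoodState Us (200 * r * κ ^ 2) ψ U)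
    (hB : CoeffAccurate c (Us * bs) (linearData (Us * bs) X Z) τ 0.1 U) :
    min (pot Us (200 * r * κ ^ 2) (gdStep c (linearData (Us * bs) X Z) τ U)) (basin r κ) ≤
      ψ * exp (-0.28 / κ ^ 2 +
        3 * (totalDev c (Us * bs) (linearData (Us * bs) X Z) τ U / ψ)) := by
  obtain ⟨Y, hY, ha, hb, hc⟩ := gdStep_bounds hG hW hw1 hw hω0 hω hn hη hψ0 hψ hs hB
  rw [hY]
  refine pot_descent_le hG.one_le hG.rank_pos hs hψ hψ0 hω0 hω ?_ ha hb hc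
  have hσ := hG.sigma_pos
  have hη0 : 0 ≤ c.η := by rw [hη]; positivity
  unfold totalDev
  positivity

/-- A crude bound of one step of the algorithm. -/
lemma gdStep_pot_crude (hG : GroundTruth Us bs σ κ) (hW : IsWeightMatrix c.graph c.W) {ω : ℝ}
    (hw1 : ∀ g, ∑ j, (c.W ^ c.TconGD) g j = 1)
    (hw : ∀ g j, |(c.W ^ c.TconGD) g j - 1 / L| ≤ ω / L ^ 2) (hω0 : 0 ≤ ω)
    (hω : ω * (r ^ 2 * κ ^ 2) ≤ 1e-6) {τ : ℕ} (hn : 0 < c.size (τ + K + 1))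
    (hη : c.η = 0.4 / (c.size (τ + K + 1) * σ ^ 2)) {ψ : ℝ} (hψ0 : 0 ≤ ψ) (hψ : ψ ≤ basin r κ)
    {U : Fin L → Matrix (Fin d) (Fin r) ℝ} (hs : GoodState Us (200 * r * κ ^ 2) ψ U) {m : ℝ} (hm : 1 ≤ m)
    (h1 : ∀ t z, 1 / m * nrm z ≤
      nrm ((splitX c (linearData (Us * bs) X Z) (τ + 1) t * U (c.node t)) *ᵥ z))
    (h2 : ∀ t, ‖splitX c (linearData (Us * bs) X Z) (τ + 1) t‖ ≤ m)
    (h3 : ∀ t, ‖splitX c (linearData (Us * bs) X Z) (τ + K + 1) t‖ ≤ m) :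
    min (pot Us (200 * r * κ ^ 2) (gdStep c (linearData (Us * bs) X Z) τ U)) (basin r κ) ≤
      1056000 * r ^ 2 * κ ^ 2 * m ^ 10 * ψ := by
  set D := linearData (Us * bs) X Z with hD
  have hσ := hG.sigma_pos
  have hrN : (1 : ℝ) ≤ r := by exact_mod_cast hG.rank_pos
  have hn1 : (1 : ℝ) ≤ c.size (τ + K + 1) := by exact_mod_cast hn
  have hη0 : 0 ≤ c.η := by rw [hη]; positivity
  have hψ1 : ψ ≤ 1 := hψ.trans ((basin_le hG.rank_pos hG.one_le).trans (by norm_num))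
  have hm0 : 0 < m := by linarith
  have hm4 : 1 ≤ m ^ 4 := one_le_pow₀ hm
  have hb : ∀ t, nrm (bStep c D τ U t - (U (c.node t))ᵀ *ᵥ (Us *ᵥ bs.col t)) ≤
      m ^ 4 * nrm ((1 - U (c.node t) * (U (c.node t))ᵀ) *ᵥ (Us *ᵥ bs.col t)) := fun t => by
    rw [hD, bStep_linearData, ← hD, mul_col_eq]
    refine pinv_mulVec_error (c := (1 / m) ^ 2) (by positivity) ?_ ?_
    · intro z
      set M := splitX c D (τ + 1) t * U (c.node t) with hM
      have h4 := pow_le_pow_left₀ (mul_nonneg (by positivity) (nrm_nonneg _)) (h1 t z) 2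
      rw [nrm_mulVec_sq, ← hM, mul_pow] at h4
      have h5 := dotProduct_le z ((Mᵀ * M) *ᵥ z)
      rcases (nrm_nonneg z).eq_or_lt with h0 | h0
      · rw [← h0, mul_zero]; exact nrm_nonneg _
      · nlinarith
    · set h := (1 - U (c.node t) * (U (c.node t))ᵀ) *ᵥ (Us *ᵥ bs.col t)
      have h4 : m ^ 4 * (1 / m) ^ 2 * nrm h = m * (m * nrm h) := by field_simp
      rw [h4]
      refine (nrm_mulVec_le _ _).trans ?_
      rw [norm_transpose]
      refine mul_le_mul ?_ ((nrm_mulVec_le _ _).trans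
        (mul_le_mul_of_nonneg_right (h2 t) (nrm_nonneg _))) (nrm_nonneg _) hm0.le
      refine (norm_mul_le' _ _).trans ((mul_le_of_le_one_right (norm_nonneg _)
        (norm_orthonormal_le (hs.orth _))).trans (h2 t))
  have hce := fun t => hs.coeff_error hG.orth hψ1 (by positivity) (c.node t) _ _ (hb t)
  have hgr : ∀ j, fro (c.η • localGrad c D τ U j) ≤
      ∑ t ∈ Finset.univ.filter (fun t => c.node t = j), c.η * (4 * m ^ 10 * ψ * nrm (bs.col t) ^ 2) := fun j => by
    rw [fro_smul, abs_of_nonneg hη0, ← Finset.mul_sum]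
    refine mul_le_mul_of_nonneg_left ?_ hη0
    rw [hD, localGrad_linearData, ← hD]
    refine (fro_sum_le _ _).trans (Finset.sum_le_sum fun t _ => ?_)
    refine (fro_vecMulVec_le _ _).trans ?_
    rw [mul_col_eq]
    have h4 : nrm (((splitX c D (τ + K + 1) t)ᵀ * splitX c D (τ + K + 1) t) *ᵥ
        (U (c.node t) *ᵥ bStep c D τ U t - Us *ᵥ bs.col t)) ≤
        m ^ 2 * ((1 + m ^ 4) * ψ * nrm (bs.col t)) := by
      refine (nrm_mulVec_le _ _).trans (mul_le_mul ?_ (hce t).1 (nrm_nonneg _) (by positivity))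
      refine (norm_mul_le' _ _).trans ?_
      rw [norm_transpose, sq]
      exact mul_le_mul (h3 t) (h3 t) (norm_nonneg _) hm0.le
    calc _ ≤ m ^ 2 * ((1 + m ^ 4) * ψ * nrm (bs.col t)) * ((1 + m ^ 4) * nrm (bs.col t)) :=
          mul_le_mul h4 (hce t).2 (nrm_nonneg _) (mul_nonneg (by positivity)
            (mul_nonneg (by positivity) (nrm_nonneg _)))
      _ = m ^ 2 * (1 + m ^ 4) ^ 2 * (ψ * nrm (bs.col t) ^ 2) := by ring
      _ ≤ m ^ 2 * (2 * m ^ 4) ^ 2 * (ψ * nrm (bs.col t) ^ 2) := by gcongr; linarith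
      _ = _ := by ring
  have hsum : ∑ j, fro (c.η • localGrad c D τ U j) ≤ 2 * r * m ^ 10 * ψ := by
    refine (Finset.sum_le_sum fun j _ => hgr j).trans ?_
    rw [Finset.sum_fiberwise, ← Finset.mul_sum, ← Finset.mul_sum, ← fro_sq_eq_sum_col]
    have h5 : fro bs ^ 2 ≤ r * σ ^ 2 := by
      have := pow_le_pow_left₀ (fro_nonneg _) hG.fro_le 2
      rwa [mul_pow, Real.sq_sqrt (by positivity)] at this
    calc c.η * (4 * m ^ 10 * ψ * fro bs ^ 2) ≤ c.η * (4 * m ^ 10 * ψ * (r * σ ^ 2)) := by gcongr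
      _ = 1.6 * r * m ^ 10 * ψ / c.size (τ + K + 1) := by rw [hη]; field_simp; ring
      _ ≤ 1.6 * r * m ^ 10 * ψ := div_le_self (by positivity) hn1
      _ ≤ _ := by gcongr; norm_num
  have e : gdStep c D τ U = fun g => qrQ (∑ j, (c.W ^ c.TconGD) g j •
      (U j - (L : ℝ) • (c.η • localGrad c D τ U j))) := funext fun g => gdStep_eq c D hW τ U g
  rw [e]
  refine (pot_crude_le hG.one_le hG.rank_pos hs hG.orth hψ0 hw1 hw hω0 hω (S := 2 * r * m ^ 10) ?_ hsum
    (fun g => rfl)).trans (le_of_eq (by ring))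
  have : 1 ≤ m ^ 10 := one_le_pow₀ hm
  nlinarith

end Algorithm

section RowMatrix
variable {J ι : Type*} [Fintype J] [Fintype ι] {d : ℕ}

/-- The matrix whose rows are the rows of coordinates of `x` prescribed by `e`. -/
def rowMatrix (e : ι → Fin d → J) (x : J → ℝ) : Matrix ι (Fin d) ℝ := Matrix.of fun i j => x (e i j)

lemma measurable_rowMatrix (e : ι → Fin d → J) : Measurable (rowMatrix e) :=
  measurable_matrix_iff.2 fun i j => measurable_pi_apply (e i j)

lemma rowMatrix_mulVec (e : ι → Fin d → J) (x : J → ℝ) (v : Fin d → ℝ) (i : ι) :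
    (rowMatrix e x *ᵥ v) i = v ⬝ᵥ fun j => x (e i j) := by
  rw [mulVec, dotProduct_comm]; rfl

lemma five_pow_mul_le (a : ℕ) (B : ℝ) :
    (5 : ENNReal) ^ a * ofReal (exp B) ≤ ofReal (exp (2 * a + B)) := by
  have h5 : (5 : ℝ) ≤ exp 2 := by
    have h1 := Real.exp_one_gt_d9
    have : exp 2 = exp 1 * exp 1 := by rw [← Real.exp_add]; norm_num
    rw [this]; nlinarith
  have : (5 : ENNReal) ^ a = ofReal (5 ^ a) := by
    rw [ENNReal.ofReal_pow (by norm_num)]; norm_num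
  rw [this, ← ENNReal.ofReal_mul (by positivity), Real.exp_add]
  refine ENNReal.ofReal_le_ofReal ?_
  gcongr
  rw [Real.exp_mul, Real.rpow_natCast]
  gcongr

variable {α β : Type*} [Fintype α] [Fintype β] [DecidableEq α] [DecidableEq β]

/-- Concentration of the Gram matrix of two projections of a Gaussian matrix. -/
lemma gaussM_gram_dev {e : ι → Fin d → J} (he : Function.Injective (Function.uncurry e))
    {P : Matrix (Fin d) α ℝ} {Q : Matrix (Fin d) β ℝ} (hP : ‖P‖ ≤ 1) (hQ : ‖Q‖ ≤ 1) {δ : ℝ}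
    (hδ : 0 ≤ δ) (hδ1 : δ ≤ 16) :
    gaussM J {x | δ * Fintype.card ι ≤ ‖(rowMatrix e x * P)ᵀ * (rowMatrix e x * Q) -
        (Fintype.card ι : ℝ) • (Pᵀ * Q)‖} ≤
      ofReal (exp (2 * (Fintype.card α + Fintype.card β : ℕ) -
        δ ^ 2 / 1024 * Fintype.card ι)) := by
  classical
  set A : (J → ℝ) → Matrix α β ℝ := fun x => (rowMatrix e x * P)ᵀ * (rowMatrix e x * Q) -
        (Fintype.card ι : ℝ) • (Pᵀ * Q) with hA
  have hAm : Measurable A :=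
    (((measurable_rowMatrix e).matrix_mul measurable_const).matrix_transpose.matrix_mul
      ((measurable_rowMatrix e).matrix_mul measurable_const)).matrix_sub measurable_const
  have key : ∀ w z, nrm w ≤ 1 → nrm z ≤ 1 →
      ∫⁻ x, ofReal (exp (4 * (δ / 512) * (w ⬝ᵥ A x *ᵥ z))) ∂gaussM J ≤
        ofReal (exp (δ ^ 2 / 1024 * Fintype.card ι)) := by
    intro w z hw hz
    have hPw : nrm (P *ᵥ w) ≤ 1 := (nrm_mulVec_le _ _).trans (mul_le_one₀ hP (nrm_nonneg _) hw)
    have hQz : nrm (Q *ᵥ z) ≤ 1 := (nrm_mulVec_le _ _).trans (mul_le_one₀ hQ (nrm_nonneg _) hz)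
    have hn : nrm ((δ / 128) • (P *ᵥ w)) ≤ δ / 128 := by
      rw [nrm_smul, abs_of_nonneg (by positivity)]
      exact mul_le_of_le_one_right (by positivity) hPw
    have h1 := lintegral_exp_sum_bilin he Finset.univ (fun _ => (δ / 128) • (P *ᵥ w)) (fun _ => Q *ᵥ z)
      (fun i _ => by
        refine (mul_le_mul hn hQz (nrm_nonneg _) (by positivity)).trans ?_
        linarith)
    refine le_trans (le_of_eq ?_) (h1.trans (ENNReal.ofReal_le_ofReal (Real.exp_le_exp.2 ?_)))
    · refine lintegral_congr fun x => ?_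
      congr 2
      have e1 : w ⬝ᵥ ((rowMatrix e x * P)ᵀ * (rowMatrix e x * Q)) *ᵥ z =
          ∑ i, ((P *ᵥ w) ⬝ᵥ fun j => x (e i j)) * ((Q *ᵥ z) ⬝ᵥ fun j => x (e i j)) := by
        rw [← mulVec_mulVec, dot_mulVec_comm, transpose_transpose, ← mulVec_mulVec, ← mulVec_mulVec,
          dotProduct]
        exact Finset.sum_congr rfl fun i _ => by rw [rowMatrix_mulVec, rowMatrix_mulVec]
      have e2 : w ⬝ᵥ (Pᵀ * Q) *ᵥ z = (P *ᵥ w) ⬝ᵥ (Q *ᵥ z) := by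
        rw [← mulVec_mulVec, dot_mulVec_comm, transpose_transpose]
      rw [hA]
      simp only [sub_mulVec, dotProduct_sub, smul_mulVec, dotProduct_smul, smul_dotProduct, smul_eq_mul,
        Finset.sum_sub_distrib, Finset.sum_const, Finset.card_univ, nsmul_eq_mul]
      rw [e1, e2, mul_sub, Finset.mul_sum]
      congr 1
      · exact Finset.sum_congr rfl fun i _ => by ring
      · ring
    · rw [Finset.sum_const, Finset.card_univ, nsmul_eq_mul, mul_comm]
      gcongr
      have h2 := pow_le_pow_left₀ (nrm_nonneg _) hn 2
      have h3 := pow_le_pow_left₀ (nrm_nonneg _) hQz 2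
      calc 16 * (nrm ((δ / 128) • (P *ᵥ w)) ^ 2 * nrm (Q *ᵥ z) ^ 2)
          ≤ 16 * ((δ / 128) ^ 2 * 1 ^ 2) := by gcongr
        _ = _ := by ring
  have h2 := (lintegral_exp_norm_le hAm (by positivity) key).trans (five_pow_mul_le _ _)
  refine (measure_ge_le_exp hAm.matrix_norm (by positivity) (t := δ * Fintype.card ι) h2).trans
    (ENNReal.ofReal_le_ofReal (Real.exp_le_exp.2 (le_of_eq ?_)))
  ring

/-- Exponential moments of the deviation of a sum of rank-one gradients. -/
lemma lintegral_exp_gradDev_le {T r : ℕ} {e : Fin T × ι → Fin d → J}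
    (he : Function.Injective (Function.uncurry e)) (S : Finset (Fin T)) (v : Fin T → Fin d → ℝ)
    (B : Matrix (Fin r) (Fin T) ℝ) {α β γ s : ℝ} (hs : 0 ≤ s) (hα : ∀ t, nrm (v t) ≤ α)
    (hβ : ∀ t, nrm (B.col t) ≤ β) (hγ : ‖B‖ ≤ γ) (h : 4 * s * (α * β) ≤ 1 / 8) :
    ∫⁻ x, ofReal (exp (s * ‖∑ t ∈ S,
      vecMulVec (((rowMatrix (fun i => e (t, i)) x)ᵀ * rowMatrix (fun i => e (t, i)) x -
        (Fintype.card ι : ℝ) • 1) *ᵥ v t) (B.col t)‖)) ∂gaussM J ≤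
      ofReal (exp (2 * (d + r : ℕ) + 256 * s ^ 2 * α ^ 2 * γ ^ 2 * Fintype.card ι)) := by
  classical
  set A : (J → ℝ) → Matrix (Fin d) (Fin r) ℝ := fun x => ∑ t ∈ S,
      vecMulVec (((rowMatrix (fun i => e (t, i)) x)ᵀ * rowMatrix (fun i => e (t, i)) x -
        (Fintype.card ι : ℝ) • 1) *ᵥ v t) (B.col t) with hA
  have hAm : Measurable A := by
    refine Measurable.matrix_sum fun t _ => measurable_matrix_iff.2 fun i k => ?_
    simp only [vecMulVec_apply]
    refine Measurable.mul_const ?_ _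
    exact measurable_pi_iff.1 (((((measurable_rowMatrix fun i => e (t, i)).matrix_transpose).matrix_mul
      (measurable_rowMatrix fun i => e (t, i))).matrix_sub measurable_const).mulVec measurable_const) i
  have hdot : ∀ x w z, w ⬝ᵥ A x *ᵥ z = ∑ p ∈ S ×ˢ Finset.univ,
      ((w ⬝ᵥ fun j => x (e p j)) * (v p.1 ⬝ᵥ fun j => x (e p j)) - w ⬝ᵥ v p.1) * (B.col p.1 ⬝ᵥ z) := by
    intro x w z
    rw [Finset.sum_product, hA]
    simp only [sum_mulVec, dotProduct_sum]
    refine Finset.sum_congr rfl fun t _ => ?_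
    rw [← Finset.sum_mul, Finset.sum_sub_distrib, Finset.sum_const, Finset.card_univ, nsmul_eq_mul]
    have e1 : ∀ a : Fin d → ℝ, vecMulVec a (B.col t) *ᵥ z = (B.col t ⬝ᵥ z) • a := fun a => by
      ext i
      simp only [vecMulVec_apply, mulVec, dotProduct, Pi.smul_apply, smul_eq_mul, Finset.sum_mul]
      exact Finset.sum_congr rfl fun _ _ => by ring
    rw [e1, dotProduct_smul, smul_eq_mul, mul_comm, sub_mulVec, dotProduct_sub, smul_mulVec, one_mulVec,
      dotProduct_smul, smul_eq_mul]
    congr 2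
    rw [← mulVec_mulVec, dot_mulVec_comm, transpose_transpose, dotProduct]
    exact Finset.sum_congr rfl fun i _ => by rw [rowMatrix_mulVec, rowMatrix_mulVec]
  have key : ∀ w z, nrm w ≤ 1 → nrm z ≤ 1 →
      ∫⁻ x, ofReal (exp (4 * s * (w ⬝ᵥ A x *ᵥ z))) ∂gaussM J ≤
        ofReal (exp (256 * s ^ 2 * α ^ 2 * γ ^ 2 * Fintype.card ι)) := by
    intro w z hw hz
    have hbz : ∀ t, |B.col t ⬝ᵥ z| ≤ β := fun t => by
      refine (abs_dotProduct_le _ _).trans ?_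
      exact (mul_le_of_le_one_right (nrm_nonneg _) hz).trans (hβ t)
    have hn : ∀ t, nrm ((4 * s * (B.col t ⬝ᵥ z)) • w) ≤ 4 * s * |B.col t ⬝ᵥ z| := fun t => by
      rw [nrm_smul, abs_mul, abs_of_nonneg (by positivity : 0 ≤ 4 * s)]
      exact mul_le_of_le_one_right (by positivity) hw
    have h1 := lintegral_exp_sum_bilin he (S ×ˢ Finset.univ) (fun p => (4 * s * (B.col p.1 ⬝ᵥ z)) • w)
      (fun p => v p.1) (fun p _ => by
        refine le_trans ?_ h
        calc _ ≤ (4 * s * |B.col p.1 ⬝ᵥ z|) * α :=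
              mul_le_mul (hn _) (hα _) (nrm_nonneg _) (by positivity)
          _ ≤ (4 * s * β) * α := by
              have := (nrm_nonneg _).trans (hα p.1)
              gcongr; exact hbz _
          _ = _ := by ring)
    refine le_trans (le_of_eq ?_) (h1.trans (ENNReal.ofReal_le_ofReal (Real.exp_le_exp.2 ?_)))
    · refine lintegral_congr fun x => ?_
      congr 2
      rw [hdot, Finset.mul_sum]
      refine Finset.sum_congr rfl fun p _ => ?_
      rw [smul_dotProduct, smul_dotProduct, smul_eq_mul, smul_eq_mul]
      ring
    · rw [Finset.sum_product]
      simp only [Finset.sum_const, Finset.card_univ, nsmul_eq_mul]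
      have hB : ∑ t ∈ S, (B.col t ⬝ᵥ z) ^ 2 ≤ γ ^ 2 := by
        have h2 : nrm (Bᵀ *ᵥ z) ≤ γ := by
          refine (nrm_mulVec_le _ _).trans ?_
          rw [norm_transpose]
          exact (mul_le_of_le_one_right (norm_nonneg _) hz).trans hγ
        have h3 := pow_le_pow_left₀ (nrm_nonneg _) h2 2
        rw [nrm_sq_eq_sum] at h3
        exact (Finset.sum_le_sum_of_subset_of_nonneg (Finset.subset_univ S)
          fun _ _ _ => sq_nonneg _).trans h3
      calc ∑ t ∈ S, (Fintype.card ι : ℝ) *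
            (16 * (nrm ((4 * s * (B.col t ⬝ᵥ z)) • w) ^ 2 * nrm (v t) ^ 2))
          ≤ ∑ t ∈ S, (Fintype.card ι : ℝ) * (16 * ((4 * s * |B.col t ⬝ᵥ z|) ^ 2 * α ^ 2)) := by
            refine Finset.sum_le_sum fun t _ => ?_
            have h4 := pow_le_pow_left₀ (nrm_nonneg _) (hn t) 2
            have h5 := pow_le_pow_left₀ (nrm_nonneg _) (hα t) 2
            gcongr
        _ = 256 * s ^ 2 * α ^ 2 * Fintype.card ι * ∑ t ∈ S, (B.col t ⬝ᵥ z) ^ 2 := by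
            rw [Finset.mul_sum]
            refine Finset.sum_congr rfl fun t _ => ?_
            rw [mul_pow, sq_abs]; ring
        _ ≤ 256 * s ^ 2 * α ^ 2 * Fintype.card ι * γ ^ 2 := by gcongr
        _ = _ := by ring
  have h2 := (lintegral_exp_norm_le hAm hs key).trans (five_pow_mul_le _ _)
  simpa using h2

end RowMatrix

/-- The index set of all the Gaussian variables. -/
abbrev Coord (T n d r : ℕ) : Type := (Fin T × Fin n × Fin d) ⊕ (Fin d × Fin r)

section Canonical
variable {d T r L n K : ℕ}

/-- The data as a function of all the Gaussian variables. -/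
def canonData (Θ : Matrix (Fin d) (Fin T) ℝ) (x : Coord T n d r → ℝ) : Data d T n r :=
  linearData Θ (fun t => Matrix.of fun i j => x (Sum.inl (t, i, j))) (Matrix.of fun j k => x (Sum.inr (j, k)))

/-- The rows of the samples of a set of the split. -/
def sampleRow (r : ℕ) (c : Config T n L K) (d l : ℕ) (p : Fin T × c.Idx l) (j : Fin d) : Coord T n d r :=
  Sum.inl (p.1, p.2.1, j)

lemma sampleRow_injective (c : Config T n L K) (l : ℕ) :
    Function.Injective (Function.uncurry (sampleRow r c d l)) := by
  rintro ⟨⟨t, i⟩, j⟩ ⟨⟨t', i'⟩, j'⟩ h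
  simp only [sampleRow, Function.uncurry_apply_pair, Sum.inl.injEq, Prod.mk.injEq] at h
  obtain ⟨h1, h2, h3⟩ := h
  simp [h1, Subtype.ext h2, h3]

lemma sampleRow_injective' (c : Config T n L K) (l : ℕ) (t : Fin T) :
    Function.Injective (Function.uncurry fun i => sampleRow r c d l (t, i)) := by
  rintro ⟨i, j⟩ ⟨i', j'⟩ h
  have := @sampleRow_injective d T r L n K c l ((t, i), j) ((t, i'), j') h
  simp only [Prod.mk.injEq, true_and] at this
  simp [this.1, this.2]

lemma splitX_canonData (c : Config T n L K) (Θ : Matrix (Fin d) (Fin T) ℝ) (l : ℕ) (t : Fin T)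
    (x : Coord T n d r → ℝ) :
    splitX c (canonData Θ x) l t = rowMatrix (fun i => sampleRow r c d l (t, i)) x := rfl

variable {Us : Matrix (Fin d) (Fin r) ℝ} {bs : Matrix (Fin r) (Fin T) ℝ} {σ κ : ℝ} {c : Config T n L K}

/-- Accuracy of the coefficients from concentration of Gram matrices. -/
lemma coeffAccurate_of_gram {Θ : Matrix (Fin d) (Fin T) ℝ} {x : Coord T n d r → ℝ} {τ : ℕ}
    (hn : 0 < c.size (τ + 1))
    {U : Fin L → Matrix (Fin d) (Fin r) ℝ} (hU : ∀ g, (U g)ᵀ * U g = 1)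
    (h1 : ∀ t, ‖(splitX c (canonData (r := r) Θ x) (τ + 1) t * U (c.node t))ᵀ *
        (splitX c (canonData (r := r) Θ x) (τ + 1) t * U (c.node t)) -
        (c.size (τ + 1) : ℝ) • ((U (c.node t))ᵀ * U (c.node t))‖ < 0.09 * c.size (τ + 1))
    (h2 : ∀ t, ‖(splitX c (canonData (r := r) Θ x) (τ + 1) t * U (c.node t))ᵀ *
        (splitX c (canonData (r := r) Θ x) (τ + 1) t *
          replicateCol Unit ((nrm ((1 - U (c.node t) * (U (c.node t))ᵀ) *ᵥ Θ.col t))⁻¹ •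
            ((1 - U (c.node t) * (U (c.node t))ᵀ) *ᵥ Θ.col t))) -
        (c.size (τ + 1) : ℝ) • ((U (c.node t))ᵀ *
          replicateCol Unit ((nrm ((1 - U (c.node t) * (U (c.node t))ᵀ) *ᵥ Θ.col t))⁻¹ •
            ((1 - U (c.node t) * (U (c.node t))ᵀ) *ᵥ Θ.col t)))‖ < 0.09 * c.size (τ + 1)) :
    CoeffAccurate c Θ (canonData Θ x) τ 0.1 U := by
  intro t
  have hN : (0 : ℝ) < c.size (τ + 1) := by exact_mod_cast hn
  specialize h1 t
  specialize h2 t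
  set V := U (c.node t) with hV
  have hVo : Vᵀ * V = 1 := hU _
  set Xt := splitX c (canonData (r := r) Θ x) (τ + 1) t with hX
  set N : ℝ := ((c.size (τ + 1) : ℕ) : ℝ)
  set h := (1 - V * Vᵀ) *ᵥ Θ.col t with hh
  refine pinv_mulVec_error (c := 0.91 * N) (by positivity) (fun z => ?_) ?_
  · have e : ((Xt * V)ᵀ * (Xt * V)) *ᵥ z = N • z + ((Xt * V)ᵀ * (Xt * V) - N • (Vᵀ * V)) *ᵥ z := by
      rw [hVo, sub_mulVec, smul_mulVec, one_mulVec]; abel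
    have h3 := le_nrm_add (N • z) (((Xt * V)ᵀ * (Xt * V) - N • (Vᵀ * V)) *ᵥ z)
    rw [← e, nrm_smul, abs_of_pos hN] at h3
    have h4 := (nrm_mulVec_le ((Xt * V)ᵀ * (Xt * V) - N • (Vᵀ * V)) z).trans
      (mul_le_mul_of_nonneg_right h1.le (nrm_nonneg z))
    linarith
  · have hVh : Vᵀ *ᵥ h = 0 := by
      rw [hh, mulVec_mulVec, Matrix.mul_sub, ← Matrix.mul_assoc, hVo]; simp
    have e : (Xt * V)ᵀ *ᵥ (Xt *ᵥ h) = nrm h • (((Xt * V)ᵀ * (Xt * replicateCol Unit ((nrm h)⁻¹ • h)) -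
        N • (Vᵀ * replicateCol Unit ((nrm h)⁻¹ • h))) *ᵥ fun _ => 1) := by
      have e1 : (replicateCol Unit ((nrm h)⁻¹ • h)) *ᵥ (fun _ => (1 : ℝ)) = (nrm h)⁻¹ • h := by
        ext i; simp [mulVec, dotProduct, replicateCol]
      rw [sub_mulVec, smul_mulVec, ← mulVec_mulVec, ← mulVec_mulVec, ← mulVec_mulVec, e1,
        mulVec_smul Vᵀ, hVh, smul_zero, smul_zero, sub_zero, mulVec_smul, mulVec_smul, smul_smul]
      rcases eq_or_ne (nrm h) 0 with h0 | h0
      · rw [nrm_eq_zero.1 h0]; simp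
      · rw [mul_inv_cancel₀ h0, one_smul]
    rw [e, nrm_smul, abs_of_nonneg (nrm_nonneg h)]
    have h5 : nrm (fun _ : Unit => (1 : ℝ)) = 1 := by
      have := nrm_sq_eq_sum (fun _ : Unit => (1 : ℝ))
      simp at this
      rcases this with h | h
      · exact h
      · linarith [nrm_nonneg (fun _ : Unit => (1 : ℝ))]
    have h4 := nrm_mulVec_le ((Xt * V)ᵀ * (Xt * replicateCol Unit ((nrm h)⁻¹ • h)) -
        N • (Vᵀ * replicateCol Unit ((nrm h)⁻¹ • h))) fun _ => 1
    rw [h5, mul_one] at h4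
    have := mul_le_mul_of_nonneg_left (h4.trans h2.le) (nrm_nonneg h)
    refine this.trans ?_
    have := mul_nonneg (nrm_nonneg h) hN.le
    linarith

lemma norm_replicateCol_le (v : Fin d → ℝ) (h : nrm v ≤ 1) : ‖replicateCol Unit v‖ ≤ 1 := by
  refine (norm_le_fro _).trans (abs_le_of_sq_le_sq' ?_ zero_le_one |>.2)
  rw [fro_sq_eq_sum_col]
  have := pow_le_pow_left₀ (nrm_nonneg _) h 2
  have e : ∀ j, (replicateCol Unit v).col j = v := fun _ => rfl
  simpa only [e, Finset.univ_unique, Finset.sum_const, Finset.card_singleton, one_smul] using this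

/-- Failure probability of the coefficient estimates. -/
lemma measure_not_coeffAccurate_le {Θ : Matrix (Fin d) (Fin T) ℝ} {τ : ℕ} (hr : 1 ≤ r)
    (hn : 0 < c.size (τ + 1)) {U : Fin L → Matrix (Fin d) (Fin r) ℝ} (hU : ∀ g, (U g)ᵀ * U g = 1) :
    gaussM (Coord T n d r) {x | ¬ CoeffAccurate c Θ (canonData Θ x) τ 0.1 U} ≤
      ofReal (2 * T * exp (4 * r - 7e-6 * c.size (τ + 1))) := by
  have hc : Fintype.card (c.Idx (τ + 1)) = c.size (τ + 1) := rfl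
  have hb : ∀ {β : Type} [Fintype β] [DecidableEq β] (Q : Matrix (Fin d) β ℝ) (t : Fin T), ‖Q‖ ≤ 1 →
      Fintype.card β ≤ r → gaussM (Coord T n d r) {x | 0.09 * c.size (τ + 1) ≤
        ‖(splitX c (canonData (r := r) Θ x) (τ + 1) t * U (c.node t))ᵀ *
        (splitX c (canonData (r := r) Θ x) (τ + 1) t * Q) -
        (c.size (τ + 1) : ℝ) • ((U (c.node t))ᵀ * Q)‖} ≤
        ofReal (exp (4 * r - 7e-6 * c.size (τ + 1))) := by
    intro β _ _ Q t hQ hβ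
    have := gaussM_gram_dev (sampleRow_injective' (r := r) (d := d) c (τ + 1) t)
      (norm_orthonormal_le (hU (c.node t))) hQ (δ := 0.09) (by norm_num) (by norm_num)
    refine this.trans (ENNReal.ofReal_le_ofReal (Real.exp_le_exp.2 ?_))
    rw [Fintype.card_fin, hc]
    have h1 : ((r + Fintype.card β : ℕ) : ℝ) ≤ 2 * r := by
      have : r + Fintype.card β ≤ 2 * r := by omega
      exact_mod_cast this
    have h2 : (0 : ℝ) ≤ c.size (τ + 1) := by positivity
    linarith
  have hunion : {x : Coord T n d r → ℝ | ¬ CoeffAccurate c Θ (canonData Θ x) τ 0.1 U} ⊆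
      ⋃ t ∈ (Finset.univ : Finset (Fin T)), ({x | 0.09 * c.size (τ + 1) ≤
        ‖(splitX c (canonData (r := r) Θ x) (τ + 1) t * U (c.node t))ᵀ *
        (splitX c (canonData (r := r) Θ x) (τ + 1) t * U (c.node t)) -
        (c.size (τ + 1) : ℝ) • ((U (c.node t))ᵀ * U (c.node t))‖} ∪ {x | 0.09 * c.size (τ + 1) ≤
        ‖(splitX c (canonData (r := r) Θ x) (τ + 1) t * U (c.node t))ᵀ *
        (splitX c (canonData (r := r) Θ x) (τ + 1) t *
          replicateCol Unit ((nrm ((1 - U (c.node t) * (U (c.node t))ᵀ) *ᵥ Θ.col t))⁻¹ •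
            ((1 - U (c.node t) * (U (c.node t))ᵀ) *ᵥ Θ.col t))) -
        (c.size (τ + 1) : ℝ) • ((U (c.node t))ᵀ *
          replicateCol Unit ((nrm ((1 - U (c.node t) * (U (c.node t))ᵀ) *ᵥ Θ.col t))⁻¹ •
            ((1 - U (c.node t) * (U (c.node t))ᵀ) *ᵥ Θ.col t)))‖}) := by
    intro x hx
    by_contra hcon
    simp only [Set.mem_iUnion, Set.mem_union, Set.mem_ofPred_eq, Finset.mem_univ,
      exists_prop, true_and, not_exists, not_or, not_le] at hcon
    exact hx (coeffAccurate_of_gram hn hU (fun t => (hcon t).1) fun t => (hcon t).2)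
  refine (measure_mono hunion).trans ((measure_biUnion_finset_le _ _).trans ?_)
  have hE : 0 ≤ exp (4 * r - 7e-6 * c.size (τ + 1)) := (Real.exp_pos _).le
  calc _ ≤ ∑ t : Fin T, ofReal (2 * exp (4 * r - 7e-6 * c.size (τ + 1))) := by
        refine Finset.sum_le_sum fun t _ => (measure_union_le _ _).trans ?_
        rw [show ofReal (2 * exp (4 * r - 7e-6 * c.size (τ + 1))) = _ from by
          rw [two_mul, ENNReal.ofReal_add hE hE]]
        refine add_le_add (hb _ t (norm_orthonormal_le (hU _)) (by simp)) (hb _ t ?_ (by simpa using hr))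
        exact norm_replicateCol_le _ (nrm_normalize_le _)
    _ = _ := by
      rw [Finset.sum_const, Finset.card_univ, Fintype.card_fin, nsmul_eq_mul,
        ← ENNReal.ofReal_natCast, ← ENNReal.ofReal_mul (by positivity)]
      congr 1; ring

/-- Second moment bound for the norm of a matrix with standard Gaussian entries. -/
lemma measure_fro_ge_le {J ι ι' : Type*} [Fintype J] [Fintype ι] [Fintype ι'] (e : ι → ι' → J) {m : ℝ}
    (hm : 1 ≤ m) :
    gaussM J {x | m ≤ fro (Matrix.of fun i j => x (e i j))} ≤
      ofReal ((Fintype.card ι * Fintype.card ι') / m) := by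
  classical
  have hsq : ∀ x : J → ℝ, fro (Matrix.of fun i j => x (e i j)) ^ 2 = ∑ i, ∑ j, x (e i j) ^ 2 :=
    fun x => fro_sq _
  have hmeas : Measurable fun x : J → ℝ => ofReal (fro (Matrix.of fun i j => x (e i j)) ^ 2) := by
    simp only [hsq]
    refine Measurable.ennreal_ofReal (Finset.measurable_sum _ fun i _ => Finset.measurable_sum _ fun j _ => ?_)
    exact (measurable_pi_apply (e i j)).pow_const 2
  have h1 : ∀ x : J → ℝ, ofReal (fro (Matrix.of fun i j => x (e i j)) ^ 2) =
      ∑ i, ∑ j, ofReal (x (e i j) ^ 2) := fun x => by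
    rw [hsq, ENNReal.ofReal_sum_of_nonneg fun i _ => Finset.sum_nonneg fun j _ => sq_nonneg _]
    refine Finset.sum_congr rfl fun i _ => ?_
    rw [ENNReal.ofReal_sum_of_nonneg fun j _ => sq_nonneg _]
  have h2 : ∀ q : J, ∫⁻ x, ofReal (x q ^ 2) ∂gaussM J = 1 := fun q => by
    have h3 := lintegral_gaussM_dotProduct (J := J) (Pi.single q 1)
      (F := fun g => ofReal (g ^ 2)) (by fun_prop)
    simp only [single_dotProduct, one_mul, nrm_single, abs_one] at h3
    rw [h3, ← ofReal_integral_eq_lintegral_ofReal]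
    · have h4 := variance_id_gaussianReal (μ := 0) (v := 1)
      have h5 := variance_eq_integral (X := id) (μ := gaussianReal 0 1) aemeasurable_id
      rw [h4] at h5
      simp only [id_eq, integral_id_gaussianReal, sub_zero] at h5
      rw [← h5]; simp
    · exact (memLp_id_gaussianReal (μ := 0) (v := 1) 2).integrable_sq
    · exact Filter.Eventually.of_forall fun _ => sq_nonneg _
  have hint : ∫⁻ x, ofReal (fro (Matrix.of fun i j => x (e i j)) ^ 2) ∂gaussM J =
      ofReal (Fintype.card ι * Fintype.card ι') := by
    simp only [h1]
    rw [lintegral_finsetSum _ fun i _ => Finset.measurable_sum _ fun j _ =>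
      ((measurable_pi_apply _).pow_const 2).ennreal_ofReal]
    have h4 : ∀ i, ∫⁻ x, ∑ j, ofReal (x (e i j) ^ 2) ∂gaussM J = Fintype.card ι' := fun i => by
      rw [lintegral_finsetSum _ fun j _ => ((measurable_pi_apply _).pow_const 2).ennreal_ofReal]
      simp [h2]
    simp only [h4, Finset.sum_const, Finset.card_univ, nsmul_eq_mul]
    rw [ENNReal.ofReal_mul (by positivity), ENNReal.ofReal_natCast, ENNReal.ofReal_natCast]
  have h5 := meas_ge_le_lintegral_div (μ := gaussM J) hmeas.aemeasurable
    (ε := ofReal m) (by simp; linarith) ENNReal.ofReal_ne_top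
  rw [hint, ← ENNReal.ofReal_div_of_pos (by linarith)] at h5
  refine (measure_mono fun x hx => ?_).trans h5
  refine ENNReal.ofReal_le_ofReal ?_
  have hx' : m ≤ fro (Matrix.of fun i j => x (e i j)) := hx
  nlinarith

/-- The matrices of all the tasks in a set of the split are rarely very large. -/
lemma measure_norm_splitX_gt_le {Θ : Matrix (Fin d) (Fin T) ℝ} (l : ℕ) {m : ℝ} (hm : 1 ≤ m) :
    gaussM (Coord T n d r) {x | ¬ ∀ t, ‖splitX c (canonData (r := r) Θ x) l t‖ ≤ m} ≤
      ofReal (T * (c.size l * d) / m) := by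
  have hone : ∀ t, gaussM (Coord T n d r) {x | m ≤ fro (splitX c (canonData (r := r) Θ x) l t)} ≤
      ofReal ((c.size l * d) / m) := fun t => by
    have := measure_fro_ge_le (fun (i : c.Idx l) (j : Fin d) => sampleRow r c d l (t, i) j) hm
    rwa [Fintype.card_fin] at this
  have hsub : {x : Coord T n d r → ℝ | ¬ ∀ t, ‖splitX c (canonData (r := r) Θ x) l t‖ ≤ m} ⊆
      ⋃ t ∈ (Finset.univ : Finset (Fin T)), {x | m ≤ fro (splitX c (canonData (r := r) Θ x) l t)} := by
    intro x hx
    simp only [Set.mem_ofPred_eq, not_forall, not_le] at hx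
    obtain ⟨t, ht⟩ := hx
    simp only [Set.mem_iUnion, Finset.mem_univ, exists_prop, true_and]
    exact ⟨t, ht.le.trans (norm_le_fro _)⟩
  refine (measure_mono hsub).trans ((measure_biUnion_finset_le _ _).trans ?_)
  refine (Finset.sum_le_sum fun t _ => hone t).trans (le_of_eq ?_)
  rw [Finset.sum_const, Finset.card_univ, Fintype.card_fin, nsmul_eq_mul,
    ← ENNReal.ofReal_natCast, ← ENNReal.ofReal_mul (by positivity)]
  congr 1; ring

/-- The matrices `Xₜ U` are rarely very badly conditioned. -/
lemma measure_small_singular_le {Θ : Matrix (Fin d) (Fin T) ℝ} {l : ℕ} (hrn : r ≤ c.size l)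
    {U : Fin L → Matrix (Fin d) (Fin r) ℝ} (hU : ∀ g, (U g)ᵀ * U g = 1) {m : ℝ} (hm : 1 ≤ m) :
    gaussM (Coord T n d r) {x | ¬ ∀ t z, 1 / m * nrm z ≤
        nrm ((splitX c (canonData (r := r) Θ x) l t * U (c.node t)) *ᵥ z)} ≤
      ofReal (T * r ^ 2 / m) := by
  have hm0 : 0 < m := by linarith
  obtain ⟨f⟩ : Nonempty (Fin r ↪ c.Idx l) := by
    rw [Function.Embedding.nonempty_iff_card_le, Fintype.card_fin]; exact hrn
  set e : Fin T → Fin d → Fin r → Coord T n d r := fun t j k => sampleRow r c d l (t, f k) j with he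
  have hei : ∀ t, Function.Injective (Function.uncurry (e t)) := fun t => by
    rintro ⟨j, k⟩ ⟨j', k'⟩ h
    have := @sampleRow_injective d T r L n K c l ((t, f k), j) ((t, f k'), j') h
    simp only [Prod.mk.injEq, true_and] at this
    rw [Prod.mk.injEq]
    exact ⟨this.2, f.injective this.1⟩
  have hsub : {x : Coord T n d r → ℝ | ¬ ∀ t z, 1 / m * nrm z ≤
        nrm ((splitX c (canonData (r := r) Θ x) l t * U (c.node t)) *ᵥ z)} ⊆
      ⋃ t ∈ (Finset.univ : Finset (Fin T)),
        {x | ∃ w, nrm w = 1 ∧ nrm (((U (c.node t))ᵀ * entryMatrix (e t) x) *ᵥ w) ≤ 1 / m} := by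
    intro x hx
    by_contra hcon
    simp only [Set.mem_iUnion, Set.mem_ofPred_eq, Finset.mem_univ, exists_prop, true_and, not_exists,
      not_and, not_le] at hcon
    refine hx fun t z => ?_
    set M := (U (c.node t))ᵀ * entryMatrix (e t) x with hM
    have h1 : ∀ w, 1 / m * nrm w ≤ nrm (M *ᵥ w) := fun w => by
      rcases (nrm_nonneg w).eq_or_lt with h0 | h0
      · rw [← h0, mul_zero]; exact nrm_nonneg _
      have h2 := hcon t ((nrm w)⁻¹ • w) (by
        rw [nrm_smul, abs_of_pos (inv_pos.2 h0), inv_mul_cancel₀ h0.ne'])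
      rw [mulVec_smul, nrm_smul, abs_of_pos (inv_pos.2 h0), lt_inv_mul_iff₀ h0] at h2
      linarith
    refine (lower_transpose h1 z).trans (abs_le_of_sq_le_sq' ?_ (nrm_nonneg _) |>.2)
    rw [nrm_sq_eq_sum, nrm_sq_eq_sum]
    have h3 : ∀ k, (Mᵀ *ᵥ z) k = ((splitX c (canonData (r := r) Θ x) l t * U (c.node t)) *ᵥ z) (f k) := fun k => by
      rw [hM, transpose_mul, transpose_transpose, ← mulVec_mulVec, ← mulVec_mulVec]
      rfl
    simp only [h3]
    rw [← Finset.sum_map Finset.univ f fun i =>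
      ((splitX c (canonData (r := r) Θ x) l t * U (c.node t)) *ᵥ z) i ^ 2]
    exact Finset.sum_le_sum_of_subset_of_nonneg (Finset.subset_univ _) fun _ _ _ => sq_nonneg _
  refine (measure_mono hsub).trans ((measure_biUnion_finset_le _ _).trans ?_)
  refine (Finset.sum_le_sum fun t _ => gaussM_small_ball (hei t) (hU _) (by positivity)).trans (le_of_eq ?_)
  rw [Finset.sum_const, Finset.card_univ, Fintype.card_fin, nsmul_eq_mul,
    ← ENNReal.ofReal_natCast, ← ENNReal.ofReal_mul (by positivity)]
  congr 1; ring

end Canonical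

section Measurability
variable {α : Type*} [MeasurableSpace α]

lemma _root_.Measurable.matrix_det {m : Type*} [Fintype m] [DecidableEq m] {A : α → Matrix m m ℝ}
    (hA : Measurable A) : Measurable fun x => (A x).det := by
  simp only [det_apply]
  refine Finset.measurable_sum _ fun σ _ => Measurable.const_smul ?_ _
  exact Finset.measurable_fun_prod _ fun i _ => hA.matrix_entry _ _

lemma _root_.Measurable.matrix_inv {m : Type*} [Fintype m] [DecidableEq m] {A : α → Matrix m m ℝ}
    (hA : Measurable A) : Measurable fun x => (A x)⁻¹ := by
  simp only [Matrix.inv_def, Ring.inverse_eq_inv']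
  refine Measurable.matrix_smul hA.matrix_det.inv (measurable_matrix_iff.2 fun i j => ?_)
  simp only [adjugate_apply]
  refine Measurable.matrix_det (measurable_matrix_iff.2 fun k l => ?_)
  simp only [updateRow_apply]
  split_ifs
  · exact measurable_const
  · exact hA.matrix_entry _ _

lemma measurable_gramSchmidt {d r : ℕ} {f : α → Fin r → EuclideanSpace ℝ (Fin d)}
    (hf : ∀ k, Measurable fun x => f x k) (k : Fin r) :
    Measurable fun x => InnerProductSpace.gramSchmidt ℝ (f x) k := by
  induction k using WellFoundedLT.induction with
  | _ k ih =>
    simp only [InnerProductSpace.gramSchmidt_def ℝ _ k, Submodule.starProjection_singleton]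
    refine (hf k).sub (Finset.measurable_sum _ fun i hi => ?_)
    have hi' := ih i (Finset.mem_Iio.1 hi)
    exact ((hi'.inner (hf k)).div (hi'.norm.pow_const 2)).smul hi'

lemma _root_.Measurable.qrQ {d r : ℕ} {A : α → Matrix (Fin d) (Fin r) ℝ} (hA : Measurable A) :
    Measurable fun x => qrQ (A x) := by
  refine measurable_matrix_iff.2 fun i k => ?_
  have hf : ∀ k, Measurable fun x => (WithLp.toLp 2 fun j => A x j k : EuclideanSpace ℝ (Fin d)) :=
    fun k => (WithLp.measurable_toLp 2 _).comp (measurable_pi_lambda _ fun j => hA.matrix_entry j k)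
  have hg := measurable_gramSchmidt hf k
  have h2 : Measurable fun x => InnerProductSpace.gramSchmidtNormed ℝ
      (fun l : Fin r => (WithLp.toLp 2 fun j => A x j l : EuclideanSpace ℝ (Fin d))) k := by
    unfold InnerProductSpace.gramSchmidtNormed
    exact hg.norm.inv.smul hg
  exact (measurable_pi_apply i).comp ((WithLp.measurable_ofLp 2 _).comp h2)

lemma _root_.Measurable.agree {L : ℕ} {G : SimpleGraph (Fin L)} {W : Matrix (Fin L) (Fin L) ℝ}
    (hW : IsWeightMatrix G W) {d r : ℕ} (k : ℕ) {Z : Fin L → α → Matrix (Fin d) (Fin r) ℝ}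
    (hZ : ∀ g, Measurable (Z g)) (g : Fin L) : Measurable fun x => agree G W k (fun g => Z g x) g := by
  simp only [agree_eq hW]
  exact Measurable.matrix_sum fun j _ => Measurable.matrix_smul measurable_const (hZ j)

variable {d T r L n K : ℕ} (c : Config T n L K) (Θ : Matrix (Fin d) (Fin T) ℝ)
  {x : α → Coord T n d r → ℝ}

lemma measurable_splitX (hx : Measurable x) (l : ℕ) (t : Fin T) :
    Measurable fun a => splitX c (canonData Θ (x a)) l t :=
  (measurable_rowMatrix fun i => sampleRow r c d l (t, i)).comp hx

lemma measurable_bStep (hx : Measurable x) {U : α → Fin L → Matrix (Fin d) (Fin r) ℝ}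
    (hU : Measurable U) (τ : ℕ) (t : Fin T) :
    Measurable fun a => bStep c (canonData Θ (x a)) τ (U a) t := by
  have hX := measurable_splitX c Θ hx (τ + 1) t
  have hM : Measurable fun a => splitX c (canonData Θ (x a)) (τ + 1) t * U a (c.node t) :=
    hX.matrix_mul (measurable_pi_iff.1 hU _)
  have hY : Measurable fun a => splitX c (canonData Θ (x a)) (τ + 1) t *ᵥ Θ.col t :=
    hX.mulVec measurable_const
  exact (((hM.matrix_transpose.matrix_mul hM).matrix_inv).matrix_mul hM.matrix_transpose).mulVec hY

lemma _root_.Measurable.vecMulVec {m n : Type*} {v : α → m → ℝ} {w : α → n → ℝ} (hv : Measurable v)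
    (hw : Measurable w) : Measurable fun a => vecMulVec (v a) (w a) :=
  measurable_matrix_iff.2 fun i j =>
    (measurable_pi_iff.1 hv i).mul (measurable_pi_iff.1 hw j)

lemma measurable_localGrad (hx : Measurable x) {U : α → Fin L → Matrix (Fin d) (Fin r) ℝ}
    (hU : Measurable U) (τ : ℕ) (j : Fin L) :
    Measurable fun a => localGrad c (canonData Θ (x a)) τ (U a) j := by
  refine Measurable.matrix_sum fun t _ => ?_
  have hb := measurable_bStep c Θ hx hU τ t
  have hX := measurable_splitX c Θ hx (τ + K + 1) t
  refine Measurable.vecMulVec (hX.matrix_transpose.mulVec (Measurable.sub (hX.mulVec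
    ((measurable_pi_iff.1 hU j).mulVec hb)) ?_)) hb
  exact hX.mulVec measurable_const

lemma measurable_gdStep (hW : IsWeightMatrix c.graph c.W) (hx : Measurable x)
    {U : α → Fin L → Matrix (Fin d) (Fin r) ℝ} (hU : Measurable U) (τ : ℕ) :
    Measurable fun a => gdStep c (canonData Θ (x a)) τ (U a) := by
  refine measurable_pi_lambda _ fun g => ?_
  unfold gdStep
  refine Measurable.qrQ (Measurable.agree hW _ (Z := fun g' a => U a g' - (c.η * (L : ℝ)) •
    localGrad c (canonData Θ (x a)) τ (U a) g') (fun g' => ?_) g)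
  exact (measurable_pi_iff.1 hU g').matrix_sub
    (Measurable.matrix_smul measurable_const (measurable_localGrad c Θ hx hU τ g'))

lemma measurable_pot [NeZero L] (Us : Matrix (Fin d) (Fin r) ℝ) (A : ℝ)
    {U : α → Fin L → Matrix (Fin d) (Fin r) ℝ} (hU : Measurable U) :
    Measurable fun a => pot Us A (U a) := by
  unfold pot
  have hUg := measurable_pi_iff.1 hU
  have hs : MeasurableSet {a | ∀ g, (U a g)ᵀ * U a g = 1} := by
    have : {a | ∀ g, (U a g)ᵀ * U a g = 1} = ⋂ g, {a | (U a g)ᵀ * U a g = 1} := by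
      ext; simp
    rw [this]
    exact MeasurableSet.iInter fun g =>
      ((hUg g).matrix_transpose.matrix_mul (hUg g)) (measurableSet_singleton _)
  refine Measurable.ite hs (Measurable.max ?_ (Measurable.const_mul ?_ _)) measurable_const
  · exact measurable_norm.comp (measurable_pi_lambda _ fun g => measurable_const.matrix_mul (hUg g))
  · exact measurable_norm.comp (measurable_pi_lambda _ fun g => (hUg g).matrix_sub (hUg 0))

lemma measurable_gradDev (hx : Measurable x) {U : α → Fin L → Matrix (Fin d) (Fin r) ℝ}
    (hU : Measurable U) (τ : ℕ) (j : Fin L) :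
    Measurable fun a => gradDev c Θ (canonData Θ (x a)) τ (U a) j := by
  refine Measurable.matrix_sum fun t _ => ?_
  have hb := measurable_bStep c Θ hx hU τ t
  have hX := measurable_splitX c Θ hx (τ + K + 1) t
  exact Measurable.vecMulVec (((hX.matrix_transpose.matrix_mul hX).matrix_sub measurable_const).mulVec
    (((measurable_pi_iff.1 hU _).mulVec hb).sub measurable_const)) hb

lemma measurable_totalDev (hx : Measurable x) {U : α → Fin L → Matrix (Fin d) (Fin r) ℝ}
    (hU : Measurable U) (τ : ℕ) :
    Measurable fun a => totalDev c Θ (canonData Θ (x a)) τ (U a) := by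
  unfold totalDev
  have h := measurable_gradDev c Θ hx hU τ
  exact ((Measurable.matrix_sum fun j _ => h j).matrix_norm.const_mul _).add
    ((Finset.measurable_sum _ fun j _ => (h j).matrix_norm.const_mul _).const_mul _)

lemma measurableSet_coeffAccurate (hx : Measurable x) {U : α → Fin L → Matrix (Fin d) (Fin r) ℝ}
    (hU : Measurable U) (τ : ℕ) (q : ℝ) :
    MeasurableSet {a | CoeffAccurate c Θ (canonData Θ (x a)) τ q (U a)} := by
  have : {a | CoeffAccurate c Θ (canonData Θ (x a)) τ q (U a)} = ⋂ t,
      {a | nrm (bStep c (canonData Θ (x a)) τ (U a) t - (U a (c.node t))ᵀ *ᵥ Θ.col t) ≤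
        q * nrm ((1 - U a (c.node t) * (U a (c.node t))ᵀ) *ᵥ Θ.col t)} := by
    ext; simp [CoeffAccurate]
  rw [this]
  refine MeasurableSet.iInter fun t => measurableSet_le ?_ ?_
  · have hU' := measurable_pi_iff.1 hU (c.node t)
    exact ((measurable_bStep c Θ hx hU τ t).sub (hU'.matrix_transpose.mulVec measurable_const)).nrm
  · have hU' := measurable_pi_iff.1 hU (c.node t)
    exact (((measurable_const.matrix_sub (hU'.matrix_mul hU'.matrix_transpose)).mulVec
      measurable_const).nrm).const_mul _

end Measurability

section Locality
variable {d T r L n K : ℕ} {c : Config T n L K} {Θ : Matrix (Fin d) (Fin T) ℝ}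

/-- The index set of the samples of a set of the split. -/
def inSplit (c : Config T n L K) (l : ℕ) : Coord T n d r → Prop
  | Sum.inl q => (c.part q.2.1 : ℕ) = l
  | Sum.inr _ => False

lemma splitX_congr {l : ℕ} {x y : Coord T n d r → ℝ} (h : ∀ q, inSplit c l q → x q = y q) (t : Fin T) :
    splitX c (canonData Θ x) l t = splitX c (canonData Θ y) l t := by
  ext i j
  exact h (Sum.inl (t, i.1, j)) i.2

lemma bStep_congr {τ : ℕ} {x y : Coord T n d r → ℝ} (h : ∀ q, inSplit c (τ + 1) q → x q = y q)
    (U : Fin L → Matrix (Fin d) (Fin r) ℝ) (t : Fin T) :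
    bStep c (canonData Θ x) τ U t = bStep c (canonData Θ y) τ U t := by
  have e1 := splitX_congr (Θ := Θ) h t
  change pinv (splitX c (canonData Θ x) (τ + 1) t * U (c.node t)) *ᵥ
    (splitX c (canonData Θ x) (τ + 1) t *ᵥ Θ.col t) = pinv (splitX c (canonData Θ y) (τ + 1) t * U (c.node t)) *ᵥ
    (splitX c (canonData Θ y) (τ + 1) t *ᵥ Θ.col t)
  rw [e1]

lemma gdStep_congr {τ : ℕ} {x y : Coord T n d r → ℝ} (h : ∀ q, inSplit c (τ + 1) q → x q = y q)
    (h' : ∀ q, inSplit c (τ + K + 1) q → x q = y q) (U : Fin L → Matrix (Fin d) (Fin r) ℝ) :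
    gdStep c (canonData Θ x) τ U = gdStep c (canonData Θ y) τ U := by
  have e : localGrad c (canonData Θ x) τ U = localGrad c (canonData Θ y) τ U := by
    ext1 j
    unfold canonData
    rw [localGrad_linearData, localGrad_linearData]
    refine Finset.sum_congr rfl fun t _ => ?_
    have e1 := splitX_congr (Θ := Θ) h' t
    have e2 := bStep_congr (Θ := Θ) h U t
    unfold canonData at e1 e2
    rw [e1, e2]
  unfold gdStep
  rw [e]

end Locality

lemma exp_add_average_le {L : ℕ} [NeZero L] (a : ℝ) (b : Fin L → ℝ) :
    exp (a + 1 / L * ∑ j, b j) ≤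
      1 / 2 * exp (2 * a) + 1 / 2 * (1 / L * ∑ j, exp (2 * b j)) := by
  have hL : (0 : ℝ) < L := by exact_mod_cast NeZero.pos L
  have h1 := convexOn_exp.map_sum_le (t := Finset.univ) (w := fun _ : Fin L => 1 / (L : ℝ))
    (p := fun j => 2 * b j) (fun _ _ => by positivity) (by simp) (fun _ _ => Set.mem_univ _)
  simp only [smul_eq_mul, ← Finset.mul_sum] at h1
  have h2 := convexOn_exp.2 (Set.mem_univ (2 * a)) (Set.mem_univ (1 / L * (2 * ∑ j, b j)))
    (show (0 : ℝ) ≤ 1 / 2 by norm_num) (show (0 : ℝ) ≤ 1 / 2 by norm_num) (by norm_num)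
  simp only [smul_eq_mul] at h2
  calc exp (a + 1 / L * ∑ j, b j) =
        exp (1 / 2 * (2 * a) + 1 / 2 * (1 / L * (2 * ∑ j, b j))) := by congr 1; ring
    _ ≤ _ := h2
    _ ≤ _ := by gcongr

section Moments
variable {d T r L n K : ℕ} [NeZero L] {Us : Matrix (Fin d) (Fin r) ℝ} {bs : Matrix (Fin r) (Fin T) ℝ}
  {σ κ : ℝ} {c : Config T n L K}

/-- Deviation of the gradients with prescribed coefficients. -/
noncomputable def fixedDev (c : Config T n L K) (Θ : Matrix (Fin d) (Fin T) ℝ) (τ : ℕ)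
    (U : Fin L → Matrix (Fin d) (Fin r) ℝ) (b : Fin T → Fin r → ℝ) (x : Coord T n d r → ℝ) (j : Fin L) :
    Matrix (Fin d) (Fin r) ℝ :=
  ∑ t ∈ Finset.univ.filter (fun t => c.node t = j),
    vecMulVec (((rowMatrix (fun i => sampleRow r c d (τ + K + 1) (t, i)) x)ᵀ *
      rowMatrix (fun i => sampleRow r c d (τ + K + 1) (t, i)) x - (c.size (τ + K + 1) : ℝ) • 1) *ᵥ
      (U (c.node t) *ᵥ b t - Θ.col t)) (b t)

lemma measurable_fixedDev {α : Type*} [MeasurableSpace α] (Θ : Matrix (Fin d) (Fin T) ℝ) (τ : ℕ)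
    (U : Fin L → Matrix (Fin d) (Fin r) ℝ) {b : α → Fin T → Fin r → ℝ} {x : α → Coord T n d r → ℝ}
    (hb : Measurable b) (hx : Measurable x) (j : Fin L) :
    Measurable fun a => fixedDev c Θ τ U (b a) (x a) j := by
  refine Measurable.matrix_sum fun t _ => ?_
  have hb' := measurable_pi_iff.1 hb t
  have hX := (measurable_rowMatrix fun i => sampleRow r c d (τ + K + 1) (t, i)).comp hx
  exact Measurable.vecMulVec (((hX.matrix_transpose.matrix_mul hX).matrix_sub measurable_const).mulVec
    ((measurable_const.mulVec hb').sub measurable_const)) hb'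

/-- Exponential moments of the deviation for accurate coefficients. -/
lemma lintegral_exp_fixedDev_le (hG : GroundTruth Us bs σ κ) {τ : ℕ} {N : ℕ}
    (hN : c.size (τ + K + 1) = N) (hN0 : 0 < N) (hη : c.η = 0.4 / (N * σ ^ 2)) {μ : ℝ} (hμ : 1 ≤ μ)
    (hinc : ∀ t, nrm (bs.col t) ^ 2 ≤ μ ^ 2 * (r / T) * σ ^ 2) (hT : 1 ≤ T) (hrd : r ≤ d)
    (hsamp : 6e7 * κ ^ 4 * μ ^ 2 * r * (d + T) ≤ N * T) {ψ : ℝ} (hψ0 : 0 < ψ) (hψ : ψ ≤ basin r κ)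
    {U : Fin L → Matrix (Fin d) (Fin r) ℝ} (hs : GoodState Us (200 * r * κ ^ 2) ψ U)
    {b : Fin T → Fin r → ℝ}
    (hb : ∀ t, nrm (b t - (U (c.node t))ᵀ *ᵥ (Us *ᵥ bs.col t)) ≤
      0.1 * nrm ((1 - U (c.node t) * (U (c.node t))ᵀ) *ᵥ (Us *ᵥ bs.col t))) :
    ∫⁻ x, ofReal (exp (500 * κ ^ 2 * (d + T) / ψ *
      (c.η * ‖∑ j, fixedDev c (Us * bs) τ U b x j‖ +
        1 / L * ∑ j, c.η * ‖fixedDev c (Us * bs) τ U b x j‖))) ∂gaussM (Coord T n d r) ≤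
      ofReal (exp (5 * (d + T))) := by
  have hκ := hG.one_le
  have hσ := hG.sigma_pos
  have hrN : (1 : ℝ) ≤ r := by exact_mod_cast hG.rank_pos
  have hTR : (1 : ℝ) ≤ T := by exact_mod_cast hT
  have hNR : (0 : ℝ) < N := by exact_mod_cast hN0
  have hdR : (r : ℝ) ≤ d := by exact_mod_cast hrd
  have hκκ : 1 ≤ κ ^ 2 := one_le_pow₀ hκ
  have hψ1 : ψ ≤ 1 := hψ.trans ((basin_le hG.rank_pos hκ).trans (by norm_num))
  set a : ℝ := sqrt (μ ^ 2 * (r / T) * σ ^ 2) with ha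
  have haa : a ^ 2 = μ ^ 2 * (r / T) * σ ^ 2 := Real.sq_sqrt (by positivity)
  have ha0 : 0 ≤ a := Real.sqrt_nonneg _
  have hba : ∀ t, nrm (bs.col t) ≤ a := fun t => Real.le_sqrt_of_sq_le (hinc t)
  set B : Matrix (Fin r) (Fin T) ℝ := Matrix.of fun k t => b t k with hB
  have hBc : ∀ t, B.col t = b t := fun _ => rfl
  have hr0 : 0 ≤ sqrt r := Real.sqrt_nonneg _
  have hcond := coeff_conditioning (B := B) (node := c.node) hG hs (by nlinarith)
    (((mul_le_mul_of_nonneg_left hψ hr0).trans (sqrt_mul_basin hG.rank_pos).le).trans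
      (by gcongr; norm_num)) hψ0.le hb
  have hce := fun t => hs.coeff_error hG.orth hψ1 (by norm_num) (c.node t) _ _ (hb t)
  set s : ℝ := 400 * κ ^ 2 * (d + T) / (N * σ ^ 2 * ψ) with hsdef
  have hs0 : 0 ≤ s := by positivity
  have hsη : 2 * (500 * κ ^ 2 * (d + T) / ψ * c.η) = s := by
    rw [hη, hsdef]; field_simp; norm_num
  have hα : ∀ t, nrm (U (c.node t) *ᵥ b t - (Us * bs).col t) ≤ 1.1 * ψ * a := fun t => by
    rw [mul_col_eq]
    refine (hce t).1.trans ?_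
    calc (1 + 0.1) * ψ * nrm (bs.col t) ≤ (1 + 0.1) * ψ * a := by gcongr; exact hba t
      _ = _ := by norm_num
  have hβ : ∀ t, nrm (B.col t) ≤ 1.1 * a := fun t => by
    refine (hce t).2.trans ?_
    calc (1 + 0.1) * nrm (bs.col t) ≤ (1 + 0.1) * a := by gcongr; exact hba t
      _ = _ := by norm_num
  have hsa : s * ψ * a ^ 2 * (N * T) = 400 * κ ^ 2 * (d + T) * (μ ^ 2 * r) := by
    rw [hsdef, haa]; field_simp
  have hNT : 0 < (N : ℝ) * T := by positivity
  have hm1 : 4 * s * (1.1 * ψ * a * (1.1 * a)) ≤ 1 / 8 := by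
    have h1 : s * ψ * a ^ 2 ≤ 1 / 100 := by
      refine le_of_mul_le_mul_right ?_ hNT
      rw [hsa]
      have h2 : κ ^ 2 * ((d + T) * (μ ^ 2 * r)) ≤ κ ^ 4 * ((d + T) * (μ ^ 2 * r)) := by
        gcongr 1
        exact pow_le_pow_right₀ hκ (by norm_num)
      have h3 : 6e7 * (κ ^ 4 * ((d + T) * (μ ^ 2 * r))) ≤ N * T :=
        le_trans (le_of_eq (by ring)) hsamp
      have h0 : 0 ≤ κ ^ 4 * ((d + T) * (μ ^ 2 * r)) := by positivity
      have e1 : 400 * κ ^ 2 * (d + T) * (μ ^ 2 * r) = 400 * (κ ^ 2 * ((d + T) * (μ ^ 2 * r))) := by ring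
      rw [e1]
      linarith
    have e1 : 4 * s * (1.1 * ψ * a * (1.1 * a)) = 4.84 * (s * ψ * a ^ 2) := by ring
    rw [e1]
    linarith
  have hm2 : 256 * s ^ 2 * (1.1 * ψ * a) ^ 2 * (1.01 * σ) ^ 2 * N ≤ d + T := by
    have e : 256 * s ^ 2 * (1.1 * ψ * a) ^ 2 * (1.01 * σ) ^ 2 * N * (N * T) =
        256 * 1.1 ^ 2 * 1.01 ^ 2 * (s * ψ * a ^ 2 * (N * T)) * (s * ψ * (σ ^ 2 * N)) := by ring
    have e2 : s * ψ * (σ ^ 2 * N) = 400 * κ ^ 2 * (d + T) := by rw [hsdef]; field_simp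
    refine le_of_mul_le_mul_right ?_ hNT
    rw [e, hsa, e2]
    have h3 : (d + T : ℝ) * (6e7 * κ ^ 4 * μ ^ 2 * r * (d + T)) ≤ (d + T) * (N * T) := by gcongr
    refine le_trans ?_ h3
    calc _ = (256 * 1.1 ^ 2 * 1.01 ^ 2 * 160000) * (κ ^ 4 * (d + T) * (μ ^ 2 * r) * (d + T)) := by ring
      _ ≤ 6e7 * (κ ^ 4 * (d + T) * (μ ^ 2 * r) * (d + T)) :=
        mul_le_mul_of_nonneg_right (by norm_num) (by positivity)
      _ = _ := by ring
  have hmgf : ∀ S : Finset (Fin T), ∫⁻ x, ofReal (exp (s * ‖∑ t ∈ S,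
      vecMulVec (((rowMatrix (fun i => sampleRow r c d (τ + K + 1) (t, i)) x)ᵀ *
        rowMatrix (fun i => sampleRow r c d (τ + K + 1) (t, i)) x - (c.size (τ + K + 1) : ℝ) • 1) *ᵥ
        (U (c.node t) *ᵥ b t - (Us * bs).col t)) (b t)‖)) ∂gaussM (Coord T n d r) ≤
      ofReal (exp (5 * (d + T))) := fun S => by
    have h4 := lintegral_exp_gradDev_le (sampleRow_injective (r := r) (d := d) c (τ + K + 1)) S
      (fun t => U (c.node t) *ᵥ b t - (Us * bs).col t) B hs0 hα hβ hcond.1 hm1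
    refine h4.trans (ENNReal.ofReal_le_ofReal (Real.exp_le_exp.2 ?_))
    have hc : Fintype.card (c.Idx (τ + K + 1)) = N := hN
    rw [hc]
    push_cast
    linarith
  have hjm : ∀ j, Measurable fun x => fixedDev c (Us * bs) τ U b x j :=
    fun j => measurable_fixedDev _ _ _ measurable_const measurable_id j
  have hem : ∀ j, Measurable fun x => ofReal (exp (s * ‖fixedDev c (Us * bs) τ U b x j‖)) :=
    fun j => ((hjm j).matrix_norm.const_mul s).exp.ennreal_ofReal
  have hem' : Measurable fun x => ofReal (exp (s * ‖∑ j, fixedDev c (Us * bs) τ U b x j‖)) :=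
    ((Measurable.matrix_sum fun j _ => hjm j).matrix_norm.const_mul s).exp.ennreal_ofReal
  set E := ofReal (exp (5 * (d + T))) with hE
  have hL : (0 : ℝ) < L := by exact_mod_cast NeZero.pos L
  calc _ ≤ ∫⁻ x, (ofReal (1 / 2) * ofReal (exp (s * ‖∑ j, fixedDev c (Us * bs) τ U b x j‖)) +
          ∑ j, ofReal (1 / 2 * (1 / L)) *
            ofReal (exp (s * ‖fixedDev c (Us * bs) τ U b x j‖))) ∂gaussM (Coord T n d r) := by
        refine lintegral_mono fun x => ?_
        rw [← ENNReal.ofReal_mul (by norm_num)]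
        simp only [← ENNReal.ofReal_mul (show (0 : ℝ) ≤ 1 / 2 * (1 / L) by positivity)]
        rw [← ENNReal.ofReal_sum_of_nonneg fun _ _ => by positivity,
          ← ENNReal.ofReal_add (by positivity) (Finset.sum_nonneg fun _ _ => by positivity)]
        refine ENNReal.ofReal_le_ofReal ?_
        have h5 := exp_add_average_le (500 * κ ^ 2 * (d + T) / ψ * (c.η * ‖∑ j, fixedDev c (Us * bs) τ U b x j‖))
          fun j => 500 * κ ^ 2 * (d + T) / ψ * (c.η * ‖fixedDev c (Us * bs) τ U b x j‖)
        have e1 : ∀ y : ℝ, 2 * (500 * κ ^ 2 * (d + T) / ψ * (c.η * y)) = s * y := fun y => by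
          rw [← hsη]; ring
        simp only [e1] at h5
        rw [mul_add]
        refine le_trans (le_of_eq ?_) (h5.trans (le_of_eq ?_))
        · congr 1
          rw [Finset.mul_sum, Finset.mul_sum, Finset.mul_sum]
          congr 1
          exact Finset.sum_congr rfl fun j _ => by ring
        · rw [← mul_assoc, Finset.mul_sum]
    _ = ofReal (1 / 2) * ∫⁻ x, ofReal (exp (s * ‖∑ j, fixedDev c (Us * bs) τ U b x j‖))
          ∂gaussM (Coord T n d r) + ∑ j, ofReal (1 / 2 * (1 / L)) *
            ∫⁻ x, ofReal (exp (s * ‖fixedDev c (Us * bs) τ U b x j‖)) ∂gaussM (Coord T n d r) := by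
        rw [lintegral_add_left (hem'.const_mul _), lintegral_const_mul _ hem',
          lintegral_finsetSum _ fun j _ => (hem j).const_mul _]
        congr 1
        exact Finset.sum_congr rfl fun j _ => lintegral_const_mul _ (hem j)
    _ ≤ ofReal (1 / 2) * E + ∑ j : Fin L, ofReal (1 / 2 * (1 / L)) * E := by
        gcongr with j
        · have := hmgf Finset.univ
          refine le_trans (le_of_eq ?_) this
          refine lintegral_congr fun x => ?_
          congr 4
          exact Finset.sum_fiberwise _ _ _
        · exact hmgf _
    _ = E := by
        rw [Finset.sum_const, Finset.card_univ, Fintype.card_fin, nsmul_eq_mul, ← mul_assoc, ← add_mul,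
          ← ENNReal.ofReal_natCast, ← ENNReal.ofReal_mul (by positivity), ← ENNReal.ofReal_add (by norm_num) (by positivity)]
        have : (1 / 2 + (L : ℝ) * (1 / 2 * (1 / L))) = 1 := by field_simp; norm_num
        rw [this]; simp

/-- Exponential moments of the total deviation on the event that the coefficients are accurate. -/
lemma setLIntegral_exp_totalDev_le (hG : GroundTruth Us bs σ κ) {τ : ℕ} {N : ℕ} (hK : 1 ≤ K)
    (hN : c.size (τ + K + 1) = N) (hN0 : 0 < N) (hη : c.η = 0.4 / (N * σ ^ 2)) {μ : ℝ} (hμ : 1 ≤ μ)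
    (hinc : ∀ t, nrm (bs.col t) ^ 2 ≤ μ ^ 2 * (r / T) * σ ^ 2) (hT : 1 ≤ T) (hrd : r ≤ d)
    (hsamp : 6e7 * κ ^ 4 * μ ^ 2 * r * (d + T) ≤ N * T) {ψ : ℝ} (hψ0 : 0 < ψ) (hψ : ψ ≤ basin r κ)
    {U : Fin L → Matrix (Fin d) (Fin r) ℝ} (hs : GoodState Us (200 * r * κ ^ 2) ψ U) :
    ∫⁻ x in {x | CoeffAccurate c (Us * bs) (canonData (Us * bs) x) τ 0.1 U},
      ofReal (exp (500 * κ ^ 2 * (d + T) / ψ *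
        totalDev c (Us * bs) (canonData (Us * bs) x) τ U)) ∂gaussM (Coord T n d r) ≤
      ofReal (exp (5 * (d + T))) := by
  set Θ := Us * bs with hΘ
  set S : Set (Fin T → Fin r → ℝ) := {b | ∀ t, nrm (b t - (U (c.node t))ᵀ *ᵥ Θ.col t) ≤
      0.1 * nrm ((1 - U (c.node t) * (U (c.node t))ᵀ) *ᵥ Θ.col t)} with hS
  have hSm : MeasurableSet S := by
    have : S = ⋂ t, {b | nrm (b t - (U (c.node t))ᵀ *ᵥ Θ.col t) ≤
      0.1 * nrm ((1 - U (c.node t) * (U (c.node t))ᵀ) *ᵥ Θ.col t)} := by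
      ext; simp [hS]
    rw [this]
    exact MeasurableSet.iInter fun t =>
      measurableSet_le ((measurable_pi_apply t).sub measurable_const).nrm measurable_const
  set f : (Coord T n d r → ℝ) → Fin T → Fin r → ℝ := fun x => bStep c (canonData Θ x) τ U with hf
  have hfm : Measurable f := measurable_pi_lambda _ fun t =>
    measurable_bStep c Θ measurable_id measurable_const τ t
  set q : ℝ := 500 * κ ^ 2 * (d + T) / ψ with hq
  set h : (Fin T → Fin r → ℝ) → (Coord T n d r → ℝ) → ENNReal := fun b x =>
    S.indicator (fun b => ofReal (exp (q * (c.η * ‖∑ j, fixedDev c Θ τ U b x j‖ +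
        1 / L * ∑ j, c.η * ‖fixedDev c Θ τ U b x j‖)))) b with hh
  have hhm : Measurable (Function.uncurry h) := by
    have e : Function.uncurry h = (Prod.fst ⁻¹' S).indicator fun p : (Fin T → Fin r → ℝ) × (Coord T n d r → ℝ) =>
        ofReal (exp (q * (c.η * ‖∑ j, fixedDev c Θ τ U p.1 p.2 j‖ +
        1 / L * ∑ j, c.η * ‖fixedDev c Θ τ U p.1 p.2 j‖))) := by
      ext ⟨b, x⟩
      simp only [Function.uncurry_apply_pair, hh]
      by_cases hb : b ∈ S
      · rw [Set.indicator_of_mem hb, Set.indicator_of_mem (show (b, x) ∈ Prod.fst ⁻¹' S from hb)]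
      · rw [Set.indicator_of_notMem hb, Set.indicator_of_notMem (show (b, x) ∉ Prod.fst ⁻¹' S from hb)]
    rw [e]
    refine Measurable.indicator ?_ (measurable_fst hSm)
    have hj := fun j => measurable_fixedDev (c := c) Θ τ U
      (measurable_fst (α := Fin T → Fin r → ℝ) (β := Coord T n d r → ℝ)) measurable_snd j
    exact ((((Measurable.matrix_sum fun j _ => hj j).matrix_norm.const_mul _).add
      ((Finset.measurable_sum _ fun j _ => (hj j).matrix_norm.const_mul _).const_mul _)).const_mul
        q).exp.ennreal_ofReal
  have hA : MeasurableSet {x | CoeffAccurate c Θ (canonData (r := r) Θ x) τ 0.1 U} :=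
    measurableSet_coeffAccurate c Θ measurable_id measurable_const τ _
  rw [← lintegral_indicator hA]
  have e1 : ∀ x, {x | CoeffAccurate c Θ (canonData (r := r) Θ x) τ 0.1 U}.indicator (fun x =>
      ofReal (exp (q * totalDev c Θ (canonData Θ x) τ U))) x = h (f x) x := fun x => by
    by_cases hx : x ∈ {x | CoeffAccurate c Θ (canonData (r := r) Θ x) τ 0.1 U}
    · rw [Set.indicator_of_mem hx, hh]
      have : f x ∈ S := hx
      simp only
      rw [Set.indicator_of_mem this]
      rfl
    · rw [Set.indicator_of_notMem hx, hh]
      have : f x ∉ S := hx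
      simp only
      rw [Set.indicator_of_notMem this]
  rw [lintegral_congr e1, lintegral_decouple (fun _ => gaussianReal 0 1) (inSplit c (τ + K + 1)) hfm hhm]
  · calc _ ≤ ∫⁻ _ : Coord T n d r → ℝ, ofReal (exp (5 * (d + T))) ∂gaussM (Coord T n d r) := by
          refine lintegral_mono fun x => ?_
          by_cases hx : f x ∈ S
          · simp only [hh, Set.indicator_of_mem hx]
            refine lintegral_exp_fixedDev_le hG hN hN0 hη hμ hinc hT hrd hsamp hψ0 hψ hs fun t => ?_
            have := hx t
            rwa [hΘ, mul_col_eq] at this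
          · simp [hh, Set.indicator_of_notMem hx]
      _ = _ := by simp
  · intro x y hxy
    ext1 t
    refine bStep_congr (fun p hp => hxy p fun hp' => ?_) U t
    rcases p with p | p
    · have h1 : (c.part p.2.1 : ℕ) = τ + 1 := hp
      have h2 : (c.part p.2.1 : ℕ) = τ + K + 1 := hp'
      omega
    · exact hp
  · intro b x y hxy
    have e2 : ∀ j, fixedDev c Θ τ U b x j = fixedDev c Θ τ U b y j := fun j => by
      unfold fixedDev
      refine Finset.sum_congr rfl fun t _ => ?_
      have := splitX_congr (Θ := Θ) hxy t
      rw [splitX_canonData, splitX_canonData] at this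
      rw [this]
    by_cases hb : b ∈ S
    · simp only [hh, Set.indicator_of_mem hb, e2]
    · simp only [hh, Set.indicator_of_notMem hb]

/-- Fractional exponential moments. -/
lemma setLIntegral_exp_frac_le {Ω : Type*} [MeasurableSpace Ω] {P : Measure Ω} [IsProbabilityMeasure P]
    {A : Set Ω} {Y : Ω → ℝ} (hY : Measurable Y) {c θ : ℝ} (hθ0 : 0 ≤ θ) (hθ1 : θ ≤ 1)
    (h : ∫⁻ x in A, ofReal (exp (Y x)) ∂P ≤ ofReal (exp c)) :
    ∫⁻ x in A, ofReal (exp (θ * Y x)) ∂P ≤ ofReal (exp (θ * c)) := by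
  have hm : Measurable fun x => ofReal (exp (Y x)) := hY.exp.ennreal_ofReal
  calc _ ≤ ∫⁻ x in A, (ofReal (exp (θ * c) * (1 - θ)) +
        ofReal (exp (θ * c) * θ * exp (-c)) * ofReal (exp (Y x))) ∂P := by
        refine lintegral_mono fun x => ?_
        rw [← ENNReal.ofReal_mul (by positivity), ← ENNReal.ofReal_add
          (mul_nonneg (Real.exp_pos _).le (by linarith)) (by positivity)]
        refine ENNReal.ofReal_le_ofReal ?_
        have h1 := convexOn_exp.2 (Set.mem_univ (0 : ℝ)) (Set.mem_univ (Y x - c))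
          (show 0 ≤ 1 - θ by linarith) hθ0 (by ring)
        simp only [smul_eq_mul, mul_zero, zero_add, Real.exp_zero, mul_one] at h1
        have h2 : exp (θ * Y x) = exp (θ * c) * exp (θ * (Y x - c)) := by
          rw [← Real.exp_add]; congr 1; ring
        have h3 : exp (Y x - c) = exp (-c) * exp (Y x) := by
          rw [← Real.exp_add]; congr 1; ring
        rw [h2]
        calc _ ≤ exp (θ * c) * (1 - θ + θ * exp (Y x - c)) := by gcongr
          _ = _ := by rw [h3]; ring
    _ = ofReal (exp (θ * c) * (1 - θ)) * P A +
        ofReal (exp (θ * c) * θ * exp (-c)) *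
          ∫⁻ x in A, ofReal (exp (Y x)) ∂P := by
        rw [lintegral_add_left measurable_const, lintegral_const_mul _ hm, lintegral_const,
          Measure.restrict_apply_univ]
    _ ≤ ofReal (exp (θ * c) * (1 - θ)) * 1 +
        ofReal (exp (θ * c) * θ * exp (-c)) * ofReal (exp c) := by
        gcongr
        exact prob_le_one
    _ = _ := by
        rw [mul_one, ← ENNReal.ofReal_mul (by positivity), ← ENNReal.ofReal_add
          (mul_nonneg (Real.exp_pos _).le (by linarith)) (by positivity)]
        congr 1
        have : exp (-c) * exp c = 1 := by rw [← Real.exp_add]; simp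
        linear_combination exp (θ * c) * θ * this

/-- Integration of a function with polynomial growth on a rare event. -/
lemma setLIntegral_rare_le {Ω : Type*} [MeasurableSpace Ω] {P : Measure Ω}
    {F : Set Ω} {H : ℕ → Set Ω} {f : Ω → ENNReal} {b e Q : ℝ} (hb : 0 < b) (he : 0 < e) (hQ : 1 ≤ Q)
    (heQ : e ≤ 1) (hF : MeasurableSet F) (hPF : P F ≤ ofReal (e ^ 2 / Q))
    (hH : ∀ k, P (H k)ᶜ ≤ ofReal (Q / 16 ^ k))
    (hf : ∀ k, ∀ x ∈ F ∩ H k, f x ≤ ofReal (b * 2 ^ k)) :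
    ∫⁻ x in F, f x ∂P ≤ ofReal (5 * b * e) := by
  have hpt : ∀ x ∈ F, f x ≤ ofReal b + ∑' k : ℕ, (F ∩ toMeasurable P (H k)ᶜ).indicator
      (fun _ => ofReal (b * 2 ^ (k + 1))) x := by
    intro x hx
    by_cases hall : ∃ k, x ∈ H k
    · classical
      obtain ⟨k, hk, hmin⟩ : ∃ k, x ∈ H k ∧ ∀ j < k, x ∉ H j :=
        ⟨Nat.find hall, Nat.find_spec hall, fun j hj => Nat.find_min hall hj⟩
      rcases k with _ | k
      · refine (hf 0 x ⟨hx, hk⟩).trans ?_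
        simp
      · refine (hf _ x ⟨hx, hk⟩).trans (le_add_left ?_)
        refine le_trans ?_ (ENNReal.le_tsum k)
        rw [Set.indicator_of_mem]
        exact ⟨hx, subset_toMeasurable _ _ (hmin k (Nat.lt_succ_self k))⟩
    · push Not at hall
      refine le_trans le_top (le_add_left (top_le_iff.2 ?_).ge)
      have h1 : ∀ k : ℕ, ofReal b ≤ (F ∩ toMeasurable P (H k)ᶜ).indicator
          (fun _ => ofReal (b * 2 ^ (k + 1))) x := fun k => by
        rw [Set.indicator_of_mem (Set.mem_inter hx (subset_toMeasurable _ _ (hall k)))]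
        refine ENNReal.ofReal_le_ofReal (le_mul_of_one_le_right hb.le (one_le_pow₀ (by norm_num)))
      refine top_le_iff.1 ?_
      calc (⊤ : ENNReal) = ∑' _ : ℕ, ofReal b := by
            rw [ENNReal.tsum_const_eq_top_of_ne_zero]; simpa using hb
        _ ≤ _ := ENNReal.tsum_le_tsum h1
  have hmeas : ∀ k : ℕ, MeasurableSet (F ∩ toMeasurable P (H k)ᶜ) := fun k =>
    hF.inter (measurableSet_toMeasurable _ _)
  have hPk : ∀ k : ℕ, P (F ∩ toMeasurable P (H k)ᶜ) ≤ ofReal (e / 4 ^ k) := fun k => by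
    rcases le_or_gt (Q / 16 ^ k) (e / 4 ^ k) with h1 | h1
    · refine (measure_mono Set.inter_subset_right).trans ?_
      rw [measure_toMeasurable]
      exact (hH k).trans (ENNReal.ofReal_le_ofReal h1)
    · refine (measure_mono Set.inter_subset_left).trans (hPF.trans (ENNReal.ofReal_le_ofReal ?_))
      have e16 : (16 : ℝ) ^ k = 4 ^ k * 4 ^ k := by rw [← mul_pow]; norm_num
      have h4 : (0 : ℝ) < 4 ^ k := by positivity
      rw [e16, ← div_div, div_lt_div_iff_of_pos_right h4, lt_div_iff₀ h4] at h1
      rw [div_le_div_iff₀ (by linarith) h4]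
      nlinarith
  calc ∫⁻ x in F, f x ∂P ≤ ∫⁻ x in F, (ofReal b + ∑' k : ℕ, (F ∩ toMeasurable P (H k)ᶜ).indicator
      (fun _ => ofReal (b * 2 ^ (k + 1))) x) ∂P := setLIntegral_mono' hF hpt
    _ = ofReal b * P F + ∑' k : ℕ, ∫⁻ x in F, (F ∩ toMeasurable P (H k)ᶜ).indicator
      (fun _ => ofReal (b * 2 ^ (k + 1))) x ∂P := by
        rw [lintegral_add_left measurable_const, lintegral_tsum fun k =>
          (measurable_const.indicator (hmeas k)).aemeasurable]
        simp
    _ ≤ ofReal (b * e) + ∑' k : ℕ, ofReal (2 * b * e) * (2⁻¹) ^ k := by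
        refine add_le_add ?_ (ENNReal.tsum_le_tsum fun k => ?_)
        · rw [ENNReal.ofReal_mul hb.le]
          gcongr
          refine hPF.trans (ENNReal.ofReal_le_ofReal ?_)
          rw [div_le_iff₀ (by linarith)]; nlinarith
        · refine (setLIntegral_le_lintegral _ _).trans ?_
          rw [lintegral_indicator_const (hmeas k)]
          refine (mul_le_mul_of_nonneg_left (hPk k) zero_le).trans (le_of_eq ?_)
          have : (2⁻¹ : ENNReal) ^ k = ofReal (2⁻¹ ^ k) := by
            rw [ENNReal.ofReal_pow (by norm_num), ENNReal.ofReal_inv_of_pos (by norm_num)]; norm_num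
          rw [this, ← ENNReal.ofReal_mul (by positivity), ← ENNReal.ofReal_mul (by positivity)]
          congr 1
          have e4 : (4 : ℝ) ^ k = 2 ^ k * 2 ^ k := by rw [← mul_pow]; norm_num
          rw [e4, inv_pow, pow_succ]
          field_simp
    _ = ofReal (5 * b * e) := by
        rw [ENNReal.tsum_mul_left, ENNReal.tsum_geometric_two]
        rw [show (2 : ENNReal) = ofReal 2 by norm_num, ← ENNReal.ofReal_mul (by positivity),
          ← ENNReal.ofReal_add (by positivity) (by positivity)]
        congr 1; ring

end Moments

/-- The function of the normalized potential whose expectation does not increase. -/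
noncomputable def lyap (p β v : ℝ) : ℝ := v ^ p + β * v ^ (1 / 40 : ℝ)

lemma lyap_nonneg {p β v : ℝ} (hβ : 0 ≤ β) (hv : 0 ≤ v) : 0 ≤ lyap p β v := by
  unfold lyap; positivity

lemma measurable_lyap (p β : ℝ) : Measurable (lyap p β) := by
  unfold lyap; fun_prop

section Step
variable {d T r L n K : ℕ} [NeZero L] {Us : Matrix (Fin d) (Fin r) ℝ} {bs : Matrix (Fin r) (Fin T) ℝ}
  {σ κ : ℝ} {c : Config T n L K}

/-- Standing assumptions on the descent. -/
structure DescentSetup (c : Config T n L K) (Us : Matrix (Fin d) (Fin r) ℝ)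
    (bs : Matrix (Fin r) (Fin T) ℝ) (σ κ μ ω β : ℝ) (N : ℕ) : Prop where
  truth : GroundTruth Us bs σ κ
  weight : IsWeightMatrix c.graph c.W
  row_sum : ∀ g, ∑ j, (c.W ^ c.TconGD) g j = 1
  mixing : ∀ g j, |(c.W ^ c.TconGD) g j - 1 / L| ≤ ω / L ^ 2
  omega_nonneg : 0 ≤ ω
  omega_le : ω * (r ^ 2 * κ ^ 2) ≤ 1e-6
  steps : 1 ≤ K
  size_eq : ∀ l, 2 ≤ l → l < 2 * K + 2 → c.size l = N
  size_pos : 0 < N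
  rank_le : r ≤ N
  step_size : c.η = 0.4 / (N * σ ^ 2)
  one_le_mu : 1 ≤ μ
  incoherent : ∀ t, nrm (bs.col t) ^ 2 ≤ μ ^ 2 * (r / T) * σ ^ 2
  tasks : 1 ≤ T
  rank_le_dim : r ≤ d
  samples : 6e7 * κ ^ 4 * μ ^ 2 * r * (d + T) ≤ N * T
  beta_pos : 0 < β
  beta_le : β ≤ 1
  rare : 2 * T * exp (4 * r - 7e-6 * N) ≤
    (β * 1e-10 / (r ^ 2 * κ ^ 4)) ^ 2 / (T * (r ^ 2 + 2 * N * d))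

variable {μ ω β : ℝ} {N : ℕ}

/-- Moments of the deviation on the event of accurate coefficients. -/
lemma DescentSetup.moment_le (h : DescentSetup c Us bs σ κ μ ω β N) {τ : ℕ} (hτ : 1 ≤ τ) (hτK : τ ≤ K)
    {ψ : ℝ} (hψ0 : 0 < ψ) (hψ : ψ ≤ basin r κ)
    {U : Fin L → Matrix (Fin d) (Fin r) ℝ} (hs : GoodState Us (200 * r * κ ^ 2) ψ U) {a : ℝ} (ha : 0 ≤ a)
    (ha1 : 3 * a ≤ 500 * κ ^ 2 * (d + T)) :
    ∫⁻ x in {x | CoeffAccurate c (Us * bs) (canonData (Us * bs) x) τ 0.1 U},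
      ofReal (exp (a * (3 * (totalDev c (Us * bs) (canonData (Us * bs) x) τ U / ψ))))
        ∂gaussM (Coord T n d r) ≤ ofReal (exp (0.03 * a / κ ^ 2)) := by
  have h1 := setLIntegral_exp_totalDev_le h.truth h.steps (h.size_eq (τ + K + 1) (by omega) (by omega)) h.size_pos
    h.step_size h.one_le_mu h.incoherent h.tasks h.rank_le_dim h.samples hψ0 hψ hs
  have hκ := h.truth.one_le
  have hT : (1 : ℝ) ≤ T := by exact_mod_cast h.tasks
  have hq : 0 < 500 * κ ^ 2 * (d + T) := by positivity
  have h2 := setLIntegral_exp_frac_le (((measurable_totalDev c (Us * bs) measurable_id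
    (measurable_const (a := U)) τ).const_mul (500 * κ ^ 2 * (d + T) / ψ))) (θ := 3 * a / (500 * κ ^ 2 * (d + T)))
    (by positivity) (by rw [div_le_one hq]; exact ha1) h1
  refine le_trans (le_of_eq ?_) (h2.trans (le_of_eq ?_))
  · refine lintegral_congr fun x => ?_
    congr 2
    simp only [id_eq]
    field_simp
  · congr 2
    have : (0 : ℝ) < d + T := by positivity
    field_simp
    ring

/-- The capped and normalized potential after one step. -/
noncomputable def nextVal (c : Config T n L K) (Us : Matrix (Fin d) (Fin r) ℝ)
    (bs : Matrix (Fin r) (Fin T) ℝ) (κ D : ℝ) (τ : ℕ) (U : Fin L → Matrix (Fin d) (Fin r) ℝ)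
    (x : Coord T n d r → ℝ) : ℝ :=
  min (pot Us (200 * r * κ ^ 2) (gdStep c (canonData (Us * bs) x) τ U) / (D * exp (-0.1 / κ ^ 2))) 1

lemma nextVal_nonneg {D : ℝ} (hD : 0 ≤ D) (τ : ℕ) (U : Fin L → Matrix (Fin d) (Fin r) ℝ)
    (x : Coord T n d r → ℝ) : 0 ≤ nextVal c Us bs κ D τ U x :=
  le_min (div_nonneg (pot_nonneg _ _) (by positivity)) zero_le_one

lemma nextVal_le {D y : ℝ} (hκ : 1 ≤ κ) (hD : 0 < D) (hDb : D ≤ basin r κ) {τ : ℕ}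
    {U : Fin L → Matrix (Fin d) (Fin r) ℝ} {x : Coord T n d r → ℝ}
    (h : min (pot Us (200 * r * κ ^ 2) (gdStep c (canonData (Us * bs) x) τ U)) (basin r κ) ≤ y) :
    nextVal c Us bs κ D τ U x ≤ y / (D * exp (-0.1 / κ ^ 2)) := by
  have hE : 0 < D * exp (-0.1 / κ ^ 2) := by positivity
  have h1 : D * exp (-0.1 / κ ^ 2) ≤ basin r κ := by
    refine (mul_le_of_le_one_right hD.le ?_).trans hDb
    rw [Real.exp_le_one_iff]
    exact div_nonpos_of_nonpos_of_nonneg (by norm_num) (by positivity)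
  rw [le_div_iff₀ hE]
  refine le_trans ?_ h
  unfold nextVal
  rw [min_mul_of_nonneg _ _ hE.le, one_mul, div_mul_cancel₀ _ hE.ne']
  exact min_le_min_left _ h1

lemma DescentSetup.step_accurate (h : DescentSetup c Us bs σ κ μ ω β N) {τ : ℕ} (hτ : 1 ≤ τ) (hτK : τ ≤ K)
    {ψ D : ℝ} (hψ0 : 0 < ψ) (hψD : ψ ≤ D) (hD : D ≤ basin r κ)
    {U : Fin L → Matrix (Fin d) (Fin r) ℝ} (hs : GoodState Us (200 * r * κ ^ 2) ψ U) {a : ℝ} (ha : 0 ≤ a)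
    (ha1 : 3 * a ≤ 500 * κ ^ 2 * (d + T)) :
    ∫⁻ x in {x | CoeffAccurate c (Us * bs) (canonData (Us * bs) x) τ 0.1 U},
      ofReal (nextVal c Us bs κ D τ U x ^ a) ∂gaussM (Coord T n d r) ≤
      ofReal ((ψ / D) ^ a * exp (-0.15 * a / κ ^ 2)) := by
  have hD0 : 0 < D := hψ0.trans_le hψD
  have hκ := h.truth.one_le
  have hmeas := measurableSet_coeffAccurate c (Us * bs)
    (measurable_id (α := Coord T n d r → ℝ)) (measurable_const (a := U)) τ 0.1
  have hm : Measurable fun x : Coord T n d r → ℝ => ofReal (exp (a * (3 *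
      (totalDev c (Us * bs) (canonData (Us * bs) x) τ U / ψ)))) :=
    ((((measurable_totalDev c (Us * bs) measurable_id (measurable_const (a := U)) τ).div_const _).const_mul
      _).const_mul _).exp.ennreal_ofReal
  calc _ ≤ ∫⁻ x in {x | CoeffAccurate c (Us * bs) (canonData (Us * bs) x) τ 0.1 U},
        ofReal ((ψ / D) ^ a * exp (-0.18 * a / κ ^ 2)) *
        ofReal (exp (a * (3 * (totalDev c (Us * bs) (canonData (Us * bs) x) τ U / ψ))))
          ∂gaussM (Coord T n d r) := by
        refine setLIntegral_mono' hmeas fun x hx => ?_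
        rw [← ENNReal.ofReal_mul (by positivity)]
        refine ENNReal.ofReal_le_ofReal ?_
        have hsz := h.size_eq (τ + K + 1) (by omega) (by omega)
        have h1 := gdStep_pot_le h.truth h.weight h.row_sum h.mixing h.omega_nonneg h.omega_le
          (τ := τ) (by rw [hsz]; exact h.size_pos) (by rw [hsz]; exact h.step_size) hψ0 (hψD.trans hD) hs hx
        have h2 := nextVal_le (bs := bs) hκ hD0 hD h1
        set ξ := totalDev c (Us * bs) (canonData (Us * bs) x) τ U / ψ with hξ
        have h3 : nextVal c Us bs κ D τ U x ≤ ψ / D * exp (-0.18 / κ ^ 2 + 3 * ξ) := by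
          refine h2.trans (le_of_eq ?_)
          have e : exp (-0.28 / κ ^ 2 + 3 * ξ) =
              exp (-0.18 / κ ^ 2 + 3 * ξ) * exp (-0.1 / κ ^ 2) := by
            rw [← Real.exp_add]; congr 1; ring
          have e' : totalDev c (Us * bs) (linearData (Us * bs) (fun t => of fun i j => x (Sum.inl (t, i, j)))
            (of fun j k => x (Sum.inr (j, k)))) τ U / ψ = ξ := rfl
          rw [e', e]
          field_simp
        calc nextVal c Us bs κ D τ U x ^ a ≤ (ψ / D * exp (-0.18 / κ ^ 2 + 3 * ξ)) ^ a :=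
              Real.rpow_le_rpow (nextVal_nonneg hD0.le _ _ _) h3 ha
          _ = _ := by
            rw [Real.mul_rpow (by positivity) (Real.exp_pos _).le, ← Real.exp_mul, mul_assoc, ← Real.exp_add]
            congr 2; ring
    _ = ofReal ((ψ / D) ^ a * exp (-0.18 * a / κ ^ 2)) *
        ∫⁻ x in {x | CoeffAccurate c (Us * bs) (canonData (Us * bs) x) τ 0.1 U},
        ofReal (exp (a * (3 * (totalDev c (Us * bs) (canonData (Us * bs) x) τ U / ψ))))
          ∂gaussM (Coord T n d r) := lintegral_const_mul _ hm
    _ ≤ ofReal ((ψ / D) ^ a * exp (-0.18 * a / κ ^ 2)) *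
        ofReal (exp (0.03 * a / κ ^ 2)) := by
        gcongr
        exact h.moment_le hτ hτK hψ0 (hψD.trans hD) hs ha ha1
    _ = _ := by
        rw [← ENNReal.ofReal_mul (by positivity), mul_assoc, ← Real.exp_add]
        congr 3; ring

lemma DescentSetup.measure_inaccurate_le (h : DescentSetup c Us bs σ κ μ ω β N) {τ : ℕ} (hτ : 1 ≤ τ)
    (hτK : τ ≤ K) {U : Fin L → Matrix (Fin d) (Fin r) ℝ} (hU : ∀ g, (U g)ᵀ * U g = 1) :
    gaussM (Coord T n d r) {x | ¬ CoeffAccurate c (Us * bs) (canonData (Us * bs) x) τ 0.1 U} ≤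
      ofReal ((β * 1e-10 / (r ^ 2 * κ ^ 4)) ^ 2 / (T * (r ^ 2 + 2 * N * d))) := by
  have hsz := h.size_eq (τ + 1) (by omega) (by omega)
  refine (measure_not_coeffAccurate_le h.truth.rank_pos (by rw [hsz]; exact h.size_pos) hU).trans
    (ENNReal.ofReal_le_ofReal ?_)
  have := h.rare
  rwa [hsz]

lemma DescentSetup.step_inaccurate (h : DescentSetup c Us bs σ κ μ ω β N) {τ : ℕ} (hτ : 1 ≤ τ) (hτK : τ ≤ K)
    {ψ D : ℝ} (hψ0 : 0 < ψ) (hψD : ψ ≤ D) (hD : D ≤ basin r κ)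
    {U : Fin L → Matrix (Fin d) (Fin r) ℝ} (hs : GoodState Us (200 * r * κ ^ 2) ψ U) :
    ∫⁻ x in {x | ¬ CoeffAccurate c (Us * bs) (canonData (Us * bs) x) τ 0.1 U},
      ofReal (nextVal c Us bs κ D τ U x ^ (1 / 40 : ℝ)) ∂gaussM (Coord T n d r) ≤
      ofReal ((ψ / D) ^ (1 / 40 : ℝ) * (β * 6e-4 / κ ^ 2)) := by
  have hD0 : 0 < D := hψ0.trans_le hψD
  have hκ := h.truth.one_le
  have hr : (1 : ℝ) ≤ r := by exact_mod_cast h.truth.rank_pos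
  have hT : (1 : ℝ) ≤ T := by exact_mod_cast h.tasks
  have hβ := h.beta_pos
  have hκκ : 1 ≤ κ ^ 2 := one_le_pow₀ hκ
  have hrr : 1 ≤ (r : ℝ) ^ 2 := one_le_pow₀ hr
  set F := {x | ¬ CoeffAccurate c (Us * bs) (canonData (r := r) (Us * bs) x) τ 0.1 U} with hF
  have hFm : MeasurableSet F := (measurableSet_coeffAccurate c (Us * bs)
    (measurable_id (α := Coord T n d r → ℝ)) (measurable_const (a := U)) τ 0.1).compl
  set Q : ℝ := T * (r ^ 2 + 2 * N * d) with hQ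
  have hQ1 : 1 ≤ Q := by
    rw [hQ]
    refine one_le_mul_of_one_le_of_one_le hT ?_
    have : (0 : ℝ) ≤ 2 * N * d := by positivity
    linarith
  set e : ℝ := β * 1e-10 / (r ^ 2 * κ ^ 4) with he
  have he0 : 0 < e := by positivity
  have he1 : e ≤ 1 := by
    rw [he, div_le_one (by positivity)]
    have : 1 ≤ (r : ℝ) ^ 2 * κ ^ 4 := one_le_mul_of_one_le_of_one_le hrr (one_le_pow₀ hκ)
    have := h.beta_le
    linarith
  set H : ℕ → Set (Coord T n d r → ℝ) := fun k => {x |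
    (∀ t z, 1 / (16 : ℝ) ^ k * nrm z ≤ nrm ((splitX c (canonData (r := r) (Us * bs) x) (τ + 1) t * U (c.node t)) *ᵥ z)) ∧
    (∀ t, ‖splitX c (canonData (r := r) (Us * bs) x) (τ + 1) t‖ ≤ 16 ^ k) ∧
    ∀ t, ‖splitX c (canonData (r := r) (Us * bs) x) (τ + K + 1) t‖ ≤ 16 ^ k} with hH
  have hs1 := h.size_eq (τ + 1) (by omega) (by omega)
  have hs2 := h.size_eq (τ + K + 1) (by omega) (by omega)
  have hHP : ∀ k, gaussM (Coord T n d r) (H k)ᶜ ≤ ofReal (Q / 16 ^ k) := fun k => by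
    have h16 : (1 : ℝ) ≤ 16 ^ k := one_le_pow₀ (by norm_num)
    have hsub : (H k)ᶜ ⊆ ({x | ¬ ∀ t z, 1 / (16 : ℝ) ^ k * nrm z ≤
          nrm ((splitX c (canonData (r := r) (Us * bs) x) (τ + 1) t * U (c.node t)) *ᵥ z)} ∪
        {x | ¬ ∀ t, ‖splitX c (canonData (r := r) (Us * bs) x) (τ + 1) t‖ ≤ 16 ^ k}) ∪
        {x | ¬ ∀ t, ‖splitX c (canonData (r := r) (Us * bs) x) (τ + K + 1) t‖ ≤ 16 ^ k} := by
      intro x hx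
      by_contra hcon
      simp only [Set.mem_union, Set.mem_ofPred_eq, not_or, not_not] at hcon
      exact hx ⟨hcon.1.1, hcon.1.2, hcon.2⟩
    refine (measure_mono hsub).trans ((measure_union_le _ _).trans
      ((add_le_add_left (measure_union_le _ _) _).trans ?_))
    refine (add_le_add (add_le_add (measure_small_singular_le (by rw [hs1]; exact h.rank_le) hs.orth h16)
      (measure_norm_splitX_gt_le _ h16)) (measure_norm_splitX_gt_le _ h16)).trans (le_of_eq ?_)
    rw [hs1, hs2, ← ENNReal.ofReal_add (by positivity) (by positivity),
      ← ENNReal.ofReal_add (by positivity) (by positivity)]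
    congr 1
    rw [hQ]; ring
  set b : ℝ := (ψ / D) ^ (1 / 40 : ℝ) * (1.2e6 * r ^ 2 * κ ^ 2) with hb
  have hb0 : 0 < b := by positivity
  refine (setLIntegral_rare_le hb0 he0 hQ1 he1 hFm (h.measure_inaccurate_le hτ hτK hs.orth) hHP ?_).trans
    (ENNReal.ofReal_le_ofReal (le_of_eq ?_))
  · rintro k x ⟨-, hx1, hx2, hx3⟩
    refine ENNReal.ofReal_le_ofReal ?_
    have h1 := gdStep_pot_crude h.truth h.weight h.row_sum h.mixing h.omega_nonneg h.omega_le
          (τ := τ) (by rw [hs2]; exact h.size_pos) (by rw [hs2]; exact h.step_size) hψ0.le (hψD.trans hD) hs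
          (one_le_pow₀ (by norm_num)) hx1 hx2 hx3
    have h2 := nextVal_le (bs := bs) hκ hD0 hD h1
    have hex : (0.9 : ℝ) ≤ exp (-0.1 / κ ^ 2) := by
      have h3 := Real.add_one_le_exp (-0.1 / κ ^ 2)
      have h4 : 0.1 / κ ^ 2 ≤ 0.1 := div_le_self (by norm_num) hκκ
      have h5 : -0.1 / κ ^ 2 = -(0.1 / κ ^ 2) := by ring
      linarith
    have h3 : nextVal c Us bs κ D τ U x ≤ ψ / D * (1.2e6 * r ^ 2 * κ ^ 2) * (2 ^ k) ^ 40 := by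
      refine h2.trans ?_
      rw [div_le_iff₀ (by positivity)]
      have e1 : ((16 : ℝ) ^ k) ^ 10 = (2 ^ k) ^ 40 := by
        rw [← pow_mul, ← pow_mul, show (16 : ℝ) = 2 ^ 4 by norm_num, ← pow_mul]
        congr 1; ring
      rw [e1]
      calc 1056000 * r ^ 2 * κ ^ 2 * (2 ^ k) ^ 40 * ψ ≤
            (1.2e6 * r ^ 2 * κ ^ 2 * (2 ^ k) ^ 40 * ψ) * 0.9 := by
            have : 0 ≤ r ^ 2 * κ ^ 2 * (2 ^ k) ^ 40 * ψ := by positivity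
            nlinarith
        _ ≤ (1.2e6 * r ^ 2 * κ ^ 2 * (2 ^ k) ^ 40 * ψ) * exp (-0.1 / κ ^ 2) := by gcongr
        _ = _ := by field_simp
    have hbig : 1 ≤ 1.2e6 * (r : ℝ) ^ 2 * κ ^ 2 := by
      have : 1 ≤ (r : ℝ) ^ 2 * κ ^ 2 := one_le_mul_of_one_le_of_one_le hrr hκκ
      linarith
    calc nextVal c Us bs κ D τ U x ^ (1 / 40 : ℝ) ≤
          (ψ / D * (1.2e6 * r ^ 2 * κ ^ 2) * (2 ^ k) ^ 40) ^ (1 / 40 : ℝ) :=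
          Real.rpow_le_rpow (nextVal_nonneg hD0.le _ _ _) h3 (by norm_num)
      _ = (ψ / D) ^ (1 / 40 : ℝ) * (1.2e6 * r ^ 2 * κ ^ 2) ^ (1 / 40 : ℝ) * 2 ^ k := by
          rw [Real.mul_rpow (by positivity) (by positivity), Real.mul_rpow (by positivity) (by positivity)]
          congr 1
          rw [show (1 / 40 : ℝ) = ((40 : ℕ) : ℝ)⁻¹ by norm_num]
          exact Real.pow_rpow_inv_natCast (by positivity) (by norm_num)
      _ ≤ _ := by
          rw [hb]
          gcongr
          exact Real.rpow_le_self_of_one_le hbig (by norm_num)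
  · rw [hb, he]
    field_simp
    norm_num

end Step

section Step
variable {d T r L n K : ℕ} [NeZero L] {Us : Matrix (Fin d) (Fin r) ℝ} {bs : Matrix (Fin r) (Fin T) ℝ}
  {σ κ : ℝ} {c : Config T n L K} {μ ω β : ℝ} {N : ℕ}

lemma exp_neg_small_le {u : ℝ} (h0 : 0 ≤ u) (h1 : u ≤ 1) : exp (-u) ≤ 1 - u / 2 := by
  have h2 := Real.add_one_le_exp u
  rw [Real.exp_neg, inv_le_comm₀ (Real.exp_pos _) (by linarith)]
  refine le_trans ?_ h2
  rw [inv_le_iff_one_le_mul₀ (by linarith)]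
  nlinarith

lemma measurable_nextVal (hW : IsWeightMatrix c.graph c.W) (D : ℝ) (τ : ℕ) {α : Type*}
    [MeasurableSpace α] {x : α → Coord T n d r → ℝ} (hx : Measurable x)
    {U : α → Fin L → Matrix (Fin d) (Fin r) ℝ} (hU : Measurable U) :
    Measurable fun a => nextVal c Us bs κ D τ (U a) (x a) :=
  ((measurable_pot Us _ (measurable_gdStep c (Us * bs) hW hx hU τ)).div_const _).min measurable_const

/-- The expectation of the Lyapunov function does not increase. -/
lemma DescentSetup.lintegral_lyap_le_of_goodState (h : DescentSetup c Us bs σ κ μ ω β N) {τ : ℕ}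
    (hτ : 1 ≤ τ) (hτK : τ ≤ K) {ψ D : ℝ} (hψ0 : 0 < ψ) (hψD : ψ ≤ D) (hD : D ≤ basin r κ)
    {U : Fin L → Matrix (Fin d) (Fin r) ℝ} (hs : GoodState Us (200 * r * κ ^ 2) ψ U) {p : ℝ}
    (hp : 1 / 40 ≤ p) (hp1 : 3 * p ≤ 500 * κ ^ 2 * (d + T)) :
    ∫⁻ x, ofReal (lyap p β (nextVal c Us bs κ D τ U x)) ∂gaussM (Coord T n d r) ≤
      ofReal (lyap p β (ψ / D)) := by
  have hD0 : 0 < D := hψ0.trans_le hψD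
  have hκ := h.truth.one_le
  have hκκ : 1 ≤ κ ^ 2 := one_le_pow₀ hκ
  have hβ := h.beta_pos
  have hp0 : 0 ≤ p := by linarith
  set A := {x | CoeffAccurate c (Us * bs) (canonData (r := r) (Us * bs) x) τ 0.1 U} with hA
  have hAm : MeasurableSet A := measurableSet_coeffAccurate c (Us * bs)
    (measurable_id (α := Coord T n d r → ℝ)) (measurable_const (a := U)) τ 0.1
  set v := nextVal c Us bs κ D τ U with hv
  have hvm : Measurable v := measurable_nextVal h.weight D τ measurable_id measurable_const
  have hv0 : ∀ x, 0 ≤ v x := fun x => nextVal_nonneg hD0.le _ _ _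
  have hv1 : ∀ x, v x ≤ 1 := fun x => min_le_right _ _
  set y := ψ / D with hy
  have hy0 : 0 < y := by positivity
  set s : ℝ := 1 / 40 with hs'
  have a1 := h.step_accurate hτ hτK hψ0 hψD hD hs hp0 hp1
  have a2 := h.step_accurate hτ hτK hψ0 hψD hD hs (a := s) (by norm_num [hs']) (by linarith)
  have a3 := h.step_inaccurate hτ hτK hψ0 hψD hD hs
  rw [← lintegral_add_compl _ hAm]
  have hpm : ∀ a : ℝ, Measurable fun x => ofReal (v x ^ a) := fun a =>
    (hvm.pow_const a).ennreal_ofReal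
  have b1 : ∫⁻ x in A, ofReal (lyap p β (v x)) ∂gaussM (Coord T n d r) ≤
      ofReal (y ^ p * exp (-0.15 * p / κ ^ 2)) +
      ofReal β * ofReal (y ^ s * exp (-0.15 * s / κ ^ 2)) := by
    have e : ∀ x, ofReal (lyap p β (v x)) =
        ofReal (v x ^ p) + ofReal β * ofReal (v x ^ s) := fun x => by
      have h1 := Real.rpow_nonneg (hv0 x) p
      have h2 := Real.rpow_nonneg (hv0 x) s
      rw [lyap, ENNReal.ofReal_add h1 (mul_nonneg hβ.le h2), ENNReal.ofReal_mul hβ.le]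
    simp_rw [e]
    rw [lintegral_add_left (hpm p), lintegral_const_mul _ (hpm s)]
    gcongr
  have b2 : ∫⁻ x in Aᶜ, ofReal (lyap p β (v x)) ∂gaussM (Coord T n d r) ≤
      ofReal 2 * ofReal (y ^ s * (β * 6e-4 / κ ^ 2)) := by
    have : ∀ x, ofReal (lyap p β (v x)) ≤ ofReal 2 * ofReal (v x ^ s) := fun x => by
      rw [← ENNReal.ofReal_mul (by norm_num)]
      refine ENNReal.ofReal_le_ofReal ?_
      have h2 := Real.rpow_nonneg (hv0 x) s
      have h1 : v x ^ p ≤ v x ^ s := by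
        rcases (hv0 x).eq_or_lt with h0 | h0
        · rw [← h0, Real.zero_rpow (by positivity), Real.zero_rpow (by norm_num [hs'])]
        · exact Real.rpow_le_rpow_of_exponent_ge h0 (hv1 x) hp
      have h3 : β * v x ^ s ≤ v x ^ s := mul_le_of_le_one_left h2 h.beta_le
      unfold lyap
      linarith
    refine (lintegral_mono this).trans ?_
    rw [lintegral_const_mul _ (hpm s)]
    gcongr
    exact a3
  refine (add_le_add b1 b2).trans ?_
  rw [← ENNReal.ofReal_mul hβ.le, ← ENNReal.ofReal_mul (by norm_num),
    ← ENNReal.ofReal_add (by positivity) (by positivity), ← ENNReal.ofReal_add (by positivity) (by positivity)]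
  refine ENNReal.ofReal_le_ofReal ?_
  have c1 : exp (-0.15 * p / κ ^ 2) ≤ 1 := Real.exp_le_one_iff.2
    (div_nonpos_of_nonpos_of_nonneg (by linarith) (by positivity))
  have hk0 : 0 < 1 / κ ^ 2 := by positivity
  have hk1 : 1 / κ ^ 2 ≤ 1 := by rw [div_le_one (by positivity)]; exact hκκ
  have c2 : exp (-0.15 * s / κ ^ 2) ≤ 1 - 0.001875 * (1 / κ ^ 2) := by
    have := exp_neg_small_le (u := 0.00375 * (1 / κ ^ 2)) (by positivity) (by linarith)
    refine le_trans (le_of_eq ?_) (this.trans (le_of_eq (by ring)))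
    congr 1; rw [hs']; ring
  have hyp : 0 ≤ y ^ p := by positivity
  have hys : 0 ≤ y ^ s := by positivity
  unfold lyap
  have d1 : y ^ p * exp (-0.15 * p / κ ^ 2) ≤ y ^ p := mul_le_of_le_one_right hyp c1
  have d2 : β * (y ^ s * exp (-0.15 * s / κ ^ 2)) ≤ β * (y ^ s * (1 - 0.001875 * (1 / κ ^ 2))) := by
    gcongr
  have d3 : 0 ≤ β * y ^ s * (1 / κ ^ 2) := by positivity
  have d4 : 2 * (y ^ s * (β * 6e-4 / κ ^ 2)) = 1.2e-3 * (β * y ^ s * (1 / κ ^ 2)) := by ring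
  rw [d4]
  linarith

lemma DescentSetup.lintegral_lyap_le (h : DescentSetup c Us bs σ κ μ ω β N) {τ : ℕ}
    (hτ : 1 ≤ τ) (hτK : τ ≤ K) {D : ℝ} (hD0 : 0 < D) (hD : D ≤ basin r κ)
    {U : Fin L → Matrix (Fin d) (Fin r) ℝ} (hs : pot Us (200 * r * κ ^ 2) U ≤ D) {p : ℝ}
    (hp : 1 / 40 ≤ p) (hp1 : 3 * p ≤ 500 * κ ^ 2 * (d + T)) :
    ∫⁻ x, ofReal (lyap p β (nextVal c Us bs κ D τ U x)) ∂gaussM (Coord T n d r) ≤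
      ofReal (lyap p β (pot Us (200 * r * κ ^ 2) U / D)) := by
  have hκ := h.truth.one_le
  have hr : (1 : ℝ) ≤ r := by exact_mod_cast h.truth.rank_pos
  have hA : 0 < 200 * r * κ ^ 2 := by positivity
  have hb := basin_le h.truth.rank_pos hκ
  have key : ∀ ψ, 0 < ψ → ψ ≤ D → pot Us (200 * r * κ ^ 2) U ≤ ψ → _ := fun ψ h0 h1 h2 =>
    h.lintegral_lyap_le_of_goodState hτ hτK h0 h1 hD
      (goodState_of_pot_le hA (by linarith) h2) hp hp1
  rcases (pot_nonneg (Us := Us) (200 * r * κ ^ 2) U).eq_or_lt with h0 | h0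
  · have hc : Filter.Tendsto (fun ψ => ofReal (lyap p β (ψ / D))) (nhdsWithin 0 (Set.Ioi 0))
        (nhds (ofReal (lyap p β (0 / D)))) := by
      have : Continuous fun ψ => ofReal (lyap p β (ψ / D)) := by
        unfold lyap
        refine ENNReal.continuous_ofReal.comp (Continuous.add ?_ (continuous_const.mul ?_))
        · exact (continuous_id.div_const D).rpow_const fun _ => Or.inr (by linarith)
        · exact (continuous_id.div_const D).rpow_const fun _ => Or.inr (by norm_num)
      exact (this.tendsto 0).mono_left nhdsWithin_le_nhds
    rw [← h0]
    refine ge_of_tendsto hc ?_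
    filter_upwards [Ioc_mem_nhdsGT hD0] with ψ hψ
    exact key ψ hψ.1 hψ.2 (by rw [← h0]; exact hψ.1.le)
  · exact key _ h0 hs le_rfl

/-- The gradients of a step are accurate. -/
def StepAccurate (c : Config T n L K) (Θ : Matrix (Fin d) (Fin T) ℝ) (D : Data d T n r)
    (κ ψ : ℝ) (τ : ℕ) (U : Fin L → Matrix (Fin d) (Fin r) ℝ) : Prop :=
  CoeffAccurate c Θ D τ 0.1 U ∧ totalDev c Θ D τ U ≤ ψ * (0.02 / κ ^ 2)

lemma DescentSetup.measure_not_stepAccurate_le (h : DescentSetup c Us bs σ κ μ ω β N) {τ : ℕ}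
    (hτ : 1 ≤ τ) (hτK : τ ≤ K) {ψ : ℝ} (hψ0 : 0 < ψ) (hψ : ψ ≤ basin r κ)
    {U : Fin L → Matrix (Fin d) (Fin r) ℝ} (hs : GoodState Us (200 * r * κ ^ 2) ψ U) :
    gaussM (Coord T n d r) {x | ¬ StepAccurate c (Us * bs) (canonData (Us * bs) x) κ ψ τ U} ≤
      ofReal ((β * 1e-10 / (r ^ 2 * κ ^ 4)) ^ 2 / (T * (r ^ 2 + 2 * N * d)) +
        exp (-5 * (d + T))) := by
  have hκ := h.truth.one_le
  have hT : (1 : ℝ) ≤ T := by exact_mod_cast h.tasks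
  set A := {x | CoeffAccurate c (Us * bs) (canonData (r := r) (Us * bs) x) τ 0.1 U} with hA
  have hAm : MeasurableSet A := measurableSet_coeffAccurate c (Us * bs)
    (measurable_id (α := Coord T n d r → ℝ)) (measurable_const (a := U)) τ 0.1
  have h1 := setLIntegral_exp_totalDev_le h.truth h.steps (h.size_eq (τ + K + 1) (by omega) (by omega)) h.size_pos
    h.step_size h.one_le_mu h.incoherent h.tasks h.rank_le_dim h.samples hψ0 hψ hs
  set f : (Coord T n d r → ℝ) → ENNReal := fun x => ofReal (exp (500 * κ ^ 2 * (d + T) / ψ *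
        totalDev c (Us * bs) (canonData (Us * bs) x) τ U)) with hf
  have hfm : Measurable f := ((measurable_totalDev c (Us * bs) measurable_id
    (measurable_const (a := U)) τ).const_mul _).exp.ennreal_ofReal
  have hsub : {x | ¬ StepAccurate c (Us * bs) (canonData (Us * bs) x) κ ψ τ U} ⊆
      Aᶜ ∪ (A ∩ {x | ofReal (exp (10 * (d + T))) ≤ f x}) := by
    intro x hx
    by_cases hxA : x ∈ A
    · refine Or.inr ⟨hxA, ?_⟩
      have : ψ * (0.02 / κ ^ 2) < totalDev c (Us * bs) (canonData (Us * bs) x) τ U := by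
        by_contra hcon
        exact hx ⟨hxA, not_lt.1 hcon⟩
      refine ENNReal.ofReal_le_ofReal (Real.exp_le_exp.2 ?_)
      calc (10 : ℝ) * (d + T) = 500 * κ ^ 2 * (d + T) / ψ * (ψ * (0.02 / κ ^ 2)) := by field_simp; norm_num
        _ ≤ _ := by gcongr
    · exact Or.inl hxA
  refine (measure_mono hsub).trans ((measure_union_le _ _).trans ?_)
  rw [ENNReal.ofReal_add (by positivity) (by positivity)]
  refine add_le_add (h.measure_inaccurate_le hτ hτK hs.orth) ?_
  have h2 := mul_meas_ge_le_lintegral (μ := (gaussM (Coord T n d r)).restrict A) hfm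
    (ofReal (exp (10 * (d + T))))
  rw [Measure.restrict_apply (measurableSet_le measurable_const hfm), Set.inter_comm] at h2
  have h3 := h2.trans h1
  have hpos : ofReal (exp (10 * (d + T))) ≠ 0 := by
    simp [ENNReal.ofReal_eq_zero, Real.exp_pos]
  have h4 := (ENNReal.le_div_iff_mul_le (Or.inl hpos) (Or.inl ENNReal.ofReal_ne_top)).2
    ((mul_comm _ _).trans_le h3)
  refine h4.trans (le_of_eq ?_)
  rw [← ENNReal.ofReal_div_of_pos (Real.exp_pos _), ← Real.exp_sub]
  congr 2; ring

/-- An accurate step. -/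
lemma DescentSetup.stepAccurate_bounds (h : DescentSetup c Us bs σ κ μ ω β N) {τ : ℕ}
    (hτ : 1 ≤ τ) (hτK : τ ≤ K) {ψ : ℝ} (hψ0 : 0 < ψ) (hψ : ψ ≤ basin r κ)
    {U : Fin L → Matrix (Fin d) (Fin r) ℝ} (hs : GoodState Us (200 * r * κ ^ 2) ψ U)
    {X : Fin T → Matrix (Fin n) (Fin d) ℝ} {Z : Matrix (Fin d) (Fin r) ℝ}
    (hx : StepAccurate c (Us * bs) (linearData (Us * bs) X Z) κ ψ τ U) :
    GoodState Us (200 * r * κ ^ 2) (ψ * exp (-0.22 / κ ^ 2))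
      (gdStep c (linearData (Us * bs) X Z) τ U) ∧
    ∀ t, nrm (U (c.node t) *ᵥ bStep c (linearData (Us * bs) X Z) τ U t - (Us * bs).col t) ≤
        ψ / basin r κ * 0.001 * nrm ((Us * bs).col t) ∧
      nrm (gdStep c (linearData (Us * bs) X Z) τ U (c.node t) *ᵥ bStep c (linearData (Us * bs) X Z) τ U t -
        (Us * bs).col t) ≤ ψ / basin r κ * 0.1 * nrm ((Us * bs).col t) := by
  obtain ⟨hacc, hdev⟩ := hx
  have hκ := h.truth.one_le
  have hκκ : 1 ≤ κ ^ 2 := one_le_pow₀ hκ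
  have hr := h.truth.rank_pos
  have hr1 : 1 ≤ sqrt r := Real.one_le_sqrt.2 (by exact_mod_cast hr)
  have hsz := h.size_eq (τ + K + 1) (by omega) (by omega)
  have hb0 := basin_pos hr hκ
  have hb1 := basin_le hr hκ
  have hsb := sqrt_mul_basin (κ := κ) hr
  have hsψ : sqrt r * ψ ≤ 1 / 10000 / κ ^ 2 := by rw [← hsb]; gcongr
  obtain ⟨Y, hY, ha, hb, hc⟩ := gdStep_bounds h.truth h.weight h.row_sum h.mixing h.omega_nonneg h.omega_le
    (τ := τ) (by rw [hsz]; exact h.size_pos) (by rw [hsz]; exact h.step_size) hψ0 hψ hs hacc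
  set dev := totalDev c (Us * bs) (linearData (Us * bs) X Z) τ U with hdev'
  have hη0 : 0 ≤ c.η := by
    rw [h.step_size]; exact div_nonneg (by norm_num) (by positivity)
  have hdev0 : 0 ≤ dev := by
    rw [hdev', totalDev]
    refine add_nonneg (mul_nonneg hη0 (norm_nonneg _)) (mul_nonneg (by positivity)
      (Finset.sum_nonneg fun j _ => mul_nonneg hη0 (norm_nonneg _)))
  have hk1 : 0.02 / κ ^ 2 ≤ 0.02 := div_le_self (by norm_num) hκκ
  have hdevψ : dev ≤ 0.02 * ψ := by
    refine hdev.trans ?_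
    rw [mul_comm]; gcongr
  have hk2 : 1 / 10000 / κ ^ 2 ≤ 1 / 10000 := div_le_self (by norm_num) hκκ
  have hdr : sqrt r * dev ≤ 0.49 := by
    calc sqrt r * dev ≤ sqrt r * (0.02 * ψ) := by gcongr
      _ = 0.02 * (sqrt r * ψ) := by ring
      _ ≤ 0.49 := by linarith
  obtain ⟨g1, g2⟩ := goodState_descent hκ hr hs hsψ hψ0 h.omega_nonneg h.omega_le hdev0 hdr ha hb hc
  rw [hY]
  refine ⟨g1.mono ?_, fun t => ?_⟩
  · gcongr
    have h3 : dev / ψ ≤ 0.02 / κ ^ 2 := by rw [div_le_iff₀ hψ0, mul_comm]; exact hdev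
    have h4 : (-0.22 : ℝ) / κ ^ 2 = -0.28 / κ ^ 2 + 3 * (0.02 / κ ^ 2) := by ring
    rw [h4]; linarith
  · have hacct := hacc t
    rw [mul_col_eq] at hacct ⊢
    obtain ⟨e1, e2⟩ := hs.coeff_error h.truth.orth (by linarith) (by norm_num) (c.node t) (bs.col t)
      (bStep c (linearData (Us * bs) X Z) τ U t) hacct
    rw [nrm_mulVec_orthonormal h.truth.orth]
    set m := nrm (bs.col t) with hm
    have hm0 : 0 ≤ m := nrm_nonneg _
    set ratio := ψ / basin r κ with hratio
    have hra : ψ = ratio * basin r κ := by rw [hratio]; field_simp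
    have hra0 : 0 ≤ ratio := by positivity
    have f0 : ψ ≤ ratio * (1 / 10000) := by rw [hra]; gcongr
    have f1 : (1 + 0.1) * ψ * m ≤ ratio * 0.00011 * m :=
      mul_le_mul_of_nonneg_right (by linarith) hm0
    refine ⟨(e1.trans f1).trans (by gcongr; norm_num), ?_⟩
    have e3 : qrQ (Y (c.node t)) *ᵥ bStep c (linearData (Us * bs) X Z) τ U t - Us *ᵥ bs.col t =
        (qrQ (Y (c.node t)) - U (c.node t)) *ᵥ bStep c (linearData (Us * bs) X Z) τ U t +
        (U (c.node t) *ᵥ bStep c (linearData (Us * bs) X Z) τ U t - Us *ᵥ bs.col t) := by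
      rw [sub_mulVec]; abel
    rw [e3]
    refine (nrm_add_le _ _).trans ?_
    have f2 : sqrt r * (0.51 * ψ + dev) ≤ 0.53 * (ratio * (1 / 10000)) := by
      calc sqrt r * (0.51 * ψ + dev) ≤ sqrt r * (0.51 * ψ + 0.02 * ψ) := by gcongr
        _ = 0.53 * (ratio * (sqrt r * basin r κ)) := by rw [hra]; ring
        _ ≤ _ := by rw [hsb]; gcongr
    have f3 : nrm ((qrQ (Y (c.node t)) - U (c.node t)) *ᵥ bStep c (linearData (Us * bs) X Z) τ U t) ≤
        (330 * (0.53 * (ratio * (1 / 10000)))) * ((1 + 0.1) * m) := by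
      refine (nrm_mulVec_le _ _).trans (mul_le_mul ?_ e2 (nrm_nonneg _) (by positivity))
      exact (norm_le_fro _).trans ((g2 _).trans (by gcongr))
    have f4 : 0 ≤ ratio * m := by positivity
    calc _ ≤ (330 * (0.53 * (ratio * (1 / 10000)))) * ((1 + 0.1) * m) + ratio * 0.00011 * m :=
          add_le_add f3 (e1.trans f1)
      _ = 0.019349 * (ratio * m) := by ring
      _ ≤ 0.1 * (ratio * m) := by gcongr; norm_num
      _ = _ := by ring

end Step

section Iterates
variable {d T r L n K : ℕ} [NeZero L] {c : Config T n L K} {Θ : Matrix (Fin d) (Fin T) ℝ}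
  {α : Type*} [MeasurableSpace α] {x : α → Coord T n d r → ℝ}

lemma measurable_broadcastStep (G : SimpleGraph (Fin L)) :
    Measurable (broadcastStep G : (Fin L → Matrix (Fin d) (Fin r) ℝ) → _) := by
  classical
  refine measurable_pi_lambda _ fun g => ?_
  let F : (Fin L → Prop) × (Fin L → Matrix (Fin d) (Fin r) ℝ) → Matrix (Fin d) (Fin r) ℝ := fun q =>
    if h : ∃ j, G.Adj g j ∧ q.1 j then q.2 h.choose else q.2 g
  have hF : Measurable F := measurable_from_prod_countable_right fun s => by
    have hm : ∀ k, Measurable fun U : Fin L → Matrix (Fin d) (Fin r) ℝ => U k := fun k =>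
      measurable_pi_apply k
    by_cases h : ∃ j, G.Adj g j ∧ s j
    · simp only [F, h, dite_true]
      exact hm h.choose
    · simp only [F, h, dite_false]
      exact hm _
  have hp : Measurable fun U : Fin L → Matrix (Fin d) (Fin r) ℝ => fun j => U j ≠ 0 :=
    measurable_pi_lambda _ fun j => measurableSet_setOfPred.1
      ((measurable_pi_iff.1 measurable_id j) (measurableSet_singleton 0)).compl
  have e : (fun U : Fin L → Matrix (Fin d) (Fin r) ℝ => broadcastStep G U g) =
      fun U => F (fun j => U j ≠ 0, U) := by
    funext U
    simp only [broadcastStep, F]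
  rw [e]
  exact hF.comp (hp.prodMk measurable_id)

lemma measurable_broadcast (G : SimpleGraph (Fin L)) :
    Measurable (broadcast G : (Fin L → Matrix (Fin d) (Fin r) ℝ) → _) := by
  unfold broadcast
  refine ((measurable_broadcastStep G).iterate _).comp (measurable_pi_lambda _ fun g => ?_)
  split_ifs
  · exact measurable_pi_apply _
  · exact measurable_const

lemma splitY_canonData (x : Coord T n d r → ℝ) (l : ℕ) (t : Fin T) :
    splitY c (canonData Θ x) l t = splitX c (canonData Θ x) l t *ᵥ Θ.col t := rfl

lemma measurable_splitY (hx : Measurable x) (l : ℕ) (t : Fin T) :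
    Measurable fun a => splitY c (canonData Θ (x a)) l t :=
  (measurable_splitX c Θ hx l t).mulVec measurable_const

lemma measurable_alpha (hW : IsWeightMatrix c.graph c.W) (hx : Measurable x) (g : Fin L) :
    Measurable fun a => alpha c (canonData Θ (x a)) g := by
  simp only [alpha, agree_eq hW, alphaIn, smul_eq_mul]
  refine Finset.measurable_sum _ fun j _ => Measurable.const_mul (Measurable.const_mul ?_ _) _
  exact Finset.measurable_sum _ fun t _ => Finset.measurable_sum _ fun i _ =>
    (measurable_pi_iff.1 (measurable_splitY hx 0 t) i).pow_const 2

end Iterates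

section Initialization
variable {d T r L n K : ℕ} [NeZero L] {c : Config T n L K}

/-- Truncation of a value at a threshold of its square. -/
noncomputable def trunc (α y : ℝ) : ℝ := if y ^ 2 ≤ α then y else 0

lemma measurable_trunc_uncurry : Measurable fun q : ℝ × ℝ => trunc q.1 q.2 :=
  Measurable.ite (measurableSet_le (measurable_snd.pow_const 2) measurable_fst) measurable_snd measurable_const

/-- The matrix of truncated averages with given thresholds. -/
noncomputable def truncTheta (c : Config T n L K) (Θ : Matrix (Fin d) (Fin T) ℝ) (α : Fin L → ℝ)
    (x : Coord T n d r → ℝ) : Matrix (Fin d) (Fin T) ℝ :=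
  Matrix.of fun j t => (1 / (c.size 1 : ℝ)) * ((splitX c (canonData Θ x) 1 t)ᵀ *ᵥ
    fun i => trunc (α (c.node t)) (splitY c (canonData Θ x) 1 t i)) j

lemma theta0_canonData (Θ : Matrix (Fin d) (Fin T) ℝ) (x : Coord T n d r → ℝ) (g : Fin L) :
    theta0 c (canonData Θ x) g = (truncTheta c Θ (alpha c (canonData Θ x)) x).submatrix id Subtype.val := by
  ext j ⟨t, ht⟩
  have : yTrunc c (canonData Θ x) t = fun i => trunc (alpha c (canonData Θ x) (c.node t))
      (splitY c (canonData Θ x) 1 t i) := by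
    funext i
    unfold yTrunc trunc
    split_ifs <;> rfl
  simp only [theta0, truncTheta, of_apply, submatrix_apply, id_eq, this]

lemma measurable_truncTheta (Θ : Matrix (Fin d) (Fin T) ℝ) {β : Type*} [MeasurableSpace β]
    {α : β → Fin L → ℝ} (hα : Measurable α) {x : β → Coord T n d r → ℝ} (hx : Measurable x) :
    Measurable fun a => truncTheta c Θ (α a) (x a) := by
  refine measurable_matrix_iff.2 fun j t => Measurable.const_mul (measurable_pi_iff.1
    ((measurable_splitX c Θ hx 1 t).matrix_transpose.mulVec (measurable_pi_lambda _ fun i => ?_)) j) _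
  exact measurable_trunc_uncurry.comp ((measurable_pi_iff.1 hα _).prodMk
    (measurable_pi_iff.1 (measurable_splitY hx 1 t) i))

/-- A round of the power iteration as a function of the pooled initial estimate. -/
noncomputable def powerStep (c : Config T n L K) (A : Matrix (Fin d) (Fin T) ℝ)
    (U : Fin L → Matrix (Fin d) (Fin r) ℝ) : Fin L → Matrix (Fin d) (Fin r) ℝ :=
  broadcast c.graph fun g => qrQ (agree c.graph c.W c.TconInit (fun g' =>
    (A.submatrix id Subtype.val : Matrix (Fin d) {t : Fin T // c.node t = g'} ℝ) *
      (A.submatrix id Subtype.val : Matrix (Fin d) {t : Fin T // c.node t = g'} ℝ)ᵀ * U g') g)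

/-- The initialization as a function of the pooled initial estimate and the variables. -/
noncomputable def initFrom (c : Config T n L K) (A : Matrix (Fin d) (Fin T) ℝ) (x : Coord T n d r → ℝ) :
    Fin L → Matrix (Fin d) (Fin r) ℝ :=
  (powerStep c A)^[c.Tpm] fun _ => qrQ (entryMatrix (fun j k => Sum.inr (j, k)) x)

lemma spectralInit_canonData (Θ : Matrix (Fin d) (Fin T) ℝ) (x : Coord T n d r → ℝ) :
    spectralInit c (canonData Θ x) = initFrom c (truncTheta c Θ (alpha c (canonData Θ x)) x) x := by
  have h : pmStep c (canonData Θ x) = powerStep c (truncTheta c Θ (alpha c (canonData Θ x)) x) := by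
    funext U
    simp only [pmStep, powerStep, theta0_canonData]
  rw [spectralInit, initFrom, h]
  rfl

lemma measurable_initFrom (hW : IsWeightMatrix c.graph c.W) {β : Type*} [MeasurableSpace β]
    {A : β → Matrix (Fin d) (Fin T) ℝ} (hA : Measurable A) {x : β → Coord T n d r → ℝ} (hx : Measurable x) :
    Measurable fun a => initFrom c (A a) (x a) := by
  unfold initFrom
  induction c.Tpm with
  | zero =>
    refine measurable_pi_lambda _ fun g => Measurable.qrQ (measurable_matrix_iff.2 fun j k => ?_)
    exact measurable_pi_iff.1 hx (Sum.inr (j, k))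
  | succ m ih =>
    simp only [Function.iterate_succ', Function.comp]
    unfold powerStep
    refine (measurable_broadcast c.graph).comp (measurable_pi_lambda _ fun g => Measurable.qrQ ?_)
    refine Measurable.agree hW _ (fun g' => ?_) g
    have h : Measurable fun a => ((A a).submatrix id Subtype.val : Matrix (Fin d) {t : Fin T // c.node t = g'} ℝ) :=
      measurable_matrix_iff.2 fun i t => measurable_matrix_iff.1 hA i t.1
    exact (h.matrix_mul h.matrix_transpose).matrix_mul (measurable_pi_iff.1 ih g')

lemma alpha_congr {Θ : Matrix (Fin d) (Fin T) ℝ} {x y : Coord T n d r → ℝ}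
    (h : ∀ q, inSplit c 0 q → x q = y q) : alpha c (canonData Θ x) = alpha c (canonData Θ y) := by
  unfold alpha
  congr 1
  funext g
  simp only [alphaIn, splitY_canonData, splitX_congr (Θ := Θ) h]

lemma truncTheta_congr {Θ : Matrix (Fin d) (Fin T) ℝ} (α : Fin L → ℝ) {x y : Coord T n d r → ℝ}
    (h : ∀ q, inSplit c 1 q → x q = y q) : truncTheta c Θ α x = truncTheta c Θ α y := by
  simp only [truncTheta, splitY_canonData, splitX_congr (Θ := Θ) h]

lemma initFrom_congr (A : Matrix (Fin d) (Fin T) ℝ) {x y : Coord T n d r → ℝ}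
    (h : ∀ q, x (Sum.inr q) = y (Sum.inr q)) : initFrom c A x = initFrom c A y := by
  have : entryMatrix (fun j k => Sum.inr (j, k)) x = entryMatrix (fun j k => Sum.inr (j, k)) y := by
    ext j k; exact h (j, k)
  rw [initFrom, initFrom, this]

end Initialization

section Iterates
variable {d T r L n K : ℕ} [NeZero L] {c : Config T n L K} {Θ : Matrix (Fin d) (Fin T) ℝ}
  {α : Type*} [MeasurableSpace α] {x : α → Coord T n d r → ℝ}

lemma measurable_spectralInit (hW : IsWeightMatrix c.graph c.W) (hx : Measurable x) :
    Measurable fun a => spectralInit c (canonData Θ (x a)) := by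
  have hα : Measurable fun a => alpha c (canonData Θ (x a)) :=
    measurable_pi_lambda _ fun g => measurable_alpha hW hx g
  have e : (fun a => spectralInit c (canonData Θ (x a))) = fun a =>
      initFrom c (truncTheta c Θ (alpha c (canonData Θ (x a))) (x a)) (x a) :=
    funext fun a => spectralInit_canonData _ _
  rw [e]
  exact measurable_initFrom hW (measurable_truncTheta Θ hα hx) hx

lemma measurable_iterU (hW : IsWeightMatrix c.graph c.W) (hx : Measurable x) (τ : ℕ) :
    Measurable fun a => iterU c (canonData Θ (x a)) τ := by
  induction τ with
  | zero => exact measurable_spectralInit hW hx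
  | succ τ ih => exact measurable_gdStep c Θ hW hx ih (τ + 1)

lemma inSplit_unique {l l' : ℕ} {q : Coord T n d r} (h : inSplit c l q) (h' : inSplit c l' q) : l = l' := by
  rcases q with q | q
  · exact h.symm.trans h'
  · exact h.elim

lemma spectralInit_congr {x y : Coord T n d r → ℝ} (h0 : ∀ q, inSplit c 0 q → x q = y q)
    (h1 : ∀ q, inSplit c 1 q → x q = y q) (hZ : ∀ q, x (Sum.inr q) = y (Sum.inr q)) :
    spectralInit c (canonData Θ x) = spectralInit c (canonData Θ y) := by
  rw [spectralInit_canonData, spectralInit_canonData, alpha_congr h0, truncTheta_congr _ h1, initFrom_congr _ hZ]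

lemma iterU_congr {x y : Coord T n d r → ℝ} {τ : ℕ} (h0 : ∀ q, inSplit c 0 q → x q = y q)
    (h1 : ∀ q, inSplit c 1 q → x q = y q) (hZ : ∀ q, x (Sum.inr q) = y (Sum.inr q))
    (h2 : ∀ i, 1 ≤ i → i ≤ τ → (∀ q, inSplit c (i + 1) q → x q = y q) ∧
      ∀ q, inSplit c (i + K + 1) q → x q = y q) :
    iterU c (canonData Θ x) τ = iterU c (canonData Θ y) τ := by
  induction τ with
  | zero => exact spectralInit_congr h0 h1 hZ
  | succ τ ih =>
    have h := h2 (τ + 1) (by omega) le_rfl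
    change gdStep c _ (τ + 1) (iterU c _ τ) = gdStep c _ (τ + 1) (iterU c _ τ)
    rw [ih fun i hi hi' => h2 i hi (by omega), gdStep_congr h.1 h.2]

lemma coeffAccurate_congr {τ : ℕ} {x y : Coord T n d r → ℝ} (h : ∀ q, inSplit c (τ + 1) q → x q = y q)
    (q : ℝ) (U : Fin L → Matrix (Fin d) (Fin r) ℝ) :
    CoeffAccurate c Θ (canonData Θ x) τ q U ↔ CoeffAccurate c Θ (canonData Θ y) τ q U := by
  simp only [CoeffAccurate, bStep_congr (Θ := Θ) h]

lemma totalDev_congr {τ : ℕ} {x y : Coord T n d r → ℝ} (h : ∀ q, inSplit c (τ + 1) q → x q = y q)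
    (h' : ∀ q, inSplit c (τ + K + 1) q → x q = y q) (U : Fin L → Matrix (Fin d) (Fin r) ℝ) :
    totalDev c Θ (canonData Θ x) τ U = totalDev c Θ (canonData Θ y) τ U := by
  simp only [totalDev, gradDev, bStep_congr (Θ := Θ) h, splitX_congr (Θ := Θ) h']

end Iterates

section Iteration
variable {d T r L n K : ℕ} [NeZero L] {Us : Matrix (Fin d) (Fin r) ℝ} {bs : Matrix (Fin r) (Fin T) ℝ}
  {σ κ : ℝ} {c : Config T n L K} {μ ω β : ℝ} {N : ℕ}

/-- The radius aimed at in a step. -/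
noncomputable def radius (r : ℕ) (κ : ℝ) (τ : ℕ) : ℝ := basin r κ * exp (-0.1 / κ ^ 2) ^ τ

lemma radius_succ (r : ℕ) (κ : ℝ) (τ : ℕ) :
    radius r κ (τ + 1) = radius r κ τ * exp (-0.1 / κ ^ 2) := by
  unfold radius; rw [pow_succ, mul_assoc]

lemma radius_pos (hr : 1 ≤ r) (hκ : 1 ≤ κ) (τ : ℕ) : 0 < radius r κ τ :=
  mul_pos (basin_pos hr hκ) (by positivity)

lemma radius_le (hr : 1 ≤ r) (hκ : 1 ≤ κ) (τ : ℕ) : radius r κ τ ≤ basin r κ :=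
  mul_le_of_le_one_right (basin_pos hr hκ).le (pow_le_one₀ (Real.exp_pos _).le (Real.exp_le_one_iff.2
    (div_nonpos_of_nonpos_of_nonneg (by norm_num) (by positivity))))

/-- The potential of an iterate. -/
noncomputable def iterPot (c : Config T n L K) (Us : Matrix (Fin d) (Fin r) ℝ)
    (bs : Matrix (Fin r) (Fin T) ℝ) (κ : ℝ) (τ : ℕ) (x : Coord T n d r → ℝ) : ℝ :=
  pot Us (200 * r * κ ^ 2) (iterU c (canonData (Us * bs) x) τ)

/-- The iterations have been on schedule. -/
def OnSchedule (c : Config T n L K) (Us : Matrix (Fin d) (Fin r) ℝ)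
    (bs : Matrix (Fin r) (Fin T) ℝ) (κ : ℝ) (τ : ℕ) (x : Coord T n d r → ℝ) : Prop :=
  iterPot c Us bs κ 0 x ≤ basin r κ / 2 ∧ ∀ i ≤ τ, iterPot c Us bs κ i x ≤ radius r κ i

lemma measurable_iterPot (hW : IsWeightMatrix c.graph c.W) (τ : ℕ) :
    Measurable (iterPot c Us bs κ τ) :=
  measurable_pot Us _ (measurable_iterU hW measurable_id τ)

lemma measurableSet_onSchedule (hW : IsWeightMatrix c.graph c.W) (τ : ℕ) :
    MeasurableSet {x | OnSchedule c Us bs κ τ x} := by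
  have : {x | OnSchedule c Us bs κ τ x} = {x | iterPot c Us bs κ 0 x ≤ basin r κ / 2} ∩
      ⋂ i ∈ Finset.range (τ + 1), {x | iterPot c Us bs κ i x ≤ radius r κ i} := by
    ext x
    simp [OnSchedule]
  rw [this]
  refine (measurableSet_le (measurable_iterPot hW 0) measurable_const).inter
    (Finset.measurableSet_biInter _ fun i _ => measurableSet_le (measurable_iterPot hW i) measurable_const)

/-- The samples used in a step. -/
def inStep (c : Config T n L K) (τ : ℕ) (q : Coord T n d r) : Prop :=
  inSplit c (τ + 1) q ∨ inSplit c (τ + K + 1) q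

lemma iterU_congr_of_inStep {x y : Coord T n d r → ℝ} {τ i : ℕ} (hi : i < τ) (hτK : τ ≤ K)
    (h : ∀ q, ¬ inStep c τ q → x q = y q) :
    iterU c (canonData (Us * bs) x) i = iterU c (canonData (Us * bs) y) i := by
  have key : ∀ l, l ≠ τ + 1 → l ≠ τ + K + 1 → ∀ q, inSplit c l q → x q = y q := by
    intro l h1 h2 q hq
    refine h q ?_
    rintro (h3 | h3)
    · exact h1 (inSplit_unique hq h3)
    · exact h2 (inSplit_unique hq h3)
  refine iterU_congr (key 0 (by omega) (by omega)) (key 1 (by omega) (by omega)) (fun q => h _ ?_)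
    fun j hj hj' => ⟨key _ (by omega) (by omega), key _ (by omega) (by omega)⟩
  rintro (h3 | h3) <;> exact h3.elim

/-- Integration over the fresh samples of a step. -/
lemma lintegral_step (hW : IsWeightMatrix c.graph c.W) {τ : ℕ} (hτK : τ + 1 ≤ K)
    {F : (Fin L → Matrix (Fin d) (Fin r) ℝ) → (Coord T n d r → ℝ) → ENNReal}
    (hF : Measurable (Function.uncurry F))
    (hFl : ∀ U x y, (∀ q, inStep c (τ + 1) q → x q = y q) → F U x = F U y) :
    ∫⁻ x in {x | OnSchedule c Us bs κ τ x}, F (iterU c (canonData (Us * bs) x) τ) x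
        ∂gaussM (Coord T n d r) =
      ∫⁻ x in {x | OnSchedule c Us bs κ τ x}, ∫⁻ y, F (iterU c (canonData (Us * bs) x) τ) y
        ∂gaussM (Coord T n d r) ∂gaussM (Coord T n d r) := by
  classical
  set S := {x | OnSchedule c Us bs κ τ x} with hS
  have hSm : MeasurableSet S := measurableSet_onSchedule hW τ
  have hU : Measurable fun x : Coord T n d r → ℝ => iterU c (canonData (Us * bs) x) τ :=
    measurable_iterU hW measurable_id τ
  set f : (Coord T n d r → ℝ) → (Fin L → Matrix (Fin d) (Fin r) ℝ) × ENNReal := fun x =>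
    (iterU c (canonData (Us * bs) x) τ, S.indicator 1 x) with hf
  have hfm : Measurable f := hU.prodMk (measurable_one.indicator hSm)
  have h := lintegral_decouple (fun _ : Coord T n d r => gaussianReal 0 1) (inStep c (τ + 1)) hfm
    (h := fun s x => s.2 * F s.1 x) ((measurable_snd.comp measurable_fst).mul (hF.comp ((measurable_fst.comp measurable_fst).prodMk measurable_snd)))
    (fun x y hxy => ?_) (fun s x y hxy => by simp only [hFl s.1 x y hxy])
  · simp only [hf] at h
    rw [← lintegral_indicator hSm, ← lintegral_indicator hSm]
    convert h using 2
    · ext x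
      by_cases hx : x ∈ S <;> simp [hx]
    · ext x
      by_cases hx : x ∈ S <;> simp [hx]
  · have e : ∀ i, i ≤ τ → iterU c (canonData (Us * bs) x) i = iterU c (canonData (Us * bs) y) i :=
      fun i hi => iterU_congr_of_inStep (by omega) hτK hxy
    have e2 : x ∈ S ↔ y ∈ S := by
      simp only [hS, Set.mem_ofPred_eq, OnSchedule, iterPot]
      rw [e 0 (by omega)]
      refine and_congr_right fun _ => forall_congr' fun i => ?_
      refine ⟨fun h hi => by rw [← e i hi]; exact h hi, fun h hi => by rw [e i hi]; exact h hi⟩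
    simp only [hf, e τ le_rfl]
    by_cases hx : x ∈ S
    · simp [hx, e2.1 hx]
    · simp [hx, e2.not.1 hx]

lemma lyap_mono {p v w : ℝ} (hp : 0 ≤ p) (hβ : 0 ≤ β) (hv : 0 ≤ v) (h : v ≤ w) :
    lyap p β v ≤ lyap p β w := by
  unfold lyap
  gcongr

/-- The iterations remain on schedule. -/
lemma DescentSetup.measure_offSchedule_le (h : DescentSetup c Us bs σ κ μ ω β N) {p : ℝ}
    (hp : 1 / 40 ≤ p) (hp1 : 3 * p ≤ 500 * κ ^ 2 * (d + T)) {τ : ℕ} (hτ : τ ≤ K) :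
    gaussM (Coord T n d r) {x | iterPot c Us bs κ 0 x ≤ basin r κ / 2 ∧ ¬ OnSchedule c Us bs κ τ x} ≤
      ofReal (lyap p β (1 / 2)) := by
  have hκ := h.truth.one_le
  have hr := h.truth.rank_pos
  have hp0 : 0 ≤ p := by linarith
  set M := gaussM (Coord T n d r) with hM
  set S : ℕ → Set (Coord T n d r → ℝ) := fun τ => {x | OnSchedule c Us bs κ τ x} with hS
  have hSm : ∀ τ, MeasurableSet (S τ) := fun τ => measurableSet_onSchedule h.weight τ
  set B : Set (Coord T n d r → ℝ) := {x | iterPot c Us bs κ 0 x ≤ basin r κ / 2} with hB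
  have hBm : MeasurableSet B := measurableSet_le (measurable_iterPot h.weight 0) measurable_const
  set ly : ℕ → (Coord T n d r → ℝ) → ENNReal := fun τ x =>
    ofReal (lyap p β (iterPot c Us bs κ τ x / radius r κ τ)) with hly
  have hlym : ∀ τ, Measurable (ly τ) := fun τ =>
    ((measurable_lyap p β).comp ((measurable_iterPot h.weight τ).div_const _)).ennreal_ofReal
  have hSS : ∀ τ, S (τ + 1) ⊆ S τ := fun τ x hx => ⟨hx.1, fun i hi => hx.2 i (by omega)⟩
  have key : ∀ τ ≤ K, ∫⁻ x in S τ, ly τ x ∂M + M (B \ S τ) ≤ ofReal (lyap p β (1 / 2)) := by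
    intro τ
    induction τ with
    | zero =>
      intro _
      have e : B \ S 0 = ∅ := by
        rw [Set.sdiff_eq_empty]
        intro x hx
        refine ⟨hx, fun i hi => ?_⟩
        have : i = 0 := by omega
        subst this
        have hb := basin_pos hr hκ
        have hx' : iterPot c Us bs κ 0 x ≤ basin r κ / 2 := hx
        simp only [radius, pow_zero, mul_one]
        linarith
      rw [e, measure_empty, add_zero]
      calc ∫⁻ x in S 0, ly 0 x ∂M ≤ ∫⁻ x in S 0, ofReal (lyap p β (1 / 2)) ∂M := by
            refine setLIntegral_mono' (hSm 0) fun x hx => ENNReal.ofReal_le_ofReal ?_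
            refine lyap_mono hp0 h.beta_pos.le (div_nonneg (pot_nonneg _ _) (radius_pos hr hκ 0).le) ?_
            rw [div_le_iff₀ (radius_pos hr hκ 0)]
            have := hx.1
            simp only [radius, pow_zero, mul_one]
            linarith
        _ ≤ _ := by
            rw [setLIntegral_const]
            exact mul_le_of_le_one_right zero_le prob_le_one
    | succ τ ih =>
      intro hτ
      refine le_trans ?_ (ih (by omega))
      have hsplit : M (B \ S (τ + 1)) ≤ M (S τ \ S (τ + 1)) + M (B \ S τ) := by
        refine (measure_mono ?_).trans (measure_union_le _ _)
        intro x hx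
        by_cases hx' : x ∈ S τ
        · exact Or.inl ⟨hx', hx.2⟩
        · exact Or.inr ⟨hx.1, hx'⟩
      refine (add_le_add_right hsplit _).trans ?_
      rw [← add_assoc]
      refine add_le_add_left ?_ _
      set nv : (Coord T n d r → ℝ) → ENNReal := fun x => ofReal (lyap p β
        (nextVal c Us bs κ (radius r κ τ) (τ + 1) (iterU c (canonData (Us * bs) x) τ) x)) with hnv
      calc ∫⁻ x in S (τ + 1), ly (τ + 1) x ∂M + M (S τ \ S (τ + 1)) ≤
            ∫⁻ x in S (τ + 1), nv x ∂M + ∫⁻ x in S τ \ S (τ + 1), nv x ∂M := by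
            refine add_le_add (setLIntegral_mono' (hSm _) fun x hx => ?_) ?_
            · refine ENNReal.ofReal_le_ofReal (le_of_eq ?_)
              have hx1 := hx.2 (τ + 1) le_rfl
              have : nextVal c Us bs κ (radius r κ τ) (τ + 1) (iterU c (canonData (Us * bs) x) τ) x =
                  iterPot c Us bs κ (τ + 1) x / radius r κ (τ + 1) := by
                rw [nextVal, ← radius_succ]
                refine min_eq_left ?_
                rw [div_le_one (radius_pos hr hκ _)]
                exact hx1
              rw [this]
            · calc M (S τ \ S (τ + 1)) = ∫⁻ x in S τ \ S (τ + 1), 1 ∂M := by simp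
                _ ≤ _ := by
                  refine setLIntegral_mono' ((hSm _).diff (hSm _)) fun x hx => ?_
                  have : nextVal c Us bs κ (radius r κ τ) (τ + 1) (iterU c (canonData (Us * bs) x) τ) x = 1 := by
                    rw [nextVal, ← radius_succ]
                    refine min_eq_right ?_
                    rw [one_le_div (radius_pos hr hκ _)]
                    by_contra hcon
                    refine hx.2 ⟨hx.1.1, fun i hi => ?_⟩
                    rcases Nat.lt_or_ge i (τ + 1) with hi' | hi'
                    · exact hx.1.2 i (by omega)
                    · have : i = τ + 1 := by omega
                      subst this
                      exact (not_le.1 hcon).le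
                  rw [hnv]
                  simp only [this, lyap, Real.one_rpow, mul_one]
                  rw [ENNReal.one_le_ofReal]
                  linarith [h.beta_pos]
        _ = ∫⁻ x in S τ, nv x ∂M := by
            rw [← lintegral_union ((hSm _).diff (hSm _)) Set.disjoint_sdiff_right,
              Set.union_sdiff_cancel (hSS τ)]
        _ = ∫⁻ x in S τ, ∫⁻ y, ofReal (lyap p β
              (nextVal c Us bs κ (radius r κ τ) (τ + 1) (iterU c (canonData (Us * bs) x) τ) y)) ∂M ∂M := by
            refine lintegral_step h.weight hτ (F := fun U y => ofReal (lyap p β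
              (nextVal c Us bs κ (radius r κ τ) (τ + 1) U y))) ?_ ?_
            · exact ((measurable_lyap p β).comp
                (measurable_nextVal h.weight _ _ measurable_snd measurable_fst)).ennreal_ofReal
            · intro U x y hxy
              simp only [nextVal]
              rw [gdStep_congr (fun q hq => hxy q (Or.inl hq)) (fun q hq => hxy q (Or.inr hq))]
        _ ≤ ∫⁻ x in S τ, ly τ x ∂M := by
            refine setLIntegral_mono' (hSm τ) fun x hx => ?_
            exact h.lintegral_lyap_le (by omega) hτ (radius_pos hr hκ τ) (radius_le hr hκ τ)
              (hx.2 τ le_rfl) hp hp1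
  exact le_trans (le_trans (by rfl) le_add_self) (key τ hτ)

lemma DescentSetup.measure_last_step_le (h : DescentSetup c Us bs σ κ μ ω β N) {τ : ℕ} (hτ : τ + 1 ≤ K) :
    gaussM (Coord T n d r) {x | OnSchedule c Us bs κ τ x ∧ ¬ StepAccurate c (Us * bs)
      (canonData (Us * bs) x) κ (radius r κ τ) (τ + 1) (iterU c (canonData (Us * bs) x) τ)} ≤
      ofReal ((β * 1e-10 / (r ^ 2 * κ ^ 4)) ^ 2 / (T * (r ^ 2 + 2 * N * d)) +
        exp (-5 * (d + T))) := by
  classical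
  have hκ := h.truth.one_le
  have hr := h.truth.rank_pos
  have hrN : (1 : ℝ) ≤ r := by exact_mod_cast hr
  set M := gaussM (Coord T n d r) with hM
  set S : Set (Coord T n d r → ℝ) := {x | OnSchedule c Us bs κ τ x} with hS
  have hSm : MeasurableSet S := measurableSet_onSchedule h.weight τ
  set E : Set ((Fin L → Matrix (Fin d) (Fin r) ℝ) × (Coord T n d r → ℝ)) := {q | ¬ StepAccurate c (Us * bs)
      (canonData (Us * bs) q.2) κ (radius r κ τ) (τ + 1) q.1} with hE
  have hEm : MeasurableSet E :=
    ((measurableSet_coeffAccurate c (Us * bs) measurable_snd measurable_fst (τ + 1) 0.1).inter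
      (measurableSet_le (measurable_totalDev c (Us * bs) measurable_snd measurable_fst (τ + 1))
        measurable_const)).compl
  have hU : Measurable fun x : Coord T n d r → ℝ => iterU c (canonData (Us * bs) x) τ :=
    measurable_iterU h.weight measurable_id τ
  calc M {x | OnSchedule c Us bs κ τ x ∧ ¬ StepAccurate c (Us * bs)
        (canonData (Us * bs) x) κ (radius r κ τ) (τ + 1) (iterU c (canonData (Us * bs) x) τ)} =
        ∫⁻ x in S, E.indicator (fun _ => (1 : ENNReal)) (iterU c (canonData (Us * bs) x) τ, x) ∂M := by
        have hEm' : MeasurableSet {x | (iterU c (canonData (Us * bs) x) τ, x) ∈ E} :=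
          (hU.prodMk measurable_id) hEm
        have : (fun x => E.indicator (fun _ => (1 : ENNReal)) (iterU c (canonData (Us * bs) x) τ, x)) =
            {x | (iterU c (canonData (Us * bs) x) τ, x) ∈ E}.indicator 1 := by
          ext x; simp [Set.indicator]
        rw [this, lintegral_indicator_one hEm', Measure.restrict_apply hEm', Set.inter_comm]
        rfl
    _ = ∫⁻ x in S, ∫⁻ y, E.indicator (fun _ => (1 : ENNReal)) (iterU c (canonData (Us * bs) x) τ, y) ∂M ∂M := by
        refine lintegral_step h.weight hτ (F := fun U y => E.indicator (fun _ => (1 : ENNReal)) (U, y))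
          (measurable_const.indicator hEm) fun U x y hxy => ?_
        have e1 := coeffAccurate_congr (c := c) (Θ := Us * bs) (τ := τ + 1)
          (fun q hq => hxy q (Or.inl hq)) 0.1 U
        have e2 := totalDev_congr (c := c) (Θ := Us * bs) (τ := τ + 1)
          (fun q hq => hxy q (Or.inl hq)) (fun q hq => hxy q (Or.inr hq)) U
        have e3 : (U, x) ∈ E ↔ (U, y) ∈ E := by
          simp only [hE, Set.mem_ofPred_eq, StepAccurate, e1, e2]
        by_cases hx : (U, x) ∈ E
        · simp [hx, e3.1 hx]
        · simp [hx, e3.not.1 hx]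
    _ ≤ ∫⁻ x in S, ofReal ((β * 1e-10 / (r ^ 2 * κ ^ 4)) ^ 2 / (T * (r ^ 2 + 2 * N * d)) +
        exp (-5 * (d + T))) ∂M := by
        refine setLIntegral_mono' hSm fun x hx => ?_
        have hb := basin_le hr hκ
        have hrad := radius_le hr hκ τ
        have h1 := h.measure_not_stepAccurate_le (τ := τ + 1) (by omega) hτ (radius_pos hr hκ τ) hrad
          (goodState_of_pot_le (by positivity) (by linarith) (hx.2 τ le_rfl))
        refine le_trans (le_of_eq ?_) h1
        have hEm' : MeasurableSet {y | (iterU c (canonData (Us * bs) x) τ, y) ∈ E} :=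
          (measurable_const.prodMk measurable_id) hEm
        have : (fun y => E.indicator (fun _ => (1 : ENNReal)) (iterU c (canonData (Us * bs) x) τ, y)) =
            {y | (iterU c (canonData (Us * bs) x) τ, y) ∈ E}.indicator 1 := by
          ext y; simp [Set.indicator]
        rw [this, lintegral_indicator_one hEm']
        rfl
    _ ≤ _ := by
        rw [setLIntegral_const]
        exact mul_le_of_le_one_right zero_le prob_le_one

end Iteration

section Conclusion
variable {d T r L n K : ℕ} [NeZero L] {Us : Matrix (Fin d) (Fin r) ℝ} {bs : Matrix (Fin r) (Fin T) ℝ}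
  {σ κ : ℝ} {c : Config T n L K} {μ ω β : ℝ} {N : ℕ}

/-- The estimates of the algorithm are `ε`-accurate. -/
def Success (c : Config T n L K) (Θ : Matrix (Fin d) (Fin T) ℝ) (Us : Matrix (Fin d) (Fin r) ℝ) (ε : ℝ)
    (D : Data d T n r) : Prop :=
  (∀ t, vecNorm (thetaHat c D t - Θ.col t) ≤ 1.4 * ε * vecNorm (Θ.col t) ∧
    vecNorm (thetaOut c D t - Θ.col t) ≤ 1.4 * ε * vecNorm (Θ.col t)) ∧
  ∀ g, subspaceDist (iterU c D K g) Us ≤ ε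

lemma DescentSetup.success (h : DescentSetup c Us bs σ κ μ ω β N) {ε : ℝ} (hε : 0 < ε)
    (hrad : radius r κ (K - 1) ≤ 2 * ε * basin r κ) {x : Coord T n d r → ℝ}
    (h1 : OnSchedule c Us bs κ (K - 1) x)
    (h2 : StepAccurate c (Us * bs) (canonData (Us * bs) x) κ (radius r κ (K - 1)) K
      (iterU c (canonData (Us * bs) x) (K - 1))) :
    Success c (Us * bs) Us ε (canonData (Us * bs) x) := by
  have hκ := h.truth.one_le
  have hr := h.truth.rank_pos
  have hrN : (1 : ℝ) ≤ r := by exact_mod_cast hr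
  have hb0 := basin_pos hr hκ
  have hb := basin_le hr hκ
  have hr0 := radius_pos hr hκ (K - 1)
  have hrb := radius_le hr hκ (K - 1)
  have hs := goodState_of_pot_le (by positivity) (by linarith) (h1.2 (K - 1) le_rfl)
  obtain ⟨g1, g2⟩ := h.stepAccurate_bounds (τ := K) h.steps le_rfl hr0 hrb hs h2
  have hK : iterU c (canonData (Us * bs) x) K =
      gdStep c (canonData (Us * bs) x) K (iterU c (canonData (Us * bs) x) (K - 1)) := by
    obtain ⟨m, rfl⟩ : ∃ m, K = m + 1 := ⟨K - 1, by have := h.steps; omega⟩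
    rfl
  have hq : radius r κ (K - 1) / basin r κ ≤ 2 * ε := by rwa [div_le_iff₀ hb0]
  refine ⟨fun t => ⟨?_, ?_⟩, fun g => ?_⟩
  · refine ((g2 t).1).trans ?_
    rw [vecNorm_eq]
    refine mul_le_mul_of_nonneg_right ?_ (nrm_nonneg _)
    linarith
  · unfold thetaOut
    rw [hK]
    refine ((g2 t).2).trans ?_
    rw [vecNorm_eq]
    refine mul_le_mul_of_nonneg_right ?_ (nrm_nonneg _)
    linarith
  · rw [hK]
    refine (subspaceDist_le_comm (g1.orth g) h.truth.orth).trans ((g1.dist g).trans ?_)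
    have h3 : exp (-0.22 / κ ^ 2) ≤ 1 := Real.exp_le_one_iff.2
      (div_nonpos_of_nonpos_of_nonneg (by norm_num) (by positivity))
    have h4 := mul_le_of_le_one_right hr0.le h3
    have h5 : 2 * ε * basin r κ ≤ 2 * ε * (1 / 10000) := by gcongr
    linarith

lemma DescentSetup.measure_failure_le (h : DescentSetup c Us bs σ κ μ ω β N) {ε : ℝ} (hε : 0 < ε)
    (hrad : radius r κ (K - 1) ≤ 2 * ε * basin r κ) {p : ℝ}
    (hp : 1 / 40 ≤ p) (hp1 : 3 * p ≤ 500 * κ ^ 2 * (d + T)) :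
    gaussM (Coord T n d r) {x | iterPot c Us bs κ 0 x ≤ basin r κ / 2 ∧
        ¬ Success c (Us * bs) Us ε (canonData (Us * bs) x)} ≤
      ofReal (lyap p β (1 / 2) + ((β * 1e-10 / (r ^ 2 * κ ^ 4)) ^ 2 / (T * (r ^ 2 + 2 * N * d)) +
        exp (-5 * (d + T)))) := by
  have hK := h.steps
  have hκ := h.truth.one_le
  rw [ENNReal.ofReal_add (lyap_nonneg h.beta_pos.le (by norm_num)) (by positivity)]
  have e : K - 1 + 1 = K := by omega
  have h1 := h.measure_offSchedule_le hp hp1 (τ := K - 1) (by omega)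
  have h2 := h.measure_last_step_le (τ := K - 1) (by omega)
  rw [e] at h2
  refine le_trans ((measure_mono ?_).trans (measure_union_le _ _)) (add_le_add h1 h2)
  rintro x ⟨hx, hx'⟩
  by_cases hS : OnSchedule c Us bs κ (K - 1) x
  · exact Or.inr ⟨hS, fun hA => hx' (h.success hε hrad hS hA)⟩
  · exact Or.inl ⟨hx, hS⟩

end Conclusion

section Truncation
variable {d : ℕ}

lemma exp_le_add_exp_sq (x : ℝ) : exp x ≤ x + exp (x ^ 2) := by
  rcases le_or_gt |x| 1 with h | h
  · have h1 := (abs_le.1 (Real.abs_exp_sub_one_sub_id_le h)).2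
    have h2 := Real.add_one_le_exp (x ^ 2)
    linarith
  · rcases lt_abs.1 h with h | h
    · have : exp x ≤ exp (x ^ 2) := Real.exp_le_exp.2 (by nlinarith)
      linarith
    · have h1 := Real.add_one_le_exp (x ^ 2)
      have h2 : exp x ≤ 1 := Real.exp_le_one_iff.2 (by linarith)
      nlinarith

lemma measurable_trunc (α : ℝ) : Measurable (trunc α) :=
  measurable_trunc_uncurry.comp measurable_prodMk_left

lemma abs_trunc_le (α y : ℝ) : |trunc α y| ≤ sqrt α := by
  unfold trunc
  split_ifs with h
  · exact Real.abs_le_sqrt h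
  · simp

/-- The truncated second moment of a Gaussian variable of standard deviation `ν`, relative to `ν²`. -/
noncomputable def truncMass (α ν : ℝ) : ℝ := ∫ g, (if (ν * g) ^ 2 ≤ α then g ^ 2 else 0) ∂gaussianReal 0 1

lemma integrable_sq_gaussianReal : Integrable (fun g : ℝ => g ^ 2) (gaussianReal 0 1) :=
  (memLp_id_gaussianReal 2).integrable_sq

lemma integral_sq_gaussianReal : ∫ g, g ^ 2 ∂gaussianReal 0 1 = 1 := by
  have h := variance_fun_id_gaussianReal (μ := 0) (v := 1)
  rw [variance_of_integral_eq_zero (by fun_prop) (by simp)] at h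
  simpa using h

lemma measurable_truncMass_aux (α ν : ℝ) :
    Measurable fun g : ℝ => if (ν * g) ^ 2 ≤ α then g ^ 2 else 0 :=
  Measurable.ite (measurableSet_le (by fun_prop) measurable_const) (by fun_prop) measurable_const

lemma integrable_truncMass_aux (α ν : ℝ) :
    Integrable (fun g : ℝ => if (ν * g) ^ 2 ≤ α then g ^ 2 else 0) (gaussianReal 0 1) := by
  refine integrable_sq_gaussianReal.mono (measurable_truncMass_aux α ν).aestronglyMeasurable
    (Filter.Eventually.of_forall fun g => ?_)
  split_ifs
  · simp
  · simpa using sq_nonneg g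

lemma truncMass_le_one (α ν : ℝ) : truncMass α ν ≤ 1 := by
  rw [← integral_sq_gaussianReal]
  refine integral_mono (integrable_truncMass_aux α ν) integrable_sq_gaussianReal fun g => ?_
  simp only
  split_ifs
  · exact le_rfl
  · positivity

lemma truncMass_ge {α ν : ℝ} (h : 8 * ν ^ 2 ≤ α) : 0.2 ≤ truncMass α ν := by
  have hE := lintegral_exp_sq_gaussianReal_eq (s := 3 / 8) (by norm_num)
  have hs : sqrt (1 / (1 - 2 * (3 / 8))) = 2 := by
    rw [Real.sqrt_eq_iff_mul_self_eq (by norm_num) (by norm_num)]; norm_num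
  rw [hs] at hE
  have hm : Measurable fun g : ℝ => exp (3 / 8 * g ^ 2) := by fun_prop
  have hint : Integrable (fun g : ℝ => exp (3 / 8 * g ^ 2)) (gaussianReal 0 1) := by
    refine ⟨hm.aestronglyMeasurable, ?_⟩
    rw [hasFiniteIntegral_iff_ofReal (Filter.Eventually.of_forall fun g => (Real.exp_pos _).le), hE]
    exact ENNReal.ofReal_lt_top
  have hv : ∫ g, exp (3 / 8 * g ^ 2) ∂gaussianReal 0 1 = 2 := by
    rw [integral_eq_lintegral_of_nonneg_ae (Filter.Eventually.of_forall fun g => (Real.exp_pos _).le)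
      hm.aestronglyMeasurable, hE]
    exact ENNReal.toReal_ofReal (by norm_num)
  have he : 8 * exp (-3) ≤ 0.4 := by
    have h1 := Real.exp_one_gt_d9
    have h2 : exp 3 = exp 1 ^ 3 := by rw [← Real.exp_nat_mul]; norm_num
    rw [Real.exp_neg, h2, ← div_eq_mul_inv, div_le_iff₀ (by positivity)]
    have h3 : (2.718 : ℝ) ^ 3 ≤ exp 1 ^ 3 := by gcongr; linarith
    norm_num at h3 ⊢
    linarith
  have hle : ∫ g, (g ^ 2 - 0.4 * exp (3 / 8 * g ^ 2)) ∂gaussianReal 0 1 ≤ truncMass α ν := by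
    refine integral_mono (integrable_sq_gaussianReal.sub (hint.const_mul _)) (integrable_truncMass_aux α ν)
      fun g => ?_
    simp only
    split_ifs with hg
    · have := Real.exp_pos (3 / 8 * g ^ 2); linarith
    · have hg8 : 8 < g ^ 2 := by
        by_contra hcon
        refine hg ?_
        have : ν ^ 2 * g ^ 2 ≤ ν ^ 2 * 8 := by gcongr; exact not_lt.1 hcon
        rw [mul_pow]; linarith
      have h1 := Real.add_one_le_exp (g ^ 2 / 8 - 1)
      have h2 : exp (g ^ 2 / 8 - 1) ≤ exp (3 * (g ^ 2 / 8 - 1)) :=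
        Real.exp_le_exp.2 (by linarith)
      have h3 : exp (3 * (g ^ 2 / 8 - 1)) = exp (-3) * exp (3 / 8 * g ^ 2) := by
        rw [← Real.exp_add]; congr 1; ring
      have h4 : 8 * exp (-3) * exp (3 / 8 * g ^ 2) ≤ 0.4 * exp (3 / 8 * g ^ 2) := by
        gcongr
      linarith
  rw [integral_sub integrable_sq_gaussianReal (hint.const_mul _), integral_sq_gaussianReal,
    integral_const_mul, hv] at hle
  linarith

lemma integrable_dotProduct (w : Fin d → ℝ) : Integrable (fun x => w ⬝ᵥ x) (gaussM (Fin d)) := by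
  have hm : Measurable fun x : Fin d → ℝ => w ⬝ᵥ x := Measurable.dotProduct measurable_const measurable_id
  have h : Integrable id ((gaussM (Fin d)).map fun x => w ⬝ᵥ x) := by
    rw [gaussM_map_dotProduct]
    refine (integrable_map_measure measurable_id.aestronglyMeasurable (by fun_prop)).2 ?_
    exact ((memLp_id_gaussianReal 1).integrable (by simp)).const_mul _
  exact (integrable_map_measure measurable_id.aestronglyMeasurable hm.aemeasurable).1 h

lemma integral_dotProduct_mul_eq_zero {v θ : Fin d → ℝ} (h : v ⬝ᵥ θ = 0) {f : ℝ → ℝ} (hf : Measurable f) :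
    ∫ x, (v ⬝ᵥ x) * f (θ ⬝ᵥ x) ∂gaussM (Fin d) = 0 := by
  let V : EuclideanSpace ℝ (Fin d) := WithLp.toLp 2 v
  let R := (Submodule.span ℝ {V})ᗮ.reflection
  have hin : ∀ a x : Fin d → ℝ, a ⬝ᵥ x = inner ℝ (WithLp.toLp 2 a : EuclideanSpace ℝ (Fin d)) (WithLp.toLp 2 x) :=
    fun a x => by rw [inner_toLp]
  have hR : ∀ a b : EuclideanSpace ℝ (Fin d), inner ℝ a (R b) = inner ℝ (R a) b := fun a b => by
    rw [← LinearIsometryEquiv.inner_map_map R a (R b), Submodule.reflection_reflection]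
  have h1 : R V = -V := Submodule.reflection_orthogonalComplement_singleton_eq_neg V
  have h2 : R (WithLp.toLp 2 θ) = WithLp.toLp 2 θ := by
    refine Submodule.reflection_mem_subspace_eq_self ?_
    rw [Submodule.mem_orthogonal_singleton_iff_inner_right, ← hin, h]
  have hm : Measurable fun x : Fin d → ℝ => (v ⬝ᵥ x) * f (θ ⬝ᵥ x) :=
    (Measurable.dotProduct measurable_const measurable_id).mul
      (hf.comp (Measurable.dotProduct measurable_const measurable_id))
  let G : EuclideanSpace ℝ (Fin d) → ℝ := fun z => inner ℝ V z * f (inner ℝ (WithLp.toLp 2 θ) z)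
  have hG : Measurable G := by
    refine Measurable.mul ?_ (hf.comp ?_) <;> exact measurable_const.inner measurable_id
  have e1 : ∫ x, (v ⬝ᵥ x) * f (θ ⬝ᵥ x) ∂gaussM (Fin d) = ∫ z, G z ∂stdGaussian (EuclideanSpace ℝ (Fin d)) := by
    rw [← map_pi_eq_stdGaussian, integral_map (by fun_prop) hG.aestronglyMeasurable]
    refine integral_congr_ae (Filter.Eventually.of_forall fun x => ?_)
    simp only [G, V, hin]
  have e2 : ∫ z, G z ∂stdGaussian (EuclideanSpace ℝ (Fin d)) =
      -∫ z, G z ∂stdGaussian (EuclideanSpace ℝ (Fin d)) := by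
    conv_lhs => rw [← stdGaussian_map R]
    rw [integral_map (by fun_prop) hG.aestronglyMeasurable, ← integral_neg]
    refine integral_congr_ae (Filter.Eventually.of_forall fun z => ?_)
    simp only [G, hR, h1, h2, inner_neg_left, neg_mul]
  rw [e1]
  linarith

lemma integrable_dotProduct_mul_trunc (w θ : Fin d → ℝ) (α : ℝ) :
    Integrable (fun x => (w ⬝ᵥ x) * trunc α (θ ⬝ᵥ x)) (gaussM (Fin d)) := by
  have hw : Measurable fun x : Fin d → ℝ => w ⬝ᵥ x := Measurable.dotProduct measurable_const measurable_id
  have hθ : Measurable fun x : Fin d → ℝ => θ ⬝ᵥ x := Measurable.dotProduct measurable_const measurable_id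
  refine ((integrable_dotProduct w).norm.const_mul (sqrt α)).mono
    (hw.mul ((measurable_trunc α).comp hθ)).aestronglyMeasurable (Filter.Eventually.of_forall fun x => ?_)
  simp only [norm_mul, Real.norm_eq_abs, abs_abs, abs_of_nonneg (Real.sqrt_nonneg α)]
  rw [mul_comm]
  gcongr
  exact abs_trunc_le _ _

/-- The mean of a truncated response times a covariate. -/
lemma integral_dotProduct_mul_trunc (w θ : Fin d → ℝ) (α : ℝ) :
    ∫ x, (w ⬝ᵥ x) * trunc α (θ ⬝ᵥ x) ∂gaussM (Fin d) = truncMass α (nrm θ) * (w ⬝ᵥ θ) := by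
  by_cases hθ : nrm θ = 0
  · rw [nrm_eq_zero] at hθ
    subst hθ
    simp [trunc]
  set a := (w ⬝ᵥ θ) / nrm θ ^ 2 with ha
  set v := w - a • θ with hv
  have hvθ : v ⬝ᵥ θ = 0 := by
    rw [hv, sub_dotProduct, smul_dotProduct, ← nrm_sq, smul_eq_mul, ha]
    field_simp
    ring
  have e : ∀ x, (w ⬝ᵥ x) * trunc α (θ ⬝ᵥ x) =
      a * ((θ ⬝ᵥ x) * trunc α (θ ⬝ᵥ x)) + (v ⬝ᵥ x) * trunc α (θ ⬝ᵥ x) := fun x => by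
    rw [hv, sub_dotProduct, smul_dotProduct, smul_eq_mul]; ring
  simp_rw [e]
  rw [integral_add ((integrable_dotProduct_mul_trunc θ θ α).const_mul a) (integrable_dotProduct_mul_trunc v θ α),
    integral_dotProduct_mul_eq_zero hvθ (measurable_trunc α), add_zero, integral_const_mul]
  have hθm : Measurable fun x : Fin d → ℝ => θ ⬝ᵥ x := Measurable.dotProduct measurable_const measurable_id
  have hG : Measurable fun y : ℝ => y * trunc α y := measurable_id.mul (measurable_trunc α)
  have e2 : ∫ x, (θ ⬝ᵥ x) * trunc α (θ ⬝ᵥ x) ∂gaussM (Fin d) = nrm θ ^ 2 * truncMass α (nrm θ) := by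
    rw [← integral_map (f := fun y : ℝ => y * trunc α y) hθm.aemeasurable hG.aestronglyMeasurable,
      gaussM_map_dotProduct, integral_map (by fun_prop) hG.aestronglyMeasurable, truncMass,
      ← integral_const_mul]
    refine integral_congr_ae (Filter.Eventually.of_forall fun g => ?_)
    simp only [trunc]
    split_ifs <;> ring
  rw [e2, ha]
  field_simp

/-- Sub-Gaussian moments of a centered product of a truncated response and a covariate. -/
lemma lintegral_exp_trunc_le {w θ : Fin d → ℝ} (hw : nrm w ≤ 1) {α : ℝ} (hα : 8 * nrm θ ^ 2 ≤ α) (s : ℝ) :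
    ∫⁻ x, ofReal (exp (s * ((w ⬝ᵥ x) * trunc α (θ ⬝ᵥ x) -
      truncMass α (nrm θ) * (w ⬝ᵥ θ)))) ∂gaussM (Fin d) ≤ ofReal (exp (7 * (s ^ 2 * α))) := by
  have hα0 : 0 ≤ α := le_trans (by positivity) hα
  have hν := nrm_nonneg θ
  have hw0 := nrm_nonneg w
  have hwm : Measurable fun x : Fin d → ℝ => w ⬝ᵥ x := Measurable.dotProduct measurable_const measurable_id
  have hθm : Measurable fun x : Fin d → ℝ => θ ⬝ᵥ x := Measurable.dotProduct measurable_const measurable_id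
  set m := truncMass α (nrm θ) * (w ⬝ᵥ θ) with hm
  set Y : (Fin d → ℝ) → ℝ := fun x => (w ⬝ᵥ x) * trunc α (θ ⬝ᵥ x) - m with hY
  have hYm : Measurable Y := (hwm.mul ((measurable_trunc α).comp hθm)).sub_const _
  have hYi : Integrable Y (gaussM (Fin d)) := (integrable_dotProduct_mul_trunc w θ α).sub (integrable_const _)
  have hY0 : ∫ x, Y x ∂gaussM (Fin d) = 0 := by
    rw [hY, integral_sub (integrable_dotProduct_mul_trunc w θ α) (integrable_const _),
      integral_dotProduct_mul_trunc]
    simp [hm]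
  set q := sqrt α with hq
  have hq0 : 0 ≤ q := Real.sqrt_nonneg _
  have hqα : q ^ 2 = α := Real.sq_sqrt hα0
  have hmq : |m| ≤ q := by
    have h1 := truncMass_le_one α (nrm θ)
    have h2 := truncMass_ge hα
    rw [hm, abs_mul, abs_of_nonneg (by linarith : 0 ≤ truncMass α (nrm θ))]
    refine (mul_le_of_le_one_left (abs_nonneg _) h1).trans ((abs_dotProduct_le _ _).trans ?_)
    refine (mul_le_of_le_one_left hν hw).trans ?_
    exact Real.le_sqrt_of_sq_le (by nlinarith)
  have hYb : ∀ x, |Y x| ≤ q * (|w ⬝ᵥ x| + 1) := fun x => by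
    calc |Y x| ≤ |(w ⬝ᵥ x) * trunc α (θ ⬝ᵥ x)| + |m| := abs_sub _ _
      _ ≤ |w ⬝ᵥ x| * q + q := by
          rw [abs_mul]
          gcongr
          exact abs_trunc_le _ _
      _ = _ := by ring
  have hMG : ∀ u : ℝ, 0 ≤ u → u ≤ 1 / 4 →
      ∫⁻ x, ofReal (exp (u * (w ⬝ᵥ x) ^ 2)) ∂gaussM (Fin d) ≤ ofReal (exp (2 * u)) := by
    intro u hu0 hu1
    rw [lintegral_gaussM_dotProduct w (F := fun y => ofReal (exp (u * y ^ 2))) (by fun_prop)]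
    have hw2 : nrm w ^ 2 ≤ 1 := pow_le_one₀ hw0 hw
    have h3 : u * nrm w ^ 2 ≤ u := mul_le_of_le_one_right hu0 hw2
    have h1 := lintegral_exp_sq_gaussianReal (s := u * nrm w ^ 2)
      (by rw [abs_of_nonneg (by positivity)]; linarith)
    refine le_trans (le_of_eq (lintegral_congr fun g => ?_)) (h1.trans (ENNReal.ofReal_le_ofReal
      (Real.exp_le_exp.2 ?_)))
    · congr 2; ring
    · have h4 : 0 ≤ u * nrm w ^ 2 := by positivity
      nlinarith
  rcases le_or_gt (s ^ 2 * α) (1 / 8) with hs | hs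
  · have hsq : ∀ x, (s * Y x) ^ 2 ≤ 2 * (s ^ 2 * α) + 2 * (s ^ 2 * α) * (w ⬝ᵥ x) ^ 2 := fun x => by
      have h1 : Y x ^ 2 ≤ (q * (|w ⬝ᵥ x| + 1)) ^ 2 := by
        rw [← sq_abs]; gcongr; exact hYb x
      have h2 : (|w ⬝ᵥ x| + 1) ^ 2 ≤ 2 + 2 * (w ⬝ᵥ x) ^ 2 := by
        rw [← sq_abs (w ⬝ᵥ x)]; nlinarith [sq_nonneg (|w ⬝ᵥ x| - 1)]
      calc (s * Y x) ^ 2 = s ^ 2 * Y x ^ 2 := by ring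
        _ ≤ s ^ 2 * (q ^ 2 * (2 + 2 * (w ⬝ᵥ x) ^ 2)) := by
            rw [mul_pow] at h1
            gcongr
            exact h1.trans (by gcongr)
        _ = _ := by rw [hqα]; ring
    have hb : ∫⁻ x, ofReal (exp ((s * Y x) ^ 2)) ∂gaussM (Fin d) ≤
        ofReal (exp (7 * (s ^ 2 * α))) := by
      have h0 : 0 ≤ s ^ 2 * α := by positivity
      calc _ ≤ ∫⁻ x, ofReal (exp (2 * (s ^ 2 * α))) *
            ofReal (exp (2 * (s ^ 2 * α) * (w ⬝ᵥ x) ^ 2)) ∂gaussM (Fin d) := by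
            refine lintegral_mono fun x => ?_
            rw [← ENNReal.ofReal_mul (Real.exp_pos _).le, ← Real.exp_add]
            exact ENNReal.ofReal_le_ofReal (Real.exp_le_exp.2 (hsq x))
        _ ≤ ofReal (exp (2 * (s ^ 2 * α))) * ofReal (exp (2 * (2 * (s ^ 2 * α)))) := by
            rw [lintegral_const_mul _ (((hwm.pow_const 2).const_mul _).exp.ennreal_ofReal)]
            gcongr
            exact hMG _ (by positivity) (by linarith)
        _ ≤ _ := by
            rw [← ENNReal.ofReal_mul (Real.exp_pos _).le, ← Real.exp_add]
            exact ENNReal.ofReal_le_ofReal (Real.exp_le_exp.2 (by linarith))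
    have hEm : Measurable fun x => exp ((s * Y x) ^ 2) := ((hYm.const_mul s).pow_const 2).exp
    have hEi : Integrable (fun x => exp ((s * Y x) ^ 2)) (gaussM (Fin d)) := by
      refine ⟨hEm.aestronglyMeasurable, ?_⟩
      rw [hasFiniteIntegral_iff_ofReal (Filter.Eventually.of_forall fun g => (Real.exp_pos _).le)]
      exact hb.trans_lt ENNReal.ofReal_lt_top
    have hpos : ∀ x, 0 ≤ s * Y x + exp ((s * Y x) ^ 2) := fun x =>
      (Real.exp_pos _).le.trans (exp_le_add_exp_sq _)
    calc _ ≤ ∫⁻ x, ofReal (s * Y x + exp ((s * Y x) ^ 2)) ∂gaussM (Fin d) :=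
          lintegral_mono fun x => ENNReal.ofReal_le_ofReal (exp_le_add_exp_sq _)
      _ = ofReal (∫ x, (s * Y x + exp ((s * Y x) ^ 2)) ∂gaussM (Fin d)) :=
          (ofReal_integral_eq_lintegral_ofReal ((hYi.const_mul s).add hEi)
            (Filter.Eventually.of_forall hpos)).symm
      _ = ofReal (∫ x, exp ((s * Y x) ^ 2) ∂gaussM (Fin d)) := by
          rw [integral_add (hYi.const_mul s) hEi, integral_const_mul, hY0, mul_zero, zero_add]
      _ = ∫⁻ x, ofReal (exp ((s * Y x) ^ 2)) ∂gaussM (Fin d) :=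
          ofReal_integral_eq_lintegral_ofReal hEi (Filter.Eventually.of_forall fun x => (Real.exp_pos _).le)
      _ ≤ _ := hb
  · set u := |s| * q with hu
    have hu0 : 0 ≤ u := by positivity
    have hu2 : u ^ 2 = s ^ 2 * α := by rw [hu, mul_pow, sq_abs, hqα]
    rw [← hu2] at hs ⊢
    calc _ ≤ ∫⁻ x, ofReal (exp (2 * u ^ 2 + u)) *
          ofReal (exp (1 / 8 * (w ⬝ᵥ x) ^ 2)) ∂gaussM (Fin d) := by
          refine lintegral_mono fun x => ?_
          rw [← ENNReal.ofReal_mul (Real.exp_pos _).le, ← Real.exp_add]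
          refine ENNReal.ofReal_le_ofReal (Real.exp_le_exp.2 ?_)
          have h1 : s * Y x ≤ u * (|w ⬝ᵥ x| + 1) := by
            refine (le_abs_self _).trans ?_
            rw [abs_mul, hu, mul_assoc]
            exact mul_le_mul_of_nonneg_left (hYb x) (abs_nonneg _)
          have h2 : u * |w ⬝ᵥ x| ≤ 2 * u ^ 2 + 1 / 8 * (w ⬝ᵥ x) ^ 2 := by
            rw [← sq_abs (w ⬝ᵥ x)]; nlinarith [sq_nonneg (4 * u - |w ⬝ᵥ x|)]
          linarith
      _ ≤ ofReal (exp (2 * u ^ 2 + u)) * ofReal (exp (2 * (1 / 8))) := by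
          rw [lintegral_const_mul _ (((hwm.pow_const 2).const_mul _).exp.ennreal_ofReal)]
          gcongr
          exact hMG _ (by norm_num) (by norm_num)
      _ ≤ _ := by
          rw [← ENNReal.ofReal_mul (Real.exp_pos _).le, ← Real.exp_add]
          refine ENNReal.ofReal_le_ofReal (Real.exp_le_exp.2 ?_)
          nlinarith [sq_nonneg (u - 1 / 3)]

end Truncation

section InitialEstimate
variable {d T r L n K : ℕ} [NeZero L] {Us : Matrix (Fin d) (Fin r) ℝ} {bs : Matrix (Fin r) (Fin T) ℝ}
  {σ κ μ : ℝ} {c : Config T n L K}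

/-- The scale of the truncation thresholds. -/
noncomputable def truncScale (bs : Matrix (Fin r) (Fin T) ℝ) (κ μ : ℝ) : ℝ := κ ^ 2 * μ ^ 2 * fro bs ^ 2 / T

lemma GroundTruth.fro_ge (h : GroundTruth Us bs σ κ) : r * (σ / κ) ^ 2 ≤ fro bs ^ 2 := by
  classical
  rw [← fro_transpose, fro_sq_eq_sum_col]
  calc r * (σ / κ) ^ 2 = ∑ _k : Fin r, (σ / κ) ^ 2 := by simp
    _ ≤ _ := Finset.sum_le_sum fun k _ => by
      have h1 := h.lower (Pi.single k 1)
      rw [nrm_single, abs_one, mul_one, mulVec_single_one] at h1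
      have := h.sigma_pos
      have := h.one_le
      gcongr

lemma GroundTruth.truncScale_bounds (h : GroundTruth Us bs σ κ) (hT : 1 ≤ T) :
    μ ^ 2 * (r / T) * σ ^ 2 ≤ truncScale bs κ μ ∧ truncScale bs κ μ ≤ κ ^ 2 * μ ^ 2 * r * σ ^ 2 / T := by
  have h1 := h.fro_ge
  have h2 := h.fro_le
  have hσ := h.sigma_pos
  have hκ := h.one_le
  have hT' : (0 : ℝ) < T := by exact_mod_cast hT
  have h3 : fro bs ^ 2 ≤ r * σ ^ 2 := by
    have h4 : fro bs ^ 2 ≤ (sqrt r * σ) ^ 2 := by gcongr; exact fro_nonneg _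
    rwa [mul_pow, Real.sq_sqrt (by positivity)] at h4
  unfold truncScale
  constructor
  · calc μ ^ 2 * (r / T) * σ ^ 2 = κ ^ 2 * μ ^ 2 * (r * (σ / κ) ^ 2) / T := by field_simp
      _ ≤ _ := by gcongr
  · calc κ ^ 2 * μ ^ 2 * fro bs ^ 2 / T ≤ κ ^ 2 * μ ^ 2 * (r * σ ^ 2) / T := by gcongr
      _ = _ := by ring

/-- Sum of the squared responses of the first set. -/
noncomputable def energy (c : Config T n L K) (Θ : Matrix (Fin d) (Fin T) ℝ) (x : Coord T n d r → ℝ) : ℝ :=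
  ∑ t, ∑ i, splitY c (canonData Θ x) 0 t i ^ 2

/-- The thresholds are within a constant factor of their scale. -/
def ThresholdsGood (bs : Matrix (Fin r) (Fin T) ℝ) (κ μ : ℝ) (α : Fin L → ℝ) : Prop :=
  ∀ g, 8 * truncScale bs κ μ ≤ α g ∧ α g ≤ 10 * truncScale bs κ μ

lemma measurableSet_thresholdsGood : MeasurableSet {α : Fin L → ℝ | ThresholdsGood bs κ μ α} := by
  have : {α : Fin L → ℝ | ThresholdsGood bs κ μ α} = ⋂ g, {α : Fin L → ℝ | 8 * truncScale bs κ μ ≤ α g} ∩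
      {α | α g ≤ 10 * truncScale bs κ μ} := by
    ext; simp [ThresholdsGood]
  rw [this]
  exact MeasurableSet.iInter fun g => (measurableSet_le measurable_const (measurable_pi_apply g)).inter
    (measurableSet_le (measurable_pi_apply g) measurable_const)

lemma thresholdsGood_of_energy (hW : IsWeightMatrix c.graph c.W) {ω : ℝ}
    (hw : ∀ g j, |(c.W ^ c.TconInit) g j - 1 / L| ≤ ω / L ^ 2) (hω : ω ≤ 0.05)
    (hκ : c.κ = κ) (hμ : c.μ = μ) (hn : 0 < c.size 0) {x : Coord T n d r → ℝ}
    (h1 : 0.95 * (c.size 0 * fro bs ^ 2) ≤ energy c (Us * bs) x)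
    (h2 : energy c (Us * bs) x ≤ 1.05 * (c.size 0 * fro bs ^ 2)) :
    ThresholdsGood bs κ μ (alpha c (canonData (Us * bs) x)) := by
  intro g
  have hL : (1 : ℝ) ≤ L := by exact_mod_cast NeZero.one_le
  have hn' : (0 : ℝ) < c.size 0 := by exact_mod_cast hn
  set D := canonData (Us * bs) x with hD
  set q : Fin L → ℝ := fun j => ∑ t ∈ Finset.univ.filter (fun t => c.node t = j),
    ∑ i, splitY c D 0 t i ^ 2 with hq
  have hq0 : ∀ j, 0 ≤ q j := fun j => Finset.sum_nonneg fun t _ => Finset.sum_nonneg fun i _ => sq_nonneg _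
  have hsum : ∑ j, q j = energy c (Us * bs) x := by
    rw [hq, energy]
    exact Finset.sum_fiberwise _ _ _
  set a := 9 * κ ^ 2 * μ ^ 2 / (c.size 0 * T) with ha
  have ha0 : 0 ≤ a := by positivity
  have hw' : ∀ j, 0.95 ≤ (c.W ^ c.TconInit) g j * L ∧ (c.W ^ c.TconInit) g j * L ≤ 1.05 := fun j => by
    have h3 := abs_le.1 (hw g j)
    have h4 : ω / L ^ 2 ≤ 0.05 * (1 / L) := by
      rw [div_le_iff₀ (by positivity)]
      have : 0.05 * (1 / (L : ℝ)) * L ^ 2 = 0.05 * L := by field_simp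
      rw [this]; linarith
    have h5 : 1 / (L : ℝ) * L = 1 := by field_simp
    constructor
    · have h6 : 0.95 * (1 / (L : ℝ)) ≤ (c.W ^ c.TconInit) g j := by linarith
      have := mul_le_mul_of_nonneg_right h6 (by linarith : (0 : ℝ) ≤ L)
      linarith
    · have h6 : (c.W ^ c.TconInit) g j ≤ 1.05 * (1 / (L : ℝ)) := by linarith
      have := mul_le_mul_of_nonneg_right h6 (by linarith : (0 : ℝ) ≤ L)
      linarith
  have hα : alpha c D g = a * ∑ j, (c.W ^ c.TconInit) g j * L * q j := by
    rw [alpha, agree_eq hW, Finset.mul_sum]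
    refine Finset.sum_congr rfl fun j _ => ?_
    rw [alphaIn, hκ, hμ, smul_eq_mul, ha, hq]
    ring
  have hlo : 0.95 * energy c (Us * bs) x ≤ ∑ j, (c.W ^ c.TconInit) g j * L * q j := by
    rw [← hsum, Finset.mul_sum]
    exact Finset.sum_le_sum fun j _ => mul_le_mul_of_nonneg_right (hw' j).1 (hq0 j)
  have hhi : ∑ j, (c.W ^ c.TconInit) g j * L * q j ≤ 1.05 * energy c (Us * bs) x := by
    rw [← hsum, Finset.mul_sum]
    exact Finset.sum_le_sum fun j _ => mul_le_mul_of_nonneg_right (hw' j).2 (hq0 j)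
  have hsc : a * (c.size 0 * fro bs ^ 2) = 9 * truncScale bs κ μ := by
    rw [ha, truncScale]
    field_simp
  have hsc0 : 0 ≤ truncScale bs κ μ := by unfold truncScale; positivity
  rw [hα]
  generalize ∑ j, (c.W ^ c.TconInit) g j * L * q j = S at hlo hhi ⊢
  constructor
  · have := mul_le_mul_of_nonneg_left (show 0.9025 * (c.size 0 * fro bs ^ 2) ≤ S by linarith) ha0
    linarith
  · have := mul_le_mul_of_nonneg_left (show S ≤ 1.1025 * (c.size 0 * fro bs ^ 2) by linarith) ha0
    linarith

lemma nrm_mul_col (hU : Usᵀ * Us = 1) (t : Fin T) : nrm ((Us * bs).col t) = nrm (bs.col t) := by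
  rw [mul_col_eq, nrm_mulVec_orthonormal hU]

lemma measure_not_thresholdsGood_le (hG : GroundTruth Us bs σ κ) (hW : IsWeightMatrix c.graph c.W) {ω : ℝ}
    (hw : ∀ g j, |(c.W ^ c.TconInit) g j - 1 / L| ≤ ω / L ^ 2) (hω : ω ≤ 0.05)
    (hκ : c.κ = κ) (hμ : c.μ = μ) (hn : 0 < c.size 0) (hT : 1 ≤ T) (hμ1 : 1 ≤ μ)
    (hinc : ∀ t, nrm (bs.col t) ^ 2 ≤ μ ^ 2 * (r / T) * σ ^ 2)
    (hsamp : 2e5 * κ ^ 2 * μ ^ 2 * (d + T) ≤ c.size 0 * T) :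
    gaussM (Coord T n d r) {x | ¬ ThresholdsGood bs κ μ (alpha c (canonData (Us * bs) x))} ≤
      ofReal (2 * exp (-5 * (d + T))) := by
  have hσ := hG.sigma_pos
  have hκ1 := hG.one_le
  have hr : (1 : ℝ) ≤ r := by exact_mod_cast hG.rank_pos
  have hT' : (1 : ℝ) ≤ T := by exact_mod_cast hT
  have hn' : (0 : ℝ) < c.size 0 := by exact_mod_cast hn
  set F := (c.size 0 : ℝ) * fro bs ^ 2 with hF
  set B := μ ^ 2 * (r / T) * σ ^ 2 with hB
  have hB0 : 0 < B := by positivity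
  have hFB : 2e5 * (d + T) * B ≤ F := by
    have h1 : (c.size 0 : ℝ) * (r * (σ / κ) ^ 2) ≤ F := by rw [hF]; gcongr; exact hG.fro_ge
    refine le_trans ?_ h1
    calc 2e5 * (d + T) * B = (2e5 * κ ^ 2 * μ ^ 2 * (d + T)) * (r * (σ / κ) ^ 2 / T) := by
          rw [hB]; field_simp
      _ ≤ (c.size 0 * T) * (r * (σ / κ) ^ 2 / T) := by gcongr
      _ = _ := by field_simp
  set Y : (Coord T n d r → ℝ) → ℝ := fun x => energy c (Us * bs) x - F with hY
  have hYm : Measurable Y := by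
    refine Measurable.sub_const (Finset.measurable_sum _ fun t _ => Finset.measurable_sum _ fun i _ => ?_) _
    exact (measurable_pi_iff.1 (measurable_splitY measurable_id 0 t) i).pow_const 2
  have hmgf : ∀ s : ℝ, |s| * B ≤ 1 / 8 → ∫⁻ x, ofReal (exp (s * Y x)) ∂gaussM (Coord T n d r) ≤
      ofReal (exp (16 * (s ^ 2 * B * F))) := by
    intro s hs
    have h1 := lintegral_exp_sum_bilin (sampleRow_injective (r := r) (d := d) c 0) Finset.univ
      (fun p => s • (Us * bs).col p.1) (fun p => (Us * bs).col p.1) (fun p _ => by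
        rw [nrm_smul, nrm_mul_col hG.orth, mul_assoc, ← pow_two]
        exact (mul_le_mul_of_nonneg_left (hinc p.1) (abs_nonneg s)).trans hs)
    refine le_trans (le_of_eq (lintegral_congr fun x => ?_)) (h1.trans (ENNReal.ofReal_le_ofReal
      (Real.exp_le_exp.2 ?_)))
    · congr 2
      rw [hY, Fintype.sum_prod_type]
      have e1 : F = ∑ t, ∑ _i : c.Idx 0, (Us * bs).col t ⬝ᵥ (Us * bs).col t := by
        rw [hF, fro_sq_eq_sum_col, Finset.mul_sum]
        refine Finset.sum_congr rfl fun t _ => ?_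
        rw [← nrm_sq, nrm_mul_col hG.orth, Finset.sum_const, Finset.card_univ, nsmul_eq_mul]
        rfl
      have e2 : ∀ t i, splitY c (canonData (Us * bs) x) 0 t i =
          (Us * bs).col t ⬝ᵥ fun j => x (sampleRow r c d 0 (t, i) j) := fun t i => by
        rw [splitY_canonData, splitX_canonData, rowMatrix_mulVec]
      simp only [energy]
      rw [e1, ← Finset.sum_sub_distrib, Finset.mul_sum]
      refine Finset.sum_congr rfl fun t _ => ?_
      rw [← Finset.sum_sub_distrib, Finset.mul_sum]
      refine Finset.sum_congr rfl fun i _ => ?_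
      rw [e2, smul_dotProduct, smul_dotProduct, smul_eq_mul, smul_eq_mul]
      ring
    · rw [← Finset.mul_sum, Fintype.sum_prod_type]
      refine mul_le_mul_of_nonneg_left ?_ (by norm_num)
      rw [hF, fro_sq_eq_sum_col, Finset.mul_sum, Finset.mul_sum]
      refine Finset.sum_le_sum fun t _ => ?_
      simp only [Finset.sum_const, Finset.card_univ, nsmul_eq_mul]
      rw [nrm_smul, nrm_mul_col hG.orth, mul_pow, sq_abs]
      calc (Fintype.card (c.Idx 0) : ℝ) * (s ^ 2 * nrm (bs.col t) ^ 2 * nrm (bs.col t) ^ 2) ≤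
            Fintype.card (c.Idx 0) * (s ^ 2 * B * nrm (bs.col t) ^ 2) := by gcongr; exact hinc t
        _ = _ := by rw [Config.size]; ring
  set s := 1 / (640 * B) with hs
  have hs0 : 0 < s := by positivity
  have hsB : s * B = 1 / 640 := by rw [hs]; field_simp
  have hexp : 16 * (s ^ 2 * B * F) - s * (0.05 * F) ≤ -5 * (d + T) := by
    have h1 : s ^ 2 * B * F = 1 / 640 * (s * F) := by rw [← hsB]; ring
    have h2 : 2e5 * (d + T) * (1 / 640) ≤ s * F := by
      rw [← hsB]
      calc 2e5 * (d + T) * (s * B) = s * (2e5 * (d + T) * B) := by ring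
        _ ≤ _ := by gcongr
    have h3 : (0 : ℝ) ≤ d + T := by positivity
    rw [h1]; linarith
  have hup := measure_ge_le_exp hYm hs0.le (t := 0.05 * F) (hmgf s (by rw [abs_of_pos hs0, hsB]; norm_num))
  have hlow := measure_ge_le_exp hYm.neg hs0.le (t := 0.05 * F) (B := 16 * (s ^ 2 * B * F)) (by
    have := hmgf (-s) (by rw [abs_neg, abs_of_pos hs0, hsB]; norm_num)
    simpa [neg_sq] using this)
  rw [two_mul, ENNReal.ofReal_add (Real.exp_pos _).le (Real.exp_pos _).le]
  refine le_trans ((measure_mono ?_).trans (measure_union_le _ _)) (add_le_add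
    (hup.trans (ENNReal.ofReal_le_ofReal (Real.exp_le_exp.2 hexp)))
    (hlow.trans (ENNReal.ofReal_le_ofReal (Real.exp_le_exp.2 hexp))))
  intro x hx
  by_contra hcon
  simp only [Set.mem_union, Set.mem_ofPred_eq, not_or, not_le, hY, Pi.neg_apply] at hcon
  exact hx (thresholdsGood_of_energy hW hw hω hκ hμ hn (by linarith [hcon.2]) (by linarith [hcon.1]))

lemma dotProduct_truncTheta_sub (Θ : Matrix (Fin d) (Fin T) ℝ) (hn : 0 < c.size 1) (α : Fin L → ℝ)
    (x : Coord T n d r → ℝ) (b : Fin T → ℝ) (w : Fin d → ℝ) (z : Fin T → ℝ) :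
    w ⬝ᵥ (truncTheta c Θ α x - Θ * diagonal b) *ᵥ z = ∑ p : Fin T × c.Idx 1, z p.1 / c.size 1 *
      ((w ⬝ᵥ fun j => x (sampleRow r c d 1 p j)) *
        trunc (α (c.node p.1)) (Θ.col p.1 ⬝ᵥ fun j => x (sampleRow r c d 1 p j)) - b p.1 * (w ⬝ᵥ Θ.col p.1)) := by
  have hn' : (c.size 1 : ℝ) ≠ 0 := by positivity
  rw [mulVec_eq_sum, dotProduct_sum, Fintype.sum_prod_type]
  refine Finset.sum_congr rfl fun t _ => ?_
  set X := splitX c (canonData (r := r) Θ x) 1 t with hX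
  have e1 : ∀ i, splitY c (canonData Θ x) 1 t i = Θ.col t ⬝ᵥ fun j => x (sampleRow r c d 1 (t, i) j) := fun i => by
    rw [splitY_canonData, splitX_canonData, rowMatrix_mulVec]
  have e2 : ∀ i, (X *ᵥ w) i = w ⬝ᵥ fun j => x (sampleRow r c d 1 (t, i) j) := fun i => by
    rw [hX, splitX_canonData, rowMatrix_mulVec]
  have e3 : (truncTheta c Θ α x - Θ * diagonal b)ᵀ t = (1 / (c.size 1 : ℝ)) • (Xᵀ *ᵥ fun i =>
      trunc (α (c.node t)) (Θ.col t ⬝ᵥ fun j => x (sampleRow r c d 1 (t, i) j))) - b t • Θ.col t := by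
    ext j
    simp only [transpose_apply, Matrix.sub_apply, truncTheta, of_apply, mul_diagonal, Pi.sub_apply,
      Pi.smul_apply, smul_eq_mul, e1, col_apply, hX]
    ring
  rw [op_smul_eq_smul, dotProduct_smul, e3, dotProduct_sub, dotProduct_smul, dotProduct_smul, dotProduct_mulVec,
    ← mulVec_transpose, transpose_transpose, smul_eq_mul, smul_eq_mul, smul_eq_mul]
  simp only
  rw [← Finset.mul_sum, Finset.sum_sub_distrib, Finset.sum_const, Finset.card_univ, nsmul_eq_mul]
  simp only [← e2]
  rw [← dotProduct]
  rw [show (Fintype.card (c.Idx 1) : ℝ) = c.size 1 from rfl]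
  field_simp

/-- Matrices close to the true parameters with rescaled columns. -/
def NearScaled (Θ : Matrix (Fin d) (Fin T) ℝ) (δ : ℝ) (A : Matrix (Fin d) (Fin T) ℝ) : Prop :=
  ∃ b ∈ Set.univ.pi fun _ : Fin T => Set.Icc (0.2 : ℝ) 1, ‖A - Θ * diagonal b‖ ≤ δ

lemma measurableSet_nearScaled (Θ : Matrix (Fin d) (Fin T) ℝ) (δ : ℝ) :
    MeasurableSet {A | NearScaled Θ δ A} := by
  refine (isClosed_exists_compact (isCompact_univ_pi fun _ => isCompact_Icc)
    (S := {q : Matrix (Fin d) (Fin T) ℝ × (Fin T → ℝ) | ‖q.1 - Θ * diagonal q.2‖ ≤ δ}) ?_).measurableSet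
  refine isClosed_le ?_ continuous_const
  exact (continuous_fst.sub (continuous_const.matrix_mul continuous_snd.matrix_diagonal)).norm

lemma measure_not_nearScaled_le (hG : GroundTruth Us bs σ κ) (hn : 0 < c.size 1) (hT : 1 ≤ T) (hμ1 : 1 ≤ μ)
    (hinc : ∀ t, nrm (bs.col t) ^ 2 ≤ μ ^ 2 * (r / T) * σ ^ 2) {δ : ℝ} (hδ : 0 < δ)
    (hsamp : 31360 * truncScale bs κ μ * (d + T) ≤ c.size 1 * δ ^ 2) {α : Fin L → ℝ}
    (hα : ThresholdsGood bs κ μ α) :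
    gaussM (Coord T n d r) {x | ¬ NearScaled (Us * bs) δ (truncTheta c (Us * bs) α x)} ≤
      ofReal (exp (-5 * (d + T))) := by
  have hσ := hG.sigma_pos
  have hκ1 := hG.one_le
  have hr : (1 : ℝ) ≤ r := by exact_mod_cast hG.rank_pos
  have hT' : (1 : ℝ) ≤ T := by exact_mod_cast hT
  have hn' : (0 : ℝ) < c.size 1 := by exact_mod_cast hn
  have hsc := hG.truncScale_bounds (μ := μ) hT
  set A := truncScale bs κ μ with hA
  have hA0 : 0 < A := lt_of_lt_of_le (by positivity) hsc.1
  have hα8 : ∀ t, 8 * nrm ((Us * bs).col t) ^ 2 ≤ α (c.node t) := fun t => by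
    rw [nrm_mul_col hG.orth]
    have := (hα (c.node t)).1
    linarith [hinc t, hsc.1]
  set b : Fin T → ℝ := fun t => truncMass (α (c.node t)) (nrm ((Us * bs).col t)) with hb
  have hbm : b ∈ Set.univ.pi fun _ : Fin T => Set.Icc (0.2 : ℝ) 1 := fun t _ =>
    ⟨truncMass_ge (hα8 t), truncMass_le_one _ _⟩
  set E : (Coord T n d r → ℝ) → Matrix (Fin d) (Fin T) ℝ := fun x =>
    truncTheta c (Us * bs) α x - Us * bs * diagonal b with hE
  have hEm : Measurable E := (measurable_truncTheta _ measurable_const measurable_id).matrix_sub measurable_const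
  set s := c.size 1 * δ / (2240 * A) with hs
  have hs0 : 0 < s := by positivity
  have h1 : ∫⁻ x, ofReal (exp (s * ‖E x‖)) ∂gaussM (Coord T n d r) ≤
      5 ^ (Fintype.card (Fin d) + Fintype.card (Fin T)) *
        ofReal (exp (1120 * s ^ 2 * A / c.size 1)) := by
    refine lintegral_exp_norm_le hEm hs0.le fun w z hw hz => ?_
    have h2 := lintegral_exp_sum_rows (sampleRow_injective (r := r) (d := d) c 1) Finset.univ
      (F := fun p y => 4 * s * (z p.1 / c.size 1) * ((w ⬝ᵥ y) * trunc (α (c.node p.1)) ((Us * bs).col p.1 ⬝ᵥ y) -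
        b p.1 * (w ⬝ᵥ (Us * bs).col p.1)))
      (fun p => (((Measurable.dotProduct measurable_const measurable_id).mul ((measurable_trunc _).comp
        (Measurable.dotProduct measurable_const measurable_id))).sub_const _).const_mul _)
      (fun p _ => lintegral_exp_trunc_le hw (hα8 p.1) (4 * s * (z p.1 / c.size 1)))
    refine le_trans (le_of_eq (lintegral_congr fun x => ?_)) (h2.trans (ENNReal.ofReal_le_ofReal
      (Real.exp_le_exp.2 ?_)))
    · congr 2
      rw [hE, dotProduct_truncTheta_sub _ hn, Finset.mul_sum]
      refine Finset.sum_congr rfl fun p _ => ?_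
      ring
    · rw [Fintype.sum_prod_type]
      have hz1 : ∑ t, z t ^ 2 ≤ 1 := by
        rw [← nrm_sq_eq_sum]; exact pow_le_one₀ (nrm_nonneg _) hz
      calc ∑ t, ∑ _i : c.Idx 1, 7 * ((4 * s * (z t / c.size 1)) ^ 2 * α (c.node t)) ≤
            ∑ t, ∑ _i : c.Idx 1, 7 * ((4 * s * (z t / c.size 1)) ^ 2 * (10 * A)) := by
            gcongr with t _ i _
            exact (hα _).2
        _ = 1120 * s ^ 2 * A / c.size 1 * ∑ t, z t ^ 2 := by
            rw [Finset.mul_sum]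
            refine Finset.sum_congr rfl fun t _ => ?_
            rw [Finset.sum_const, Finset.card_univ, nsmul_eq_mul,
              show (Fintype.card (c.Idx 1) : ℝ) = c.size 1 from rfl]
            field_simp
            ring
        _ ≤ _ := mul_le_of_le_one_right (by positivity) hz1
  have h3 := measure_ge_le_exp hEm.matrix_norm hs0.le (t := δ) (h1.trans (five_pow_mul_le _ _))
  refine le_trans (measure_mono fun x hx => ?_) (h3.trans (ENNReal.ofReal_le_ofReal (Real.exp_le_exp.2 ?_)))
  · by_contra hcon
    exact hx ⟨b, hbm, (not_le.1 hcon).le⟩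
  · rw [Fintype.card_fin, Fintype.card_fin]
    have e1 : 1120 * s ^ 2 * A / c.size 1 - s * δ = -(c.size 1 * δ ^ 2 / (4480 * A)) := by
      rw [hs]; field_simp; ring
    have e2 : 7 * ((d : ℝ) + T) ≤ c.size 1 * δ ^ 2 / (4480 * A) := by
      rw [le_div_iff₀ (by positivity)]; linarith
    push_cast
    linarith

end InitialEstimate

section Spectral
variable {d r T : ℕ} {M O : Matrix (Fin d) (Fin d) ℝ} {ev : Fin d → ℝ} {H : Finset (Fin d)} {hi : ℝ}

/-- Eigendecomposition `M = O diag(ev) Oᵀ`. -/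
structure Diagonalizes (M O : Matrix (Fin d) (Fin d) ℝ) (ev : Fin d → ℝ) : Prop where
  orth : Oᵀ * O = 1
  orth' : O * Oᵀ = 1
  coord : ∀ v i, (Oᵀ *ᵥ (M *ᵥ v)) i = ev i * (Oᵀ *ᵥ v) i

lemma exists_diagonalizes (hM : M.IsHermitian) : ∃ O ev, Diagonalizes M O ev := by
  set O : Matrix (Fin d) (Fin d) ℝ := hM.eigenvectorUnitary.1 with hO
  have ht : star O = Oᵀ := by rw [star_eq_conjTranspose, conjTranspose_eq_transpose_of_trivial]
  have h1 : Oᵀ * O = 1 := by rw [← ht]; exact Unitary.coe_star_mul_self _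
  have h2 : O * Oᵀ = 1 := by rw [← ht]; exact Unitary.coe_mul_star_self _
  refine ⟨O, hM.eigenvalues, h1, h2, fun v i => ?_⟩
  have h3 : M = O * diagonal hM.eigenvalues * Oᵀ := by
    have := hM.spectral_theorem
    rw [Unitary.conjStarAlgAut_apply] at this
    rw [← ht]
    exact this
  have h4 : Oᵀ *ᵥ (M *ᵥ v) = diagonal hM.eigenvalues *ᵥ (Oᵀ *ᵥ v) := by
    conv_lhs => rw [h3]
    rw [mulVec_mulVec, mulVec_mulVec, ← Matrix.mul_assoc, ← Matrix.mul_assoc, h1, Matrix.one_mul]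
  rw [h4, mulVec_diagonal]

lemma Diagonalizes.nrm_sq (h : Diagonalizes M O ev) (v : Fin d → ℝ) :
    nrm v ^ 2 = ∑ i, (Oᵀ *ᵥ v) i ^ 2 := by
  rw [← nrm_sq_eq_sum, nrm_mulVec_orthonormal (by rw [transpose_transpose]; exact h.orth')]

lemma Diagonalizes.quadratic (h : Diagonalizes M O ev) (v : Fin d → ℝ) :
    v ⬝ᵥ M *ᵥ v = ∑ i, ev i * (Oᵀ *ᵥ v) i ^ 2 := by
  have e : v ⬝ᵥ M *ᵥ v = (Oᵀ *ᵥ v) ⬝ᵥ (Oᵀ *ᵥ (M *ᵥ v)) := by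
    rw [dot_mulVec_comm Oᵀ, transpose_transpose, mulVec_mulVec, h.orth', one_mulVec]
  rw [e, dotProduct]
  refine Finset.sum_congr rfl fun i _ => ?_
  rw [h.coord]; ring

/-- The eigenvalues split into a set of large ones and a set of small ones. -/
structure SpectralSplit (M O : Matrix (Fin d) (Fin d) ℝ) (ev : Fin d → ℝ) (H : Finset (Fin d)) (hi : ℝ) :
    Prop extends Diagonalizes M O ev where
  pos : 0 < hi
  large : ∀ i ∈ H, hi ≤ ev i
  small : ∀ i ∉ H, |ev i| ≤ hi / 4

/-- Counting of eigenvalues by the values of the quadratic form on a subspace and its complement. -/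
lemma exists_spectralSplit (hM : M.IsHermitian) {Us : Matrix (Fin d) (Fin r) ℝ} (hU : Usᵀ * Us = 1)
    {lo : ℝ} (hhi : 0 < hi) (hlo : lo < hi / 4)
    (h1 : ∀ v, Usᵀ *ᵥ v = 0 → v ⬝ᵥ M *ᵥ v ≤ lo * nrm v ^ 2)
    (h2 : ∀ a, hi * nrm a ^ 2 ≤ (Us *ᵥ a) ⬝ᵥ M *ᵥ (Us *ᵥ a))
    (h3 : ∀ v, -(hi / 4) * nrm v ^ 2 ≤ v ⬝ᵥ M *ᵥ v) :
    ∃ O ev H, SpectralSplit M O ev H hi ∧ H.card = r := by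
  classical
  obtain ⟨O, ev, hD⟩ := exists_diagonalizes hM
  set H := Finset.univ.filter (fun i => hi ≤ ev i) with hH
  set H' := Finset.univ.filter (fun i => hi / 4 ≤ ev i) with hH'
  have hsub : H ⊆ H' := fun i hi' => by
    simp only [hH, hH', Finset.mem_filter, Finset.mem_univ, true_and] at hi' ⊢
    linarith
  have hge : r ≤ H.card := by
    by_contra hcon
    let f : (Fin r → ℝ) →ₗ[ℝ] (H → ℝ) := (LinearMap.funLeft ℝ ℝ (fun i : H => (i : Fin d))).comp
      (Matrix.mulVecLin (Oᵀ * Us))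
    have hk : LinearMap.ker f ≠ ⊥ := LinearMap.ker_ne_bot_of_finrank_lt (by simpa using hcon)
    obtain ⟨a, ha, ha0⟩ := (Submodule.ne_bot_iff _).1 hk
    have hz : ∀ i ∈ H, (Oᵀ *ᵥ (Us *ᵥ a)) i = 0 := fun i hi' => by
      have := congrFun (LinearMap.mem_ker.1 ha) ⟨i, hi'⟩
      rw [mulVec_mulVec]; exact this
    have h4 := h2 a
    rw [hD.quadratic, ← nrm_mulVec_orthonormal hU, hD.nrm_sq, Finset.mul_sum] at h4
    refine absurd h4 (not_le.2 (Finset.sum_lt_sum (fun i _ => ?_) ?_))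
    · by_cases hi' : i ∈ H
      · rw [hz i hi']; simp
      · have : ev i < hi := by simpa [hH] using hi'
        gcongr
    · have hne : Oᵀ *ᵥ (Us *ᵥ a) ≠ 0 := fun h0 => by
        have h5 := hD.nrm_sq (Us *ᵥ a)
        rw [h0, nrm_mulVec_orthonormal hU] at h5
        simp only [Pi.zero_apply, ne_eq, OfNat.ofNat_ne_zero, not_false_eq_true, zero_pow,
          Finset.sum_const_zero, pow_eq_zero_iff] at h5
        exact ha0 (nrm_eq_zero.1 h5)
      obtain ⟨i, hi'⟩ := Function.ne_iff.1 hne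
      have hiH : i ∉ H := fun hh => hi' (hz i hh)
      have : ev i < hi := by simpa [hH] using hiH
      have hpos : 0 < (Oᵀ *ᵥ (Us *ᵥ a)) i ^ 2 := by
        have : (Oᵀ *ᵥ (Us *ᵥ a)) i ≠ 0 := hi'
        positivity
      exact ⟨i, Finset.mem_univ _, by gcongr⟩
  have hle : H'.card ≤ r := by
    by_contra hcon
    let f : (Fin d → ℝ) →ₗ[ℝ] (Fin r → ℝ) × ((H'ᶜ : Finset (Fin d)) → ℝ) :=
      (Matrix.mulVecLin (Usᵀ * O)).prod (LinearMap.funLeft ℝ ℝ (fun i : (H'ᶜ : Finset (Fin d)) => (i : Fin d)))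
    have hk : LinearMap.ker f ≠ ⊥ := LinearMap.ker_ne_bot_of_finrank_lt (by
      have h5 := Finset.card_add_card_compl H'
      simp only [Fintype.card_fin] at h5
      simp only [Module.finrank_prod, Module.finrank_fintype_fun_eq_card, Fintype.card_fin, Fintype.card_coe]
      omega)
    obtain ⟨y, hy, hy0⟩ := (Submodule.ne_bot_iff _).1 hk
    have hy1 := LinearMap.mem_ker.1 hy
    have hya : Usᵀ *ᵥ (O *ᵥ y) = 0 := by
      rw [mulVec_mulVec]; exact congrArg Prod.fst hy1
    have hyb : ∀ i ∉ H', y i = 0 := fun i hi' =>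
      congrFun (congrArg Prod.snd hy1) ⟨i, Finset.mem_compl.2 hi'⟩
    have h4 := h1 _ hya
    have hOy : Oᵀ *ᵥ (O *ᵥ y) = y := by rw [mulVec_mulVec, hD.orth, one_mulVec]
    rw [hD.quadratic, hD.nrm_sq, hOy, Finset.mul_sum] at h4
    obtain ⟨i, hi'⟩ := Function.ne_iff.1 hy0
    have hiH : i ∈ H' := by
      by_contra hh; exact hi' (hyb i hh)
    refine absurd h4 (not_le.2 (Finset.sum_lt_sum (fun j _ => ?_) ⟨i, Finset.mem_univ _, ?_⟩))
    · by_cases hj : j ∈ H'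
      · have : hi / 4 ≤ ev j := by simpa [hH'] using hj
        have : lo ≤ ev j := by linarith
        gcongr
      · rw [hyb j hj]; simp
    · have h6 : hi / 4 ≤ ev i := by simpa [hH'] using hiH
      have : lo < ev i := by linarith
      have hpos : 0 < y i ^ 2 := by
        have : y i ≠ 0 := hi'
        positivity
      gcongr
  have hcard := Finset.card_le_card hsub
  have heq : H = H' := Finset.eq_of_subset_of_card_le hsub (by omega)
  refine ⟨O, ev, H, ⟨hD, hhi, fun i hi' => by simpa [hH] using hi', fun i hi' => abs_le.2 ⟨?_, ?_⟩⟩, by omega⟩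
  · have h4 := h3 (O *ᵥ Pi.single i 1)
    have hOy : Oᵀ *ᵥ (O *ᵥ Pi.single i 1) = Pi.single i 1 := by rw [mulVec_mulVec, hD.orth, one_mulVec]
    rw [hD.quadratic, hD.nrm_sq, hOy] at h4
    simpa [Pi.single_apply] using h4
  · rw [heq] at hi'
    have : ev i < hi / 4 := by simpa [hH'] using hi'
    exact this.le

/-- The part of the squared norm of a vector in a set of eigendirections. -/
noncomputable def partSq (O : Matrix (Fin d) (Fin d) ℝ) (H : Finset (Fin d)) (v : Fin d → ℝ) : ℝ :=
  ∑ i ∈ H, (Oᵀ *ᵥ v) i ^ 2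

lemma partSq_nonneg (v : Fin d → ℝ) : 0 ≤ partSq O H v := Finset.sum_nonneg fun _ _ => sq_nonneg _

lemma partSq_smul (c : ℝ) (v : Fin d → ℝ) : partSq O H (c • v) = c ^ 2 * partSq O H v := by
  simp only [partSq, mulVec_smul, Pi.smul_apply, smul_eq_mul, mul_pow, Finset.mul_sum]

lemma Diagonalizes.partSq_add (h : Diagonalizes M O ev) (v : Fin d → ℝ) :
    partSq O H v + partSq O Hᶜ v = nrm v ^ 2 := by
  rw [h.nrm_sq]; exact Finset.sum_add_sum_compl H _

lemma SpectralSplit.le_partSq (h : SpectralSplit M O ev H hi) (v : Fin d → ℝ) :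
    hi ^ 2 * partSq O H v ≤ partSq O H (M *ᵥ v) := by
  unfold partSq
  rw [Finset.mul_sum]
  refine Finset.sum_le_sum fun i hi' => ?_
  rw [h.coord, mul_pow]
  have := h.large i hi'
  have := h.pos
  gcongr

lemma SpectralSplit.partSq_le (h : SpectralSplit M O ev H hi) (v : Fin d → ℝ) :
    partSq O Hᶜ (M *ᵥ v) ≤ (hi / 4) ^ 2 * partSq O Hᶜ v := by
  unfold partSq
  rw [Finset.mul_sum]
  refine Finset.sum_le_sum fun i hi' => ?_
  rw [h.coord, mul_pow, ← sq_abs (ev i)]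
  have := h.small i (Finset.mem_compl.1 hi')
  gcongr

/-- The range of `U` makes a small angle with the dominant eigenspace. -/
def InCone (O : Matrix (Fin d) (Fin d) ℝ) (H : Finset (Fin d)) (t : ℝ) (U : Matrix (Fin d) (Fin r) ℝ) : Prop :=
  ∀ w, partSq O Hᶜ (U *ᵥ w) ≤ t ^ 2 * partSq O H (U *ᵥ w)

lemma InCone.qrQ {t c : ℝ} {A : Matrix (Fin d) (Fin r) ℝ} (h : InCone O H t A) (hc : 0 < c)
    (hA : ∀ v, c * nrm v ≤ nrm (A *ᵥ v)) : InCone O H t (qrQ A) ∧ (qrQ A)ᵀ * qrQ A = 1 := by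
  obtain ⟨h1, h2, -, -⟩ := qrQ_spec hc hA
  refine ⟨fun w => ?_, h1⟩
  set R := (DifAltGDmin.qrQ A)ᵀ * A with hR
  have hRl : ∀ v, c * nrm v ≤ nrm (R *ᵥ v) := fun v => by
    have := hA v
    rw [h2, ← mulVec_mulVec, nrm_mulVec_orthonormal h1] at this
    exact this
  have hu := (Matrix.isUnit_iff_isUnit_det _).1 (isUnit_det_of_lower (M := R) hc fun v => by
    exact hRl v)
  have hw : DifAltGDmin.qrQ A *ᵥ w = A *ᵥ (R⁻¹ *ᵥ w) := by
    conv_rhs => rw [h2]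
    rw [mulVec_mulVec, Matrix.mul_assoc, Matrix.mul_nonsing_inv _ hu, Matrix.mul_one]
  rw [hw]
  exact h _

lemma SpectralSplit.inCone_step (h : SpectralSplit M O ev H hi) {t a : ℝ} (ht : 0 ≤ t) (ha : 0 < a)
    {U : Matrix (Fin d) (Fin r) ℝ} (hU : Uᵀ * U = 1) (hc : InCone O H t U) :
    InCone O H (t / 4) (qrQ ((a • M) * U)) ∧ (qrQ ((a • M) * U))ᵀ * qrQ ((a • M) * U) = 1 := by
  have hhi := h.pos
  have e : ∀ w, ((a • M) * U) *ᵥ w = a • (M *ᵥ (U *ᵥ w)) := fun w => by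
    rw [← mulVec_mulVec, smul_mulVec]
  refine InCone.qrQ (c := a * hi / (1 + t)) (fun w => ?_) (by positivity) fun w => ?_
  · rw [e, partSq_smul, partSq_smul]
    calc a ^ 2 * partSq O Hᶜ (M *ᵥ (U *ᵥ w)) ≤ a ^ 2 * ((hi / 4) ^ 2 * (t ^ 2 * partSq O H (U *ᵥ w))) := by
          gcongr
          exact (h.partSq_le _).trans (by gcongr; exact hc w)
      _ = (t / 4) ^ 2 * (a ^ 2 * (hi ^ 2 * partSq O H (U *ᵥ w))) := by ring
      _ ≤ _ := by gcongr; exact h.le_partSq _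
  · rw [e, nrm_smul, abs_of_pos ha]
    have h1 : nrm w ^ 2 ≤ (1 + t) ^ 2 * partSq O H (U *ᵥ w) := by
      rw [← nrm_mulVec_orthonormal hU w, ← h.toDiagonalizes.partSq_add (H := H)]
      have := hc w
      have h0 := partSq_nonneg (O := O) (H := H) (U *ᵥ w)
      nlinarith [mul_nonneg ht h0]
    have h2 : hi ^ 2 * partSq O H (U *ᵥ w) ≤ nrm (M *ᵥ (U *ᵥ w)) ^ 2 := by
      rw [← h.toDiagonalizes.partSq_add (H := H)]
      have := h.le_partSq (U *ᵥ w)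
      have := partSq_nonneg (O := O) (H := Hᶜ) (M *ᵥ (U *ᵥ w))
      linarith
    have h3 : hi * nrm w ≤ (1 + t) * nrm (M *ᵥ (U *ᵥ w)) := by
      refine le_of_sq_le_sq ?_ (mul_nonneg (by linarith) (nrm_nonneg _))
      rw [mul_pow, mul_pow]
      calc hi ^ 2 * nrm w ^ 2 ≤ hi ^ 2 * ((1 + t) ^ 2 * partSq O H (U *ᵥ w)) := by gcongr
        _ = (1 + t) ^ 2 * (hi ^ 2 * partSq O H (U *ᵥ w)) := by ring
        _ ≤ _ := by gcongr
    calc a * hi / (1 + t) * nrm w = a * (hi * nrm w / (1 + t)) := by ring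
      _ ≤ a * nrm (M *ᵥ (U *ᵥ w)) := by
          gcongr
          rw [div_le_iff₀ (by linarith)]
          linarith

/-- The dominant eigenspace of `M ≈ A Aᵀ` is close to the range of `Us`. -/
lemma SpectralSplit.proj_compl_le (h : SpectralSplit M O ev H hi) {Us : Matrix (Fin d) (Fin r) ℝ}
    (hUs : Usᵀ * Us = 1) {A : Matrix (Fin d) (Fin T) ℝ} {ν e q : ℝ} (hν : 0 ≤ ν) (he : 0 ≤ e) (hq : 0 ≤ q)
    (h1 : ∀ z, nrm ((1 - Us * Usᵀ) *ᵥ (M *ᵥ z)) ≤ e * nrm (Aᵀ *ᵥ z) + ν * nrm z)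
    (h2 : ∀ z, nrm (Aᵀ *ᵥ z) ^ 2 ≤ z ⬝ᵥ M *ᵥ z + ν * nrm z ^ 2)
    (hq1 : 1 / hi + ν / hi ^ 2 ≤ q ^ 2)
    {t : ℝ} (ht : 0 ≤ t) {U : Matrix (Fin d) (Fin r) ℝ} (hU : Uᵀ * U = 1) (hc : InCone O H t U) :
    ‖(1 - Us * Usᵀ) * U‖ ≤ e * q + ν / hi + t := by
  classical
  have hhi := h.pos
  refine opNorm_le (by positivity) fun w => ?_
  rw [← mulVec_mulVec]
  set u := U *ᵥ w with hu
  set y := Oᵀ *ᵥ u with hy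
  have hnw : nrm u = nrm w := nrm_mulVec_orthonormal hU w
  have hadd := h.toDiagonalizes.partSq_add (H := H) u
  have hp1 := partSq_nonneg (O := O) (H := H) u
  have hp2 := partSq_nonneg (O := O) (H := Hᶜ) u
  set z := O *ᵥ fun i => if i ∈ H then y i / ev i else 0 with hz
  set uL := u - M *ᵥ z with huL
  have hOz : Oᵀ *ᵥ z = fun i => if i ∈ H then y i / ev i else 0 := by
    rw [hz, mulVec_mulVec, h.orth, one_mulVec]
  have hev : ∀ i ∈ H, 0 < ev i := fun i hi' => hhi.trans_le (h.large i hi')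
  have hz1 : nrm z ^ 2 ≤ (1 / hi ^ 2) * nrm w ^ 2 := by
    rw [h.toDiagonalizes.nrm_sq, hOz, ← hnw, h.toDiagonalizes.nrm_sq, Finset.mul_sum]
    refine Finset.sum_le_sum fun i _ => ?_
    simp only [← hy]
    split_ifs with hi'
    · rw [div_pow, div_eq_mul_one_div, mul_comm]
      have := h.large i hi'
      gcongr
    · rw [zero_pow two_ne_zero]; positivity
  have hz2 : z ⬝ᵥ M *ᵥ z ≤ 1 / hi * nrm w ^ 2 := by
    rw [h.toDiagonalizes.quadratic, hOz, ← hnw, h.toDiagonalizes.nrm_sq, Finset.mul_sum]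
    refine Finset.sum_le_sum fun i _ => ?_
    simp only [← hy]
    split_ifs with hi'
    · have h3 := hev i hi'
      have h4 : ev i * (y i / ev i) ^ 2 = 1 / ev i * y i ^ 2 := by field_simp
      rw [h4]
      have := h.large i hi'
      gcongr
    · rw [zero_pow two_ne_zero, mul_zero]; positivity
  have hz3 : nrm z ≤ nrm w / hi := by
    refine le_of_sq_le_sq ?_ (div_nonneg (nrm_nonneg _) hhi.le)
    rw [div_pow]
    exact hz1.trans (le_of_eq (by ring))
  have hz4 : nrm (Aᵀ *ᵥ z) ≤ q * nrm w := by
    refine le_of_sq_le_sq ((h2 z).trans ?_) (mul_nonneg hq (nrm_nonneg _))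
    calc z ⬝ᵥ M *ᵥ z + ν * nrm z ^ 2 ≤ 1 / hi * nrm w ^ 2 + ν * ((1 / hi ^ 2) * nrm w ^ 2) := by gcongr
      _ = (1 / hi + ν / hi ^ 2) * nrm w ^ 2 := by ring
      _ ≤ q ^ 2 * nrm w ^ 2 := by gcongr
      _ = _ := by ring
  have hL : nrm uL ≤ t * nrm w := by
    refine le_of_sq_le_sq ?_ (mul_nonneg ht (nrm_nonneg _))
    have h3 : nrm uL ^ 2 = partSq O Hᶜ u := by
      rw [h.toDiagonalizes.nrm_sq, partSq, ← Finset.sum_add_sum_compl H, Finset.sum_eq_zero, zero_add]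
      · refine Finset.sum_congr rfl fun i hi' => ?_
        rw [huL, mulVec_sub, Pi.sub_apply, h.coord, hOz]
        simp only [Finset.mem_compl] at hi'
        simp [hi']
      · intro i hi'
        rw [huL, mulVec_sub, Pi.sub_apply, h.coord, hOz]
        have := (hev i hi').ne'
        simp only [hi', if_true]
        rw [mul_div_cancel₀ _ this, ← hy]
        simp
    rw [h3, mul_pow]
    refine (hc w).trans ?_
    rw [← hnw]
    gcongr
    linarith
  have hdec : (1 - Us * Usᵀ) *ᵥ u = (1 - Us * Usᵀ) *ᵥ (M *ᵥ z) + (1 - Us * Usᵀ) *ᵥ uL := by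
    rw [← mulVec_add, huL]; congr 1; abel
  rw [hdec]
  refine (nrm_add_le _ _).trans ?_
  have h5 : nrm ((1 - Us * Usᵀ) *ᵥ uL) ≤ t * nrm w := by
    refine (nrm_mulVec_le _ _).trans ((mul_le_of_le_one_left (nrm_nonneg _) (norm_proj_compl_le hUs)).trans hL)
  have h6 := h1 z
  have h7 : e * nrm (Aᵀ *ᵥ z) ≤ e * (q * nrm w) := by gcongr
  have h8 : ν * nrm z ≤ ν * (nrm w / hi) := by gcongr
  calc _ ≤ e * (q * nrm w) + ν * (nrm w / hi) + t * nrm w := by linarith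
    _ = _ := by ring

end Spectral

/-- Events that are decided by fresh coordinates for each value of the other ones. -/
lemma measure_decouple {J S : Type*} [Fintype J] [MeasurableSpace S] (μ : J → Measure ℝ)
    [∀ j, IsProbabilityMeasure (μ j)] (p : J → Prop) {f : (J → ℝ) → S} (hf : Measurable f) {A : Set S}
    (hA : MeasurableSet A) {E : Set (S × (J → ℝ))} (hE : MeasurableSet E)
    (hfp : ∀ x y, (∀ j, ¬ p j → x j = y j) → f x = f y)
    (hEp : ∀ s x y, (∀ j, p j → x j = y j) → ((s, x) ∈ E ↔ (s, y) ∈ E)) {b : ENNReal}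
    (hb : ∀ s ∈ A, Measure.pi μ {y | (s, y) ∈ E} ≤ b) :
    Measure.pi μ {x | f x ∈ A ∧ (f x, x) ∈ E} ≤ b := by
  set B : Set (S × (J → ℝ)) := {q | q.1 ∈ A ∧ q ∈ E} with hB
  have hBm : MeasurableSet B := (measurable_fst hA).inter hE
  have h := lintegral_decouple μ p hf (h := fun s x => B.indicator (fun _ => (1 : ENNReal)) (s, x))
    (measurable_const.indicator hBm) hfp (fun s x y hxy => by
      have : (s, x) ∈ B ↔ (s, y) ∈ B := and_congr_right fun _ => hEp s x y hxy
      by_cases hx : (s, x) ∈ B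
      · simp [hx, this.1 hx]
      · simp [hx, this.not.1 hx])
  have hm : MeasurableSet {x | f x ∈ A ∧ (f x, x) ∈ E} := (hf.prodMk measurable_id) hBm
  calc Measure.pi μ {x | f x ∈ A ∧ (f x, x) ∈ E} =
        ∫⁻ x, B.indicator (fun _ => (1 : ENNReal)) (f x, x) ∂Measure.pi μ := by
        rw [← lintegral_indicator_one hm]
        refine lintegral_congr fun x => ?_
        by_cases hx : (f x, x) ∈ B
        · rw [Set.indicator_of_mem hx, Set.indicator_of_mem (show x ∈ {x | f x ∈ A ∧ (f x, x) ∈ E} from hx)]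
          rfl
        · rw [Set.indicator_of_notMem hx, Set.indicator_of_notMem (show x ∉ {x | f x ∈ A ∧ (f x, x) ∈ E} from hx)]
    _ = _ := h
    _ ≤ ∫⁻ _, b ∂Measure.pi μ := by
        refine lintegral_mono fun x => ?_
        by_cases hx : f x ∈ A
        · refine le_trans (le_of_eq ?_) (hb (f x) hx)
          have hE' : MeasurableSet {y | (f x, y) ∈ E} := measurable_prodMk_left hE
          rw [← lintegral_indicator_one hE']
          refine lintegral_congr fun y => ?_
          by_cases hy : (f x, y) ∈ E
          · rw [Set.indicator_of_mem (show (f x, y) ∈ B from ⟨hx, hy⟩), Set.indicator_of_mem (by exact hy)]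
            rfl
          · rw [Set.indicator_of_notMem fun h => hy h.2, Set.indicator_of_notMem (by exact hy)]
        · refine le_trans (le_of_eq ?_) zero_le
          rw [lintegral_congr fun y => Set.indicator_of_notMem (fun h => hx h.1) _, lintegral_zero]
    _ = b := by simp

section NearSpectral
variable {d r T : ℕ} {Us : Matrix (Fin d) (Fin r) ℝ} {bs : Matrix (Fin r) (Fin T) ℝ} {σ κ δ : ℝ}
  {A : Matrix (Fin d) (Fin T) ℝ} {M : Matrix (Fin d) (Fin d) ℝ}

lemma NearScaled.norm_le (hG : GroundTruth Us bs σ κ) {e : ℝ} (hA : NearScaled (Us * bs) e A) :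
    ‖A‖ ≤ σ + e := by
  obtain ⟨b, hb, hbA⟩ := hA
  have h1 : ‖diagonal b‖ ≤ 1 := by
    rw [Matrix.l2_opNorm_diagonal, pi_norm_le_iff_of_nonneg zero_le_one]
    intro t
    have := hb t (Set.mem_univ _)
    rw [Real.norm_eq_abs, abs_of_nonneg (by linarith [this.1])]
    exact this.2
  have h2 : ‖Us * bs * diagonal b‖ ≤ σ := by
    refine (norm_mul_le' _ _).trans ?_
    have h3 : ‖Us * bs‖ ≤ σ := (norm_mul_le' _ _).trans
      ((mul_le_of_le_one_left (norm_nonneg _) (norm_orthonormal_le hG.orth)).trans hG.upper)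
    exact (mul_le_of_le_one_right (norm_nonneg _) h1).trans h3
  calc ‖A‖ = ‖Us * bs * diagonal b + (A - Us * bs * diagonal b)‖ := by congr 1; abel
    _ ≤ _ := (norm_add_le _ _).trans (add_le_add h2 hbA)

lemma abs_quadratic_sub_le {ν : ℝ} (hM : ‖M - A * Aᵀ‖ ≤ ν) (v : Fin d → ℝ) :
    |v ⬝ᵥ M *ᵥ v - nrm (Aᵀ *ᵥ v) ^ 2| ≤ ν * nrm v ^ 2 := by
  have e : v ⬝ᵥ M *ᵥ v - nrm (Aᵀ *ᵥ v) ^ 2 = v ⬝ᵥ (M - A * Aᵀ) *ᵥ v := by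
    rw [nrm_mulVec_sq, transpose_transpose, sub_mulVec, dotProduct_sub]
  rw [e]
  calc _ ≤ nrm v * nrm ((M - A * Aᵀ) *ᵥ v) := abs_dotProduct_le _ _
    _ ≤ nrm v * (ν * nrm v) := by
        have := nrm_nonneg v
        gcongr
        exact (nrm_mulVec_le _ _).trans (by gcongr)
    _ = _ := by ring

/-- The spectrum of a perturbed Gram matrix splits, and the large part belongs to the column space of the truth. -/
lemma exists_spectralSplit_of_nearScaled (hG : GroundTruth Us bs σ κ) (hδ0 : 0 < δ) (hδ : δ ≤ 1e-3)
    (hA : NearScaled (Us * bs) (δ * (σ / κ)) A) (hM : M.IsHermitian)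
    (hMA : ‖M - A * Aᵀ‖ ≤ (δ * (σ / κ)) ^ 2) :
    ∃ O ev H, SpectralSplit M O ev H (0.039 * (σ / κ) ^ 2) ∧ H.card = r ∧
      ∀ t, 0 ≤ t → ∀ U : Matrix (Fin d) (Fin r) ℝ, Uᵀ * U = 1 → InCone O H t U →
        ‖(1 - Us * Usᵀ) * U‖ ≤ 6 * δ + t := by
  have hκ := hG.one_le
  have hσ := hG.sigma_pos
  set s := σ / κ with hs
  have hs0 : 0 < s := by positivity
  set e := δ * s with he
  have he0 : 0 < e := by positivity
  have hes : e ≤ 1e-3 * s := by rw [he]; gcongr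
  have hee : e ^ 2 ≤ 1e-6 * s ^ 2 := by
    calc e ^ 2 ≤ (1e-3 * s) ^ 2 := by gcongr
      _ = _ := by ring
  obtain ⟨b, hb, hbA⟩ := hA
  set E := A - Us * bs * diagonal b with hE
  have hAE : A = Us * (bs * diagonal b) + E := by rw [hE, Matrix.mul_assoc]; abel
  have hAT : ∀ v, Aᵀ *ᵥ v = (bs * diagonal b)ᵀ *ᵥ (Usᵀ *ᵥ v) + Eᵀ *ᵥ v := fun v => by
    rw [mulVec_mulVec, ← transpose_mul, ← add_mulVec, ← transpose_add, ← hAE]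
  have hET : ∀ v, nrm (Eᵀ *ᵥ v) ≤ e * nrm v := fun v =>
    (nrm_mulVec_le _ _).trans (mul_le_mul_of_nonneg_right ((norm_transpose E).le.trans hbA) (nrm_nonneg _))
  have hlow : ∀ a, 0.2 * s * nrm a ≤ nrm ((bs * diagonal b)ᵀ *ᵥ a) := fun a => by
    rw [transpose_mul, diagonal_transpose, ← mulVec_mulVec]
    have h1 : 0.2 * nrm (bsᵀ *ᵥ a) ≤ nrm (diagonal b *ᵥ (bsᵀ *ᵥ a)) := by
      refine le_of_sq_le_sq ?_ (nrm_nonneg _)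
      rw [mul_pow, nrm_sq_eq_sum, nrm_sq_eq_sum, Finset.mul_sum]
      refine Finset.sum_le_sum fun t _ => ?_
      rw [mulVec_diagonal, mul_pow]
      have := (hb t (Set.mem_univ _)).1
      gcongr
    have h2 := hG.lower a
    nlinarith
  have hq := abs_quadratic_sub_le hMA
  have hq1 : ∀ v, Usᵀ *ᵥ v = 0 → v ⬝ᵥ M *ᵥ v ≤ 2 * e ^ 2 * nrm v ^ 2 := fun v hv => by
    have h1 := (abs_le.1 (hq v)).2
    have h2 : nrm (Aᵀ *ᵥ v) ^ 2 ≤ (e * nrm v) ^ 2 := by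
      have h3 := hET v
      rw [hAT, hv, mulVec_zero, zero_add]
      have := nrm_nonneg (Eᵀ *ᵥ v)
      gcongr
    linarith [mul_pow e (nrm v) 2]
  have hq2 : ∀ a, 0.039 * s ^ 2 * nrm a ^ 2 ≤ (Us *ᵥ a) ⬝ᵥ M *ᵥ (Us *ᵥ a) := fun a => by
    have h1 := (abs_le.1 (hq (Us *ᵥ a))).1
    rw [nrm_mulVec_orthonormal hG.orth] at h1
    have h2 : 0.199 * s * nrm a ≤ nrm (Aᵀ *ᵥ (Us *ᵥ a)) := by
      have h3 := hET (Us *ᵥ a)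
      rw [nrm_mulVec_orthonormal hG.orth] at h3
      have h4 := le_nrm_add ((bs * diagonal b)ᵀ *ᵥ a) (Eᵀ *ᵥ (Us *ᵥ a))
      rw [hAT, mulVec_mulVec a Usᵀ, hG.orth, one_mulVec]
      have h5 := hlow a
      have h6 : e * nrm a ≤ 1e-3 * s * nrm a := mul_le_mul_of_nonneg_right hes (nrm_nonneg _)
      linarith
    have h3 : (0.199 * s * nrm a) ^ 2 ≤ nrm (Aᵀ *ᵥ (Us *ᵥ a)) ^ 2 := by
      have := nrm_nonneg a
      gcongr
    have h4 : e ^ 2 * nrm a ^ 2 ≤ 1e-6 * s ^ 2 * nrm a ^ 2 := by gcongr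
    have h5 : 0 ≤ s ^ 2 * nrm a ^ 2 := by positivity
    nlinarith
  have hq3 : ∀ v, -(0.039 * s ^ 2 / 4) * nrm v ^ 2 ≤ v ⬝ᵥ M *ᵥ v := fun v => by
    have h1 := (abs_le.1 (hq v)).1
    have h2 := sq_nonneg (nrm (Aᵀ *ᵥ v))
    have h4 : e ^ 2 * nrm v ^ 2 ≤ 1e-6 * s ^ 2 * nrm v ^ 2 := by gcongr
    have h5 : 0 ≤ s ^ 2 * nrm v ^ 2 := by positivity
    nlinarith
  obtain ⟨O, ev, H, hS, hH⟩ := exists_spectralSplit hM hG.orth (by positivity)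
    (by nlinarith [sq_pos_of_pos hs0]) hq1 hq2 hq3
  refine ⟨O, ev, H, hS, hH, fun t ht U hU hc => ?_⟩
  have hb1 := hS.proj_compl_le hG.orth (A := A) (ν := e ^ 2) (e := e) (q := 5.2 / s) (by positivity)
    he0.le (by positivity) (fun z => ?_) (fun z => ?_) ?_ ht hU hc
  · refine hb1.trans ?_
    have h1 : e * (5.2 / s) = 5.2 * δ := by rw [he]; field_simp
    have h2 : e ^ 2 / (0.039 * s ^ 2) = δ ^ 2 / 0.039 := by rw [he]; field_simp
    rw [h1, h2]
    have h3 : δ ^ 2 / 0.039 ≤ 0.8 * δ := by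
      rw [div_le_iff₀ (by norm_num)]; nlinarith
    linarith
  · have h1 : (1 - Us * Usᵀ) *ᵥ (M *ᵥ z) = (1 - Us * Usᵀ) *ᵥ (E *ᵥ (Aᵀ *ᵥ z)) +
        (1 - Us * Usᵀ) *ᵥ ((M - A * Aᵀ) *ᵥ z) := by
      have h2 : (1 - Us * Usᵀ) * A = (1 - Us * Usᵀ) * E := by
        rw [hAE, Matrix.mul_add, ← Matrix.mul_assoc, proj_compl_mul hG.orth, Matrix.zero_mul, zero_add]
      have h3 : M *ᵥ z = A *ᵥ (Aᵀ *ᵥ z) + (M - A * Aᵀ) *ᵥ z := by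
        rw [sub_mulVec, mulVec_mulVec]; abel
      conv_lhs => rw [h3, mulVec_add, mulVec_mulVec (Aᵀ *ᵥ z), h2, ← mulVec_mulVec]
    have hP : ∀ v, nrm ((1 - Us * Usᵀ) *ᵥ v) ≤ nrm v := fun v =>
      (nrm_mulVec_le _ _).trans (mul_le_of_le_one_left (nrm_nonneg _) (norm_proj_compl_le hG.orth))
    rw [h1]
    refine (nrm_add_le _ _).trans (add_le_add ((hP _).trans ?_) ((hP _).trans ?_))
    · exact (nrm_mulVec_le _ _).trans (mul_le_mul_of_nonneg_right hbA (nrm_nonneg _))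
    · exact (nrm_mulVec_le _ _).trans (mul_le_mul_of_nonneg_right hMA (nrm_nonneg _))
  · have := (abs_le.1 (hq z)).1
    linarith
  · have h1 : 1 / (0.039 * s ^ 2) + e ^ 2 / (0.039 * s ^ 2) ^ 2 ≤
        1 / (0.039 * s ^ 2) + 1e-6 * s ^ 2 / (0.039 * s ^ 2) ^ 2 := by gcongr
    refine h1.trans ?_
    have h2 : 1 / (0.039 * s ^ 2) + 1e-6 * s ^ 2 / (0.039 * s ^ 2) ^ 2 =
        (1 / 0.039 + 1e-6 / 0.039 ^ 2) * (1 / s ^ 2) := by field_simp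
    have h3 : (5.2 / s) ^ 2 = 27.04 * (1 / s ^ 2) := by field_simp; norm_num
    rw [h2, h3]
    gcongr
    norm_num

lemma Diagonalizes.exists_orthonormal {O : Matrix (Fin d) (Fin d) ℝ} {ev : Fin d → ℝ} {H : Finset (Fin d)}
    (h : Diagonalizes M O ev) (hH : H.card = r) :
    ∃ V : Matrix (Fin d) (Fin r) ℝ, Vᵀ * V = 1 ∧ ∀ v, nrm (Vᵀ *ᵥ v) ^ 2 = partSq O H v := by
  refine ⟨O.submatrix id (H.orderEmbOfFin hH), ?_, fun v => ?_⟩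
  · have : (O.submatrix id (H.orderEmbOfFin hH))ᵀ * O.submatrix id (H.orderEmbOfFin hH) =
        (Oᵀ * O).submatrix (H.orderEmbOfFin hH) (H.orderEmbOfFin hH) := by
      ext i j; simp [Matrix.mul_apply]
    rw [this, h.orth, Matrix.submatrix_one _ (H.orderEmbOfFin hH).injective]
  · rw [nrm_sq_eq_sum, partSq]
    have : H = Finset.univ.map (H.orderEmbOfFin hH).toEmbedding := (Finset.map_orderEmbOfFin_univ H hH).symm
    conv_rhs => rw [this, Finset.sum_map]
    rfl

/-- A random start makes an angle with the dominant eigenspace that is not too close to a right one. -/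
lemma inCone_of_start {O : Matrix (Fin d) (Fin d) ℝ} {ev : Fin d → ℝ} {H : Finset (Fin d)}
    (h : Diagonalizes M O ev) {V Z : Matrix (Fin d) (Fin r) ℝ}
    (hV : ∀ v, nrm (Vᵀ *ᵥ v) ^ 2 = partSq O H v) {s m : ℝ} (hs : 0 < s) (hm : fro Z ≤ m)
    (hZ : ∀ w, nrm w = 1 → s < nrm ((Vᵀ * Z) *ᵥ w)) :
    InCone O H (m / s) (qrQ Z) ∧ (qrQ Z)ᵀ * qrQ Z = 1 := by
  have h1 : ∀ w, s * nrm w ≤ nrm (Vᵀ *ᵥ (Z *ᵥ w)) := fun w => by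
    by_cases hw : w = 0
    · simp [hw]
    have hw' : 0 < nrm w := lt_of_le_of_ne (nrm_nonneg _) fun h0 => hw (nrm_eq_zero.1 h0.symm)
    have h2 := hZ ((nrm w)⁻¹ • w) (by rw [nrm_smul, abs_of_pos (by positivity)]; field_simp)
    rw [mulVec_smul, nrm_smul, abs_of_pos (by positivity), ← mulVec_mulVec, lt_inv_mul_iff₀ hw'] at h2
    linarith
  have h2 : ∀ w, s ^ 2 * nrm w ^ 2 ≤ partSq O H (Z *ᵥ w) := fun w => by
    rw [← hV, ← mul_pow]
    have := nrm_nonneg w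
    have := h1 w
    gcongr
  have h3 := fun w => h.partSq_add (H := H) (Z *ᵥ w)
  have h4 : ∀ w, nrm (Z *ᵥ w) ^ 2 ≤ m ^ 2 * nrm w ^ 2 := fun w => by
    have h5 := (nrm_mulVec_le Z w).trans (mul_le_mul_of_nonneg_right ((norm_le_fro Z).trans hm) (nrm_nonneg w))
    rw [← mul_pow]
    have := nrm_nonneg (Z *ᵥ w)
    gcongr
  refine InCone.qrQ (c := s) (fun w => ?_) hs fun w => ?_
  · have h5 : partSq O Hᶜ (Z *ᵥ w) ≤ m ^ 2 * nrm w ^ 2 := by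
      have := partSq_nonneg (O := O) (H := H) (Z *ᵥ w)
      linarith [h3 w, h4 w]
    calc _ ≤ m ^ 2 * nrm w ^ 2 := h5
      _ = (m / s) ^ 2 * (s ^ 2 * nrm w ^ 2) := by field_simp
      _ ≤ _ := by gcongr; exact h2 w
  · refine le_of_sq_le_sq ?_ (nrm_nonneg _)
    rw [mul_pow]
    have := partSq_nonneg (O := O) (H := Hᶜ) (Z *ᵥ w)
    linarith [h3 w, h2 w]

end NearSpectral

section PowerIteration
variable {d T r L n K : ℕ} [NeZero L] {Us : Matrix (Fin d) (Fin r) ℝ} {bs : Matrix (Fin r) (Fin T) ℝ}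
  {σ κ μ : ℝ} {c : Config T n L K}

/-- The Gram matrix which the first node iterates with, up to scaling. -/
noncomputable def pooledGram (c : Config T n L K) (A : Matrix (Fin d) (Fin T) ℝ) : Matrix (Fin d) (Fin d) ℝ :=
  A * diagonal (fun t => L * (c.W ^ c.TconInit) 0 (c.node t)) * Aᵀ

lemma pooledGram_isHermitian (A : Matrix (Fin d) (Fin T) ℝ) : (pooledGram c A).IsHermitian := by
  rw [Matrix.IsHermitian, conjTranspose_eq_transpose_of_trivial, pooledGram, transpose_mul, transpose_mul,
    diagonal_transpose, transpose_transpose, Matrix.mul_assoc]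

lemma norm_pooledGram_sub_le {ω : ℝ} (hω : 0 ≤ ω)
    (hw : ∀ g j, |(c.W ^ c.TconInit) g j - 1 / L| ≤ ω / L ^ 2) (A : Matrix (Fin d) (Fin T) ℝ) :
    ‖pooledGram c A - A * Aᵀ‖ ≤ ω * ‖A‖ ^ 2 := by
  have hL : (1 : ℝ) ≤ L := by exact_mod_cast NeZero.one_le
  have e : pooledGram c A - A * Aᵀ =
      A * diagonal (fun t => L * (c.W ^ c.TconInit) 0 (c.node t) - 1) * Aᵀ := by
    have h1 : diagonal (fun t => (L : ℝ) * (c.W ^ c.TconInit) 0 (c.node t) - 1) =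
        diagonal (fun t => L * (c.W ^ c.TconInit) 0 (c.node t)) - (1 : Matrix (Fin T) (Fin T) ℝ) := by
      rw [← diagonal_one, diagonal_sub]
    rw [h1, Matrix.mul_sub, Matrix.sub_mul, Matrix.mul_one, pooledGram]
  have h2 : ‖diagonal (fun t => (L : ℝ) * (c.W ^ c.TconInit) 0 (c.node t) - 1)‖ ≤ ω := by
    rw [Matrix.l2_opNorm_diagonal, pi_norm_le_iff_of_nonneg hω]
    intro t
    have h3 : (L : ℝ) * (c.W ^ c.TconInit) 0 (c.node t) - 1 =
        L * ((c.W ^ c.TconInit) 0 (c.node t) - 1 / L) := by field_simp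
    rw [h3, Real.norm_eq_abs, abs_mul, abs_of_pos (by linarith)]
    calc (L : ℝ) * _ ≤ L * (ω / L ^ 2) := by gcongr; exact hw _ _
      _ = ω / L := by field_simp
      _ ≤ ω := div_le_self hω hL
  rw [e]
  calc _ ≤ ‖A‖ * ω * ‖A‖ := by
        refine (norm_mul_le' _ _).trans ?_
        rw [norm_transpose]
        gcongr
        exact (norm_mul_le' _ _).trans (by gcongr)
    _ = _ := by ring

lemma powerStep_const (hW : IsWeightMatrix c.graph c.W) (hc : c.graph.Connected) (A : Matrix (Fin d) (Fin T) ℝ)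
    (U : Matrix (Fin d) (Fin r) ℝ) (h0 : qrQ (((1 / (L : ℝ)) • pooledGram c A) * U) ≠ 0) :
    powerStep c A (fun _ => U) = fun _ => qrQ (((1 / (L : ℝ)) • pooledGram c A) * U) := by
  classical
  have hL : (L : ℝ) ≠ 0 := by exact_mod_cast NeZero.ne L
  have e : agree c.graph c.W c.TconInit (fun g' =>
      (A.submatrix id Subtype.val : Matrix (Fin d) {t : Fin T // c.node t = g'} ℝ) *
      (A.submatrix id Subtype.val : Matrix (Fin d) {t : Fin T // c.node t = g'} ℝ)ᵀ * U) 0 =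
      ((1 / (L : ℝ)) • pooledGram c A) * U := by
    rw [agree_eq hW]
    simp only [← Matrix.smul_mul, ← Matrix.sum_mul]
    congr 1
    ext i k
    rw [Matrix.sum_apply, Matrix.smul_apply, pooledGram, Matrix.mul_apply]
    simp only [mul_diagonal]
    simp only [Matrix.smul_apply, Matrix.mul_apply, transpose_apply, submatrix_apply, id_eq,
      smul_eq_mul, Finset.mul_sum]
    have h1 : ∀ j, ∑ t : {t : Fin T // c.node t = j}, (c.W ^ c.TconInit) 0 j * A i t.1 * A k t.1 =
        ∑ t ∈ Finset.univ.filter (fun t => c.node t = j), (c.W ^ c.TconInit) 0 (c.node t) * A i t * A k t := fun j => by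
      rw [Finset.sum_subtype (p := fun t => c.node t = j) _ (by simp)]
      exact Finset.sum_congr rfl fun t _ => by rw [t.2]
    refine (Finset.sum_congr rfl fun j _ => h1 j).trans ((Finset.sum_fiberwise _ _ _).trans ?_)
    refine Finset.sum_congr rfl fun t _ => ?_
    field_simp
  funext g
  rw [powerStep, broadcast_eq hc (by rw [e]; exact h0), e]

/-- Accuracy of the power iteration. -/
lemma initFrom_eq (hG : GroundTruth Us bs σ κ) (hW : IsWeightMatrix c.graph c.W) (hc : c.graph.Connected)
    {O : Matrix (Fin d) (Fin d) ℝ} {B : Matrix (Fin d) (Fin T) ℝ} {ev : Fin d → ℝ} {H : Finset (Fin d)} {hi : ℝ}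
    (hS : SpectralSplit (pooledGram c B) O ev H hi) {t : ℝ} (ht : 0 ≤ t) {U : Matrix (Fin d) (Fin r) ℝ}
    (hU : InCone O H t U) (hU1 : Uᵀ * U = 1) (k : ℕ) :
    ∃ U' : Matrix (Fin d) (Fin r) ℝ, ((powerStep c B)^[k] fun _ => U) = (fun _ => U') ∧ U'ᵀ * U' = 1 ∧
      InCone O H (t / 4 ^ k) U' := by
  have hL : (0 : ℝ) < L := by exact_mod_cast NeZero.pos L
  induction k with
  | zero => exact ⟨U, rfl, hU1, by simpa using hU⟩
  | succ k ih =>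
    obtain ⟨U', h1, h2, h3⟩ := ih
    obtain ⟨h4, h5⟩ := hS.inCone_step (a := 1 / L) (by positivity) (by positivity) h2 h3
    refine ⟨_, ?_, h5, by rw [pow_succ, ← div_div]; exact h4⟩
    rw [Function.iterate_succ_apply', h1, powerStep_const hW hc]
    intro h6
    rw [h6, Matrix.mul_zero] at h5
    have : (0 : Matrix (Fin r) (Fin r) ℝ) ⟨0, hG.rank_pos⟩ ⟨0, hG.rank_pos⟩ = 1 := by rw [h5]; simp
    simp at this

end PowerIteration

section InitialPotential
variable {d T r L n K : ℕ} [NeZero L] {Us : Matrix (Fin d) (Fin r) ℝ} {bs : Matrix (Fin r) (Fin T) ℝ}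
  {σ κ μ ω : ℝ} {c : Config T n L K}

/-- The conditions under which the initialization works. -/
structure InitSetup (c : Config T n L K) (Us : Matrix (Fin d) (Fin r) ℝ)
    (bs : Matrix (Fin r) (Fin T) ℝ) (σ κ μ ω : ℝ) : Prop where
  truth : GroundTruth Us bs σ κ
  weight : IsWeightMatrix c.graph c.W
  connected : c.graph.Connected
  mixing : ∀ g j, |(c.W ^ c.TconInit) g j - 1 / L| ≤ ω / L ^ 2
  omega_nonneg : 0 ≤ ω
  omega_le : 4 * ω * κ ^ 2 ≤ (basin r κ / 30) ^ 2
  kappa_eq : c.κ = κ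
  mu_eq : c.μ = μ
  one_le_mu : 1 ≤ μ
  incoherent : ∀ t, nrm (bs.col t) ^ 2 ≤ μ ^ 2 * (r / T) * σ ^ 2
  tasks : 1 ≤ T
  dim : 1 ≤ d
  size_zero_pos : 0 < c.size 0
  size_one_pos : 0 < c.size 1
  samples_zero : 2e5 * κ ^ 2 * μ ^ 2 * (d + T) ≤ c.size 0 * T
  samples_one : 3e15 * κ ^ 8 * μ ^ 2 * r ^ 2 * (d + T) ≤ c.size 1 * T
  iterations : 4096 * (d : ℝ) ^ 3 * r ^ 3 / 4 ^ c.Tpm ≤ basin r κ / 4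

/-- The power iteration succeeds for most starting points. -/
lemma InitSetup.measure_initFrom_le (h : InitSetup c Us bs σ κ μ ω) {B : Matrix (Fin d) (Fin T) ℝ}
    (hB : NearScaled (Us * bs) (basin r κ / 30 * (σ / κ)) B) :
    gaussM (Coord T n d r) {x | ¬ pot Us (200 * r * κ ^ 2) (initFrom c B x) ≤ basin r κ / 2} ≤
      ofReal (1 / (32 * d)) := by
  have hG := h.truth
  have hκ := hG.one_le
  have hσ := hG.sigma_pos
  have hr : (1 : ℝ) ≤ r := by exact_mod_cast hG.rank_pos
  have hd : (1 : ℝ) ≤ d := by exact_mod_cast h.dim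
  have hb0 := basin_pos hG.rank_pos hκ
  have hb1 := basin_le hG.rank_pos hκ
  set δ := basin r κ / 30 with hδ
  have hδ0 : 0 < δ := by positivity
  have hω0 := h.omega_nonneg
  have hMA : ‖pooledGram c B - B * Bᵀ‖ ≤ (δ * (σ / κ)) ^ 2 := by
    refine (norm_pooledGram_sub_le h.omega_nonneg h.mixing B).trans ?_
    have h1 : ‖B‖ ≤ 2 * σ := by
      refine (hB.norm_le hG).trans ?_
      have h2 : δ * (σ / κ) ≤ 1 * σ := by
        gcongr
        · linarith
        · exact div_le_self hσ.le hκ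
      linarith
    calc ω * ‖B‖ ^ 2 ≤ ω * (2 * σ) ^ 2 := by gcongr
      _ = 4 * ω * κ ^ 2 * (σ / κ) ^ 2 := by field_simp; ring
      _ ≤ δ ^ 2 * (σ / κ) ^ 2 := by have := h.omega_le; gcongr
      _ = _ := by ring
  obtain ⟨O, ev, H, hS, hH, hcone⟩ := exists_spectralSplit_of_nearScaled hG hδ0 (by linarith) hB
    (pooledGram_isHermitian B) hMA
  obtain ⟨V, hV, hVp⟩ := hS.toDiagonalizes.exists_orthonormal hH
  set e : Fin d → Fin r → Coord T n d r := fun j k => Sum.inr (j, k) with he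
  have hei : Function.Injective (Function.uncurry e) := fun a b hab => by
    simpa [he, Function.uncurry] using hab
  set s : ℝ := 1 / (64 * r ^ 2 * d) with hs
  set m : ℝ := 64 * d ^ 2 * r with hm
  have hs0 : 0 < s := by positivity
  have hm1 : 1 ≤ m := by
    have : (1 : ℝ) ≤ d ^ 2 := one_le_pow₀ hd
    nlinarith
  have hsub : {x : Coord T n d r → ℝ | ¬ pot Us (200 * r * κ ^ 2) (initFrom c B x) ≤ basin r κ / 2} ⊆
      {x | ∃ w, nrm w = 1 ∧ nrm ((Vᵀ * entryMatrix e x) *ᵥ w) ≤ s} ∪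
        {x | m ≤ fro (Matrix.of fun j k => x (e j k))} := by
    intro x hx
    by_contra hcon
    simp only [Set.mem_union, Set.mem_ofPred_eq, not_or, not_exists, not_and, not_le] at hcon
    refine hx ?_
    obtain ⟨h1, h2⟩ := inCone_of_start hS.toDiagonalizes (Z := entryMatrix e x) hVp hs0 hcon.2.le hcon.1
    have ht0 : 0 ≤ m / s := by positivity
    obtain ⟨U, h3, h4, h5⟩ := initFrom_eq hG h.weight h.connected hS ht0 h1 h2 c.Tpm
    rw [initFrom, h3]
    refine GoodState.pot_le (by positivity) ⟨fun _ => h4, fun _ => ?_, fun _ => ?_⟩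
    · refine (hcone _ (by positivity) U h4 h5).trans ?_
      have h6 : m / s / 4 ^ c.Tpm = 4096 * (d : ℝ) ^ 3 * r ^ 3 / 4 ^ c.Tpm := by
        rw [hm, hs]; field_simp; norm_num
      have h7 := h.iterations
      rw [h6, hδ]
      linarith
    · rw [sub_self, norm_zero, mul_zero]; positivity
  refine (measure_mono hsub).trans ((measure_union_le _ _).trans ?_)
  refine (add_le_add (gaussM_small_ball hei hV hs0.le) (measure_fro_ge_le e hm1)).trans ?_
  rw [← ENNReal.ofReal_add (by positivity) (by positivity)]
  refine ENNReal.ofReal_le_ofReal (le_of_eq ?_)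
  rw [hs, hm, Fintype.card_fin, Fintype.card_fin]
  field_simp
  norm_num

/-- The initialization is accurate with high probability. -/
lemma InitSetup.measure_iterPot_gt_le (h : InitSetup c Us bs σ κ μ ω) :
    gaussM (Coord T n d r) {x | ¬ iterPot c Us bs κ 0 x ≤ basin r κ / 2} ≤
      ofReal (3 * exp (-5 * (d + T)) + 1 / (32 * d)) := by
  have hG := h.truth
  have hκ := hG.one_le
  have hσ := hG.sigma_pos
  have hr : (1 : ℝ) ≤ r := by exact_mod_cast hG.rank_pos
  have hd : (1 : ℝ) ≤ d := by exact_mod_cast h.dim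
  have hT : (1 : ℝ) ≤ T := by exact_mod_cast h.tasks
  have hb0 := basin_pos hG.rank_pos hκ
  have hb1 := basin_le hG.rank_pos hκ
  have hsq := sqrt_mul_basin (κ := κ) hG.rank_pos
  have hμ := h.one_le_mu
  set Θ := Us * bs with hΘ
  set δ := basin r κ / 30 * (σ / κ) with hδ
  have hδ0 : 0 < δ := by positivity
  have hω : ω ≤ 0.05 := by
    have h1 := h.omega_le
    have h2 : ω ≤ 4 * ω * κ ^ 2 := by
      have := h.omega_nonneg
      nlinarith [one_le_pow₀ hκ (n := 2)]
    nlinarith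
  set al : (Coord T n d r → ℝ) → Fin L → ℝ := fun x => alpha c (canonData Θ x) with hal
  have halm : Measurable al := measurable_pi_lambda _ fun g => measurable_alpha h.weight measurable_id g
  set tt : (Coord T n d r → ℝ) → Matrix (Fin d) (Fin T) ℝ := fun x => truncTheta c Θ (al x) x with htt
  have httm : Measurable tt := measurable_truncTheta Θ halm measurable_id
  have hsamp : 31360 * truncScale bs κ μ * (d + T) ≤ c.size 1 * δ ^ 2 := by
    have h1 := (hG.truncScale_bounds (μ := μ) h.tasks).2
    have h2 : r * basin r κ ^ 2 = 1e-8 / κ ^ 4 := by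
      have h3 : (sqrt r * basin r κ) ^ 2 = (1 / 10000 / κ ^ 2) ^ 2 := by rw [hsq]
      rw [mul_pow, Real.sq_sqrt (by positivity)] at h3
      rw [h3]; field_simp; norm_num
    have h3 : δ ^ 2 = 1e-8 / 900 * σ ^ 2 / (κ ^ 6 * r) := by
      have h4 : basin r κ ^ 2 = 1e-8 / κ ^ 4 / r := by rw [← h2]; field_simp
      rw [hδ, mul_pow, div_pow, div_pow, h4]
      field_simp; norm_num
    have h4 := h.samples_one
    calc 31360 * truncScale bs κ μ * (d + T) ≤ 31360 * (κ ^ 2 * μ ^ 2 * r * σ ^ 2 / T) * (d + T) := by gcongr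
      _ = 31360 / 3e15 * (3e15 * κ ^ 8 * μ ^ 2 * r ^ 2 * (d + T)) * (σ ^ 2 / (κ ^ 6 * r * T)) := by
          field_simp
      _ ≤ 31360 / 3e15 * (c.size 1 * T) * (σ ^ 2 / (κ ^ 6 * r * T)) := by gcongr
      _ = 31360 / 3e15 * (c.size 1 * (σ ^ 2 / (κ ^ 6 * r))) := by field_simp
      _ ≤ 1e-8 / 900 * (c.size 1 * (σ ^ 2 / (κ ^ 6 * r))) :=
          mul_le_mul_of_nonneg_right (by norm_num) (by positivity)
      _ = _ := by rw [h3]; ring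
  have hex : (0 : ℝ) < exp (-5 * (d + T)) := Real.exp_pos _
  have p1 : gaussM (Coord T n d r) {x | ¬ ThresholdsGood bs κ μ (al x)} ≤
      ofReal (2 * exp (-5 * (d + T))) :=
    measure_not_thresholdsGood_le hG h.weight h.mixing hω h.kappa_eq h.mu_eq h.size_zero_pos h.tasks
      h.one_le_mu h.incoherent h.samples_zero
  have p2 : gaussM (Coord T n d r) {x | ThresholdsGood bs κ μ (al x) ∧ ¬ NearScaled Θ δ (tt x)} ≤
      ofReal (exp (-5 * (d + T))) := by
    refine measure_decouple (fun _ : Coord T n d r => gaussianReal 0 1) (inSplit c 1) (f := al) halm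
      measurableSet_thresholdsGood (E := {q | ¬ NearScaled Θ δ (truncTheta c Θ q.1 q.2)}) ?_ ?_ ?_ ?_
    · exact ((measurable_truncTheta Θ measurable_fst measurable_snd) (measurableSet_nearScaled Θ δ)).compl
    · exact fun x y hxy => alpha_congr fun q hq => hxy q fun h1 => by
        have := inSplit_unique hq h1; omega
    · intro a x y hxy
      simp only [Set.mem_ofPred_eq, truncTheta_congr a hxy]
    · exact fun a ha => measure_not_nearScaled_le hG h.size_one_pos h.tasks h.one_le_mu h.incoherent hδ0 hsamp ha
  have p3 : gaussM (Coord T n d r) {x | NearScaled Θ δ (tt x) ∧ ¬ iterPot c Us bs κ 0 x ≤ basin r κ / 2} ≤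
      ofReal (1 / (32 * d)) := by
    have e : ∀ x : Coord T n d r → ℝ, iterPot c Us bs κ 0 x =
        pot Us (200 * r * κ ^ 2) (initFrom c (tt x) x) := fun x => by
      rw [iterPot, iterU, spectralInit_canonData]
    simp only [e]
    refine measure_decouple (fun _ : Coord T n d r => gaussianReal 0 1) (fun q => q.isRight = true) (f := tt) httm
      (measurableSet_nearScaled Θ δ)
      (E := {q | ¬ pot Us (200 * r * κ ^ 2) (initFrom c q.1 q.2) ≤ basin r κ / 2}) ?_ ?_ ?_ ?_
    · exact (measurableSet_le (measurable_pot Us _ (measurable_initFrom h.weight measurable_fst measurable_snd)) measurable_const).compl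
    · intro x y hxy
      have hl : ∀ l q, inSplit c l q → x q = y q := fun l q hq => hxy q fun h1 => by
        rcases q with q | q
        · simp at h1
        · exact hq
      simp only [htt, hal, alpha_congr (hl 0)]
      exact truncTheta_congr _ (hl 1)
    · intro A x y hxy
      simp only [Set.mem_ofPred_eq, initFrom_congr A fun q => hxy (Sum.inr q) rfl]
    · exact fun A hA => h.measure_initFrom_le hA
  have hsub : {x : Coord T n d r → ℝ | ¬ iterPot c Us bs κ 0 x ≤ basin r κ / 2} ⊆
      ({x | ¬ ThresholdsGood bs κ μ (al x)} ∪
        {x | ThresholdsGood bs κ μ (al x) ∧ ¬ NearScaled Θ δ (tt x)}) ∪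
      {x | NearScaled Θ δ (tt x) ∧ ¬ iterPot c Us bs κ 0 x ≤ basin r κ / 2} := by
    intro x hx
    by_cases h1 : ThresholdsGood bs κ μ (al x)
    · by_cases h2 : NearScaled Θ δ (tt x)
      · exact Or.inr ⟨h2, hx⟩
      · exact Or.inl (Or.inr ⟨h1, h2⟩)
    · exact Or.inl (Or.inl h1)
  refine (measure_mono hsub).trans ((measure_union_le _ _).trans
    ((add_le_add ((measure_union_le _ _).trans (add_le_add p1 p2)) p3).trans ?_))
  rw [← ENNReal.ofReal_add (by positivity) (by positivity), ← ENNReal.ofReal_add (by positivity) (by positivity)]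
  refine ENNReal.ofReal_le_ofReal (le_of_eq ?_)
  ring

end InitialPotential

lemma card_le_of_orthonormal {d r : ℕ} {U : Matrix (Fin d) (Fin r) ℝ} (h : Uᵀ * U = 1) : r ≤ d := by
  have hi : Function.Injective (Matrix.mulVecLin U) := fun v w hvw => by
    have h1 := congrArg (Uᵀ *ᵥ ·) hvw
    simpa [mulVec_mulVec, h] using h1
  simpa using LinearMap.finrank_le_finrank_of_injective hi

/-- A reduced singular value decomposition provides the ground truth of the estimates. -/
lemma IsReducedSVD.groundTruth {d T r : ℕ} {Θ : Matrix (Fin d) (Fin T) ℝ} {U : Matrix (Fin d) (Fin r) ℝ}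
    {s : Fin r → ℝ} {V : Matrix (Fin T) (Fin r) ℝ} (h : IsReducedSVD Θ U s V) (hr : 1 ≤ r) :
    GroundTruth U (diagonal s * Vᵀ) (sigmaMax s) (condNumber s) := by
  obtain ⟨hU, hV, hs, -⟩ := h
  have : Nonempty (Fin r) := ⟨⟨0, hr⟩⟩
  obtain ⟨k0, hk0⟩ := exists_eq_ciInf_of_finite (f := s)
  have hmin : 0 < sigmaMin s := by unfold sigmaMin; rw [← hk0]; exact hs k0
  have hle : ∀ k, sigmaMin s ≤ s k := fun k => ciInf_le (Set.finite_range s).bddBelow k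
  have hge : ∀ k, s k ≤ sigmaMax s := fun k => le_ciSup (Set.finite_range s).bddAbove k
  have hmm : sigmaMin s ≤ sigmaMax s := (hle k0).trans (hge k0)
  have hmax : 0 < sigmaMax s := hmin.trans_le hmm
  refine ⟨hU, hmax, by rw [condNumber, one_le_div hmin]; exact hmm, hr, ?_, fun z => ?_⟩
  · refine (norm_mul_le' _ _).trans ?_
    rw [norm_transpose, Matrix.l2_opNorm_diagonal]
    have h1 : ‖s‖ ≤ sigmaMax s := (pi_norm_le_iff_of_nonneg hmax.le).2 fun k => by
      rw [Real.norm_eq_abs, abs_of_pos (hs k)]; exact hge k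
    exact (mul_le_of_le_one_right (norm_nonneg _) (norm_orthonormal_le hV)).trans h1
  · have h1 : sigmaMax s / condNumber s = sigmaMin s := by unfold condNumber; field_simp
    rw [h1, transpose_mul, transpose_transpose, diagonal_transpose, ← mulVec_mulVec, nrm_mulVec_orthonormal hV]
    refine le_of_sq_le_sq ?_ (nrm_nonneg _)
    rw [mul_pow, nrm_sq_eq_sum, nrm_sq_eq_sum, Finset.mul_sum]
    refine Finset.sum_le_sum fun k _ => ?_
    rw [mulVec_diagonal, mul_pow]
    have := hle k
    gcongr

lemma exp_neg_mul_log {C x : ℝ} {k : ℕ} (hx : 0 < x) (hC : C = k) : exp (-(C * log x)) = (1 / x) ^ k := by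
  rw [hC, ← mul_neg, ← Real.log_inv, ← one_div, Real.exp_nat_mul, Real.exp_log (by positivity)]

/-- Sufficiently many rounds of agreement average well. -/
lemma exists_mixing {L : ℕ} [NeZero L] {G : SimpleGraph (Fin L)} {W : Matrix (Fin L) (Fin L) ℝ}
    (hW : IsWeightMatrix G W) (hγ : connectivity W < 1) {k : ℕ} {y : ℝ} (hy : 1 ≤ y) (hk : 1 ≤ k)
    (h : 60 * (1 / log (1 / connectivity W)) * log (L * y) ≤ k) :
    ∃ ω, 0 ≤ ω ∧ (∀ g j, |(W ^ k) g j - 1 / L| ≤ ω / L ^ 2) ∧ ω * y ^ 6 ≤ (1 / 2) ^ 52 * (1 / y) ^ 2 := by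
  have hL : (1 : ℝ) ≤ L := by exact_mod_cast NeZero.one_le
  by_cases hL1 : L = 1
  · refine ⟨0, le_rfl, fun g j => ?_, by rw [zero_mul]; positivity⟩
    have := abs_weight_pow_sub_le hW hγ k g j
    rw [if_pos hL1] at this
    simpa using this
  · have hL2 : (2 : ℝ) ≤ L := by
      have := NeZero.one_le (n := L)
      exact_mod_cast (by omega : 2 ≤ L)
    refine ⟨L ^ 2 * connectivity W ^ k, mul_nonneg (by positivity) (pow_nonneg (connectivity_nonneg W) _),
      fun g j => ?_, ?_⟩
    · have := abs_weight_pow_sub_le hW hγ k g j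
      rw [if_neg hL1] at this
      rwa [mul_div_cancel_left₀ _ (by positivity)]
    · have h1 := connectivity_pow_le hγ hk h
      rw [exp_neg_mul_log (k := 60) (by positivity) (by norm_num)] at h1
      calc L ^ 2 * connectivity W ^ k * y ^ 6 ≤ L ^ 2 * (1 / (L * y)) ^ 60 * y ^ 6 := by gcongr
        _ = (1 / L) ^ 52 * (1 / y) ^ 2 * ((1 / L) ^ 6 * (1 / y) ^ 52) := by field_simp
        _ ≤ (1 / 2) ^ 52 * (1 / y) ^ 2 * (1 * 1) := by
            have h2 : 1 / (L : ℝ) ≤ 1 := by rw [div_le_one (by positivity)]; exact hL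
            have h3 : 1 / y ≤ 1 := by rw [div_le_one (by positivity)]; exact hy
            gcongr
            · exact pow_le_one₀ (by positivity) h2
            · exact pow_le_one₀ (by positivity) h3
        _ = _ := by ring

lemma powerIterations_bound {d r m : ℕ} {κ : ℝ} (hr : 1 ≤ r) (hrd : r ≤ d) (hd : 2 ≤ d) (hκ : 1 ≤ κ)
    (h : 60 * κ ^ 2 * (log d + log κ) ≤ m) :
    4096 * (d : ℝ) ^ 3 * r ^ 3 / 4 ^ m ≤ basin r κ / 4 := by
  have hr1 : (1 : ℝ) ≤ r := by exact_mod_cast hr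
  have hrd1 : (r : ℝ) ≤ d := by exact_mod_cast hrd
  have hd2 : (2 : ℝ) ≤ d := by exact_mod_cast hd
  have hx2 : 2 ≤ d * κ := by nlinarith
  have h1 : (d * κ) ^ 60 ≤ (4 : ℝ) ^ m := by
    have h2 : 60 * log (d * κ) ≤ m := by
      rw [Real.log_mul (by positivity) (by positivity)]
      refine le_trans ?_ h
      have h3 : 0 ≤ log d + log κ := add_nonneg (Real.log_nonneg (by linarith)) (Real.log_nonneg hκ)
      nlinarith [one_le_pow₀ hκ (n := 2)]
    calc (d * κ) ^ 60 = exp (60 * log (d * κ)) := by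
          rw [show (60 : ℝ) = ((60 : ℕ) : ℝ) by norm_num, Real.exp_nat_mul, Real.exp_log (by positivity)]
      _ ≤ exp m := Real.exp_le_exp.2 h2
      _ = exp 1 ^ m := by rw [← Real.exp_nat_mul, mul_one]
      _ ≤ _ := by
          have := Real.exp_one_lt_d9
          gcongr
          linarith
  have hs : sqrt r ≤ d := (Real.sqrt_le_sqrt hrd1).trans (Real.sqrt_le_left (by positivity) |>.2 (by nlinarith))
  rw [div_le_iff₀ (by positivity), basin]
  have hs0 : 0 < sqrt r := Real.sqrt_pos.2 (by linarith)
  have h2 : 4096 * (d : ℝ) ^ 3 * r ^ 3 * (40000 * κ ^ 2 * sqrt r) ≤ 4 ^ m := by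
    calc 4096 * (d : ℝ) ^ 3 * r ^ 3 * (40000 * κ ^ 2 * sqrt r) ≤
          4096 * (d : ℝ) ^ 3 * d ^ 3 * (40000 * κ ^ 7 * d) := by
          have h3 : κ ^ 2 ≤ κ ^ 7 := pow_le_pow_right₀ hκ (by norm_num)
          gcongr
      _ = 163840000 * (d * κ) ^ 7 := by ring
      _ ≤ 2 ^ 53 * (d * κ) ^ 7 := by gcongr; norm_num
      _ ≤ (d * κ) ^ 53 * (d * κ) ^ 7 := by gcongr
      _ = (d * κ) ^ 60 := by ring
      _ ≤ _ := h1
  have h3 : 1 / 10000 / κ ^ 2 / sqrt r / 4 * 4 ^ m = 4 ^ m / (40000 * κ ^ 2 * sqrt r) := by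
    field_simp; norm_num
  rw [h3, le_div_iff₀ (by positivity)]
  exact h2

/-- Bad conditioning of the samples of a step is rare. -/
lemma rare_bound {N T d r : ℕ} {κ : ℝ} (hr : 1 ≤ r) (hrd : r ≤ d) (hT : 1 ≤ T) (hκ : 1 ≤ κ)
    (h1 : 1e9 * r ≤ (N : ℝ)) (h2 : 1e9 * κ ^ 4 ≤ N) (h3 : 1e9 * log T ≤ N) (h4 : 1e9 * log d ≤ N) :
    2 * T * exp (4 * r - 7e-6 * N) ≤
      (1 / (8 * d) * 1e-10 / (r ^ 2 * κ ^ 4)) ^ 2 / (T * (r ^ 2 + 2 * N * d)) := by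
  have hr1 : (1 : ℝ) ≤ r := by exact_mod_cast hr
  have hrd1 : (r : ℝ) ≤ d := by exact_mod_cast hrd
  have hT1 : (1 : ℝ) ≤ T := by exact_mod_cast hT
  have hN0 : (0 : ℝ) < N := by linarith
  set a : ℝ := 1e-9 * N with ha
  have ha1 : r ≤ a := by linarith
  have ha2 : κ ^ 4 ≤ a := by linarith
  have hNa : (N : ℝ) = 1e9 * a := by rw [ha]; ring
  have hE : ∀ x : ℝ, x ≤ exp x := fun x => by linarith [Real.add_one_le_exp x]
  have e1 : (r : ℝ) ≤ exp a := (hE r).trans (Real.exp_le_exp.2 ha1)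
  have e2 : κ ^ 4 ≤ exp a := (hE _).trans (Real.exp_le_exp.2 ha2)
  have e3 : (T : ℝ) ≤ exp a := by
    rw [← Real.exp_log (by linarith : (0 : ℝ) < T)]
    exact Real.exp_le_exp.2 (by linarith)
  have e4 : (d : ℝ) ≤ exp a := by
    rw [← Real.exp_log (by linarith : (0 : ℝ) < d)]
    exact Real.exp_le_exp.2 (by linarith)
  have e5 : (N : ℝ) ≤ 1e9 * exp a := by rw [hNa]; gcongr; exact hE a
  have e6 : exp (4 * r) ≤ exp a ^ 4 := by
    rw [← Real.exp_nat_mul]; exact Real.exp_le_exp.2 (by push_cast; linarith)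
  have e7 : (2 : ℝ) ≤ exp a := by linarith [Real.add_one_le_exp a]
  set X := exp a with hX
  have hX0 : 0 < X := Real.exp_pos a
  rw [le_div_iff₀ (by positivity), div_pow, le_div_iff₀ (by positivity)]
  have hexp : exp (4 * r - 7e-6 * N) = exp (4 * r) / X ^ 7000 := by
    rw [Real.exp_sub, hX, ← Real.exp_nat_mul]
    congr 2
    rw [ha]; push_cast; ring
  have hd1 : (1 : ℝ) ≤ d := hr1.trans hrd1
  have hbig : (r : ℝ) ^ 2 + 2 * N * d ≤ 3 * N * d := by
    have : (r : ℝ) * r ≤ N * d := mul_le_mul (by linarith) hrd1 (by linarith) hN0.le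
    nlinarith
  rw [hexp]
  have key : 2 * T * exp (4 * r) * (T * (r ^ 2 + 2 * N * d)) * (r ^ 2 * κ ^ 4) ^ 2 * (64 * d ^ 2 * 1e20) ≤
      X ^ 7000 := by
    calc _ ≤ 2 * X * X ^ 4 * (X * (3 * (1e9 * X) * X)) * (X ^ 2 * X) ^ 2 * (64 * X ^ 2 * 1e20) := by
          gcongr
          exact hbig.trans (by gcongr)
      _ = 384e29 * X ^ 16 := by ring
      _ ≤ 2 ^ 200 * X ^ 16 := by gcongr; norm_num
      _ ≤ X ^ 200 * X ^ 16 := by gcongr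
      _ = X ^ 216 := by ring
      _ ≤ X ^ 7000 := pow_le_pow_right₀ (by linarith) (by norm_num)
  have hlhs : 2 * T * (exp (4 * r) / X ^ 7000) * (T * (r ^ 2 + 2 * N * d)) * (r ^ 2 * κ ^ 4) ^ 2 =
      (2 * T * exp (4 * r) * (T * (r ^ 2 + 2 * N * d)) * (r ^ 2 * κ ^ 4) ^ 2) / X ^ 7000 := by
    ring
  have hrhs : (1 / (8 * (d : ℝ)) * 1e-10) ^ 2 = 1 / (64 * d ^ 2 * 1e20) := by
    field_simp; norm_num
  rw [hlhs, hrhs, div_le_div_iff₀ (by positivity) (by positivity), one_mul]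
  exact key

lemma radius_le_of_steps {r K : ℕ} {κ ε C : ℝ} (hr : 1 ≤ r) (hκ : 1 ≤ κ) (hε : 0 < ε) (hε1 : ε < 1) (hC : 60 ≤ C)
    (hK1 : 1 ≤ K) (hK : C * κ ^ 2 * log (1 / ε) ≤ K) : radius r κ (K - 1) ≤ 2 * ε * basin r κ := by
  have hb := basin_pos hr hκ
  have hl : 0 < log (1 / ε) := Real.log_pos (by rw [lt_div_iff₀ hε]; linarith)
  have hκ2 : 1 ≤ κ ^ 2 := one_le_pow₀ hκ
  have hcast : ((K - 1 : ℕ) : ℝ) = K - 1 := by push_cast [Nat.cast_sub hK1]; ring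
  have h1 : exp (-0.1 / κ ^ 2) ^ (K - 1) ≤ 2 * ε := by
    rw [← Real.exp_nat_mul, hcast]
    have h2 : log (1 / ε) ≤ 0.1 * K / κ ^ 2 := by
      rw [le_div_iff₀ (by positivity)]
      have : 60 * κ ^ 2 * log (1 / ε) ≤ C * κ ^ 2 * log (1 / ε) := by gcongr
      nlinarith [mul_pos (by positivity : 0 < κ ^ 2) hl]
    have h3 : 0.1 / κ ^ 2 ≤ 0.1 := div_le_self (by norm_num) hκ2
    have h4 : ((K : ℝ) - 1) * (-0.1 / κ ^ 2) ≤ 0.1 + log ε := by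
      have h5 : log (1 / ε) = -log ε := by rw [one_div, Real.log_inv]
      have h6 : ((K : ℝ) - 1) * (-0.1 / κ ^ 2) = 0.1 / κ ^ 2 - 0.1 * K / κ ^ 2 := by ring
      rw [h6]; linarith
    calc _ ≤ exp (0.1 + log ε) := Real.exp_le_exp.2 h4
      _ = exp 0.1 * ε := by rw [Real.exp_add, Real.exp_log hε]
      _ ≤ 2 * ε := by
          have h7 : exp 0.1 ≤ 2 := by
            have h8 := Real.one_sub_le_exp_neg 0.1
            rw [Real.exp_neg] at h8
            have h9 := Real.exp_pos 0.1
            rw [le_inv_comm₀ (by norm_num) h9] at h8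
            norm_num at h8 ⊢
            linarith
          gcongr
  unfold radius
  calc basin r κ * _ ≤ basin r κ * (2 * ε) := by gcongr
    _ = _ := by ring

/-- The failure probabilities add up. -/
lemma failure_sum_le {d T r N : ℕ} {κ : ℝ} (hd : 2 ≤ d) (hT : 1 ≤ T) (hr : 1 ≤ r) (hκ : 1 ≤ κ) :
    3 * exp (-5 * (d + T)) + 1 / (32 * d) + (lyap (4 + 2 * log d) (1 / (8 * d)) (1 / 2) +
      ((1 / (8 * d) * 1e-10 / (r ^ 2 * κ ^ 4)) ^ 2 / (T * (r ^ 2 + 2 * N * d)) + exp (-5 * (d + T)))) ≤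
      1 / (d : ℝ) := by
  have hr1 : (1 : ℝ) ≤ r := by exact_mod_cast hr
  have hT1 : (1 : ℝ) ≤ T := by exact_mod_cast hT
  have hd2 : (2 : ℝ) ≤ d := by exact_mod_cast hd
  set x : ℝ := 1 / d with hx
  have hx0 : 0 < x := by positivity
  have e1 : exp (-5 * (d + T)) ≤ x / 40 := by
    have h1 : exp (-5 * (d + T)) ≤ exp (-(5 * d)) * exp (-(5 : ℝ)) := by
      rw [← Real.exp_add]; exact Real.exp_le_exp.2 (by linarith)
    have h2 : ∀ y : ℝ, 0 < y → exp (-y) ≤ 1 / y := fun y hy => by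
      rw [Real.exp_neg, ← one_div]
      exact one_div_le_one_div_of_le hy (by linarith [Real.add_one_le_exp y])
    have h3 : exp (-(5 : ℝ)) ≤ 1 / 8 := by
      rw [Real.exp_neg, ← one_div]
      refine one_div_le_one_div_of_le (by norm_num) ?_
      have h4 : exp 5 = exp 1 ^ 5 := by rw [← Real.exp_nat_mul]; norm_num
      have h5 := Real.add_one_le_exp (1 : ℝ)
      rw [h4]
      calc (8 : ℝ) ≤ 2 ^ 5 := by norm_num
        _ ≤ _ := by gcongr; linarith
    calc _ ≤ 1 / (5 * (d : ℝ)) * (1 / 8) := h1.trans (mul_le_mul (h2 _ (by positivity)) h3 (Real.exp_nonneg _) (by positivity))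
      _ = x / 40 := by rw [hx]; field_simp; norm_num
  have e2 : 1 / (32 * (d : ℝ)) = x / 32 := by rw [hx]; field_simp
  have e3 : lyap (4 + 2 * log d) (1 / (8 * d)) (1 / 2) ≤ x / 16 + x / 8 := by
    have h1 : (1 / 2 : ℝ) ^ (1 / 40 : ℝ) ≤ 1 := Real.rpow_le_one (by norm_num) (by norm_num) (by norm_num)
    have h2 : (1 / 2 : ℝ) ^ (4 + 2 * log d) ≤ x / 16 := by
      rw [Real.rpow_add (by norm_num)]
      have h3 : (1 / 2 : ℝ) ^ (2 * log d) ≤ x := by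
        rw [Real.rpow_def_of_pos (by norm_num), hx, one_div, one_div, Real.log_inv,
          ← Real.exp_log (by positivity : (0 : ℝ) < (d : ℝ)⁻¹), Real.log_inv]
        refine Real.exp_le_exp.2 ?_
        have h4 := Real.log_two_gt_d9
        have h5 : 0 ≤ log d := Real.log_nonneg (by linarith)
        nlinarith
      have h4 : (1 / 2 : ℝ) ^ (4 : ℝ) = 1 / 16 := by
        rw [show (4 : ℝ) = ((4 : ℕ) : ℝ) by norm_num, Real.rpow_natCast]; norm_num
      rw [h4]
      linarith
    have h5 : 1 / (8 * (d : ℝ)) = x / 8 := by rw [hx]; field_simp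
    unfold lyap
    rw [h5]
    have : x / 8 * (1 / 2 : ℝ) ^ (1 / 40 : ℝ) ≤ x / 8 * 1 := by gcongr
    linarith
  have e4 : (1 / (8 * (d : ℝ)) * 1e-10 / (r ^ 2 * κ ^ 4)) ^ 2 / (T * (r ^ 2 + 2 * N * d)) ≤ x / 8 := by
    have h1 : 1 / (8 * (d : ℝ)) * 1e-10 / (r ^ 2 * κ ^ 4) ≤ x / 8 * 1 / 1 := by
      have h5 : 1 / (8 * (d : ℝ)) = x / 8 := by rw [hx]; field_simp
      rw [h5]
      gcongr
      · norm_num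
      · exact one_le_mul_of_one_le_of_one_le (one_le_pow₀ hr1) (one_le_pow₀ hκ)
    have h2 : (1 : ℝ) ≤ T * (r ^ 2 + 2 * N * d) :=
      one_le_mul_of_one_le_of_one_le hT1 (by
        have : (1 : ℝ) ≤ r ^ 2 := one_le_pow₀ hr1
        have : (0 : ℝ) ≤ 2 * N * d := by positivity
        linarith)
    have h3 : x ≤ 1 := by rw [hx, div_le_one (by linarith)]; linarith
    calc _ ≤ (x / 8 * 1 / 1) ^ 2 / 1 := by gcongr
      _ ≤ x / 8 := by nlinarith
  rw [e2]
  linarith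

section Failure
variable {d T r L n K : ℕ} [NeZero L] {Us : Matrix (Fin d) (Fin r) ℝ} {bs : Matrix (Fin r) (Fin T) ℝ}
  {σ κ μ ω ω' : ℝ} {c : Config T n L K} {N : ℕ}

/-- The algorithm fails with small probability. -/
lemma measure_not_success_le (h : InitSetup c Us bs σ κ μ ω)
    (h' : DescentSetup c Us bs σ κ μ ω' (1 / (8 * d)) N) (hd : 2 ≤ d) {ε : ℝ} (hε : 0 < ε)
    (hrad : radius r κ (K - 1) ≤ 2 * ε * basin r κ) :
    gaussM (Coord T n d r) {x | ¬ Success c (Us * bs) Us ε (canonData (Us * bs) x)} ≤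
      ofReal (1 / d) := by
  have hκ := h.truth.one_le
  have hd2 : (2 : ℝ) ≤ d := by exact_mod_cast hd
  have hT1 : (1 : ℝ) ≤ T := by exact_mod_cast h.tasks
  have hl0 : 0 ≤ log d := Real.log_nonneg (by linarith)
  have hl1 : log d ≤ d := (Real.log_le_sub_one_of_pos (by linarith)).trans (by linarith)
  have h1 := h'.measure_failure_le hε hrad (p := 4 + 2 * log d) (by linarith) (by
    have h2 : 1 * ((d : ℝ) + T) ≤ κ ^ 2 * (d + T) := by gcongr; exact one_le_pow₀ hκ
    linarith)
  have hsub : {x : Coord T n d r → ℝ | ¬ Success c (Us * bs) Us ε (canonData (Us * bs) x)} ⊆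
      {x | ¬ iterPot c Us bs κ 0 x ≤ basin r κ / 2} ∪
        {x | iterPot c Us bs κ 0 x ≤ basin r κ / 2 ∧ ¬ Success c (Us * bs) Us ε (canonData (Us * bs) x)} := by
    intro x hx
    by_cases h3 : iterPot c Us bs κ 0 x ≤ basin r κ / 2
    · exact Or.inr ⟨h3, hx⟩
    · exact Or.inl h3
  refine (measure_mono hsub).trans ((measure_union_le _ _).trans ((add_le_add h.measure_iterPot_gt_le h1).trans ?_))
  have h4 := lyap_nonneg (p := 4 + 2 * log d) h'.beta_pos.le (by norm_num : (0 : ℝ) ≤ 1 / 2)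
  rw [← ENNReal.ofReal_add (by positivity) (by positivity)]
  exact ENNReal.ofReal_le_ofReal (failure_sum_le hd h.tasks h.truth.rank_pos hκ)

/-- Events about i.i.d. Gaussian data have the probability given by the product measure. -/
lemma IsIIDGaussian.one_sub_le {Ω : Type*} [MeasurableSpace Ω] {P : Measure Ω} [IsProbabilityMeasure P]
    {X : Ω → Fin T → Matrix (Fin n) (Fin d) ℝ} {Z : Ω → Matrix (Fin d) (Fin r) ℝ} (h : IsIIDGaussian P X Z)
    {Θ : Matrix (Fin d) (Fin T) ℝ} {S : Data d T n r → Prop} {δ : ℝ} (hδ : 0 ≤ δ)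
    (hS : gaussM (Coord T n d r) {x | ¬ S (canonData Θ x)} ≤ ofReal δ) :
    1 - δ ≤ P.real {ω | S (linearData Θ (X ω) (Z ω))} := by
  obtain ⟨hX, hZ, hi⟩ := h
  set y : Ω → Coord T n d r → ℝ := fun ω p => Sum.elim (fun q : Fin T × Fin n × Fin d => X ω q.1 q.2.1 q.2.2)
    (fun q : Fin d × Fin r => Z ω q.1 q.2) p with hy
  have hlaw : ∀ p, HasLaw (fun ω => y ω p) (gaussianReal 0 1) P := by
    rintro (q | q)
    · exact hX _ _ _
    · exact hZ _ _
  have hmap : P.map y = gaussM (Coord T n d r) := by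
    rw [hi.map_fun_eq_pi_map fun p => (hlaw p).aemeasurable]
    congr 1
    funext p
    exact (hlaw p).map_eq
  have hym : AEMeasurable y P := aemeasurable_pi_lambda _ fun p => (hlaw p).aemeasurable
  have h1 : P {ω | ¬ S (linearData Θ (X ω) (Z ω))} ≤ ofReal δ := by
    refine le_trans ?_ hS
    rw [← hmap]
    exact Measure.le_map_apply hym {x | ¬ S (canonData Θ x)}
  have h2 : (1 : ENNReal) ≤ P {ω | S (linearData Θ (X ω) (Z ω))} + ofReal δ := by
    calc (1 : ENNReal) = P Set.univ := measure_univ.symm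
      _ ≤ P ({ω | S (linearData Θ (X ω) (Z ω))} ∪ {ω | ¬ S (linearData Θ (X ω) (Z ω))}) :=
          measure_mono fun ω _ => em _
      _ ≤ _ := (measure_union_le _ _).trans (by gcongr)
  have h3 := ENNReal.toReal_mono (by finiteness) h2
  rw [ENNReal.toReal_add (by finiteness) (by finiteness), ENNReal.toReal_ofReal hδ, ENNReal.toReal_one] at h3
  rw [Measure.real]
  linarith

end Failure

end DifAltGDmin

open DifAltGDmin

theorem theorem1 :
    ∃ C₀ : ℝ, 1 < C₀ ∧ ∀ C_GD : ℝ, C₀ ≤ C_GD → ∀ ρ : ℝ, 0 < ρ → ∃ C₁ : ℝ, 1 < C₁ ∧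
    ∀ (d T r L n K n₁ : ℕ) [NeZero L]
      -- ground truth
      (Θ : Matrix (Fin d) (Fin T) ℝ) (U : Matrix (Fin d) (Fin r) ℝ) (s : Fin r → ℝ)
      (V : Matrix (Fin T) (Fin r) ℝ) (μ ε : ℝ)
      -- network, sample split and parameters of the algorithm
      (c : DifAltGDmin.Config T n L K)
      -- randomness
      (Ω : Type*) [MeasurableSpace Ω] (P : Measure Ω) [IsProbabilityMeasure P]
      (X : Ω → Fin T → Matrix (Fin n) (Fin d) ℝ) (Z : Ω → Matrix (Fin d) (Fin r) ℝ),
      1 ≤ r → DifAltGDmin.IsReducedSVD Θ U s V →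
      1 < μ → DifAltGDmin.Incoherent μ s V →
      DifAltGDmin.IsIIDGaussian P X Z →
      c.graph.Connected → DifAltGDmin.IsWeightMatrix c.graph c.W →
      DifAltGDmin.connectivity c.W < 1 →
      0 < ε → ε < 1 →
      c.κ = DifAltGDmin.condNumber s → c.μ = μ →
      -- a) the initialization
      C₀ * c.κ ^ 2 * (Real.log d + Real.log c.κ) ≤ c.Tpm →
      1 ≤ c.TconInit →
      C₀ * (1 / Real.log (1 / DifAltGDmin.connectivity c.W)) *
        (Real.log L + Real.log d + Real.log r + Real.log c.κ) ≤ c.TconInit →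
      -- b) the gradient descent
      K = ⌈C_GD * c.κ ^ 2 * Real.log (1 / ε)⌉₊ →
      1 ≤ c.TconGD →
      C₀ * (1 / Real.log (1 / DifAltGDmin.connectivity c.W)) *
        (Real.log L + Real.log r + Real.log c.κ) ≤ c.TconGD →
      -- c) the number of samples
      C₁ * c.κ ^ 6 * μ ^ 2 * ((d : ℝ) + T) * r * (c.κ ^ 2 * r + Real.log (1 / ε)) ≤ (n : ℝ) * T →
      -- the sample split
      ρ * n ≤ c.size 0 → ρ * n ≤ c.size 1 →
      (∀ l, 2 ≤ l → l < 2 * K + 2 → c.size l = n₁) → ρ * n ≤ (K : ℝ) * n₁ →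
      C₁ * max (Real.log T) (Real.log d) ≤ n₁ →
      -- the step size
      c.η = 0.4 / (n₁ * DifAltGDmin.sigmaMax s ^ 2) →
      1 - 1 / (d : ℝ) ≤ P.real {ω |
        (∀ t, DifAltGDmin.vecNorm
            (DifAltGDmin.thetaHat c (DifAltGDmin.linearData Θ (X ω) (Z ω)) t - Θ.col t) ≤
              1.4 * ε * DifAltGDmin.vecNorm (Θ.col t) ∧
          DifAltGDmin.vecNorm
            (DifAltGDmin.thetaOut c (DifAltGDmin.linearData Θ (X ω) (Z ω)) t - Θ.col t) ≤
              1.4 * ε * DifAltGDmin.vecNorm (Θ.col t)) ∧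
        ∀ g, DifAltGDmin.subspaceDist
            (DifAltGDmin.iterU c (DifAltGDmin.linearData Θ (X ω) (Z ω)) K g) U ≤ ε} := by
  refine ⟨60, by norm_num, fun C_GD hC ρ hρ => ⟨3e15 * (1 + C_GD / ρ), ?_, ?_⟩⟩
  · have : 0 < C_GD / ρ := div_pos (by linarith) hρ
    linarith
  intro d T r L n K n₁ _ Θ U s V μ ε c Ω _ P _ X Z hr hsvd hμ hinc hiid hconn hW hγ hε hε1 hκ hμc hpm hti htin
    hK htg htgd hsamp hs0 hs1 hsz hKn hn1 hη
  have hG := hsvd.groundTruth hr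
  have hκ1 := hG.one_le
  have hσ := hG.sigma_pos
  have hΘ : Θ = U * (Matrix.diagonal s * V.transpose) := by rw [hsvd.2.2.2, Matrix.mul_assoc]
  have hrd : r ≤ d := card_le_of_orthonormal hsvd.1
  have hrT : r ≤ T := card_le_of_orthonormal hsvd.2.1
  rw [hκ] at hpm htin htgd hsamp hK
  set κ := condNumber s with hκdef
  set σ := sigmaMax s with hσdef
  set bs := Matrix.diagonal s * V.transpose with hbs
  obtain rfl | hd : d = 1 ∨ 2 ≤ d := by omega
  · simp [MeasureTheory.measureReal_nonneg]
  have hr1 : (1 : ℝ) ≤ r := by exact_mod_cast hr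
  have hd2 : (2 : ℝ) ≤ d := by exact_mod_cast hd
  have hT : 1 ≤ T := hr.trans hrT
  have hT1 : (1 : ℝ) ≤ T := by exact_mod_cast hT
  have hL : (1 : ℝ) ≤ L := by exact_mod_cast NeZero.one_le
  have hl : 0 < Real.log (1 / ε) := Real.log_pos (by rw [lt_div_iff₀ hε]; linarith)
  set l := Real.log (1 / ε) with hldef
  have hκ2 : 1 ≤ κ ^ 2 := one_le_pow₀ hκ1
  have hκ4 : 1 ≤ κ ^ 4 := one_le_pow₀ hκ1
  have hμ2 : 1 ≤ μ ^ 2 := one_le_pow₀ hμ.le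
  have hinc' : ∀ t, nrm (bs.col t) ^ 2 ≤ μ ^ 2 * (r / T) * σ ^ 2 := fun t => by
    have h1 : bs.col t = fun k => s k * V t k := by
      ext k
      simp [hbs, Matrix.col_apply, Matrix.diagonal_mul]
    rw [h1]
    exact hinc t
  -- sample sizes
  have hC1 : 3e15 * C_GD ≤ ρ * (3e15 * (1 + C_GD / ρ)) := by
    have : ρ * (3e15 * (1 + C_GD / ρ)) = 3e15 * ρ + 3e15 * C_GD := by field_simp
    rw [this]; linarith
  have hC0 : 3e15 ≤ 3e15 * (1 + C_GD / ρ) := by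
    have : 0 < C_GD / ρ := div_pos (by linarith) hρ
    linarith
  set C₁ := 3e15 * (1 + C_GD / ρ) with hC₁
  set q : ℝ := κ ^ 6 * μ ^ 2 * (d + T) * r with hq
  have hq0 : 0 < q := by positivity
  have hS0 : 0 < κ ^ 2 * r + l := by positivity
  have htotal : 3e15 * C_GD * (q * (κ ^ 2 * r + l)) ≤ ρ * (n * T) := by
    calc _ ≤ ρ * C₁ * (q * (κ ^ 2 * r + l)) := by gcongr
      _ = ρ * (C₁ * κ ^ 6 * μ ^ 2 * ((d : ℝ) + T) * r * (κ ^ 2 * r + l)) := by rw [hq]; ring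
      _ ≤ _ := by gcongr
  have hinit : ∀ m : ℕ, ρ * n ≤ m → 3e15 * κ ^ 8 * μ ^ 2 * r ^ 2 * (d + T) ≤ m * T := fun m hm => by
    calc 3e15 * κ ^ 8 * μ ^ 2 * r ^ 2 * (d + T) = 3e15 * 1 * (q * (κ ^ 2 * r + 0)) := by rw [hq]; ring
      _ ≤ 3e15 * C_GD * (q * (κ ^ 2 * r + l)) := by gcongr; linarith
      _ ≤ ρ * (n * T) := htotal
      _ = ρ * n * T := by ring
      _ ≤ _ := by gcongr
  have hpos : ∀ m : ℕ, ρ * n ≤ m → 0 < m := fun m hm => by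
    have h1 := hinit m hm
    have h2 : 0 < 3e15 * κ ^ 8 * μ ^ 2 * r ^ 2 * ((d : ℝ) + T) := by positivity
    by_contra h3
    have h4 : m = 0 := by omega
    rw [h4] at h1
    simp only [Nat.cast_zero, zero_mul] at h1
    linarith
  have hK0 : C_GD * κ ^ 2 * l ≤ K := by rw [hK]; exact Nat.le_ceil _
  have hK1 : 1 ≤ K := by
    have : (0 : ℝ) < K := lt_of_lt_of_le (by positivity) hK0
    exact_mod_cast this
  have hKle : (K : ℝ) ≤ C_GD * κ ^ 2 * (κ ^ 2 * r + l) := by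
    have h1 : (K : ℝ) < C_GD * κ ^ 2 * l + 1 := by rw [hK]; exact Nat.ceil_lt_add_one (by positivity)
    have h2 : 1 * 1 * (1 * 1) ≤ C_GD * κ ^ 2 * (κ ^ 2 * r) := by gcongr; linarith
    linarith
  have hdesc : 3e15 * κ ^ 4 * μ ^ 2 * r * (d + T) ≤ n₁ * T := by
    have h1 : 3e15 * κ ^ 4 * μ ^ 2 * r * (d + T) * (C_GD * κ ^ 2 * (κ ^ 2 * r + l)) ≤
        n₁ * T * (C_GD * κ ^ 2 * (κ ^ 2 * r + l)) := by
      calc _ = 3e15 * C_GD * (q * (κ ^ 2 * r + l)) := by rw [hq]; ring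
        _ ≤ ρ * (n * T) := htotal
        _ = ρ * n * T := by ring
        _ ≤ K * n₁ * T := by gcongr
        _ = n₁ * T * K := by ring
        _ ≤ _ := by gcongr
    exact le_of_mul_le_mul_right h1 (by positivity)
  have hn₁ : 3e15 * (κ ^ 4 * r) ≤ (n₁ : ℝ) := by
    refine le_of_mul_le_mul_right (le_trans ?_ hdesc) (by linarith : (0 : ℝ) < T)
    calc 3e15 * (κ ^ 4 * r) * T = 3e15 * κ ^ 4 * 1 * r * (0 + T) := by ring
      _ ≤ _ := by gcongr; linarith
  have hn₁r : 3e15 * r ≤ (n₁ : ℝ) := by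
    refine le_trans ?_ hn₁
    gcongr
    exact le_mul_of_one_le_left (by linarith) hκ4
  have hn₁κ : 3e15 * κ ^ 4 ≤ (n₁ : ℝ) := by
    refine le_trans ?_ hn₁
    gcongr
    exact le_mul_of_one_le_right (by positivity) hr1
  have hlogT : 0 ≤ Real.log T := Real.log_nonneg hT1
  have hlogd : 0 ≤ Real.log d := Real.log_nonneg (by linarith)
  have hn₁l : ∀ y, 0 ≤ y → y ≤ max (Real.log T) (Real.log d) → 1e9 * y ≤ n₁ := fun y hy hym => by
    refine le_trans ?_ hn1
    calc 1e9 * y ≤ C₁ * y := by gcongr; linarith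
      _ ≤ _ := by gcongr
  -- agreement
  have hy1 : 1 ≤ d * (r * κ) := by
    have h1 : 1 * (1 * 1) ≤ d * (r * κ) := by gcongr; linarith
    linarith
  have hy2 : 1 ≤ r * κ := by
    have h1 : 1 * 1 ≤ r * κ := by gcongr
    linarith
  obtain ⟨ω, hω0, hωm, hω⟩ := exists_mixing hW hγ hy1 hti (by
    rwa [Real.log_mul (by positivity) (by positivity), Real.log_mul (by positivity) (by positivity),
      Real.log_mul (by positivity) (by positivity), ← add_assoc, ← add_assoc])
  obtain ⟨ω', hω'0, hω'm, hω'⟩ := exists_mixing hW hγ hy2 htg (by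
    rwa [Real.log_mul (by positivity) (by positivity), Real.log_mul (by positivity) (by positivity),
      ← add_assoc])
  have hωle : 4 * ω * κ ^ 2 ≤ (basin r κ / 30) ^ 2 := by
    have h1 : ω * (κ ^ 6 * r) ≤ (1 / 2) ^ 52 := by
      calc ω * (κ ^ 6 * r) ≤ ω * (d * (r * κ)) ^ 6 := by
            have h2 : 1 * (κ ^ 6 * r ^ 1) ≤ (d : ℝ) ^ 6 * (κ ^ 6 * r ^ 6) := by
              gcongr
              · exact one_le_pow₀ (by linarith)
              · norm_num
            gcongr
            calc κ ^ 6 * r = 1 * (κ ^ 6 * r ^ 1) := by ring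
              _ ≤ _ := h2
              _ = _ := by ring
        _ ≤ (1 / 2) ^ 52 * (1 / (d * (r * κ))) ^ 2 := hω
        _ ≤ (1 / 2) ^ 52 * 1 := by
            gcongr
            exact pow_le_one₀ (by positivity) (by rw [div_le_one (by positivity)]; exact hy1)
        _ = _ := mul_one _
    have h3 : (basin r κ / 30) ^ 2 = 1e-8 / 900 / (κ ^ 4 * r) := by
      unfold basin
      rw [div_pow, div_pow, Real.sq_sqrt (by positivity)]
      field_simp; norm_num
    rw [h3, le_div_iff₀ (by positivity)]
    calc 4 * ω * κ ^ 2 * (κ ^ 4 * r) = 4 * (ω * (κ ^ 6 * r)) := by ring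
      _ ≤ 4 * (1 / 2) ^ 52 := by gcongr
      _ ≤ _ := by norm_num
  have hω'le : ω' * (r ^ 2 * κ ^ 2) ≤ 1e-6 := by
    calc ω' * (r ^ 2 * κ ^ 2) = ω' * (r * κ) ^ 2 := by ring
      _ ≤ ω' * (r * κ) ^ 6 := by gcongr; norm_num
      _ ≤ (1 / 2) ^ 52 * (1 / (r * κ)) ^ 2 := hω'
      _ ≤ (1 / 2) ^ 52 * 1 := by
          gcongr
          exact pow_le_one₀ (by positivity) (by rw [div_le_one (by positivity)]; exact hy2)
      _ ≤ _ := by norm_num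
  have hI : InitSetup c U bs σ κ μ ω :=
    { truth := hG
      weight := hW
      connected := hconn
      mixing := hωm
      omega_nonneg := hω0
      omega_le := hωle
      kappa_eq := hκ
      mu_eq := hμc
      one_le_mu := hμ.le
      incoherent := hinc'
      tasks := hT
      dim := by omega
      size_zero_pos := hpos _ hs0
      size_one_pos := hpos _ hs1
      samples_zero := by
        refine le_trans ?_ (hinit _ hs0)
        calc 2e5 * κ ^ 2 * μ ^ 2 * (d + T) ≤ 3e15 * κ ^ 8 * μ ^ 2 * (d + T) := by
              have h1 : κ ^ 2 ≤ κ ^ 8 := pow_le_pow_right₀ hκ1 (by norm_num)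
              gcongr
              norm_num
          _ = 3e15 * κ ^ 8 * μ ^ 2 * 1 * (d + T) := by ring
          _ ≤ _ := by gcongr; exact one_le_pow₀ hr1
      samples_one := hinit _ hs1
      iterations := powerIterations_bound hr hrd hd hκ1 hpm }
  have hN : 0 < n₁ := by
    have : (0 : ℝ) < n₁ := lt_of_lt_of_le (by positivity) hn₁
    exact_mod_cast this
  have hD : DescentSetup c U bs σ κ μ ω' (1 / (8 * d)) n₁ :=
    { truth := hG
      weight := hW
      row_sum := fun g =>
        (mem_doublyStochastic_iff_sum.1 ((doublyStochastic ℝ (Fin L)).pow_mem hW.1 _)).2.1 g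
      mixing := hω'm
      omega_nonneg := hω'0
      omega_le := hω'le
      steps := hK1
      size_eq := hsz
      size_pos := hN
      rank_le := by
        have : (r : ℝ) ≤ n₁ := by linarith
        exact_mod_cast this
      step_size := hη
      one_le_mu := hμ.le
      incoherent := hinc'
      tasks := hT
      rank_le_dim := hrd
      samples := by
        refine le_trans ?_ hdesc
        gcongr
        norm_num
      beta_pos := by positivity
      beta_le := by rw [div_le_one (by positivity)]; linarith
      rare := rare_bound hr hrd hT hκ1 (by linarith) (by linarith)
        (hn₁l _ hlogT (le_max_left _ _)) (hn₁l _ hlogd (le_max_right _ _)) }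
  have hfail := measure_not_success_le hI hD hd hε (radius_le_of_steps hr hκ1 hε hε1 hC hK1 hK0)
  rw [← hΘ] at hfail
  exact hiid.one_sub_le (S := Success c Θ U ε) (by positivity) hfail
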